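/- **Theorem 1.4 (nonlocal Young's law, case $s_1\neq s_2$).** *Kernels.* Let $n\ge 2$, $s_1,s_2\in(0,1)$, $\lambda\ge1$, $\varrho\in(0,\infty]$, $\sigma\in\mathbb R$. For $i=1,2$ let $K_i:\mathbb R^n\setminus\{0\}\to[0,\infty)$ be even, of class $C^2$, with $$\frac{\chi_{B_\varrho}(\zeta)}{\lambda|\zeta|^{n+s_i}}\le K_i(\zeta)\le\frac{\lambda}{|\zeta|^{n+s_i}},\qquad |D^jK_i(\zeta)|\le\frac{\lambda}{|\zeta|^{n+s_i+j}}\quad(j=1,2),\qquad \zeta\ne0 ,$$ and suppose that for all $\zeta\neq0$ the limit $K_i^*(\zeta):=\lim_{r\to0^+}r^{n+s_i}K_i(r\zeta)$ exists and equals $a_i(\zeta/|\zeta|)\,|\zeta|^{-n-s_i}$, where $a_i$ is a continuous even function on the unit sphere bounded from above and below by positive constants. *Critical sets.* Let $\Omega\subset\mathbb R^n$ be open and bounded with $C^1$ boundary and let $g\in C^1(\mathbb R^n)$. For measurable $E\subseteq\Omega$ put $$\mathcal C(E)=\int_E\int_{E^c\cap\Omega}K_1(x-y)\,dy\,dx+\sigma\int_E\int_{\Omega^c}K_2(x-y)\,dy\,dx+\int_E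 g\,dx .$$ Let $E\subseteq\Omega$ be a volume-constrained critical set of $\mathcal C$: $E$ has finite energy and $\frac{d}{dt}\big|_{t=0}\mathcal C(f_t(E))=0$ for every smooth family of diffeomorphisms $\{f_t\}_{|t|<\delta}$ of $\mathbb R^n$ with $f_0=\mathrm{Id}$, $f_t-\mathrm{Id}$ compactly supported, $f_t(\Omega)=\Omega$ and $|f_t(E)|=|E|$. Let $\partial E$ denote the set of all $x$ such that $0<|E\cap B_r(x)|<|B_r(x)|$ for every $r>0$, and let $M:=\overline{\Omega\cap\partial E}$. *The contact point.* Let $x_0\in M\cap\partial\Omega$ be a regular point: for some $\rho>0$ and $\alpha\in(s_1,1)$, $M\cap B_\rho(x_0)$ is a hypersurface of class $C^{1,\alpha}$, possibly with boundary, the boundary (if any) being contained in $\partial\Omega$. Suppose that $H$ and $V$ are open half-spaces with $$\frac{\Omega-x_0}{r}\to H,\qquad \frac{E-x_0}{r}\to H\cap V\qquad\text{in }L^1_{\rm loc}(\mathbb R^n)\text{ as }r\to0^+ .$$ For orthonormal vectors $e_1,e_n$ write $J_{\theta_1,\theta_2}$ for the set of $x$ with $(x\cdot e_1,x\cdot e_n)=\rho(\cos\beta,\sin\beta)$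 for some $\rho>0$, $\beta\in(\theta_1,\theta_2)$, and $e(\theta)=\cos\theta\,e_1+\sin\theta\,e_n$. Let $\vartheta\in[0,\pi]$ be the angle between $H$ and $V$, that is, in suitable orthonormal coordinates, $H=J_{0,\pi}=\{x\cdot e_n>0\}$ and $H\cap V=J_{0,\vartheta}$. *Conclusions.* 1. If $s_1<s_2$ and $\sigma<0$, then $\vartheta=0$. 2. If $s_1<s_2$ and $\sigma>0$, then $\vartheta=\pi$. 3. If either $s_1<s_2$ and $\sigma=0$, or $s_1>s_2$, then $\vartheta\in(0,\pi)$. Moreover, among all $\bar\vartheta\in(0,2\pi)$, the equation $$\mathrm{p.v.}\left(\int_{J_{\vartheta,\vartheta+\bar\vartheta}}\frac{a_1\big(\tfrac{x-e(\vartheta)}{|x-e(\vartheta)|}\big)}{|x-e(\vartheta)|^{n+s_1}}dx-\int_{J_{0,\vartheta}}\frac{a_1\big(\tfrac{x-e(\vartheta)}{|x-e(\vartheta)|}\big)}{|x-e(\vartheta)|^{n+s_1}}dx\right)=0$$ has exactly one solution $\widehat\vartheta$ (the dual angle), and $\widehat\vartheta=\pi-\vartheta$. Finally, for every $v\in H\cap\partial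 V$, the principal value $$\mathbf H^{K_1^*}_{\partial(H\cap V)}(v):=\mathrm{p.v.}\int_{\mathbb R^n}K_1^*(v-y)\big(\chi_{(H\cap V)^c}(y)-\chi_{H\cap V}(y)\big)\,dy$$ exists, $K_1^*(v-\cdot)$ is integrable on $H^c$, and $$\mathbf H^{K_1^*}_{\partial(H\cap V)}(v)-\int_{H^c}K_1^*(v-y)\,dy=0 .$$ -/

import Mathlib

open MeasureTheory Filter Set Topology
open scoped ENNReal RealInnerProductSpace

noncomputable section

namespace Capillarity

/-- The space `ℝⁿ` with its Euclidean structure. -/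
abbrev Eucl (n : ℕ) : Type := EuclideanSpace ℝ (Fin n)

/-! ### Interaction kernels -/

/-- The class `𝐊(n,s,lam,rad)` of even kernels comparable to `|ζ|^{-n-s}`, the lower bound being
required only in the ball of radius `rad ∈ (0,∞]`.  Kernels are functions on `ℝⁿ \ {0}`: the value
at the origin is irrelevant. -/
structure IsKernel (n : ℕ) (s lam : ℝ) (rad : ℝ≥0∞) (K : Eucl n → ℝ) : Prop where
  even : ∀ ζ, ζ ≠ 0 → K (-ζ) = K ζ
  nonneg : ∀ ζ, ζ ≠ 0 → 0 ≤ K ζ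
  lower : ∀ ζ, ζ ≠ 0 → ENNReal.ofReal ‖ζ‖ < rad → 1 / (lam * ‖ζ‖ ^ ((n : ℝ) + s)) ≤ K ζ
  upper : ∀ ζ, ζ ≠ 0 → K ζ ≤ lam / ‖ζ‖ ^ ((n : ℝ) + s)

/-- The class `𝐊ʰ(n,s,lam,rad)`: kernels of class `Cʰ` away from the origin, with
`|Dʲ K(ζ)| ≤ lam / |ζ|^{n+s+j}` for `1 ≤ j ≤ h`. -/
structure IsSmoothKernel (h n : ℕ) (s lam : ℝ) (rad : ℝ≥0∞) (K : Eucl n → ℝ) : Prop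
    extends IsKernel n s lam rad K where
  contDiffOn : ContDiffOn ℝ h K {0}ᶜ
  deriv_le : ∀ j : ℕ, 1 ≤ j → j ≤ h → ∀ ζ, ζ ≠ 0 →
    ‖iteratedFDeriv ℝ j K ζ‖ ≤ lam / ‖ζ‖ ^ ((n : ℝ) + s + j)

/-- `Kstar` is the blow-up limit of `K`: `Kstar ζ = lim_{r → 0⁺} r^{n+s} K(r ζ)` for `ζ ≠ 0`. -/
def IsBlowUpLimit {n : ℕ} (s : ℝ) (K Kstar : Eucl n → ℝ) : Prop :=
  ∀ ζ, ζ ≠ 0 →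
    Tendsto (fun r : ℝ => r ^ ((n : ℝ) + s) * K (r • ζ)) (𝓝[>] 0) (𝓝 (Kstar ζ))

/-- The homogeneous kernel `a(ζ/|ζ|) / |ζ|^{n+s}`. -/
def angularKernel {n : ℕ} (s : ℝ) (a : Eucl n → ℝ) (ζ : Eucl n) : ℝ :=
  a (‖ζ‖⁻¹ • ζ) / ‖ζ‖ ^ ((n : ℝ) + s)

/-- `a` is (the extension of) a continuous even function on the unit sphere, bounded from above and
below by positive constants. -/
structure IsAngularDensity {n : ℕ} (a : Eucl n → ℝ) : Prop where
  continuousOn : ContinuousOn a (Metric.sphere 0 1)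
  bounds : ∃ c C : ℝ, 0 < c ∧ ∀ z ∈ Metric.sphere (0 : Eucl n) 1, c ≤ a z ∧ a z ≤ C
  even : ∀ z ∈ Metric.sphere (0 : Eucl n) 1, a (-z) = a z

/-! ### The capillarity functional and its volume-constrained critical sets -/

/-- The interaction `I_K(A,B) = ∫_A ∫_B K(x-y) dx dy ∈ [0,∞]`. -/
def interaction {n : ℕ} (K : Eucl n → ℝ) (A B : Set (Eucl n)) : ℝ≥0∞ :=
  ∫⁻ x in A, ∫⁻ y in B, ENNReal.ofReal (K (x - y))

/-- The functional `𝒞(E) = I_{K₁}(E, Eᶜ ∩ Ω) + σ I_{K₂}(E, Ωᶜ) + ∫_E g`. -/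
def capillarity {n : ℕ} (Ω : Set (Eucl n)) (K₁ K₂ : Eucl n → ℝ) (σ : ℝ) (g : Eucl n → ℝ)
    (E : Set (Eucl n)) : ℝ :=
  (interaction K₁ E (Eᶜ ∩ Ω)).toReal + σ * (interaction K₂ E Ωᶜ).toReal + ∫ x in E, g x

/-- A smooth family of diffeomorphisms `f_t`, `|t| < δ`, with `f_0 = Id`, with `f_t - Id` compactly
supported, preserving `Ω` and the volume of `E`. -/
structure IsVariation {n : ℕ} (Ω E : Set (Eucl n)) (δ : ℝ) (f : ℝ → Eucl n → Eucl n) :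
    Prop where
  smooth : ContDiffOn ℝ (⊤ : ℕ∞) (fun z : ℝ × Eucl n => f z.1 z.2) (Ioo (-δ) δ ×ˢ univ)
  diffeo : ∀ t ∈ Ioo (-δ) δ, ∃ h : Eucl n → Eucl n, ContDiff ℝ (⊤ : ℕ∞) h ∧
    Function.LeftInverse h (f t) ∧ Function.RightInverse h (f t)
  zero : ∀ x, f 0 x = x
  compactSupport : ∀ t ∈ Ioo (-δ) δ, HasCompactSupport (fun x => f t x - x)
  image_domain : ∀ t ∈ Ioo (-δ) δ, f t '' Ω = Ω
  volume_image : ∀ t ∈ Ioo (-δ) δ, volume (f t '' E) = volume E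

/-- `E ⊆ Ω` is a volume-constrained critical set of `𝒞`: its energy is finite and
`d/dt 𝒞(f_t(E)) = 0` at `t = 0` along all volume-preserving variations.  (In a bounded domain with
`C¹` boundary `I_{K₂}(E, Ωᶜ)` is always finite, so only `I_{K₁}(E, Eᶜ ∩ Ω)` has to be mentioned.) -/
structure IsCriticalSet {n : ℕ} (Ω : Set (Eucl n)) (K₁ K₂ : Eucl n → ℝ) (σ : ℝ)
    (g : Eucl n → ℝ) (E : Set (Eucl n)) : Prop where
  measurableSet : MeasurableSet E
  subset : E ⊆ Ω
  finite : interaction K₁ E (Eᶜ ∩ Ω) < ∞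
  critical : ∀ δ : ℝ, 0 < δ → ∀ f : ℝ → Eucl n → Eucl n, IsVariation Ω E δ f →
    HasDerivAt (fun t => capillarity Ω K₁ K₂ σ g (f t '' E)) 0 0

/-! ### Regularity of sets -/

/-- `Ω` has `C¹` boundary: near each boundary point it is a strict sublevel set of a `C¹` function
with nonvanishing differential. -/
def HasC1Boundary {n : ℕ} (Ω : Set (Eucl n)) : Prop :=
  ∀ x ∈ frontier Ω, ∃ U : Set (Eucl n), IsOpen U ∧ x ∈ U ∧ ∃ φ : Eucl n → ℝ,
    ContDiffOn ℝ 1 φ U ∧ fderiv ℝ φ x ≠ 0 ∧ Ω ∩ U = {y ∈ U | φ y < 0}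

/-- `u` is of class `C^{1,α}` on the open set `U`. -/
def IsC1Holder {n : ℕ} (α : ℝ) (U : Set (Eucl n)) (u : Eucl n → ℝ) : Prop :=
  ContDiffOn ℝ 1 u U ∧
    ∃ C : ℝ, ∀ y ∈ U, ∀ z ∈ U, ‖fderiv ℝ u y - fderiv ℝ u z‖ ≤ C * ‖y - z‖ ^ α

/-- Near `x`, `S` is a `C^{1,α}` hypersurface, and `x` is not a boundary point of it. -/
def IsInteriorManifoldPoint {n : ℕ} (α : ℝ) (S : Set (Eucl n)) (x : Eucl n) : Prop :=
  ∃ U : Set (Eucl n), IsOpen U ∧ x ∈ U ∧ ∃ u : Eucl n → ℝ,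
    IsC1Holder α U u ∧ u x = 0 ∧ fderiv ℝ u x ≠ 0 ∧ S ∩ U = {y ∈ U | u y = 0}

/-- Near `x`, `S` is a `C^{1,α}` hypersurface with boundary, and `x` is a boundary point of it. -/
def IsBoundaryManifoldPoint {n : ℕ} (α : ℝ) (S : Set (Eucl n)) (x : Eucl n) : Prop :=
  ∃ U : Set (Eucl n), IsOpen U ∧ x ∈ U ∧ ∃ u w : Eucl n → ℝ,
    IsC1Holder α U u ∧ IsC1Holder α U w ∧ u x = 0 ∧ w x = 0 ∧
      LinearIndependent ℝ ![fderiv ℝ u x, fderiv ℝ w x] ∧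
      S ∩ U = {y ∈ U | u y = 0 ∧ 0 ≤ w y}

/-- The boundary of `E` as a set defined up to null sets (the usual convention for sets of
finite perimeter, classical or nonlocal): the points at which neither `E` nor its complement is
negligible. -/
def essBoundary {n : ℕ} (E : Set (Eucl n)) : Set (Eucl n) :=
  {x | ∀ r : ℝ, 0 < r →
    0 < volume (E ∩ Metric.ball x r) ∧ 0 < volume (Eᶜ ∩ Metric.ball x r)}

/-- The free interface `closure (Ω ∩ ∂E)`. -/
def interface {n : ℕ} (Ω E : Set (Eucl n)) : Set (Eucl n) :=
  closure (Ω ∩ essBoundary E)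

/-- `Reg_E`: the points of the interface near which, for some `α ∈ (s,1)`, it is a hypersurface of
class `C^{1,α}`, possibly with boundary, whose boundary points all lie on `∂Ω`. -/
def regularSet {n : ℕ} (s : ℝ) (Ω E : Set (Eucl n)) : Set (Eucl n) :=
  {x₀ | x₀ ∈ interface Ω E ∧ ∃ ρ : ℝ, 0 < ρ ∧ ∃ α : ℝ, s < α ∧ α < 1 ∧
    ∀ x ∈ interface Ω E ∩ Metric.ball x₀ ρ,
      IsInteriorManifoldPoint α (interface Ω E) x ∨
        (x ∈ frontier Ω ∧ IsBoundaryManifoldPoint α (interface Ω E) x)}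

/-! ### Blow-ups, half-spaces and wedges -/

/-- The rescaled set `(F - x₀) / r`. -/
def blowUp {n : ℕ} (F : Set (Eucl n)) (x₀ : Eucl n) (r : ℝ) : Set (Eucl n) :=
  (fun y => r⁻¹ • (y - x₀)) '' F

/-- `F^{x₀,r} → G` in `L¹_loc` as `r → 0⁺`. -/
def BlowUpTendsto {n : ℕ} (F : Set (Eucl n)) (x₀ : Eucl n) (G : Set (Eucl n)) : Prop :=
  ∀ R : ℝ, 0 < R →
    Tendsto (fun r : ℝ => volume (symmDiff (blowUp F x₀ r) G ∩ Metric.ball 0 R))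
      (𝓝[>] 0) (𝓝 0)

/-- Open half-spaces of `ℝⁿ`. -/
def IsOpenHalfSpace {n : ℕ} (W : Set (Eucl n)) : Prop :=
  ∃ ν : Eucl n, ν ≠ 0 ∧ ∃ c : ℝ, W = {x | c < ⟪ν, x⟫}

/-- The wedge `J_{θ₁,θ₂}`, where `p`, `q` is the orthonormal pair that plays the role of the
coordinate vectors `e₁`, `eₙ`. -/
def wedge {n : ℕ} (p q : Eucl n) (θ₁ θ₂ : ℝ) : Set (Eucl n) :=
  {x | ∃ β ∈ Ioo θ₁ θ₂, ∃ ρ : ℝ, 0 < ρ ∧ ⟪p, x⟫ = ρ * Real.cos β ∧ ⟪q, x⟫ = ρ * Real.sin β}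

/-- The unit vector `e(θ) = cos θ e₁ + sin θ eₙ`, in the same convention. -/
def unitVec {n : ℕ} (p q : Eucl n) (θ : ℝ) : Eucl n :=
  Real.cos θ • p + Real.sin θ • q

/-! ### Principal values -/

open scoped Classical in
/-- The `K`-mean curvature
`p.v. ∫ K(x-y) (χ_{Fᶜ}(y) - χ_F(y)) dy` of `∂F` at `x` exists and equals `h`. -/
def HasMeanCurvature {n : ℕ} (K : Eucl n → ℝ) (F : Set (Eucl n)) (x : Eucl n) (h : ℝ) : Prop :=
  Tendsto
    (fun ε : ℝ => ∫ y in (Metric.ball x ε)ᶜ, K (x - y) * (if y ∈ F then -1 else 1))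
    (𝓝[>] 0) (𝓝 h)

/-- `𝒟_θ(θ')`, the integral of `a((x-e(θ))/|x-e(θ)|) / |x-e(θ)|^{n+s}` over `J_{θ,θ+θ'}` minus the
one over `J_{0,θ}`, exists in the principal value sense and equals `d`. -/
def HasWedgeBalance {n : ℕ} (p q : Eucl n) (s : ℝ) (a : Eucl n → ℝ) (θ θ' d : ℝ) : Prop :=
  Tendsto
    (fun ε : ℝ =>
      (∫ x in wedge p q θ (θ + θ') \ Metric.ball (unitVec p q θ) ε,
          angularKernel s a (x - unitVec p q θ)) -
        ∫ x in wedge p q 0 θ \ Metric.ball (unitVec p q θ) ε,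
          angularKernel s a (x - unitVec p q θ))
    (𝓝[>] 0) (𝓝 d)

end Capillarity

end

/-!
**Weak equation.** The set `E` is deformed by the maps `x ↦ x + t φ(x) e` with a fixed
direction `e` and `φ` supported in `Ω`. Their Jacobian is affine in `t`, so such a map preserves the
volume of `E` for all small `t` as soon as `∫_E ∂ₑφ = 0` (`isVariation_shift`); no correction of the
volume by an implicit function is needed. Criticality therefore gives a Lagrange multiplier for each
direction (`exists_multiplier`). With the kernel truncated near the origin, the first variation
becomes the integral over `E` of the `e`-derivative of `φ` times the truncated curvature plus the
outer potential minus the multiplier (`exists_multiplier_tendsto`).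

**Pointwise equation.** Near a regular point `E` is a sublevel set `{u < 0}` of a function that is
almost linear in a direction `ν`, and the flux `∫_E ∂_ν G` of a `G` that is nonnegative near
`{u = 0}` is nonnegative (`integral_fderiv_nonneg`), positive for a suitable bump function
(`exists_integral_fderiv_pos`). This localizes the weak equation: at a point of the interface whose
distance from the walls exceeds `2 δ`, the curvature truncated at scale `δ` satisfies the equation
up to `O(δ ^ (α - s₁))`, by cancellation of the kernel on a `C^{1,α}` hypersurface
(`exists_pointwise_equation`). The constants are uniform along points that approach the contact
point `x₀` in a direction tangent to the interface: the curvature, truncated at a scale comparable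
to the distance `d` from the wall, and the wall potential times `σ` add up to a bounded quantity
(`exists_contact_estimate`).

**Dominant adhesion.** If `s₁ < s₂` and `σ ≠ 0`, the wall potential is of order `d ^ (-s₂)` and the
truncated curvature is at most of order `d ^ (-s₁)`. The estimate fails for small `d`, so that an
interface of class `C^{1,α}` up to the wall, with `α > s₁`, has no regular contact point at all
(`not_contact_of_lt`). The first two conclusions are consequences of this fact.

**Degenerate angles.** If `σ = 0` or `s₂ < s₁`, the wall potential is of lower order. If the angle
is `0` or `π`, one of the phases `E` and `Ω \ E` has an empty blow-up, which forces the wall to be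
tangent to the interface. At a point of the interface at distance `d` from the wall, the curvature
of this thin phase is then at least `c d ^ (-s₁)`, since a ball of radius `d / 4` of the complement
of `Ω` is missing (`exists_thin_curvature_ge`), against the estimate (`not_thin`).

**Young's law.** If the angle lies in `(0, π)`, the pointwise equation is rescaled at points
`x₀ + r v + o(r)` of the interface. The multiplier and the adhesion disappear, and the truncated
curvature of the tangent wedge relative to the tangent half-space vanishes for all small truncation
radii (`integral_blowUp_eq_zero`). This gives the pointwise law (`hasMeanCurvature_of_truncated`)
and the balance of the wedges of openings `ϑ` and `π - ϑ`. The integral over the second wedge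
increases strictly with its opening (`exists_wedge_integral_gap`), whence the uniqueness of the dual
angle (`hasWedgeBalance_iff`).
-/

open MeasureTheory Filter Set Topology Metric
open scoped ENNReal RealInnerProductSpace

noncomputable section

namespace Capillarity

variable {n : ℕ}

/-! ### Volumes of slabs and integrals of powers of the norm -/

/-- If `N` translates of `A` by multiples of `v` are disjoint and fit into `B`, then
`N |A| ≤ |B|`. -/
theorem card_mul_volume_le_of_translates {A B : Set (Eucl n)} (hA : MeasurableSet A) (v : Eucl n)
    (N : ℕ) (hdisj : ∀ j k : ℕ, j < k → k < N → ∀ x ∈ A, ∀ y ∈ A,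
      x + (j : ℝ) • v ≠ y + (k : ℝ) • v)
    (hsub : ∀ j < N, ∀ x ∈ A, x + (j : ℝ) • v ∈ B) :
    (N : ℝ≥0∞) * volume A ≤ volume B := by
  let f : Fin N → Set (Eucl n) := fun j => (fun y => y + (-((j : ℕ) : ℝ)) • v) ⁻¹' A
  have hf : ∀ j, volume (f j) = volume A := fun j => measure_preimage_add_right _ _ _
  have hmem : ∀ j y, y ∈ f j → ∃ x ∈ A, y = x + ((j : ℕ) : ℝ) • v := fun j y hy =>
    ⟨_, hy, by simp⟩
  have hm : ∀ j, MeasurableSet (f j) := fun j => (measurable_id.add_const _) hA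
  have hd : Pairwise (Function.onFun Disjoint f) := by
    intro j k hjk
    refine Set.disjoint_left.2 fun y hy hy' => ?_
    obtain ⟨x, hx, rfl⟩ := hmem j y hy
    obtain ⟨x', hx', h⟩ := hmem k _ hy'
    rcases lt_or_gt_of_ne (fun h => hjk (Fin.ext h) : (j : ℕ) ≠ k) with h1 | h1
    · exact hdisj j k h1 k.2 x hx x' hx' h
    · exact hdisj k j h1 j.2 x' hx' x hx h.symm
  have h1 := measure_iUnion (μ := volume) hd hm
  simp only [hf, tsum_fintype, Finset.sum_const, Finset.card_univ, Fintype.card_fin,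
    nsmul_eq_mul] at h1
  rw [← h1]
  refine measure_mono (iUnion_subset fun j y hy => ?_)
  obtain ⟨x, hx, rfl⟩ := hmem j y hy
  exact hsub j j.2 x hx

/-- The volume of the unit ball. -/
def unitBallVolume (n : ℕ) : ℝ := (volume (ball (0 : Eucl n) 1)).toReal

theorem unitBallVolume_pos : 0 < unitBallVolume n :=
  ENNReal.toReal_pos (measure_ball_pos _ _ one_pos).ne' measure_ball_lt_top.ne

theorem volume_ball_eq (x : Eucl n) {r : ℝ} (hr : 0 < r) :
    volume (ball x r) = ENNReal.ofReal (unitBallVolume n * r ^ (n : ℝ)) := by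
  rw [Measure.addHaar_ball_of_pos _ _ hr, mul_comm, ENNReal.ofReal_mul unitBallVolume_pos.le,
    unitBallVolume, ENNReal.ofReal_toReal measure_ball_lt_top.ne]
  simp

/-- Slabs of width `2 τ ρ` in a ball of radius `ρ` have volume `O(τ ρⁿ)`, uniformly in the
direction. -/
theorem volume_slab_le {ν : Eucl n} (hν : ‖ν‖ = 1) {τ ρ : ℝ} (hτ : 0 < τ) (hρ : 0 < ρ) :
    volume ({z : Eucl n | |⟪ν, z⟫| ≤ τ * ρ} ∩ ball 0 ρ) ≤
      ENNReal.ofReal (6 * 2 ^ (n : ℝ) * unitBallVolume n * τ * ρ ^ (n : ℝ)) := by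
  set A := {z : Eucl n | |⟪ν, z⟫| ≤ τ * ρ} ∩ ball 0 ρ with hAdef
  have hω := unitBallVolume_pos (n := n)
  have h2 : (1 : ℝ) ≤ 2 ^ (n : ℝ) := Real.one_le_rpow (by norm_num) (by positivity)
  rcases lt_or_ge (1 / 3) τ with h | h
  · refine (measure_mono inter_subset_right).trans ?_
    rw [volume_ball_eq _ hρ]
    refine ENNReal.ofReal_le_ofReal ?_
    have : 0 ≤ unitBallVolume n * ρ ^ (n : ℝ) := by positivity
    have h3 : 1 ≤ 6 * 2 ^ (n : ℝ) * τ := by nlinarith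
    nlinarith
  -- The translates by multiples of `3τρ` along `ν` are disjoint; `N ≈ 1 / (3τ)` of them fit into
  -- the ball of radius `2ρ`.
  · set N := ⌊1 / (3 * τ)⌋₊
    have hN1 : (N : ℝ) * (3 * τ) ≤ 1 := by
      have := Nat.floor_le (show 0 ≤ 1 / (3 * τ) by positivity)
      rwa [le_div_iff₀ (by positivity)] at this
    have hge : 1 ≤ 1 / (3 * τ) := by rw [le_div_iff₀ (by positivity)]; linarith
    have hN0 : 1 ≤ N := Nat.le_floor (by simpa using hge)
    have hN2 : 1 ≤ (N : ℝ) * (6 * τ) := by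
      have := Nat.lt_floor_add_one (1 / (3 * τ))
      rw [div_lt_iff₀ (by positivity)] at this
      have h3 : (1 : ℝ) ≤ N := by exact_mod_cast hN0
      change 1 < ((N : ℝ) + 1) * _ at this
      nlinarith
    have hA : MeasurableSet A := by
      refine MeasurableSet.inter ?_ measurableSet_ball
      exact measurableSet_le (by fun_prop) (by fun_prop)
    have key := card_mul_volume_le_of_translates (A := A) (B := ball 0 (2 * ρ)) hA
      ((3 * τ * ρ) • ν) N ?_ ?_
    · have h4 : volume A ≤ ENNReal.ofReal (6 * τ) * ((N : ℝ≥0∞) * volume A) := by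
        rw [← mul_assoc]
        conv_lhs => rw [← one_mul (volume A)]
        gcongr
        rw [← ENNReal.ofReal_natCast, ← ENNReal.ofReal_mul (by positivity)]
        rw [ENNReal.one_le_ofReal]
        linarith
      refine h4.trans ((mul_le_mul_right key _).trans ?_)
      rw [volume_ball_eq _ (by positivity), ← ENNReal.ofReal_mul (by positivity)]
      refine ENNReal.ofReal_le_ofReal ?_
      rw [Real.mul_rpow (by norm_num) hρ.le]
      apply le_of_eq; ring
    · intro j k hjk _ x hx y hy h
      have h1 : ⟪ν, x⟫ + j * (3 * τ * ρ) = ⟪ν, y⟫ + k * (3 * τ * ρ) := by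
        have := congrArg (fun z => ⟪ν, z⟫) h
        simpa [inner_add_right, inner_smul_right, hν] using this
      have hx1 := abs_le.1 (mem_ofPred.1 hx.1)
      have hy1 := abs_le.1 (mem_ofPred.1 hy.1)
      have : (j : ℝ) + 1 ≤ k := by exact_mod_cast hjk
      have hp : 0 < τ * ρ := by positivity
      nlinarith
    · intro j hj x hx
      have hx2 := mem_ball_zero_iff.1 hx.2
      rw [mem_ball_zero_iff]
      refine (norm_add_le _ _).trans_lt ?_
      rw [norm_smul, norm_smul, hν, mul_one, Real.norm_of_nonneg (by positivity),
        Real.norm_of_nonneg (by positivity)]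
      have : (j : ℝ) ≤ N := by exact_mod_cast hj.le
      have : (j : ℝ) * (3 * τ) ≤ 1 := le_trans (by gcongr) hN1
      nlinarith

/-- Dyadic decomposition near the origin: if `|S ∩ B_ρ| ≤ C ρᵖ` for `ρ ≤ δ` then
`∫_{S ∩ B_δ} |z|^{-q} ≤ C' δ^{p-q}` when `q < p`. -/
theorem lintegral_norm_rpow_inner_le {S : Set (Eucl n)} {p q C δ : ℝ} (hC : 0 ≤ C) (hq : 0 < q)
    (hqp : q < p) (hδ : 0 < δ)
    (hS : ∀ ρ, 0 < ρ → ρ ≤ δ → volume (S ∩ ball 0 ρ) ≤ ENNReal.ofReal (C * ρ ^ p)) :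
    ∫⁻ z in S ∩ ball 0 δ, ENNReal.ofReal (‖z‖ ^ (-q)) ≤
      ENNReal.ofReal (C * (2 ^ q * (1 - 2 ^ (q - p))⁻¹) * δ ^ (p - q)) := by
  let T : ℕ → Set (Eucl n) := fun k =>
    (S ∩ ball 0 (δ * (1 / 2) ^ k)) ∩ {z | δ * (1 / 2) ^ (k + 1) ≤ ‖z‖}
  -- The origin is not in any of the dyadic annuli, but `0 ^ (-q) = 0` there.
  have hcov : S ∩ ball 0 δ ⊆ (⋃ k, T k) ∪ {z | ‖z‖ ^ (-q) ≤ 0} := by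
    rintro z ⟨hzS, hz⟩
    rw [mem_ball_zero_iff] at hz
    rcases eq_or_ne z 0 with rfl | hz0
    · right; simp [Real.zero_rpow (neg_ne_zero.2 hq.ne')]
    · left
      have hzp := norm_pos_iff.2 hz0
      obtain ⟨k, hk1, hk2⟩ := exists_nat_pow_near_of_lt_one (y := (1 / 2 : ℝ)) (x := ‖z‖ / δ)
        (by positivity) (by rw [div_le_one hδ]; exact hz.le) (by norm_num) (by norm_num)
      rw [lt_div_iff₀ hδ] at hk1
      rw [div_le_iff₀ hδ] at hk2
      rcases hk2.lt_or_eq with h | h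
      · exact mem_iUnion.2 ⟨k, ⟨hzS, by rw [mem_ball_zero_iff]; linarith⟩, by
          simp only [mem_ofPred_eq]; linarith⟩
      · rcases Nat.eq_zero_or_pos k with rfl | hk
        · simp at h; linarith
        · obtain ⟨m, rfl⟩ : ∃ m, k = m + 1 := ⟨k - 1, by omega⟩
          refine mem_iUnion.2 ⟨m, ⟨hzS, ?_⟩, ?_⟩
          · rw [mem_ball_zero_iff, h, pow_succ]
            have : 0 < (1 / 2 : ℝ) ^ m * δ := by positivity
            nlinarith
          · simp only [mem_ofPred_eq]; linarith
  have hT : ∀ k, ∫⁻ z in T k, ENNReal.ofReal (‖z‖ ^ (-q)) ≤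
      ENNReal.ofReal (C * 2 ^ q * δ ^ (p - q) * (2 ^ (q - p)) ^ k) := by
    intro k
    have hr : 0 < δ * (1 / 2) ^ (k + 1) := by positivity
    calc ∫⁻ z in T k, ENNReal.ofReal (‖z‖ ^ (-q))
        ≤ ∫⁻ _ in T k, ENNReal.ofReal ((δ * (1 / 2) ^ (k + 1)) ^ (-q)) := by
          refine setLIntegral_mono measurable_const fun z hz => ENNReal.ofReal_le_ofReal ?_
          exact Real.rpow_le_rpow_of_nonpos hr hz.2 (by linarith)
      _ ≤ ENNReal.ofReal ((δ * (1 / 2) ^ (k + 1)) ^ (-q)) *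
          ENNReal.ofReal (C * (δ * (1 / 2) ^ k) ^ p) := by
          rw [setLIntegral_const]
          gcongr
          refine (measure_mono inter_subset_left).trans (hS _ (by positivity) ?_)
          exact mul_le_of_le_one_right hδ.le (pow_le_one₀ (by norm_num) (by norm_num))
      _ = _ := by
          rw [← ENNReal.ofReal_mul (by positivity)]
          congr 1
          rw [Real.mul_rpow hδ.le (by positivity), Real.mul_rpow hδ.le (by positivity),
            Real.rpow_sub hδ, Real.rpow_neg hδ.le]
          have e1 : ((1 / 2 : ℝ) ^ (k + 1)) ^ (-q) = 2 ^ q * (2 ^ q) ^ k := by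
            rw [one_div, inv_pow, Real.inv_rpow (by positivity), Real.rpow_neg (by positivity),
              inv_inv, ← Real.rpow_natCast, ← Real.rpow_natCast, ← Real.rpow_mul (by norm_num),
              ← Real.rpow_mul (by norm_num), ← Real.rpow_add (by norm_num)]
            congr 1; push_cast; ring
          have e2 : ((1 / 2 : ℝ) ^ k) ^ p = ((2 ^ p) ^ k)⁻¹ := by
            rw [one_div, inv_pow, Real.inv_rpow (by positivity), ← Real.rpow_natCast,
              ← Real.rpow_natCast, ← Real.rpow_mul (by norm_num), ← Real.rpow_mul (by norm_num)]
            congr 2; ring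
          rw [e1, e2, Real.rpow_sub (by norm_num), div_pow]
          have := Real.rpow_pos_of_pos hδ q
          field_simp
  have hlt : (2 : ℝ) ^ (q - p) < 1 := Real.rpow_lt_one_of_one_lt_of_neg (by norm_num) (by linarith)
  have hpos : (0 : ℝ) < 2 ^ (q - p) := by positivity
  calc ∫⁻ z in S ∩ ball 0 δ, ENNReal.ofReal (‖z‖ ^ (-q))
      ≤ ∫⁻ z in (⋃ k, T k) ∪ {z | ‖z‖ ^ (-q) ≤ 0}, ENNReal.ofReal (‖z‖ ^ (-q)) :=
        lintegral_mono_set hcov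
    _ ≤ (∫⁻ z in ⋃ k, T k, ENNReal.ofReal (‖z‖ ^ (-q))) +
        ∫⁻ z in {z : Eucl n | ‖z‖ ^ (-q) ≤ 0}, ENNReal.ofReal (‖z‖ ^ (-q)) :=
        lintegral_union_le _ _ _
    _ ≤ ∑' k, ENNReal.ofReal (C * 2 ^ q * δ ^ (p - q) * (2 ^ (q - p)) ^ k) + 0 := by
        refine add_le_add ((lintegral_iUnion_le _ _).trans (ENNReal.tsum_le_tsum hT)) ?_
        refine (setLIntegral_mono measurable_const (g := fun _ => 0) fun z hz => ?_).trans
          (by simp)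
        rw [ENNReal.ofReal_of_nonpos hz]
    _ = _ := by
        rw [add_zero, ← ENNReal.ofReal_tsum_of_nonneg (fun k => by positivity)
          ((summable_geometric_of_lt_one hpos.le hlt).mul_left _), tsum_mul_left,
          tsum_geometric_of_lt_one hpos.le hlt]
        congr 1; ring

/-- Dyadic decomposition near infinity: if `|S ∩ B_ρ| ≤ C ρᵖ` for `ρ ≥ δ` then
`∫_{S \ B_δ} |z|^{-q} ≤ C' δ^{p-q}` when `p < q`. -/
theorem lintegral_norm_rpow_outer_le {S : Set (Eucl n)} {p q C δ : ℝ} (hC : 0 ≤ C) (hq : 0 < q)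
    (hpq : p < q) (hδ : 0 < δ)
    (hS : ∀ ρ, δ ≤ ρ → volume (S ∩ ball 0 ρ) ≤ ENNReal.ofReal (C * ρ ^ p)) :
    ∫⁻ z in S \ ball 0 δ, ENNReal.ofReal (‖z‖ ^ (-q)) ≤
      ENNReal.ofReal (C * (2 ^ p * (1 - 2 ^ (p - q))⁻¹) * δ ^ (p - q)) := by
  let T : ℕ → Set (Eucl n) := fun k =>
    (S ∩ ball 0 (δ * 2 ^ (k + 1))) ∩ {z | δ * 2 ^ k ≤ ‖z‖}
  have hcov : S \ ball 0 δ ⊆ ⋃ k, T k := by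
    rintro z ⟨hzS, hz⟩
    rw [mem_ball_zero_iff, not_lt] at hz
    obtain ⟨k, hk1, hk2⟩ := exists_nat_pow_near (y := (2 : ℝ)) (x := ‖z‖ / δ)
      (by rw [le_div_iff₀ hδ]; linarith) (by norm_num)
    rw [le_div_iff₀ hδ] at hk1
    rw [div_lt_iff₀ hδ] at hk2
    exact mem_iUnion.2 ⟨k, ⟨hzS, by rw [mem_ball_zero_iff]; linarith⟩, by
      simp only [mem_ofPred_eq]; linarith⟩
  have hT : ∀ k, ∫⁻ z in T k, ENNReal.ofReal (‖z‖ ^ (-q)) ≤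
      ENNReal.ofReal (C * 2 ^ p * δ ^ (p - q) * (2 ^ (p - q)) ^ k) := by
    intro k
    have hr : 0 < δ * 2 ^ k := by positivity
    calc ∫⁻ z in T k, ENNReal.ofReal (‖z‖ ^ (-q))
        ≤ ∫⁻ _ in T k, ENNReal.ofReal ((δ * 2 ^ k) ^ (-q)) := by
          refine setLIntegral_mono measurable_const fun z hz => ENNReal.ofReal_le_ofReal ?_
          exact Real.rpow_le_rpow_of_nonpos hr hz.2 (by linarith)
      _ ≤ ENNReal.ofReal ((δ * 2 ^ k) ^ (-q)) * ENNReal.ofReal (C * (δ * 2 ^ (k + 1)) ^ p) := by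
          rw [setLIntegral_const]
          gcongr
          refine (measure_mono inter_subset_left).trans (hS _ ?_)
          exact le_mul_of_one_le_right hδ.le (one_le_pow₀ (by norm_num))
      _ = _ := by
          rw [← ENNReal.ofReal_mul (by positivity)]
          congr 1
          rw [Real.mul_rpow hδ.le (by positivity), Real.mul_rpow hδ.le (by positivity),
            Real.rpow_sub hδ, Real.rpow_neg hδ.le]
          have e1 : ((2 : ℝ) ^ (k + 1)) ^ p = 2 ^ p * (2 ^ p) ^ k := by
            rw [← Real.rpow_natCast, ← Real.rpow_natCast, ← Real.rpow_mul (by norm_num),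
              ← Real.rpow_mul (by norm_num), ← Real.rpow_add (by norm_num)]
            congr 1; push_cast; ring
          have e2 : ((2 : ℝ) ^ k) ^ (-q) = ((2 ^ q) ^ k)⁻¹ := by
            rw [Real.rpow_neg (by positivity), ← Real.rpow_natCast,
              ← Real.rpow_natCast, ← Real.rpow_mul (by norm_num), ← Real.rpow_mul (by norm_num)]
            congr 2; ring
          rw [e1, e2, Real.rpow_sub (by norm_num), div_pow]
          have := Real.rpow_pos_of_pos hδ q
          field_simp
  have hlt : (2 : ℝ) ^ (p - q) < 1 := Real.rpow_lt_one_of_one_lt_of_neg (by norm_num) (by linarith)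
  have hpos : (0 : ℝ) < 2 ^ (p - q) := by positivity
  calc ∫⁻ z in S \ ball 0 δ, ENNReal.ofReal (‖z‖ ^ (-q))
      ≤ ∫⁻ z in ⋃ k, T k, ENNReal.ofReal (‖z‖ ^ (-q)) := lintegral_mono_set hcov
    _ ≤ ∑' k, ENNReal.ofReal (C * 2 ^ p * δ ^ (p - q) * (2 ^ (p - q)) ^ k) :=
        (lintegral_iUnion_le _ _).trans (ENNReal.tsum_le_tsum hT)
    _ = _ := by
        rw [← ENNReal.ofReal_tsum_of_nonneg (fun k => by positivity)
          ((summable_geometric_of_lt_one hpos.le hlt).mul_left _), tsum_mul_left,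
          tsum_geometric_of_lt_one hpos.le hlt]
        congr 1; ring

theorem measurable_norm_rpow (q : ℝ) : Measurable fun z : Eucl n => ‖z‖ ^ q := by fun_prop

/-- Passing from a bound on the lower integral of `|z|^{-q}` to integrability and a bound on the
Bochner integral. -/
theorem integrableOn_norm_rpow_of_lintegral_le {S : Set (Eucl n)} {q C : ℝ} (hC : 0 ≤ C)
    (h : ∫⁻ z in S, ENNReal.ofReal (‖z‖ ^ (-q)) ≤ ENNReal.ofReal C) :
    IntegrableOn (fun z : Eucl n => ‖z‖ ^ (-q)) S ∧ ∫ z in S, ‖z‖ ^ (-q) ≤ C := by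
  have h0 : ∀ z : Eucl n, 0 ≤ ‖z‖ ^ (-q) := fun z => by positivity
  refine ⟨⟨(measurable_norm_rpow _).aestronglyMeasurable, ?_⟩, ?_⟩
  · rw [hasFiniteIntegral_iff_ofReal (Eventually.of_forall h0)]
    exact h.trans_lt ENNReal.ofReal_lt_top
  · rw [integral_eq_lintegral_of_nonneg_ae (Eventually.of_forall h0)
      (measurable_norm_rpow _).aestronglyMeasurable]
    exact ENNReal.toReal_le_of_le_ofReal hC h

/-- The tail of `|z|^{-n-s}` outside `B_δ` is `O(δ^{-s})`. -/
theorem exists_tail_bound {s : ℝ} (hs : 0 < s) : ∃ C > 0, ∀ δ > 0,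
    IntegrableOn (fun z : Eucl n => ‖z‖ ^ (-((n : ℝ) + s))) (ball 0 δ)ᶜ ∧
      ∫ z in (ball (0 : Eucl n) δ)ᶜ, ‖z‖ ^ (-((n : ℝ) + s)) ≤ C * δ ^ (-s) := by
  have hω := unitBallVolume_pos (n := n)
  have hlt : (2 : ℝ) ^ ((n : ℝ) - (n + s)) < 1 :=
    Real.rpow_lt_one_of_one_lt_of_neg (by norm_num) (by linarith)
  have : 0 < (1 - (2 : ℝ) ^ ((n : ℝ) - (n + s)))⁻¹ := inv_pos.2 (by linarith)
  refine ⟨unitBallVolume n * (2 ^ (n : ℝ) * (1 - 2 ^ ((n : ℝ) - (n + s)))⁻¹), by positivity,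
    fun δ hδ => ?_⟩
  refine integrableOn_norm_rpow_of_lintegral_le (by positivity) ?_
  have := lintegral_norm_rpow_outer_le (S := univ) (p := n) (q := n + s) hω.le (by positivity)
    (by linarith) hδ fun ρ hρ => by
      rw [univ_inter, volume_ball_eq _ (hδ.trans_le hρ)]
  rw [← compl_eq_univ_sdiff] at this
  convert this using 3
  congr 1; ring

/-- The part of `|z|^{-n-s}` outside `B_δ` in a cone of opening `τ` around a hyperplane is
`O(τ δ^{-s})`. -/
theorem exists_cone_bound {s : ℝ} (hs : 0 < s) : ∃ C > 0, ∀ ν : Eucl n, ‖ν‖ = 1 → ∀ τ > 0,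
    ∀ δ > 0, ∫ z in {z : Eucl n | |⟪ν, z⟫| ≤ τ * ‖z‖} \ ball 0 δ, ‖z‖ ^ (-((n : ℝ) + s)) ≤
      C * τ * δ ^ (-s) := by
  have hω := unitBallVolume_pos (n := n)
  have hlt : (2 : ℝ) ^ ((n : ℝ) - (n + s)) < 1 :=
    Real.rpow_lt_one_of_one_lt_of_neg (by norm_num) (by linarith)
  have : 0 < (1 - (2 : ℝ) ^ ((n : ℝ) - (n + s)))⁻¹ := inv_pos.2 (by linarith)
  refine ⟨6 * 2 ^ (n : ℝ) * unitBallVolume n * (2 ^ (n : ℝ) * (1 - 2 ^ ((n : ℝ) - (n + s)))⁻¹),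
    by positivity, fun ν hν τ hτ δ hδ => ?_⟩
  refine (integrableOn_norm_rpow_of_lintegral_le (by positivity) ?_).2
  have := lintegral_norm_rpow_outer_le (S := {z : Eucl n | |⟪ν, z⟫| ≤ τ * ‖z‖}) (p := n)
    (q := n + s) (C := 6 * 2 ^ (n : ℝ) * unitBallVolume n * τ) (by positivity) (by positivity)
    (by linarith) hδ fun ρ hρ => by
      refine (measure_mono ?_).trans (volume_slab_le hν hτ (hδ.trans_le hρ))
      rintro z ⟨hz, hz'⟩
      refine ⟨mem_ofPred.2 (le_trans (mem_ofPred.1 hz) ?_), hz'⟩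
      have := (mem_ball_zero_iff.1 hz').le
      gcongr
  convert this using 2
  rw [show (n : ℝ) - (n + s) = -s by ring]; ring

/-- The part of `|z|^{-n-s}` inside `B_δ` in the cusp `|ν·z| ≤ b |z|^{1+α}`, `α > s`, is
`O(b δ^{α-s})`. -/
theorem exists_cusp_bound {s α : ℝ} (hs : 0 < s) (hα : s < α) : ∃ C > 0, ∀ ν : Eucl n, ‖ν‖ = 1 →
    ∀ b > 0, ∀ δ > 0,
    IntegrableOn (fun z : Eucl n => ‖z‖ ^ (-((n : ℝ) + s)))
      ({z : Eucl n | |⟪ν, z⟫| ≤ b * ‖z‖ ^ (1 + α)} ∩ ball 0 δ) ∧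
    ∫ z in {z : Eucl n | |⟪ν, z⟫| ≤ b * ‖z‖ ^ (1 + α)} ∩ ball 0 δ, ‖z‖ ^ (-((n : ℝ) + s)) ≤
      C * b * δ ^ (α - s) := by
  have hω := unitBallVolume_pos (n := n)
  have hlt : (2 : ℝ) ^ ((n : ℝ) + s - (n + α)) < 1 :=
    Real.rpow_lt_one_of_one_lt_of_neg (by norm_num) (by linarith)
  have : 0 < (1 - (2 : ℝ) ^ ((n : ℝ) + s - (n + α)))⁻¹ := inv_pos.2 (by linarith)
  refine ⟨6 * 2 ^ (n : ℝ) * unitBallVolume n *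
    (2 ^ ((n : ℝ) + s) * (1 - 2 ^ ((n : ℝ) + s - (n + α)))⁻¹),
    by positivity, fun ν hν b hb δ hδ => ?_⟩
  refine integrableOn_norm_rpow_of_lintegral_le (by positivity) ?_
  have := lintegral_norm_rpow_inner_le (S := {z : Eucl n | |⟪ν, z⟫| ≤ b * ‖z‖ ^ (1 + α)})
    (p := n + α) (q := n + s) (C := 6 * 2 ^ (n : ℝ) * unitBallVolume n * b) (by positivity)
    (by positivity) (by linarith) hδ fun ρ hρ _ => by
      have hρα : 0 < b * ρ ^ α := by positivity
      refine (measure_mono ?_).trans ((volume_slab_le hν hρα hρ).trans_eq ?_)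
      · rintro z ⟨hz, hz'⟩
        refine ⟨mem_ofPred.2 (le_trans (mem_ofPred.1 hz) ?_), hz'⟩
        have := (mem_ball_zero_iff.1 hz').le
        have h1 : ‖z‖ ^ (1 + α) ≤ ρ ^ (1 + α) :=
          Real.rpow_le_rpow (norm_nonneg _) this (by linarith)
        rw [Real.rpow_add hρ, Real.rpow_one] at h1
        calc b * ‖z‖ ^ (1 + α) ≤ b * (ρ * ρ ^ α) := by gcongr
          _ = _ := by ring
      · congr 1
        rw [Real.rpow_add hρ]; ring
  convert this using 2
  rw [show (n : ℝ) + α - (n + s) = α - s by ring]; ring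

/-! ### Essential boundaries and almost linear functions -/

/-- A set is null or conull in a connected open set that does not meet its essential boundary. -/
theorem null_or_conull_of_isPreconnected {E O : Set (Eucl n)} (hc : IsPreconnected O)
    (hdisj : ∀ x ∈ O, x ∉ essBoundary E) :
    (∀ᵐ y : Eucl n, y ∈ O → y ∉ E) ∨ ∀ᵐ y : Eucl n, y ∈ O → y ∈ E := by
  -- `N F` is the open set of points near which `F` is null; off the essential boundary of `E`
  -- each point lies in exactly one of `N E` and `N Eᶜ`.
  let N : Set (Eucl n) → Set (Eucl n) := fun F => {x | ∃ r > 0, volume (F ∩ ball x r) = 0}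
  have hopen : ∀ F, IsOpen (N F) := by
    intro F
    rw [Metric.isOpen_iff]
    rintro x ⟨r, hr, h⟩
    refine ⟨r / 2, half_pos hr, fun y hy => ⟨r / 2, half_pos hr, measure_mono_null ?_ h⟩⟩
    refine inter_subset_inter_right _ (ball_subset_ball' ?_)
    have := (mem_ball.1 hy).le
    linarith
  have hnull : ∀ F, O ⊆ N F → ∀ᵐ y : Eucl n, y ∈ O → y ∉ F := by
    intro F hF
    have : volume (O ∩ F) = 0 := by
      refine measure_null_of_locally_null _ fun x hx => ?_
      obtain ⟨r, hr, h⟩ := hF hx.1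
      refine ⟨F ∩ ball x r, ?_, h⟩
      refine mem_nhdsWithin.2 ⟨ball x r, isOpen_ball, mem_ball_self hr, ?_⟩
      rintro y ⟨hy, hy'⟩
      exact ⟨hy'.2, hy⟩
    filter_upwards [measure_eq_zero_iff_ae_notMem.1 this] with y hy hyO hyF
    exact hy ⟨hyO, hyF⟩
  have hd : Disjoint (N E) (N Eᶜ) := by
    refine Set.disjoint_left.2 ?_
    rintro x ⟨r, hr, h⟩ ⟨r', hr', h'⟩
    have h1 : volume (ball x (min r r')) = 0 := by
      refine measure_mono_null ?_ (measure_union_null h h')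
      intro y hy
      by_cases hyE : y ∈ E
      · exact Or.inl ⟨hyE, ball_subset_ball (min_le_left _ _) hy⟩
      · exact Or.inr ⟨hyE, ball_subset_ball (min_le_right _ _) hy⟩
    exact (measure_ball_pos _ _ (lt_min hr hr')).ne' h1
  have hcov : O ⊆ N E ∪ N Eᶜ := by
    intro x hx
    have h := hdisj x hx
    simp only [essBoundary, mem_ofPred_eq, not_forall, not_and_or, not_lt, nonpos_iff_eq_zero] at h
    obtain ⟨r, hr, h | h⟩ := h
    · exact Or.inl ⟨r, hr, h⟩
    · exact Or.inr ⟨r, hr, h⟩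
  rcases IsPreconnected.subset_or_subset (hopen E) (hopen Eᶜ) hd hcov hc with h | h
  · exact Or.inl (hnull E h)
  · right
    filter_upwards [hnull Eᶜ h] with y hy hyO
    exact not_not.1 (hy hyO)

/-- On `B`, the function `u` differs from the linear function `⟪ν, ·⟫` by an `ε`-Lipschitz
function. -/
def AlmostLinearOn (u : Eucl n → ℝ) (ν : Eucl n) (ε : ℝ) (B : Set (Eucl n)) : Prop :=
  ∀ y ∈ B, ∀ z ∈ B, |u y - u z - ⟪ν, y - z⟫| ≤ ε * ‖y - z‖

theorem AlmostLinearOn.mono {u : Eucl n → ℝ} {ν : Eucl n} {ε ε' : ℝ} {B B' : Set (Eucl n)}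
    (h : AlmostLinearOn u ν ε B) (hε : ε ≤ ε') (hB : B' ⊆ B) : AlmostLinearOn u ν ε' B' :=
  fun y hy z hz => (h y (hB hy) z (hB hz)).trans (by gcongr)

theorem AlmostLinearOn.neg {u : Eucl n → ℝ} {ν : Eucl n} {ε : ℝ} {B : Set (Eucl n)}
    (h : AlmostLinearOn u ν ε B) : AlmostLinearOn (fun y => -u y) (-ν) ε B := by
  intro y hy z hz
  have := h y hy z hz
  rw [← abs_neg] at this
  convert this using 2
  simp only [inner_neg_left]; ring

theorem AlmostLinearOn.const_smul {u : Eucl n → ℝ} {ν : Eucl n} {ε : ℝ} {B : Set (Eucl n)}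
    (h : AlmostLinearOn u ν ε B) {c : ℝ} (hc : 0 ≤ c) :
    AlmostLinearOn (fun y => c * u y) (c • ν) (c * ε) B := by
  intro y hy z hz
  have := mul_le_mul_of_nonneg_left (h y hy z hz) hc
  have e : c * u y - c * u z - ⟪c • ν, y - z⟫ = c * (u y - u z - ⟪ν, y - z⟫) := by
    rw [real_inner_smul_left]; ring
  rwa [mul_assoc, e, abs_mul, abs_of_nonneg hc]

theorem AlmostLinearOn.continuousOn {u : Eucl n → ℝ} {ν : Eucl n} {ε : ℝ} {B : Set (Eucl n)}
    (h : AlmostLinearOn u ν ε B) : ContinuousOn u B := by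
  refine (LipschitzOnWith.of_dist_le_mul (K := (|ε| + ‖ν‖).toNNReal)
    fun y hy z hz => ?_).continuousOn
  rw [Real.coe_toNNReal _ (by positivity), Real.dist_eq, dist_eq_norm]
  have h1 := h y hy z hz
  have h2 := abs_real_inner_le_norm ν (y - z)
  have h3 : |u y - u z| ≤ |u y - u z - ⟪ν, y - z⟫| + |⟪ν, y - z⟫| := by
    have := abs_add_le (u y - u z - ⟪ν, y - z⟫) ⟪ν, y - z⟫
    simpa using this
  have h4 : ε * ‖y - z‖ ≤ |ε| * ‖y - z‖ := by gcongr; exact le_abs_self _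
  linarith

/-- A `C¹` function is almost linear near each point. -/
theorem exists_almostLinearOn {u : Eucl n → ℝ} {U : Set (Eucl n)} (hU : IsOpen U) {x : Eucl n}
    (hx : x ∈ U) (hu : ContDiffOn ℝ 1 u U) {ε : ℝ} (hε : 0 < ε) :
    ∃ ρ > 0, AlmostLinearOn u ((InnerProductSpace.toDual ℝ (Eucl n)).symm (fderiv ℝ u x)) ε
      (ball x ρ) := by
  have h1 : HasStrictFDerivAt u (fderiv ℝ u x) x :=
    (hu.contDiffAt (hU.mem_nhds hx)).hasStrictFDerivAt (by norm_num)
  obtain ⟨s, hs, h⟩ := h1.approximates_deriv_on_nhds (c := ε.toNNReal)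
    (Or.inr (Real.toNNReal_pos.2 hε))
  obtain ⟨ρ, hρ, hs'⟩ := Metric.mem_nhds_iff.1 hs
  refine ⟨ρ, hρ, fun y hy z hz => ?_⟩
  have := h y (hs' hy) z (hs' hz)
  rw [Real.coe_toNNReal _ hε.le] at this
  rwa [InnerProductSpace.toDual_symm_apply, ← Real.norm_eq_abs]

/-- Sublevel sets of almost linear functions in a ball are star-shaped around each sufficiently
deep point. -/
theorem AlmostLinearOn.lt_zero_of_segment {u : Eucl n → ℝ} {ν : Eucl n} {ε r : ℝ} {x : Eucl n}
    (h : AlmostLinearOn u ν ε (ball x r)) (hε : 0 < ε) {z : Eucl n} (hz : z ∈ ball x r)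
    (huz : u z ≤ -(4 * ε * r)) {y : Eucl n} (hy : y ∈ ball x r) (huy : u y < 0) {t : ℝ}
    (ht0 : 0 ≤ t) (ht1 : t ≤ 1) : u (y + t • (z - y)) < 0 := by
  have hmem : y + t • (z - y) ∈ ball x r :=
    (convex_ball x r).add_smul_sub_mem hy hz ⟨ht0, ht1⟩
  by_contra hcon
  push Not at hcon
  have hd : ‖z - y‖ < 2 * r := by
    have h1 := mem_ball.1 hz
    have h2 := mem_ball'.1 hy
    rw [← dist_eq_norm]
    linarith [dist_triangle z x y]
  have hr : 0 < r := by linarith [norm_nonneg (z - y)]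
  have hz0 : u z < 0 := by nlinarith [mul_pos hε hr]
  have h1 := abs_le.1 (h _ hmem y hy)
  have h2 := abs_le.1 (h z hz _ hmem)
  have e1 : y + t • (z - y) - y = t • (z - y) := by abel
  have e2 : z - (y + t • (z - y)) = (1 - t) • (z - y) := by rw [sub_smul, one_smul]; abel
  rw [e1, inner_smul_right, norm_smul, Real.norm_of_nonneg ht0] at h1
  rw [e2, inner_smul_right, norm_smul, Real.norm_of_nonneg (sub_nonneg.2 ht1)] at h2
  set D := ‖z - y‖
  set I := ⟪ν, z - y⟫
  have hεr : ε * D < 2 * ε * r := by nlinarith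
  have ht' : 0 < t := by
    rcases ht0.eq_or_lt with rfl | h
    · simp at hcon; linarith
    · exact h
  have ht'' : t < 1 := by
    rcases ht1.eq_or_lt with rfl | h
    · simp at hcon; linarith
    · exact h
  have a1 : 0 < t * (I + ε * D) := by nlinarith [h1.2]
  have a2 : 0 < I + ε * D := pos_of_mul_pos_right a1 ht0
  have a3 : (1 - t) * (I - ε * D) ≤ -(4 * ε * r) := by nlinarith [h2.1]
  nlinarith [mul_pos (sub_pos.2 ht'') a2]

theorem AlmostLinearOn.starConvex {u : Eucl n → ℝ} {ν : Eucl n} {ε r : ℝ} {x : Eucl n}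
    (h : AlmostLinearOn u ν ε (ball x r)) (hε : 0 < ε) {z : Eucl n} (hz : z ∈ ball x r)
    (huz : u z ≤ -(4 * ε * r)) : StarConvex ℝ z (ball x r ∩ {y | u y < 0}) := by
  rintro y ⟨hy, hy'⟩ a b ha hb hab
  have e : a • z + b • y = y + a • (z - y) := by
    rw [← eq_sub_iff_add_eq'] at hab
    rw [hab, sub_smul, smul_sub, one_smul]; abel
  rw [e]
  exact ⟨(convex_ball x r).add_smul_sub_mem hy hz ⟨ha, by linarith⟩,
    h.lt_zero_of_segment hε hz huz hy hy' ha (by linarith)⟩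

theorem AlmostLinearOn.add_smul_le {u : Eucl n → ℝ} {ν : Eucl n} {ε : ℝ} {B : Set (Eucl n)}
    (h : AlmostLinearOn u ν ε B) (hν : ‖ν‖ = 1) {y : Eucl n} {t : ℝ} (ht : 0 ≤ t) (hy : y ∈ B)
    (hy' : y + t • ν ∈ B) : (1 - ε) * t ≤ u (y + t • ν) - u y ∧
      u (y + t • ν) - u y ≤ (1 + ε) * t := by
  have := abs_le.1 (h _ hy' y hy)
  rw [add_sub_cancel_left, inner_smul_right, real_inner_self_eq_norm_sq, norm_smul, hν,
    Real.norm_of_nonneg ht] at this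
  constructor <;> nlinarith [this.1, this.2]

/-- The zero set of an almost linear function is null: its translates in the direction of the
gradient are disjoint. -/
theorem AlmostLinearOn.volume_zero_set {u : Eucl n → ℝ} {ν : Eucl n} {ε r : ℝ} {x : Eucl n}
    (h : AlmostLinearOn u ν ε (ball x r)) (hν : ‖ν‖ = 1) (hε : ε < 1) :
    ∀ᵐ y : Eucl n, y ∈ ball x r → u y ≠ 0 := by
  -- the radius is shrunk slightly to leave room for the translates
  have key : ∀ r' < r, volume {y | y ∈ ball x r' ∧ u y = 0} = 0 := by
    intro r' hr'
    set A := {y | y ∈ ball x r' ∧ u y = 0}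
    have hA : MeasurableSet A := by
      have hc : ContinuousOn u (ball x r') := h.continuousOn.mono (ball_subset_ball hr'.le)
      obtain ⟨V, hV, hVe⟩ := (_root_.continuousOn_iff'.1 hc) {0}ᶜ isClosed_singleton.isOpen_compl
      have : A = ball x r' \ (V ∩ ball x r') := by
        rw [← hVe]
        ext y
        simp only [A, mem_ofPred_eq, Set.mem_sdiff, mem_inter_iff, mem_preimage, mem_compl_iff,
          mem_singleton_iff]
        tauto
      rw [this]
      exact measurableSet_ball.diff (hV.measurableSet.inter measurableSet_ball)
    -- Arbitrarily many disjoint translates of `A` fit into `ball x r`, so `A` is null.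
    have hN : ∀ N : ℕ, (N : ℝ≥0∞) * volume A ≤ volume (ball x r) := by
      intro N
      have hNp : (0 : ℝ) < N + 1 := by positivity
      have hsub : ∀ j < N, ∀ y ∈ A, y + (j : ℝ) • (((r - r') / (N + 1)) • ν) ∈ ball x r := by
        intro j hj y hy
        have hy1 := mem_ball.1 hy.1
        rw [mem_ball, dist_eq_norm] at *
        have e : y + (j : ℝ) • (((r - r') / (N + 1)) • ν) - x =
          (y - x) + (j : ℝ) • (((r - r') / (N + 1)) • ν) := by abel
        rw [e]
        refine (norm_add_le _ _).trans_lt ?_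
        rw [norm_smul, norm_smul, hν, mul_one, Real.norm_of_nonneg (by positivity),
          Real.norm_of_nonneg (div_nonneg (by linarith) hNp.le)]
        have : (j : ℝ) * ((r - r') / (N + 1)) ≤ r - r' := by
          rw [mul_div_assoc', div_le_iff₀ hNp]
          have : (j : ℝ) ≤ N := by exact_mod_cast hj.le
          nlinarith
        linarith
      refine card_mul_volume_le_of_translates hA (((r - r') / (N + 1)) • ν) N ?_ hsub
      intro j k hjk hk y hy z hz heq
      have hyB := hsub j (hjk.trans hk) y hy
      have h1 : y = z + (((k : ℝ) - j) * ((r - r') / (N + 1))) • ν := by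
        have : y = z + (k : ℝ) • (((r - r') / (N + 1)) • ν) -
            (j : ℝ) • (((r - r') / (N + 1)) • ν) := by rw [← heq]; abel
        rw [this, mul_smul, sub_smul]; abel
      have hpos : 0 < ((k : ℝ) - j) * ((r - r') / (N + 1)) := by
        have : (j : ℝ) < k := by exact_mod_cast hjk
        exact mul_pos (by linarith) (div_pos (by linarith) hNp)
      have h2 := (h.add_smul_le hν hpos.le (ball_subset_ball hr'.le hz.1)
        (by rw [← h1]; exact ball_subset_ball hr'.le hy.1)).1
      rw [← h1, hy.2, hz.2] at h2
      nlinarith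
    by_contra hne
    have hlt : volume (ball x r) / volume A < ∞ :=
      ENNReal.div_lt_top measure_ball_lt_top.ne hne
    obtain ⟨N, hN'⟩ := ENNReal.exists_nat_gt hlt.ne
    have hAf : volume A ≠ ∞ :=
      (lt_of_le_of_lt (measure_mono fun y hy => hy.1) (measure_ball_lt_top (x := x) (r := r'))).ne
    rw [ENNReal.div_lt_iff (Or.inl hne) (Or.inl hAf)] at hN'
    exact absurd (hN N) (not_le.2 hN')
  have hcov : {y | ¬(y ∈ ball x r → u y ≠ 0)} ⊆
      ⋃ k : ℕ, {y | y ∈ ball x (r - 1 / (k + 1)) ∧ u y = 0} := by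
    intro y hy
    simp only [mem_ofPred_eq, Classical.not_imp, not_not] at hy
    obtain ⟨k, hk⟩ := exists_nat_one_div_lt (sub_pos.2 (mem_ball.1 hy.1))
    exact mem_iUnion.2 ⟨k, mem_ball.2 (by linarith), hy.2⟩
  exact measure_mono_null hcov (measure_iUnion_null fun k => key _ (by
    have : (0 : ℝ) < 1 / (k + 1) := by positivity
    linarith))

/-- Up to null sets, `E` is the sublevel set `{u < 0}` inside `B`. -/
def IsSublevelOn (E : Set (Eucl n)) (u : Eucl n → ℝ) (B : Set (Eucl n)) : Prop :=
  ∀ᵐ y : Eucl n, y ∈ B → (u y < 0 → y ∈ E) ∧ (0 < u y → y ∉ E)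

theorem IsSublevelOn.mono {E : Set (Eucl n)} {u : Eucl n → ℝ} {B B' : Set (Eucl n)}
    (h : IsSublevelOn E u B) (hB : B' ⊆ B) : IsSublevelOn E u B' := by
  filter_upwards [h] with y hy hyB using hy (hB hyB)

/-- Where the essential boundary of `E` is the zero set of an almost linear function `u`, the set
`E` is one of the two sides of it. -/
theorem isSublevelOn_or_of_essBoundary {E : Set (Eucl n)} {u : Eucl n → ℝ} {ν : Eucl n}
    {ε r : ℝ} {x : Eucl n} (h : AlmostLinearOn u ν ε (ball x r)) (hν : ‖ν‖ = 1) (hε0 : 0 < ε)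
    (hε : ε ≤ 1 / 16) (hr : 0 < r) (hux : u x = 0)
    (hE : ∀ y ∈ ball x r, y ∈ essBoundary E ↔ u y = 0) :
    IsSublevelOn E u (ball x r) ∨ IsSublevelOn E (fun y => -u y) (ball x r) := by
  -- Each side of `{u = 0}` is star-shaped, hence connected, so `E` is null or conull in it.
  have side : ∀ (u : Eucl n → ℝ) (ν : Eucl n), AlmostLinearOn u ν ε (ball x r) → ‖ν‖ = 1 →
      u x = 0 → (∀ y ∈ ball x r, y ∈ essBoundary E ↔ u y = 0) →
      (∀ᵐ y : Eucl n, y ∈ ball x r ∩ {y | u y < 0} → y ∉ E) ∨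
        ∀ᵐ y : Eucl n, y ∈ ball x r ∩ {y | u y < 0} → y ∈ E := by
    intro u ν h hν hux hE
    set z := x + (-(1 / 2) * r) • ν with hz
    have hzx : z - x = (-(1 / 2) * r) • ν := by rw [hz]; abel
    have hzB : z ∈ ball x r := by
      rw [mem_ball, dist_eq_norm, hzx, norm_smul, hν, Real.norm_eq_abs, abs_mul,
        abs_of_pos hr]
      norm_num
      linarith
    have huz : u z ≤ -(4 * ε * r) := by
      have := (abs_le.1 (h z hzB x (mem_ball_self hr))).2
      rw [hzx, inner_smul_right, real_inner_self_eq_norm_sq, norm_smul, hν, hux,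
        Real.norm_eq_abs, abs_mul, abs_of_pos hr] at this
      norm_num at this
      nlinarith
    refine null_or_conull_of_isPreconnected ?_ ?_
    · have hr' : 0 < 4 * ε * r := by positivity
      exact ((h.starConvex hε0 hzB huz).isPathConnected
        ⟨hzB, mem_ofPred.2 (by linarith)⟩).isConnected.isPreconnected
    · rintro y ⟨hy, hy'⟩ hyE
      rw [hE y hy] at hyE
      exact (mem_ofPred.1 hy').ne hyE
  have hx : x ∈ essBoundary E := (hE x (mem_ball_self hr)).2 hux
  have hz := h.volume_zero_set hν (by linarith)
  -- The same alternative on both sides would contradict `x ∈ essBoundary E`.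
  rcases side u ν h hν hux hE with h1 | h1 <;>
  rcases side (fun y => -u y) (-ν) h.neg (by simpa using hν) (by simpa using hux)
    (by simpa using hE) with h2 | h2
  · have h0 : volume (E ∩ ball x r) = 0 := by
      rw [measure_eq_zero_iff_ae_notMem]
      filter_upwards [h1, h2, hz] with y h1 h2 h3
      rintro ⟨hyE, hy⟩
      rcases lt_or_gt_of_ne (h3 hy) with h4 | h4
      · exact h1 ⟨hy, h4⟩ hyE
      · exact h2 ⟨hy, by simpa using h4⟩ hyE
    exact absurd h0 (hx r hr).1.ne'
  · right
    filter_upwards [h1, h2] with y h1 h2 hy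
    exact ⟨fun h => h2 ⟨hy, h⟩, fun h => h1 ⟨hy, by simpa using h⟩⟩
  · left
    filter_upwards [h1, h2] with y h1 h2 hy
    exact ⟨fun h => h1 ⟨hy, h⟩, fun h => h2 ⟨hy, by simpa using h⟩⟩
  · have h0 : volume (Eᶜ ∩ ball x r) = 0 := by
      rw [measure_eq_zero_iff_ae_notMem]
      filter_upwards [h1, h2, hz] with y h1 h2 h3
      rintro ⟨hyE, hy⟩
      rcases lt_or_gt_of_ne (h3 hy) with h4 | h4
      · exact hyE (h1 ⟨hy, h4⟩)
      · exact hyE (h2 ⟨hy, by simpa using h4⟩)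
    exact absurd h0 (hx r hr).2.ne'

/-- An almost linear function `u` with unit gradient has a zero within distance `2 |u y|` of `y`, on
the line through `y` in the direction of the gradient. -/
theorem AlmostLinearOn.exists_zero {u : Eucl n → ℝ} {ν : Eucl n} {ε : ℝ} {B : Set (Eucl n)}
    (h : AlmostLinearOn u ν ε B) (hν : ‖ν‖ = 1) (hε : ε ≤ 1 / 2) {y : Eucl n}
    (hB : closedBall y (2 * |u y|) ⊆ B) : ∃ z, ‖z - y‖ ≤ 2 * |u y| ∧ u z = 0 := by
  set a := 2 * |u y|
  have ha : 0 ≤ a := by positivity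
  have hmem : ∀ t ∈ Icc (-a) a, y + t • ν ∈ closedBall y a := by
    intro t ht
    rw [mem_closedBall, dist_eq_norm, add_sub_cancel_left, norm_smul, hν, mul_one]
    exact abs_le.2 ht
  have hc : ContinuousOn (fun t : ℝ => u (y + t • ν)) (Icc (-a) a) :=
    h.continuousOn.comp (by fun_prop) fun t ht => hB (hmem t ht)
  have hyB : y ∈ B := hB (mem_closedBall_self ha)
  have h1 : 0 ≤ u (y + a • ν) := by
    have := (h.add_smul_le hν ha hyB (hB (hmem a ⟨by linarith, le_rfl⟩))).1
    have := neg_abs_le (u y)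
    nlinarith
  have h2 : u (y + (-a) • ν) ≤ 0 := by
    have h3 := hmem (-a) ⟨le_rfl, by linarith⟩
    have := (h.add_smul_le hν ha (hB h3) (by simpa using hyB)).1
    have := le_abs_self (u y)
    simp only [neg_smul, neg_add_cancel_right] at *
    nlinarith
  obtain ⟨t, ht, htz⟩ := intermediate_value_Icc (by linarith) hc ⟨h2, h1⟩
  refine ⟨y + t • ν, ?_, htz⟩
  have := hmem t ht
  rwa [mem_closedBall, dist_eq_norm] at this

/-! ### Even singular kernels and their truncations -/

/-- Measurable even kernels with `|K(z)| ≤ Λ |z|^{-n-s}` away from the origin. -/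
structure IsSingularKernel (s Λ : ℝ) (K : Eucl n → ℝ) : Prop where
  measurable : Measurable K
  even : ∀ z, K (-z) = K z
  bound : ∀ z, z ≠ 0 → |K z| ≤ Λ * ‖z‖ ^ (-((n : ℝ) + s))

theorem IsSmoothKernel.isSingularKernel {s lam : ℝ} {rad : ℝ≥0∞} {h : ℕ} {K : Eucl n → ℝ}
    (hK : IsSmoothKernel h n s lam rad K) : IsSingularKernel s lam K where
  measurable := measurable_of_continuousOn_compl_singleton 0 hK.contDiffOn.continuousOn
  even z := by
    rcases eq_or_ne z 0 with rfl | hz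
    · simp
    · exact hK.even z hz
  bound z hz := by
    rw [abs_of_nonneg (hK.nonneg z hz), Real.rpow_neg (norm_nonneg _), ← div_eq_mul_inv]
    exact hK.upper z hz

/-- Integrals against an even kernel only see the symmetrization. -/
theorem two_mul_setIntegral_even {k χ : Eucl n → ℝ} {S : Set (Eucl n)} (hS : MeasurableSet S)
    (hSs : ∀ z, -z ∈ S ↔ z ∈ S) (hk : ∀ z, k (-z) = k z)
    (hint : IntegrableOn (fun z => k z * χ z) S) :
    2 * ∫ z in S, k z * χ z = ∫ z in S, k z * (χ z + χ (-z)) := by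
  have h1 : ∫ z in S, k z * χ (-z) = ∫ z in S, k z * χ z := by
    rw [← integral_indicator hS, ← integral_indicator hS, ← integral_neg_eq_self]
    congr 1
    ext z
    by_cases hz : z ∈ S <;> simp [hSs, hz, hk]
  have h2 : IntegrableOn (fun z => k z * χ (-z)) S := by
    rw [← integrable_indicator_iff hS] at hint ⊢
    refine hint.comp_neg.congr (Eventually.of_forall fun z => ?_)
    by_cases hz : z ∈ S <;> simp [hSs, hz, hk]
  simp only [mul_add]
  rw [integral_add hint h2, h1]; ring

/-- Cancellation: up to a cusp around a hyperplane, `χ` is odd in `B_δ`, so that its integral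
against an even singular kernel is `O(δ^{α-s})`. -/
theorem exists_cancellation_bound [NeZero n] {s α : ℝ} (hs : 0 < s) (hα : s < α) : ∃ C > 0,
    ∀ (Λ : ℝ) (k χ : Eucl n → ℝ) (ν : Eucl n) (b δ : ℝ), IsSingularKernel s Λ k → 0 ≤ Λ →
    IntegrableOn (fun z => k z * χ z) (ball 0 δ) → (∀ z, |χ z| ≤ 1) →
    ‖ν‖ = 1 → 0 < b → 0 < δ →
    (∀ᵐ z : Eucl n, z ∈ ball (0 : Eucl n) δ → b * ‖z‖ ^ (1 + α) < |⟪ν, z⟫| → χ z + χ (-z) = 0) →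
    |∫ z in ball 0 δ, k z * χ z| ≤ Λ * C * b * δ ^ (α - s) := by
  obtain ⟨C, hC, hCb⟩ := exists_cusp_bound (n := n) hs hα
  refine ⟨C, hC, fun Λ k χ ν b δ hk hΛ hint hχ1 hν hb hδ hodd => ?_⟩
  obtain ⟨hI, hB⟩ := hCb ν hν b hb δ hδ
  set T := {z : Eucl n | |⟪ν, z⟫| ≤ b * ‖z‖ ^ (1 + α)} with hT
  have hTm : MeasurableSet T := measurableSet_le (by fun_prop) (by fun_prop)
  -- Symmetrizing replaces `χ z` by `(χ z + χ (-z)) / 2`, which vanishes off the cusp `T`.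
  have h2 := two_mul_setIntegral_even measurableSet_ball (by simp) hk.even hint
  have h3 : |∫ z in ball 0 δ, k z * (χ z + χ (-z))| ≤
      ∫ z in ball 0 δ, T.indicator (fun z => 2 * Λ * ‖z‖ ^ (-((n : ℝ) + s))) z := by
    rw [← Real.norm_eq_abs]
    refine norm_integral_le_of_norm_le ?_ ?_
    · rw [integrable_indicator_iff hTm, IntegrableOn, Measure.restrict_restrict hTm]
      exact hI.const_mul _
    · rw [ae_restrict_iff' measurableSet_ball]
      filter_upwards [hodd, Measure.ae_ne volume (0 : Eucl n)] with z hz hz0 hzB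
      by_cases hzT : z ∈ T
      · rw [indicator_of_mem hzT, Real.norm_eq_abs, abs_mul]
        have h1 := hk.bound z hz0
        have h4 : |χ z + χ (-z)| ≤ 2 := by
          linarith [abs_add_le (χ z) (χ (-z)), hχ1 z, hχ1 (-z)]
        calc |k z| * |χ z + χ (-z)| ≤ (Λ * ‖z‖ ^ (-((n : ℝ) + s))) * 2 := by gcongr
          _ = _ := by ring
      · rw [indicator_of_notMem hzT, hz hzB (not_le.1 fun h => hzT h), mul_zero, norm_zero]
  have h4 : ∫ z in ball 0 δ, T.indicator (fun z => 2 * Λ * ‖z‖ ^ (-((n : ℝ) + s))) z ≤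
      2 * (Λ * C * b * δ ^ (α - s)) := by
    rw [integral_indicator hTm, Measure.restrict_restrict hTm, integral_const_mul]
    calc _ ≤ 2 * Λ * (C * b * δ ^ (α - s)) := by gcongr
      _ = _ := by ring
  rw [← h2, abs_mul, abs_two] at h3
  linarith

/-- A smooth even function equal to `1` on `B_{1/2}` and to `0` off `B_1`. -/
def originBump (n : ℕ) : ContDiffBump (0 : Eucl n) where
  rIn := 1 / 2
  rOut := 1
  rIn_pos := by norm_num
  rIn_lt_rOut := by norm_num

/-- The kernel `K`, smoothly truncated at scale `ε`: it vanishes on `B_{ε/2}` and agrees with `K`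
off `B_ε`. -/
def truncKernel (K : Eucl n → ℝ) (ε : ℝ) (z : Eucl n) : ℝ :=
  K z * (1 - originBump n (ε⁻¹ • z))

theorem truncKernel_eq_zero {K : Eucl n → ℝ} {ε : ℝ} (hε : 0 < ε) {z : Eucl n}
    (hz : ‖z‖ ≤ ε / 2) : truncKernel K ε z = 0 := by
  have : originBump n (ε⁻¹ • z) = 1 := by
    apply ContDiffBump.one_of_mem_closedBall
    rw [mem_closedBall_zero_iff, norm_smul, norm_inv, Real.norm_of_nonneg hε.le]
    change _ ≤ (1 / 2 : ℝ)
    rw [inv_mul_le_iff₀ hε]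
    linarith
  rw [truncKernel, this, sub_self, mul_zero]

theorem truncKernel_eq_self {K : Eucl n → ℝ} {ε : ℝ} (hε : 0 < ε) {z : Eucl n}
    (hz : ε ≤ ‖z‖) : truncKernel K ε z = K z := by
  have : originBump n (ε⁻¹ • z) = 0 := by
    apply ContDiffBump.zero_of_le_dist
    rw [dist_zero_right, norm_smul, norm_inv, Real.norm_of_nonneg hε.le]
    change (1 : ℝ) ≤ _
    rw [le_inv_mul_iff₀ hε]
    linarith
  rw [truncKernel, this, sub_zero, mul_one]

theorem abs_truncKernel_le (K : Eucl n → ℝ) (ε : ℝ) (z : Eucl n) :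
    |truncKernel K ε z| ≤ |K z| := by
  rw [truncKernel, abs_mul]
  refine mul_le_of_le_one_right (abs_nonneg _) (abs_le.2 ⟨?_, ?_⟩)
  · linarith [(originBump n).le_one (x := ε⁻¹ • z)]
  · linarith [(originBump n).nonneg (x := ε⁻¹ • z)]

theorem IsSingularKernel.truncKernel {s Λ : ℝ} {K : Eucl n → ℝ} (hK : IsSingularKernel s Λ K)
    (ε : ℝ) : IsSingularKernel s Λ (truncKernel K ε) where
  measurable := hK.measurable.mul (measurable_const.sub
    ((originBump n).continuous.measurable.comp (measurable_const_smul _)))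
  even z := by
    simp only [Capillarity.truncKernel, hK.even, smul_neg, ContDiffBump.neg]
  bound z hz := (abs_truncKernel_le K ε z).trans (hK.bound z hz)

theorem truncKernel_eventuallyEq (K : Eucl n → ℝ) {z : Eucl n} (hz : z ≠ 0) :
    ∀ᶠ ε in 𝓝[>] (0 : ℝ), truncKernel K ε =ᶠ[𝓝 z] K := by
  have hz' : 0 < ‖z‖ := norm_pos_iff.2 hz
  filter_upwards [Ioo_mem_nhdsGT hz'] with ε hε
  filter_upwards [(isOpen_lt continuous_const continuous_norm).mem_nhds hε.2] with w hw
  exact truncKernel_eq_self hε.1 (le_of_lt hw)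

theorem contDiff_truncKernel {K : Eucl n → ℝ} (hK : ContDiffOn ℝ 1 K {0}ᶜ) {ε : ℝ} (hε : 0 < ε) :
    ContDiff ℝ 1 (truncKernel K ε) := by
  rw [contDiff_iff_contDiffAt]
  intro z
  rcases eq_or_ne z 0 with rfl | hz
  · refine (contDiffAt_const (c := (0 : ℝ))).congr_of_eventuallyEq ?_
    filter_upwards [ball_mem_nhds (0 : Eucl n) (half_pos hε)] with w hw
    exact truncKernel_eq_zero hε (mem_ball_zero_iff.1 hw).le
  · refine (hK.contDiffAt (isOpen_compl_singleton.mem_nhds hz)).mul (contDiffAt_const.sub ?_)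
    exact ((originBump n).contDiff.comp (contDiff_const_smul _)).contDiffAt

/-- The truncated kernels satisfy the gradient bound `|DK| ≤ C |z|^{-n-s-1}` uniformly in the
truncation scale. -/
theorem exists_norm_fderiv_truncKernel_le {s lam : ℝ} {rad : ℝ≥0∞} {K : Eucl n → ℝ}
    (hK : IsSmoothKernel 2 n s lam rad K) (hlam : 0 ≤ lam) : ∃ C > 0, ∀ ε > 0, ∀ z, z ≠ 0 →
      ‖fderiv ℝ (truncKernel K ε) z‖ ≤ C * ‖z‖ ^ (-((n : ℝ) + s) - 1) := by
  have hb1 : ContDiff ℝ 1 (originBump n) := (originBump n).contDiff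
  obtain ⟨D, hD⟩ : ∃ D, ∀ z, ‖fderiv ℝ (originBump n) z‖ ≤ D :=
    ((originBump n).hasCompactSupport.fderiv ℝ).exists_bound_of_continuous
      (hb1.continuous_fderiv (by norm_num))
  have hD0 : 0 ≤ D := (norm_nonneg _).trans (hD 0)
  refine ⟨lam + lam * D + 1, by positivity, fun ε hε z hz => ?_⟩
  have hzp : 0 < ‖z‖ := norm_pos_iff.2 hz
  set P := ‖z‖ ^ (-((n : ℝ) + s) - 1) with hP
  have hPpos : 0 < P := by positivity
  have hKz := hK.isSingularKernel.bound z hz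
  have hdK : ‖fderiv ℝ K z‖ ≤ lam * P := by
    have := hK.deriv_le 1 le_rfl (by norm_num) z hz
    rw [norm_iteratedFDeriv_one] at this
    rwa [hP, show -((n : ℝ) + s) - 1 = -((n : ℝ) + s + (1 : ℕ)) by push_cast; ring,
      Real.rpow_neg hzp.le, ← div_eq_mul_inv]
  have hKd : DifferentiableAt ℝ K z :=
    (hK.contDiffOn.contDiffAt (isOpen_compl_singleton.mem_nhds hz)).differentiableAt (by norm_num)
  rcases lt_or_ge ε ‖z‖ with h | h
  · have : truncKernel K ε =ᶠ[𝓝 z] K := by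
      filter_upwards [(isOpen_lt continuous_const continuous_norm).mem_nhds h] with w hw
      exact truncKernel_eq_self hε (le_of_lt hw)
    rw [this.fderiv_eq]
    refine hdK.trans ?_
    gcongr
    have := mul_nonneg hlam hD0
    linarith
  · have hbd : HasFDerivAt (fun z => 1 - originBump n (ε⁻¹ • z))
        (-(ε⁻¹ • fderiv ℝ (originBump n) (ε⁻¹ • z))) z := by
      have h1 : HasFDerivAt (originBump n) (fderiv ℝ (originBump n) (ε⁻¹ • z)) (ε⁻¹ • z) :=
        (hb1.differentiable (by norm_num) _).hasFDerivAt
      have h2 : HasFDerivAt (fun z : Eucl n => ε⁻¹ • z)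
        (ε⁻¹ • ContinuousLinearMap.id ℝ (Eucl n)) z :=
        (hasFDerivAt_id (𝕜 := ℝ) z).const_smul ε⁻¹
      have h3 := (h1.comp z h2).const_sub 1
      refine HasFDerivAt.congr_fderiv h3 ?_
      ext w
      simp
    have hf := hKd.hasFDerivAt.mul hbd
    rw [show truncKernel K ε = K * fun z => 1 - originBump n (ε⁻¹ • z) from rfl, hf.fderiv]
    refine (norm_add_le _ _).trans ?_
    rw [norm_smul, norm_smul, norm_neg, norm_smul, norm_inv, Real.norm_of_nonneg hε.le,
      Real.norm_eq_abs, Real.norm_eq_abs]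
    have h1 : |1 - originBump n (ε⁻¹ • z)| ≤ 1 := by
      refine abs_le.2 ⟨?_, ?_⟩
      · linarith [(originBump n).le_one (x := ε⁻¹ • z)]
      · linarith [(originBump n).nonneg (x := ε⁻¹ • z)]
    have h2 : ε⁻¹ ≤ ‖z‖⁻¹ := inv_anti₀ hzp h
    have h3 : ‖z‖ ^ (-((n : ℝ) + s)) * ‖z‖⁻¹ = P := by
      rw [hP, Real.rpow_sub hzp, Real.rpow_one, div_eq_mul_inv]
    calc |K z| * (ε⁻¹ * ‖fderiv ℝ (originBump n) (ε⁻¹ • z)‖) +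
          |1 - originBump n (ε⁻¹ • z)| * ‖fderiv ℝ K z‖
        ≤ lam * ‖z‖ ^ (-((n : ℝ) + s)) * (‖z‖⁻¹ * D) + 1 * (lam * P) := by
          gcongr
          exact hD _
      _ = (lam + lam * D) * P := by rw [← h3]; ring
      _ ≤ _ := by rw [mul_le_mul_iff_left₀ hPpos]; linarith

/-- Away from the origin `‖z‖ ^ (-p)` is comparable to `(1 + ‖z‖) ^ (-p)`, which is integrable on
the whole space for `p > n`. -/
theorem norm_rpow_neg_le_one_add {c p : ℝ} (hc : 0 < c) (hp : 0 ≤ p) {z : Eucl n} (hz : c ≤ ‖z‖) :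
    ‖z‖ ^ (-p) ≤ (1 + c⁻¹) ^ p * (1 + ‖z‖) ^ (-p) := by
  have hz0 : 0 < ‖z‖ := hc.trans_le hz
  have h1 : 1 + ‖z‖ ≤ (1 + c⁻¹) * ‖z‖ := by
    have : 1 ≤ c⁻¹ * ‖z‖ := by rw [le_inv_mul_iff₀ hc]; linarith
    linarith
  have h2 : (1 + ‖z‖) ^ p ≤ (1 + c⁻¹) ^ p * ‖z‖ ^ p := by
    rw [← Real.mul_rpow (by positivity) hz0.le]
    exact Real.rpow_le_rpow (by positivity) h1 hp
  rw [Real.rpow_neg hz0.le, Real.rpow_neg (by positivity), ← div_eq_mul_inv,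
    le_div_iff₀ (by positivity), inv_mul_le_iff₀ (by positivity)]
  linarith

/-- At a fixed scale the truncated kernel and its gradient are bounded by an integrable power. -/
theorem exists_truncKernel_bound {s lam : ℝ} {rad : ℝ≥0∞} {K : Eucl n → ℝ} (hs : 0 < s)
    (hK : IsSmoothKernel 2 n s lam rad K) (hlam : 0 ≤ lam) {ε : ℝ} (hε : 0 < ε) :
    ∃ C > 0, ∀ z, |truncKernel K ε z| ≤ C * (1 + ‖z‖) ^ (-((n : ℝ) + s)) ∧
      ‖fderiv ℝ (truncKernel K ε) z‖ ≤ C * (1 + ‖z‖) ^ (-((n : ℝ) + s)) := by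
  obtain ⟨D, hD, hDb⟩ := exists_norm_fderiv_truncKernel_le hK hlam
  set A := (1 + (ε / 4)⁻¹) ^ ((n : ℝ) + s)
  have hA : 0 < A := by positivity
  refine ⟨(lam + D * (ε / 4)⁻¹) * A, by positivity, fun z => ?_⟩
  have hq : 0 ≤ (n : ℝ) + s := by positivity
  rcases lt_or_ge ‖z‖ (ε / 2) with h | h
  · have h0 : truncKernel K ε =ᶠ[𝓝 z] fun _ => 0 := by
      filter_upwards [(isOpen_lt continuous_norm continuous_const).mem_nhds h] with w hw
      exact truncKernel_eq_zero hε (le_of_lt hw)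
    rw [h0.eq_of_nhds, h0.fderiv_eq]
    simp only [abs_zero, fderiv_fun_const, Pi.zero_apply, norm_zero]
    constructor <;> positivity
  · have hz0 : 0 < ‖z‖ := by linarith
    have hz : z ≠ 0 := norm_pos_iff.1 hz0
    have h1 := norm_rpow_neg_le_one_add (c := ε / 4) (by positivity) hq (z := z) (by linarith)
    constructor
    · calc |truncKernel K ε z| ≤ lam * ‖z‖ ^ (-((n : ℝ) + s)) :=
            (abs_truncKernel_le K ε z).trans (hK.isSingularKernel.bound z hz)
        _ ≤ (lam + D * (ε / 4)⁻¹) * (A * (1 + ‖z‖) ^ (-((n : ℝ) + s))) := by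
            gcongr
            linarith [mul_pos hD (inv_pos.2 (show 0 < ε / 4 by positivity))]
        _ = _ := by ring
    · calc _ ≤ D * ‖z‖ ^ (-((n : ℝ) + s) - 1) := hDb ε hε z hz
        _ = D * (‖z‖⁻¹ * ‖z‖ ^ (-((n : ℝ) + s))) := by
            rw [Real.rpow_sub hz0, Real.rpow_one]; ring
        _ ≤ D * ((ε / 4)⁻¹ * (A * (1 + ‖z‖) ^ (-((n : ℝ) + s)))) := by
            gcongr
            linarith
        _ ≤ (lam + D * (ε / 4)⁻¹) * (A * (1 + ‖z‖) ^ (-((n : ℝ) + s))) := by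
            rw [← mul_assoc]
            gcongr
            linarith
        _ = _ := by ring

/-- Convolutions of a bounded function with a `C¹` kernel that decays together with its gradient
are of class `C¹`. -/
theorem contDiff_integral_kernel {k ψ : Eucl n → ℝ} {C p : ℝ} (hp : (n : ℝ) < p)
    (hk : ContDiff ℝ 1 k)
    (hb : ∀ z, |k z| ≤ C * (1 + ‖z‖) ^ (-p) ∧ ‖fderiv ℝ k z‖ ≤ C * (1 + ‖z‖) ^ (-p))
    (hψ : Measurable ψ) (hψ1 : ∀ y, |ψ y| ≤ 1) :
    ContDiff ℝ 1 (fun x => ∫ y, k (x - y) * ψ y) ∧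
      ∀ x, HasFDerivAt (fun x => ∫ y, k (x - y) * ψ y) (∫ y, ψ y • fderiv ℝ k (x - y)) x := by
  have hp0 : 0 ≤ p := (Nat.cast_nonneg n).trans hp.le
  have hC : 0 ≤ C := by
    have h := (abs_nonneg _).trans (hb 0).1
    simpa using h
  have hint : ∀ x, Integrable (fun y : Eucl n => (1 + ‖x - y‖) ^ (-p)) := fun x =>
    (integrable_one_add_norm (by simpa using hp)).comp_sub_left x
  -- The weight `(1 + ‖x - y‖) ^ (-p)` changes at most by the factor `2 ^ p` when `x` moves by
  -- less than one, which gives the domination needed to differentiate under the integral.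
  have hloc : ∀ x₀ : Eucl n, ∀ x ∈ ball x₀ 1, ∀ y, C * (1 + ‖x - y‖) ^ (-p) ≤
      C * (2 ^ p * (1 + ‖x₀ - y‖) ^ (-p)) := by
    intro x₀ x hx y
    gcongr
    have h1 : ‖x₀ - y‖ ≤ 1 + ‖x - y‖ := by
      have := norm_add_le (x₀ - x) (x - y)
      rw [sub_add_sub_cancel] at this
      rw [mem_ball', dist_eq_norm] at hx
      linarith
    have h2 : (1 + ‖x₀ - y‖) ^ p ≤ 2 ^ p * (1 + ‖x - y‖) ^ p := by
      rw [← Real.mul_rpow (by norm_num) (by positivity)]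
      refine Real.rpow_le_rpow (by positivity) ?_ hp0
      linarith [norm_nonneg (x - y)]
    rw [Real.rpow_neg (by positivity), Real.rpow_neg (by positivity), ← div_eq_mul_inv,
      le_div_iff₀ (by positivity), inv_mul_le_iff₀ (by positivity)]
    linarith
  have hfd : Continuous (fderiv ℝ k) := hk.continuous_fderiv (by norm_num)
  have hmeas : ∀ x, AEStronglyMeasurable (fun y => k (x - y) * ψ y) volume := fun x =>
    ((hk.continuous.comp (continuous_const.sub continuous_id)).aestronglyMeasurable).mul
      hψ.aestronglyMeasurable
  have hmeas' : ∀ x, AEStronglyMeasurable (fun y => ψ y • fderiv ℝ k (x - y)) volume := fun x =>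
    hψ.aestronglyMeasurable.smul
      ((hfd.comp (continuous_const.sub continuous_id)).aestronglyMeasurable)
  have hbd' : ∀ x y, ‖ψ y • fderiv ℝ k (x - y)‖ ≤ C * (1 + ‖x - y‖) ^ (-p) := by
    intro x y
    rw [norm_smul]
    exact (mul_le_of_le_one_left (norm_nonneg _) (hψ1 y)).trans (hb _).2
  have hbi : ∀ x₀ : Eucl n,
      Integrable fun y : Eucl n => C * (2 ^ p * (1 + ‖x₀ - y‖) ^ (-p)) := fun x₀ =>
    ((hint x₀).const_mul _).const_mul _
  have hder : ∀ x, HasFDerivAt (fun x => ∫ y, k (x - y) * ψ y)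
      (∫ y, ψ y • fderiv ℝ k (x - y)) x := by
    intro x₀
    refine hasFDerivAt_integral_of_dominated_of_fderiv_le (ball_mem_nhds x₀ one_pos)
      (Eventually.of_forall hmeas) ?_ (hmeas' x₀)
      (Eventually.of_forall fun y x hx => (hbd' x y).trans (hloc x₀ x hx y)) (hbi x₀) ?_
    · refine Integrable.mono' ((hint x₀).const_mul C) (hmeas x₀) (Eventually.of_forall fun y => ?_)
      rw [Real.norm_eq_abs, abs_mul]
      exact (mul_le_of_le_one_right (abs_nonneg _) (hψ1 y)).trans (hb _).1
    · refine Eventually.of_forall fun y x _ => ?_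
      have h1 : HasFDerivAt k (fderiv ℝ k (x - y)) (x - y) :=
        (hk.differentiable (by norm_num) _).hasFDerivAt
      have h2 := (h1.comp x ((hasFDerivAt_id x).sub_const y)).mul_const (ψ y)
      exact h2
  refine ⟨?_, hder⟩
  rw [contDiff_one_iff_fderiv]
  refine ⟨fun x => (hder x).differentiableAt, ?_⟩
  have : fderiv ℝ (fun x => ∫ y, k (x - y) * ψ y) = fun x => ∫ y, ψ y • fderiv ℝ k (x - y) :=
    funext fun x => (hder x).fderiv
  rw [this, continuous_iff_continuousAt]
  intro x₀
  refine continuousAt_of_dominated (Eventually.of_forall hmeas') ?_ (hbi x₀) ?_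
  · filter_upwards [ball_mem_nhds x₀ one_pos] with x hx
    exact Eventually.of_forall fun y => (hbd' x y).trans (hloc x₀ x hx y)
  · refine Eventually.of_forall fun y => ?_
    have h := ((hfd.comp (continuous_id.sub (continuous_const (y := y)))).const_smul
      (ψ y)).continuousAt (x := x₀)
    exact h

/-! ### Variations by shifts in a fixed direction -/

/-- The map `x ↦ x + t φ(x) e`.  Its Jacobian is the affine function `1 + t ∂ₑφ` of `t`, so that it
preserves the volume of `E` for all small `t` as soon as `∫_E ∂ₑφ = 0`. -/
def shift (φ : Eucl n → ℝ) (e : Eucl n) (t : ℝ) (x : Eucl n) : Eucl n := x + (t * φ x) • e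

theorem shift_eq_self {φ : Eucl n → ℝ} {e x : Eucl n} {t : ℝ} (hx : φ x = 0) :
    shift φ e t x = x := by simp [shift, hx]

theorem abs_sub_le_of_norm_fderiv_le {φ : Eucl n → ℝ} (hφ : Differentiable ℝ φ) {D : ℝ}
    (hD : ∀ x, ‖fderiv ℝ φ x‖ ≤ D) (x y : Eucl n) : |φ x - φ y| ≤ D * ‖x - y‖ :=
  convex_univ.norm_image_sub_le_of_norm_fderiv_le (𝕜 := ℝ) (fun z _ => hφ z) (fun z _ => hD z)
    (mem_univ y) (mem_univ x)

theorem hasFDerivAt_shift {φ : Eucl n → ℝ} (hφ : Differentiable ℝ φ) (e : Eucl n) (t : ℝ)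
    (x : Eucl n) : HasFDerivAt (shift φ e t)
      (ContinuousLinearMap.id ℝ (Eucl n) + (t • fderiv ℝ φ x).smulRight e) x :=
  (hasFDerivAt_id x).add ((((hφ x).hasFDerivAt).const_mul t).smul_const e)

theorem det_shift (ℓ : Eucl n →L[ℝ] ℝ) (e : Eucl n) :
    (ContinuousLinearMap.id ℝ (Eucl n) + ℓ.smulRight e).det = 1 + ℓ e := by
  have h := LinearMap.transvection.det (ℓ : Eucl n →ₗ[ℝ] ℝ) e
  rw [ContinuousLinearMap.coe_coe] at h
  rw [← h, ContinuousLinearMap.det]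
  rfl

section SmallShift

variable {φ : Eucl n → ℝ} {e : Eucl n} {t D : ℝ}

theorem abs_mul_fderiv_le (hD : ∀ x, ‖fderiv ℝ φ x‖ ≤ D) (ht : |t| * (D * ‖e‖) ≤ 1 / 2)
    (x : Eucl n) : |t * fderiv ℝ φ x e| ≤ 1 / 2 := by
  rw [abs_mul]
  refine le_trans ?_ ht
  gcongr
  exact ((fderiv ℝ φ x).le_opNorm e).trans (by gcongr; exact hD x)

theorem norm_shift_sub_le (hφ : Differentiable ℝ φ) (hD : ∀ x, ‖fderiv ℝ φ x‖ ≤ D)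
    (ht : |t| * (D * ‖e‖) ≤ 1 / 2) (x y : Eucl n) :
    ‖shift φ e t x - shift φ e t y - (x - y)‖ ≤ 1 / 2 * ‖x - y‖ := by
  have e1 : shift φ e t x - shift φ e t y - (x - y) = (t * (φ x - φ y)) • e := by
    simp only [shift, mul_sub, sub_smul]; abel
  rw [e1, norm_smul, Real.norm_eq_abs, abs_mul]
  calc |t| * |φ x - φ y| * ‖e‖ ≤ |t| * (D * ‖x - y‖) * ‖e‖ := by
        gcongr; exact abs_sub_le_of_norm_fderiv_le hφ hD x y
    _ = (|t| * (D * ‖e‖)) * ‖x - y‖ := by ring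
    _ ≤ _ := by gcongr

theorem half_norm_le_norm_shift_sub (hφ : Differentiable ℝ φ) (hD : ∀ x, ‖fderiv ℝ φ x‖ ≤ D)
    (ht : |t| * (D * ‖e‖) ≤ 1 / 2) (x y : Eucl n) :
    ‖x - y‖ / 2 ≤ ‖shift φ e t x - shift φ e t y‖ := by
  have h1 := norm_shift_sub_le hφ hD ht x y
  have h2 := norm_sub_norm_le (x - y) (shift φ e t x - shift φ e t y)
  rw [norm_sub_rev (x - y)] at h2
  linarith

theorem shift_injective (hφ : Differentiable ℝ φ) (hD : ∀ x, ‖fderiv ℝ φ x‖ ≤ D)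
    (ht : |t| * (D * ‖e‖) ≤ 1 / 2) : Function.Injective (shift φ e t) := by
  intro x y hxy
  have := half_norm_le_norm_shift_sub hφ hD ht x y
  rw [hxy, sub_self, norm_zero] at this
  exact sub_eq_zero.1 (norm_le_zero_iff.1 (by linarith))

/-- For small `t` the shift is a diffeomorphism. -/
theorem exists_shift_inverse [NeZero n] (hφ : ContDiff ℝ (⊤ : ℕ∞) φ)
    (hD : ∀ x, ‖fderiv ℝ φ x‖ ≤ D) (ht : |t| * (D * ‖e‖) ≤ 1 / 2) :
    ∃ h : Eucl n → Eucl n, ContDiff ℝ (⊤ : ℕ∞) h ∧ Function.LeftInverse h (shift φ e t) ∧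
      Function.RightInverse h (shift φ e t) := by
  have hφd : Differentiable ℝ φ := hφ.differentiable (by simp)
  have happ : ApproximatesLinearOn (shift φ e t)
      ((ContinuousLinearEquiv.refl ℝ (Eucl n) : Eucl n ≃L[ℝ] Eucl n) : Eucl n →L[ℝ] Eucl n)
      univ (1 / 2 : NNReal) := by
    intro x _ y _
    simpa using norm_shift_sub_le hφd hD ht x y
  let Φ := happ.toHomeomorph (shift φ e t) (Or.inr (by
    have : ‖((ContinuousLinearEquiv.refl ℝ (Eucl n)).symm : Eucl n →L[ℝ] Eucl n)‖₊ = 1 := by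
      apply NNReal.eq
      exact ContinuousLinearMap.norm_id
    rw [this]
    rw [inv_one]
    exact NNReal.half_lt_self one_ne_zero))
  have hΦ : (Φ : Eucl n → Eucl n) = shift φ e t := rfl
  have hdet : ∀ x, (ContinuousLinearMap.id ℝ (Eucl n) +
      (t • fderiv ℝ φ x).smulRight e).det ≠ 0 := by
    intro x
    rw [det_shift]
    have := abs_le.1 (abs_mul_fderiv_le hD ht x)
    simp only [_root_.smul_apply, smul_eq_mul]
    linarith [this.1]
  refine ⟨Φ.symm, ?_, fun x => Φ.symm_apply_apply x, fun x => Φ.apply_symm_apply x⟩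
  refine Φ.contDiff_symm
    (f₀' := fun x => ContinuousLinearMap.toContinuousLinearEquivOfDetNeZero _ (hdet x)) ?_ ?_
  · intro x
    rw [ContinuousLinearMap.coe_toContinuousLinearEquivOfDetNeZero, hΦ]
    exact hasFDerivAt_shift hφd e t x
  · rw [hΦ]
    exact contDiff_id.add ((contDiff_const.mul hφ).smul contDiff_const)

/-- Change of variables along a shift. -/
theorem lintegral_shift_image (hφ : Differentiable ℝ φ) (hD : ∀ x, ‖fderiv ℝ φ x‖ ≤ D)
    (ht : |t| * (D * ‖e‖) ≤ 1 / 2) {F : Set (Eucl n)} (hF : MeasurableSet F)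
    (G : Eucl n → ℝ≥0∞) : ∫⁻ x in shift φ e t '' F, G x =
      ∫⁻ x in F, ENNReal.ofReal (1 + t * fderiv ℝ φ x e) * G (shift φ e t x) := by
  rw [lintegral_image_eq_lintegral_abs_det_fderiv_mul volume hF
    (fun x _ => (hasFDerivAt_shift hφ e t x).hasFDerivWithinAt)
    (shift_injective hφ hD ht).injOn]
  refine lintegral_congr fun x => ?_
  have := abs_le.1 (abs_mul_fderiv_le hD ht x)
  rw [det_shift, _root_.smul_apply, smul_eq_mul, abs_of_nonneg (by linarith)]

theorem integral_shift_image (hφ : Differentiable ℝ φ) (hD : ∀ x, ‖fderiv ℝ φ x‖ ≤ D)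
    (ht : |t| * (D * ‖e‖) ≤ 1 / 2) {F : Set (Eucl n)} (hF : MeasurableSet F)
    (G : Eucl n → ℝ) : ∫ x in shift φ e t '' F, G x =
      ∫ x in F, (1 + t * fderiv ℝ φ x e) * G (shift φ e t x) := by
  rw [integral_image_eq_integral_abs_det_fderiv_smul volume hF
    (fun x _ => (hasFDerivAt_shift hφ e t x).hasFDerivWithinAt)
    (shift_injective hφ hD ht).injOn]
  refine integral_congr_ae (Eventually.of_forall fun x => ?_)
  have := abs_le.1 (abs_mul_fderiv_le hD ht x)
  simp only
  rw [det_shift, _root_.smul_apply, smul_eq_mul, smul_eq_mul,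
    abs_of_nonneg (by linarith)]

theorem shift_image_of_tsupport_subset [NeZero n] (hφ : ContDiff ℝ (⊤ : ℕ∞) φ)
    (hD : ∀ x, ‖fderiv ℝ φ x‖ ≤ D) (ht : |t| * (D * ‖e‖) ≤ 1 / 2) {Ω : Set (Eucl n)}
    (hΩ : tsupport φ ⊆ Ω) : shift φ e t '' Ω = Ω := by
  have hinj := shift_injective (hφ.differentiable (by simp)) hD ht
  obtain ⟨h, -, -, hr⟩ := exists_shift_inverse hφ hD ht
  have hoff : ∀ x, x ∉ Ω → shift φ e t x = x := fun x hx =>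
    shift_eq_self (image_eq_zero_of_notMem_tsupport fun hx' => hx (hΩ hx'))
  ext y
  constructor
  · rintro ⟨x, hx, rfl⟩
    by_contra hy
    have h1 := hinj (hoff _ hy)
    rw [h1] at hy
    exact hy hx
  · intro hy
    refine ⟨h y, ?_, hr y⟩
    by_contra hx
    have h1 := hoff _ hx
    rw [hr y] at h1
    rw [← h1] at hx
    exact hx hy

end SmallShift

theorem exists_fderiv_bound {φ : Eucl n → ℝ} (hφ : ContDiff ℝ (⊤ : ℕ∞) φ)
    (hc : HasCompactSupport φ) : ∃ D > 0, (∀ x, |φ x| ≤ D) ∧ ∀ x, ‖fderiv ℝ φ x‖ ≤ D := by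
  obtain ⟨D₁, h₁⟩ := hc.exists_bound_of_continuous hφ.continuous
  obtain ⟨D₂, h₂⟩ := (hc.fderiv ℝ).exists_bound_of_continuous (hφ.continuous_fderiv (by simp))
  refine ⟨max (max D₁ D₂) 1, by positivity, fun x => ?_, fun x => ?_⟩
  · exact (h₁ x).trans ((le_max_left _ _).trans (le_max_left _ _))
  · exact (h₂ x).trans ((le_max_right _ _).trans (le_max_left _ _))

/-- If `∫_E ∂ₑφ = 0` the shifts `x + t φ(x) e` form an admissible variation. -/
theorem isVariation_shift [NeZero n] {Ω E : Set (Eucl n)} (hE : MeasurableSet E)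
    (hEfin : volume E ≠ ∞) {φ : Eucl n → ℝ} (hφ : ContDiff ℝ (⊤ : ℕ∞) φ)
    (hc : HasCompactSupport φ) (hΩ : tsupport φ ⊆ Ω) {e : Eucl n}
    (hvol : ∫ x in E, fderiv ℝ φ x e = 0) {D δ : ℝ} (hD : ∀ x, ‖fderiv ℝ φ x‖ ≤ D)
    (hδ : δ * (D * ‖e‖) ≤ 1 / 2) : IsVariation Ω E δ (shift φ e) := by
  have hD0 : 0 ≤ D := (norm_nonneg _).trans (hD 0)
  have hφd : Differentiable ℝ φ := hφ.differentiable (by simp)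
  have ht : ∀ t ∈ Ioo (-δ) δ, |t| * (D * ‖e‖) ≤ 1 / 2 := by
    intro t ht
    refine le_trans ?_ hδ
    gcongr
    exact (abs_lt.2 ht).le
  refine ⟨?_, fun t h => exists_shift_inverse hφ hD (ht t h), fun x => by simp [shift], ?_,
    fun t h => shift_image_of_tsupport_subset hφ hD (ht t h) hΩ, ?_⟩
  · refine ContDiff.contDiffOn ?_
    exact contDiff_snd.add ((contDiff_fst.mul (hφ.comp contDiff_snd)).smul contDiff_const)
  · intro t _
    refine hc.mono fun x hx => ?_
    simp only [Function.mem_support, shift, add_sub_cancel_left] at hx ⊢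
    intro h
    exact hx (by rw [h]; simp)
  · intro t h
    have hcont : Continuous fun x => fderiv ℝ φ x e :=
      (hφ.continuous_fderiv (by simp)).clm_apply continuous_const
    have hint : IntegrableOn (fun x => fderiv ℝ φ x e) E :=
      (hcont.integrable_of_hasCompactSupport (hc.fderiv_apply ℝ e)).integrableOn
    have h1 : IntegrableOn (fun _ : Eucl n => (1 : ℝ)) E := integrableOn_const hEfin
    -- The Jacobian `1 + t ∂ₑφ` is affine in `t`, so the first-order condition `hvol` preserves
    -- the volume exactly.
    rw [← setLIntegral_one, lintegral_shift_image hφd hD (ht t h) hE]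
    simp only [mul_one]
    have h2 : IntegrableOn (fun x => 1 + t * fderiv ℝ φ x e) E := h1.add (hint.const_mul t)
    rw [← ofReal_integral_eq_lintegral_ofReal h2]
    · rw [integral_add h1 (hint.const_mul t), integral_const_mul, hvol, mul_zero, add_zero]
      simp [Measure.real, hEfin]
    · refine Eventually.of_forall fun x => ?_
      have := abs_le.1 (abs_mul_fderiv_le hD (ht t h) x)
      simp only [Pi.zero_apply]
      linarith

/-! ### Domains with `C¹` boundary -/

theorem measurableSet_inter_preimage_of_continuousOn {u : Eucl n → ℝ} {B : Set (Eucl n)}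
    {t : Set ℝ} (hu : ContinuousOn u B) (hB : MeasurableSet B) (ht : MeasurableSet t) :
    MeasurableSet (B ∩ u ⁻¹' t) := by
  have h1 : Measurable (B.domRestrict u) :=
    (continuousOn_iff_continuous_domRestrict.1 hu).measurable
  have h2 := hB.subtype_image (h1 ht)
  convert h2 using 1
  ext y
  simp [domRestrict, and_comm]

/-- After normalization, a `C¹` function with nonzero differential is almost linear near a point,
with a unit gradient. -/
theorem exists_unit_almostLinearOn {u : Eucl n → ℝ} {U : Set (Eucl n)} (hU : IsOpen U)
    {x : Eucl n} (hx : x ∈ U) (hu : ContDiffOn ℝ 1 u U) (hne : fderiv ℝ u x ≠ 0) :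
    ∃ κ > 0, ∃ ν : Eucl n, ‖ν‖ = 1 ∧
      ν = κ • (InnerProductSpace.toDual ℝ (Eucl n)).symm (fderiv ℝ u x) ∧
      ∀ ε > 0, ∃ ρ > 0, AlmostLinearOn (fun y => κ * u y) ν ε (ball x ρ) := by
  set ν₀ := (InnerProductSpace.toDual ℝ (Eucl n)).symm (fderiv ℝ u x) with hν₀
  have h0 : 0 < ‖ν₀‖ := by
    rw [hν₀, LinearIsometryEquiv.norm_map]
    exact norm_pos_iff.2 hne
  refine ⟨‖ν₀‖⁻¹, inv_pos.2 h0, ‖ν₀‖⁻¹ • ν₀, ?_, rfl, fun ε hε => ?_⟩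
  · rw [norm_smul, norm_inv, norm_norm, inv_mul_cancel₀ h0.ne']
  · obtain ⟨ρ, hρ, h⟩ := exists_almostLinearOn hU hx hu (mul_pos h0 hε)
    refine ⟨ρ, hρ, ?_⟩
    have h1 := h.const_smul (inv_nonneg.2 h0.le)
    rwa [inv_mul_cancel_left₀ h0.ne'] at h1

/-- Near `x` the set `Ω` is the sublevel set `{φ < 0}` of an almost linear function with unit
gradient `ν`, the outer normal of `Ω` at `x`. -/
structure IsDomainChart (Ω : Set (Eucl n)) (x : Eucl n) (φ : Eucl n → ℝ) (ν : Eucl n) :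
    Prop where
  norm_normal : ‖ν‖ = 1
  eq_zero : φ x = 0
  approx : ∀ ε > 0, ∃ ρ > 0, AlmostLinearOn φ ν ε (ball x ρ)
  mem_iff : ∃ ρ > 0, ∀ y ∈ ball x ρ, y ∈ Ω ↔ φ y < 0

theorem HasC1Boundary.exists_chart {Ω : Set (Eucl n)} (h : HasC1Boundary Ω) (hΩ : IsOpen Ω)
    {x : Eucl n} (hx : x ∈ frontier Ω) : ∃ φ ν, IsDomainChart Ω x φ ν := by
  obtain ⟨U, hU, hxU, φ, hφ, hne, hΩU⟩ := h x hx
  obtain ⟨κ, hκ, ν, hν, -, happ⟩ := exists_unit_almostLinearOn hU hxU hφ hne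
  have hmem : ∀ y ∈ U, y ∈ Ω ↔ φ y < 0 := by
    intro y hy
    have := Set.ext_iff.1 hΩU y
    simpa [hy] using this
  refine ⟨fun y => κ * φ y, ν, hν, ?_, happ, ?_⟩
  · have h1 : 0 ≤ φ x := by
      by_contra hlt
      have : x ∈ Ω := (hmem x hxU).2 (not_le.1 hlt)
      rw [hΩ.frontier_eq] at hx
      exact hx.2 this
    have h2 : φ x ≤ 0 := by
      by_contra hgt
      push Not at hgt
      have hc : ContinuousAt φ x := hφ.continuousOn.continuousAt (hU.mem_nhds hxU)
      have hev : ∀ᶠ y in 𝓝 x, 0 < φ y ∧ y ∈ U := (hc.eventually_const_lt hgt).and (hU.mem_nhds hxU)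
      obtain ⟨y, ⟨hy, hyU⟩, hyΩ⟩ := mem_closure_iff_nhds.1 (frontier_subset_closure hx) _ hev
      exact absurd ((hmem y hyU).1 hyΩ) (not_lt.2 hy.le)
    have : φ x = 0 := le_antisymm h2 h1
    simp [this]
  · obtain ⟨ρ, hρ, hρU⟩ := Metric.isOpen_iff.1 hU x hxU
    refine ⟨ρ, hρ, fun y hy => ?_⟩
    rw [hmem y (hρU hy)]
    constructor
    · intro h; exact mul_neg_of_pos_of_neg hκ h
    · intro h; by_contra h'; exact absurd h (not_lt.2 (mul_nonneg hκ.le (not_lt.1 h')))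

/-- Layers `{-τ ≤ φ < 0}` of an almost linear function have volume `O(τ)`: their translates by
multiples of `2τ` along the gradient are disjoint. -/
theorem AlmostLinearOn.volume_layer_le {φ : Eucl n → ℝ} {ν x : Eucl n} {ρ τ : ℝ}
    (h : AlmostLinearOn φ ν (1 / 2) (ball x (2 * ρ))) (hν : ‖ν‖ = 1) (hρ : 0 < ρ) (hτ : 0 < τ) :
    volume (ball x ρ ∩ φ ⁻¹' Ico (-τ) 0) ≤
      ENNReal.ofReal (4 / ρ * (unitBallVolume n * (2 * ρ) ^ (n : ℝ)) * τ) := by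
  set A := ball x ρ ∩ φ ⁻¹' Ico (-τ) 0
  have hω := unitBallVolume_pos (n := n)
  have hsubB : ball x ρ ⊆ ball x (2 * ρ) := ball_subset_ball (by linarith)
  have hA : MeasurableSet A := measurableSet_inter_preimage_of_continuousOn
    (h.continuousOn.mono hsubB) measurableSet_ball measurableSet_Ico
  have hB := volume_ball_eq x (r := 2 * ρ) (by positivity)
  set b := unitBallVolume n * (2 * ρ) ^ (n : ℝ)
  have hb : 0 ≤ b := by positivity
  rcases lt_or_ge (ρ / 2) τ with hlt | hle
  · refine (measure_mono (inter_subset_left.trans hsubB)).trans ?_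
    rw [hB]
    refine ENNReal.ofReal_le_ofReal ?_
    have : 1 ≤ 4 / ρ * τ := by
      rw [div_mul_eq_mul_div, le_div_iff₀ hρ]; linarith
    nlinarith
  · set N := ⌊ρ / (2 * τ)⌋₊
    have hN1 : (N : ℝ) * (2 * τ) ≤ ρ := by
      have := Nat.floor_le (show 0 ≤ ρ / (2 * τ) by positivity)
      rwa [le_div_iff₀ (by positivity)] at this
    have hge : 1 ≤ ρ / (2 * τ) := by rw [le_div_iff₀ (by positivity)]; linarith
    have hN0 : 1 ≤ N := Nat.le_floor (by simpa using hge)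
    have hN2 : ρ ≤ (N : ℝ) * (4 * τ) := by
      have := Nat.lt_floor_add_one (ρ / (2 * τ))
      rw [div_lt_iff₀ (by positivity)] at this
      have h3 : (1 : ℝ) ≤ N := by exact_mod_cast hN0
      change ρ < ((N : ℝ) + 1) * _ at this
      nlinarith
    have hsub : ∀ j < N, ∀ y ∈ A, y + (j : ℝ) • ((2 * τ) • ν) ∈ ball x (2 * ρ) := by
      intro j hj y hy
      have hy1 := mem_ball.1 hy.1
      rw [dist_eq_norm] at hy1
      rw [mem_ball, dist_eq_norm, add_sub_right_comm]
      refine (norm_add_le _ _).trans_lt ?_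
      rw [norm_smul, norm_smul, hν, mul_one, Real.norm_of_nonneg (by positivity),
        Real.norm_of_nonneg (by positivity)]
      have : (j : ℝ) ≤ N := by exact_mod_cast hj.le
      have : (j : ℝ) * (2 * τ) ≤ ρ := le_trans (by gcongr) hN1
      linarith
    have key := card_mul_volume_le_of_translates hA ((2 * τ) • ν) N ?_ hsub
    · have h4 : volume A ≤ ENNReal.ofReal (4 * τ / ρ) * ((N : ℝ≥0∞) * volume A) := by
        rw [← mul_assoc]
        conv_lhs => rw [← one_mul (volume A)]
        gcongr
        rw [← ENNReal.ofReal_natCast, ← ENNReal.ofReal_mul (by positivity)]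
        rw [ENNReal.one_le_ofReal, div_mul_eq_mul_div, le_div_iff₀ hρ]
        linarith
      refine h4.trans ((mul_le_mul_right key _).trans ?_)
      rw [hB, ← ENNReal.ofReal_mul (by positivity)]
      refine ENNReal.ofReal_le_ofReal (le_of_eq ?_)
      ring
    · intro j k hjk hk y hy z hz heq
      have h1 : y = z + (((k : ℝ) - j) * (2 * τ)) • ν := by
        have : y = z + (k : ℝ) • ((2 * τ) • ν) - (j : ℝ) • ((2 * τ) • ν) := by rw [← heq]; abel
        rw [this]; module
      have hk1 : (j : ℝ) + 1 ≤ k := by exact_mod_cast hjk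
      have hpos : 0 ≤ ((k : ℝ) - j) * (2 * τ) := mul_nonneg (by linarith) (by positivity)
      have h2 := (h.add_smul_le hν hpos (hsubB hz.1) (by rw [← h1]; exact hsubB hy.1)).1
      rw [← h1] at h2
      have hy2 := (mem_preimage.1 hy.2).2
      have hz2 := (mem_preimage.1 hz.2).1
      nlinarith

/-- A segment leaving an open set contains a boundary point, which is no farther from either
endpoint than the endpoints are from each other. -/
theorem exists_mem_frontier_segment {Ω : Set (Eucl n)} (hΩ : IsOpen Ω) {x y : Eucl n}
    (hx : x ∈ Ω) (hy : y ∉ Ω) : ∃ p ∈ frontier Ω, ‖p - x‖ ≤ ‖y - x‖ ∧ ‖p - y‖ ≤ ‖y - x‖ := by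
  have hc : IsPreconnected (segment ℝ x y) := (convex_segment x y).isPreconnected
  obtain ⟨p, hp, hpf⟩ : ∃ p ∈ segment ℝ x y, p ∈ frontier Ω := by
    by_contra hcon
    push Not at hcon
    rw [hΩ.frontier_eq] at hcon
    have hcov : segment ℝ x y ⊆ Ω ∪ (closure Ω)ᶜ := fun p hp => by
      by_cases h : p ∈ Ω
      · exact Or.inl h
      · exact Or.inr fun h' => hcon p hp ⟨h', h⟩
    have hyc : y ∉ closure Ω := fun h => hcon y (right_mem_segment ℝ x y) ⟨h, hy⟩
    obtain ⟨p, -, hp, hp'⟩ := hc Ω (closure Ω)ᶜ hΩ isClosed_closure.isOpen_compl hcov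
      ⟨x, left_mem_segment ℝ x y, hx⟩ ⟨y, right_mem_segment ℝ x y, hyc⟩
    exact hp' (subset_closure hp)
  refine ⟨p, hpf, ?_⟩
  rw [segment_eq_image'] at hp
  obtain ⟨θ, hθ, rfl⟩ := hp
  have e1 : x + θ • (y - x) - x = θ • (y - x) := by abel
  have e2 : x + θ • (y - x) - y = -((1 - θ) • (y - x)) := by rw [sub_smul, one_smul]; abel
  simp only [e1, e2]
  rw [norm_neg, norm_smul, norm_smul, Real.norm_of_nonneg hθ.1,
    Real.norm_of_nonneg (sub_nonneg.2 hθ.2)]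
  constructor
  · exact mul_le_of_le_one_left (norm_nonneg _) hθ.2
  · exact mul_le_of_le_one_left (norm_nonneg _) (by linarith [hθ.1])

/-- A bounded `C¹` domain differs from its translates by `O(|z|)`. -/
theorem exists_volume_diff_translate_le {Ω : Set (Eucl n)} (hΩ : IsOpen Ω)
    (hb : Bornology.IsBounded Ω) (h1 : HasC1Boundary Ω) : ∃ C ≥ 0, ∃ r > 0, ∀ z : Eucl n, z ≠ 0 →
      ‖z‖ ≤ r → volume {x | x ∈ Ω ∧ x - z ∉ Ω} ≤ ENNReal.ofReal (C * ‖z‖) := by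
  have hω := unitBallVolume_pos (n := n)
  have hcpt : IsCompact (frontier Ω) :=
    (hb.isCompact_closure).of_isClosed_subset isClosed_frontier frontier_subset_closure
  have hloc : ∀ p ∈ frontier Ω, ∃ ρ > 0, ∃ φ : Eucl n → ℝ, ∃ ν : Eucl n, ‖ν‖ = 1 ∧
      AlmostLinearOn φ ν (1 / 2) (ball p (2 * ρ)) ∧ ∀ y ∈ ball p (2 * ρ), y ∈ Ω ↔ φ y < 0 := by
    intro p hp
    obtain ⟨φ, ν, hch⟩ := h1.exists_chart hΩ hp
    obtain ⟨ρ₁, hρ₁, ha⟩ := hch.approx (1 / 2) (by norm_num)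
    obtain ⟨ρ₂, hρ₂, hm⟩ := hch.mem_iff
    refine ⟨min ρ₁ ρ₂ / 2, by positivity, φ, ν, hch.norm_normal, ha.mono le_rfl ?_, ?_⟩
    · exact ball_subset_ball (by linarith [min_le_left ρ₁ ρ₂])
    · exact fun y hy => hm y (ball_subset_ball (by linarith [min_le_right ρ₁ ρ₂]) hy)
  choose! ρ hρ φ ν hν ha hm using hloc
  obtain ⟨T, hT, hcov⟩ := hcpt.elim_nhds_subcover (fun p => ball p (ρ p / 2))
    fun p hp => ball_mem_nhds p (half_pos (hρ p hp))
  obtain ⟨r, hr, hrT⟩ : ∃ r > 0, ∀ p ∈ T, r ≤ ρ p / 2 := by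
    rcases T.eq_empty_or_nonempty with rfl | hne
    · exact ⟨1, one_pos, by simp⟩
    · obtain ⟨p, hp, hmin⟩ := T.exists_min_image (fun p => ρ p / 2) hne
      exact ⟨ρ p / 2, half_pos (hρ p (hT p hp)), hmin⟩
  set c : Eucl n → ℝ := fun p => 4 / ρ p * (unitBallVolume n * (2 * ρ p) ^ (n : ℝ)) * 2
  have hc : ∀ p ∈ T, 0 ≤ c p := fun p hp => by
    have := hρ p (hT p hp)
    positivity
  refine ⟨∑ p ∈ T, c p, Finset.sum_nonneg hc, r, hr, fun z hz0 hz => ?_⟩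
  have hzp : 0 < ‖z‖ := norm_pos_iff.2 hz0
  have hsub : {x | x ∈ Ω ∧ x - z ∉ Ω} ⊆
      ⋃ p ∈ T, ball p (ρ p) ∩ φ p ⁻¹' Ico (-(2 * ‖z‖)) 0 := by
    rintro x ⟨hx, hxz⟩
    -- The segment from `x` to `x - z` crosses the boundary, so both endpoints lie in one of the
    -- finitely many charts, and `x` lies in its layer of width `2‖z‖`.
    obtain ⟨q, hq, hq1, hq2⟩ := exists_mem_frontier_segment hΩ hx hxz
    have e : x - z - x = -z := by abel
    rw [e, norm_neg] at hq1 hq2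
    obtain ⟨p, hp, hqp⟩ := mem_iUnion₂.1 (hcov hq)
    have hrp := hrT p hp
    have hpf := hT p hp
    rw [mem_ball] at hqp
    have hxB : x ∈ ball p (ρ p) := by
      rw [mem_ball]
      have := dist_triangle x q p
      rw [dist_comm x q, dist_eq_norm q x] at this
      linarith
    have hxB2 : x ∈ ball p (2 * ρ p) := ball_subset_ball (by linarith [hρ p hpf]) hxB
    have hxzB : x - z ∈ ball p (2 * ρ p) := by
      rw [mem_ball]
      have := dist_triangle (x - z) q p
      rw [dist_comm (x - z) q, dist_eq_norm q (x - z)] at this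
      linarith
    refine mem_iUnion₂.2 ⟨p, hp, hxB, ?_, (hm p hpf x hxB2).1 hx⟩
    have h2 : 0 ≤ φ p (x - z) := not_lt.1 fun h => hxz ((hm p hpf _ hxzB).2 h)
    have h3 := (abs_le.1 (ha p hpf _ hxzB x hxB2)).2
    rw [e, norm_neg, inner_neg_right] at h3
    have h4 := (abs_le.1 (abs_real_inner_le_norm (ν p) z)).1
    rw [hν p hpf, one_mul] at h4
    linarith
  refine (measure_mono hsub).trans ((measure_biUnion_finset_le _ _).trans ?_)
  rw [Finset.sum_mul, ENNReal.ofReal_sum_of_nonneg fun p hp => mul_nonneg (hc p hp) hzp.le]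
  refine Finset.sum_le_sum fun p hp => ?_
  have := (ha p (hT p hp)).volume_layer_le (hν p (hT p hp)) (hρ p (hT p hp))
    (τ := 2 * ‖z‖) (by positivity)
  refine this.trans (ENNReal.ofReal_le_ofReal (le_of_eq ?_))
  simp only [c]; ring

/-- A bounded `C¹` domain has finite nonlocal perimeter. -/
theorem interaction_compl_lt_top [NeZero n] {s Λ : ℝ} (hs : s ∈ Ioo (0 : ℝ) 1) {K : Eucl n → ℝ}
    (hK : IsSingularKernel s Λ K) (hΛ : 0 ≤ Λ) {Ω : Set (Eucl n)} (hΩ : IsOpen Ω)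
    (hb : Bornology.IsBounded Ω) (h1 : HasC1Boundary Ω) : interaction K Ω Ωᶜ < ∞ := by
  obtain ⟨C, hC, r, hr, hCr⟩ := exists_volume_diff_translate_le hΩ hb h1
  have hn : (1 : ℝ) ≤ n := by exact_mod_cast NeZero.one_le
  have hmK : Measurable fun z => ENNReal.ofReal (K z) := hK.measurable.ennreal_ofReal
  -- With `z = x - y` the energy becomes an integral of `K` against the volume of the difference of
  -- `Ω` and its translate, which is `O(‖z‖)` at the origin.
  have hswap : interaction K Ω Ωᶜ =
      ∫⁻ z, ENNReal.ofReal (K z) * volume {x | x ∈ Ω ∧ x - z ∉ Ω} := by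
    have e1 : ∀ x : Eucl n, ∫⁻ y in Ωᶜ, ENNReal.ofReal (K (x - y)) =
        ∫⁻ z, {z | x - z ∉ Ω}.indicator (fun z => ENNReal.ofReal (K z)) z := by
      intro x
      rw [← lintegral_indicator hΩ.measurableSet.compl,
        ← lintegral_sub_left_eq_self (μ := volume) _ x]
      refine lintegral_congr fun z => ?_
      by_cases hz : x - z ∈ Ω <;> simp [hz]
    have hm : MeasurableSet {p : Eucl n × Eucl n | p.1 ∈ Ω ∧ p.1 - p.2 ∉ Ω} :=
      (measurable_fst hΩ.measurableSet).inter
        ((measurable_fst.sub measurable_snd) hΩ.measurableSet.compl)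
    unfold interaction
    simp only [e1]
    rw [← lintegral_indicator hΩ.measurableSet]
    have e2 : ∀ x, Ω.indicator (fun x => ∫⁻ z, {z | x - z ∉ Ω}.indicator
        (fun z => ENNReal.ofReal (K z)) z) x = ∫⁻ z, {p : Eucl n × Eucl n | p.1 ∈ Ω ∧
        p.1 - p.2 ∉ Ω}.indicator (fun p => ENNReal.ofReal (K p.2)) (x, z) := by
      intro x
      by_cases hx : x ∈ Ω
      · rw [indicator_of_mem hx]
        refine lintegral_congr fun z => ?_
        by_cases hz : x - z ∈ Ω <;> simp [hz, hx]
      · simp [hx]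
    simp only [e2]
    rw [lintegral_lintegral_swap]
    · refine lintegral_congr fun z => ?_
      have hmz : MeasurableSet {x | x ∈ Ω ∧ x - z ∉ Ω} :=
        hΩ.measurableSet.inter ((measurable_id.sub_const z) hΩ.measurableSet.compl)
      rw [← setLIntegral_const, ← lintegral_indicator hmz]
      rfl
    · exact ((hmK.comp measurable_snd).indicator hm).aemeasurable
  rw [hswap, ← lintegral_add_compl _ (measurableSet_ball (x := (0 : Eucl n)) (ε := r))]
  refine ENNReal.add_lt_top.2 ⟨?_, ?_⟩
  · have hin := lintegral_norm_rpow_inner_le (n := n) (S := univ) (p := n) (q := n + s - 1)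
      (C := unitBallVolume n) unitBallVolume_pos.le (by linarith [hs.1]) (by linarith [hs.2]) hr
      fun ρ hρ _ => by rw [univ_inter, volume_ball_eq _ hρ]
    rw [univ_inter] at hin
    calc _ ≤ ∫⁻ z in ball (0 : Eucl n) r,
          ENNReal.ofReal (Λ * C) * ENNReal.ofReal (‖z‖ ^ (-((n : ℝ) + s - 1))) := by
          refine setLIntegral_mono' measurableSet_ball fun z hz => ?_
          rcases eq_or_ne z 0 with rfl | hz0
          · simp
          have hzp := norm_pos_iff.2 hz0
          refine (mul_le_mul' (ENNReal.ofReal_le_ofReal ((le_abs_self _).trans (hK.bound z hz0)))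
            (hCr z hz0 (mem_ball_zero_iff.1 hz).le)).trans ?_
          rw [← ENNReal.ofReal_mul (by positivity), ← ENNReal.ofReal_mul (by positivity)]
          refine ENNReal.ofReal_le_ofReal (le_of_eq ?_)
          rw [show -((n : ℝ) + s - 1) = -((n : ℝ) + s) + 1 by ring, Real.rpow_add hzp,
            Real.rpow_one]
          ring
      _ < ∞ := by
          rw [lintegral_const_mul _ (measurable_norm_rpow _).ennreal_ofReal]
          exact ENNReal.mul_lt_top ENNReal.ofReal_lt_top (hin.trans_lt ENNReal.ofReal_lt_top)
  · have hout := lintegral_norm_rpow_outer_le (n := n) (S := univ) (p := n) (q := n + s)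
      (C := unitBallVolume n) unitBallVolume_pos.le (by linarith [hs.1]) (by linarith [hs.1]) hr
      fun ρ hρ => by rw [univ_inter, volume_ball_eq _ (hr.trans_le hρ)]
    rw [← compl_eq_univ_sdiff] at hout
    calc _ ≤ ∫⁻ z in (ball (0 : Eucl n) r)ᶜ,
          (ENNReal.ofReal Λ * volume Ω) * ENNReal.ofReal (‖z‖ ^ (-((n : ℝ) + s))) := by
          refine setLIntegral_mono' measurableSet_ball.compl fun z hz => ?_
          have hz0 : z ≠ 0 := by
            rintro rfl
            exact hz (mem_ball_self hr)
          refine (mul_le_mul' (ENNReal.ofReal_le_ofReal ((le_abs_self _).trans (hK.bound z hz0)))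
            (measure_mono fun x hx => hx.1)).trans (le_of_eq ?_)
          rw [ENNReal.ofReal_mul hΛ]; ring
      _ < ∞ := by
          rw [lintegral_const_mul _ (measurable_norm_rpow _).ennreal_ofReal]
          exact ENNReal.mul_lt_top (ENNReal.mul_lt_top ENNReal.ofReal_lt_top hb.measure_lt_top)
            (hout.trans_lt ENNReal.ofReal_lt_top)

/-! ### The wall potential -/

/-- The potential `x ↦ ∫_{Ωᶜ} K(x-y) dy` of the container walls. -/
def wallPotential (K : Eucl n → ℝ) (Ω : Set (Eucl n)) (x : Eucl n) : ℝ := ∫ y in Ωᶜ, K (x - y)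

theorem IsSingularKernel.integrableOn_compl_ball {s Λ : ℝ} (hs : 0 < s) {K : Eucl n → ℝ}
    (hK : IsSingularKernel s Λ K) {δ : ℝ} (hδ : 0 < δ) : IntegrableOn K (ball 0 δ)ᶜ := by
  obtain ⟨C, -, hC⟩ := exists_tail_bound (n := n) hs
  refine Integrable.mono' ((hC δ hδ).1.const_mul Λ) hK.measurable.aestronglyMeasurable ?_
  rw [ae_restrict_iff' measurableSet_ball.compl]
  refine Eventually.of_forall fun z hz => hK.bound z ?_
  rintro rfl
  exact hz (mem_ball_self hδ)

theorem indicator_compl_ball_comp_sub (f : Eucl n → ℝ) (x y : Eucl n) (δ : ℝ) :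
    (ball (0 : Eucl n) δ)ᶜ.indicator f (x - y) = (ball x δ)ᶜ.indicator (fun y => f (x - y)) y := by
  have h : x - y ∈ (ball (0 : Eucl n) δ)ᶜ ↔ y ∈ (ball x δ)ᶜ := by
    rw [mem_compl_iff, mem_compl_iff, mem_ball_zero_iff, mem_ball', dist_eq_norm]
  by_cases hy : y ∈ (ball x δ)ᶜ
  · rw [indicator_of_mem hy, indicator_of_mem (h.2 hy)]
  · rw [indicator_of_notMem hy, indicator_of_notMem (mt h.1 hy)]

theorem IsSingularKernel.integrableOn_comp_sub {s Λ : ℝ} (hs : 0 < s) {K : Eucl n → ℝ}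
    (hK : IsSingularKernel s Λ K) {δ : ℝ} (hδ : 0 < δ) (x : Eucl n) :
    IntegrableOn (fun y => K (x - y)) (ball x δ)ᶜ := by
  have h := hK.integrableOn_compl_ball hs hδ
  rw [← integrable_indicator_iff measurableSet_ball.compl] at h ⊢
  exact (h.comp_sub_left x).congr
    (Eventually.of_forall fun y => indicator_compl_ball_comp_sub K x y δ)

theorem setIntegral_comp_sub_left (f : Eucl n → ℝ) (x : Eucl n) (δ : ℝ) :
    ∫ y in (ball x δ)ᶜ, f (x - y) = ∫ z in (ball (0 : Eucl n) δ)ᶜ, f z := by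
  rw [← integral_indicator measurableSet_ball.compl, ← integral_indicator measurableSet_ball.compl,
    ← integral_sub_left_eq_self ((ball (0 : Eucl n) δ)ᶜ.indicator f) volume x]
  exact integral_congr_ae
    (Eventually.of_forall fun y => (indicator_compl_ball_comp_sub f x y δ).symm)

/-- Off `B_δ(x)` a singular kernel integrates to `O(δ^{-s})` against a bounded function. -/
theorem exists_abs_setIntegral_compl_ball_le {s : ℝ} (hs : 0 < s) : ∃ C > 0,
    ∀ (Λ : ℝ) (K ψ : Eucl n → ℝ), IsSingularKernel s Λ K → 0 ≤ Λ → (∀ y, |ψ y| ≤ 1) →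
    ∀ (x : Eucl n) (δ : ℝ), 0 < δ →
      |∫ y in (ball x δ)ᶜ, K (x - y) * ψ y| ≤ Λ * C * δ ^ (-s) := by
  obtain ⟨C, hC, hCb⟩ := exists_tail_bound (n := n) hs
  refine ⟨C, hC, fun Λ K ψ hK hΛ hψ x δ hδ => ?_⟩
  have h1 : IntegrableOn (fun y => |K (x - y)|) (ball x δ)ᶜ :=
    (hK.integrableOn_comp_sub hs hδ x).abs
  calc |∫ y in (ball x δ)ᶜ, K (x - y) * ψ y| ≤ ∫ y in (ball x δ)ᶜ, |K (x - y)| := by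
        rw [← Real.norm_eq_abs]
        refine norm_integral_le_of_norm_le h1 (Eventually.of_forall fun y => ?_)
        rw [Real.norm_eq_abs, abs_mul]
        exact mul_le_of_le_one_right (abs_nonneg _) (hψ y)
    _ = ∫ z in (ball (0 : Eucl n) δ)ᶜ, |K z| := setIntegral_comp_sub_left (fun z => |K z|) x δ
    _ ≤ ∫ z in (ball (0 : Eucl n) δ)ᶜ, Λ * ‖z‖ ^ (-((n : ℝ) + s)) := by
        refine setIntegral_mono_on (hK.integrableOn_compl_ball hs hδ).abs
          ((hCb δ hδ).1.const_mul Λ) measurableSet_ball.compl fun z hz => hK.bound z ?_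
        rintro rfl
        exact hz (mem_ball_self hδ)
    _ ≤ Λ * C * δ ^ (-s) := by
        rw [integral_const_mul, mul_assoc]
        exact mul_le_mul_of_nonneg_left (hCb δ hδ).2 hΛ

theorem compl_subset_compl_ball {Ω : Set (Eucl n)} {x : Eucl n} {d : ℝ} (h : ball x d ⊆ Ω) :
    Ωᶜ ⊆ (ball x d)ᶜ := compl_subset_compl.2 h

theorem IsSingularKernel.integrableOn_wall {s Λ : ℝ} (hs : 0 < s) {K : Eucl n → ℝ}
    (hK : IsSingularKernel s Λ K) {Ω : Set (Eucl n)} {x : Eucl n} {d : ℝ} (hd : 0 < d)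
    (h : ball x d ⊆ Ω) : IntegrableOn (fun y => K (x - y)) Ωᶜ :=
  (hK.integrableOn_comp_sub hs hd x).mono_set (compl_subset_compl_ball h)

/-- The wall potential at distance `d` from the walls is `O(d^{-s})`. -/
theorem exists_abs_wallPotential_le {s : ℝ} (hs : 0 < s) : ∃ C > 0,
    ∀ (Λ : ℝ) (K : Eucl n → ℝ), IsSingularKernel s Λ K → 0 ≤ Λ →
    ∀ (Ω : Set (Eucl n)), MeasurableSet Ω → ∀ (x : Eucl n) (d : ℝ), 0 < d → ball x d ⊆ Ω →
      |wallPotential K Ω x| ≤ Λ * C * d ^ (-s) := by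
  obtain ⟨C, hC, hCb⟩ := exists_abs_setIntegral_compl_ball_le (n := n) hs
  refine ⟨C, hC, fun Λ K hK hΛ Ω hΩ x d hd hsub => ?_⟩
  have h := hCb Λ K (Ωᶜ.indicator 1) hK hΛ (fun y => by
    by_cases hy : y ∈ Ωᶜ <;> simp [indicator, hy]) x d hd
  convert h using 2
  rw [wallPotential]
  have : ∀ y, K (x - y) * Ωᶜ.indicator 1 y = Ωᶜ.indicator (fun y => K (x - y)) y := by
    intro y
    by_cases hy : y ∈ Ωᶜ
    · rw [indicator_of_mem hy, indicator_of_mem hy, Pi.one_apply, mul_one]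
    · rw [indicator_of_notMem hy, indicator_of_notMem hy, mul_zero]
  simp only [this]
  rw [integral_indicator hΩ.compl, Measure.restrict_restrict hΩ.compl,
    inter_eq_left.2 (compl_subset_compl_ball hsub)]

/-- The wall potential is of class `C¹` inside the container. -/
theorem contDiffOn_wallPotential {s lam : ℝ} {rad : ℝ≥0∞} {K : Eucl n → ℝ} (hs : 0 < s)
    (hK : IsSmoothKernel 2 n s lam rad K) (hlam : 0 ≤ lam) {Ω : Set (Eucl n)} (hΩ : IsOpen Ω) :
    ContDiffOn ℝ 1 (wallPotential K Ω) Ω := by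
  intro x hx
  refine ContDiffAt.contDiffWithinAt ?_
  obtain ⟨d, hd, hdΩ⟩ := Metric.isOpen_iff.1 hΩ x hx
  obtain ⟨C, -, hC⟩ := exists_truncKernel_bound hs hK hlam (half_pos hd)
  have h := (contDiff_integral_kernel (ψ := Ωᶜ.indicator 1) (p := n + s) (by linarith)
    (contDiff_truncKernel (hK.contDiffOn.of_le (by norm_num)) (half_pos hd)) hC
    (measurable_one.indicator hΩ.measurableSet.compl) (fun y => by
      by_cases hy : y ∈ Ωᶜ <;> simp [indicator, hy])).1
  -- Near `x` the walls are at distance at least `d / 2`, where truncating changes nothing.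
  refine h.contDiffAt.congr_of_eventuallyEq ?_
  filter_upwards [ball_mem_nhds x (half_pos hd)] with w hw
  rw [wallPotential, ← integral_indicator hΩ.measurableSet.compl]
  refine integral_congr_ae (Eventually.of_forall fun y => ?_)
  by_cases hy : y ∈ Ωᶜ
  · have h1 : d ≤ dist y x := by
      by_contra hlt
      exact hy (hdΩ (mem_ball.2 (not_le.1 hlt)))
    have h2 : d / 2 ≤ ‖w - y‖ := by
      rw [← dist_eq_norm, dist_comm]
      have := dist_triangle y w x
      rw [mem_ball] at hw
      linarith
    simp only [indicator_of_mem hy, Pi.one_apply, mul_one, truncKernel_eq_self (half_pos hd) h2]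
  · simp only [indicator_of_notMem hy, mul_zero]

/-- The energy of the walls is the integral of the wall potential. -/
theorem toReal_interaction_wall {s lam : ℝ} {rad : ℝ≥0∞} {K : Eucl n → ℝ} (hs : 0 < s)
    (hK : IsSmoothKernel 2 n s lam rad K) (hlam : 0 ≤ lam) {Ω F : Set (Eucl n)} (hΩ : IsOpen Ω)
    (hF : MeasurableSet F) (hFΩ : F ⊆ Ω) :
    (interaction K F Ωᶜ).toReal = ∫ x in F, wallPotential K Ω x ∧
      interaction K F Ωᶜ = ∫⁻ x in F, ENNReal.ofReal (wallPotential K Ω x) := by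
  have hKs := hK.isSingularKernel
  have key : ∀ x ∈ Ω, 0 ≤ wallPotential K Ω x ∧
      ∫⁻ y in Ωᶜ, ENNReal.ofReal (K (x - y)) = ENNReal.ofReal (wallPotential K Ω x) := by
    intro x hx
    obtain ⟨d, hd, hdΩ⟩ := Metric.isOpen_iff.1 hΩ x hx
    have hnn : 0 ≤ᵐ[volume.restrict Ωᶜ] fun y => K (x - y) := by
      rw [EventuallyLE, ae_restrict_iff' hΩ.measurableSet.compl]
      refine Eventually.of_forall fun y hy => hK.nonneg _ ?_
      intro h
      rw [sub_eq_zero] at h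
      exact hy (h ▸ hx)
    exact ⟨integral_nonneg_of_ae hnn,
      (ofReal_integral_eq_lintegral_ofReal (hKs.integrableOn_wall hs hd hdΩ) hnn).symm⟩
  have h2 : interaction K F Ωᶜ = ∫⁻ x in F, ENNReal.ofReal (wallPotential K Ω x) :=
    setLIntegral_congr_fun hF fun x hx => (key x (hFΩ hx)).2
  refine ⟨?_, h2⟩
  rw [h2, integral_eq_lintegral_of_nonneg_ae]
  · rw [EventuallyLE, ae_restrict_iff' hF]
    exact Eventually.of_forall fun x hx => (key x (hFΩ hx)).1
  · exact ((contDiffOn_wallPotential hs hK hlam hΩ).continuousOn.mono hFΩ).aestronglyMeasurable hF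

theorem integrableOn_wallPotential [NeZero n] {s lam : ℝ} {rad : ℝ≥0∞} {K : Eucl n → ℝ}
    (hs : s ∈ Ioo (0 : ℝ) 1) (hK : IsSmoothKernel 2 n s lam rad K) (hlam : 0 ≤ lam)
    {Ω : Set (Eucl n)} (hΩ : IsOpen Ω) (hb : Bornology.IsBounded Ω) (h1 : HasC1Boundary Ω) :
    IntegrableOn (wallPotential K Ω) Ω := by
  have hfin := interaction_compl_lt_top hs hK.isSingularKernel hlam hΩ hb h1
  rw [(toReal_interaction_wall hs.1 hK hlam hΩ hΩ.measurableSet subset_rfl).2] at hfin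
  refine ⟨(contDiffOn_wallPotential hs.1 hK hlam hΩ).continuousOn.aestronglyMeasurable
    hΩ.measurableSet, ?_⟩
  rw [hasFiniteIntegral_iff_ofReal]
  · exact hfin
  · rw [EventuallyLE, ae_restrict_iff' hΩ.measurableSet]
    refine Eventually.of_forall fun x hx => ?_
    refine setIntegral_nonneg hΩ.measurableSet.compl fun y hy => hK.nonneg _ ?_
    intro h
    rw [sub_eq_zero] at h
    exact hy (h ▸ hx)

/-- First variation of a potential energy along shifts. -/
theorem hasDerivAt_integral_shift_image [NeZero n] {Ω E : Set (Eucl n)} (hΩ : IsOpen Ω)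
    (hE : MeasurableSet E) (hEΩ : E ⊆ Ω) (hEfin : volume E ≠ ∞) {Φ : Eucl n → ℝ}
    (hΦ : ContDiffOn ℝ 1 Φ Ω) (hΦi : IntegrableOn Φ E) {φ : Eucl n → ℝ}
    (hφ : ContDiff ℝ (⊤ : ℕ∞) φ) (hc : HasCompactSupport φ) (hφΩ : tsupport φ ⊆ Ω)
    (e : Eucl n) : IntegrableOn (fun x => fderiv ℝ φ x e * Φ x + φ x * fderiv ℝ Φ x e) E ∧
      HasDerivAt (fun t => ∫ x in shift φ e t '' E, Φ x)
      (∫ x in E, (fderiv ℝ φ x e * Φ x + φ x * fderiv ℝ Φ x e)) 0 := by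
  obtain ⟨D, hD0, hφD, hD⟩ := exists_fderiv_bound hφ hc
  have hφd : Differentiable ℝ φ := hφ.differentiable (by simp)
  -- a compact neighbourhood of the support on which `Φ` and its differential are bounded
  obtain ⟨η, hη, hηΩ⟩ := hc.exists_cthickening_subset_open hΩ hφΩ
  have hcpt : IsCompact (cthickening η (tsupport φ)) := hc.cthickening
  obtain ⟨M₁, hM₁⟩ := hcpt.exists_bound_of_continuousOn (hΦ.continuousOn.mono hηΩ)
  have hdΦ : ContinuousOn (fderiv ℝ Φ) Ω := hΦ.continuousOn_fderiv_of_isOpen hΩ le_rfl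
  obtain ⟨M₂, hM₂⟩ := hcpt.exists_bound_of_continuousOn (hdΦ.mono hηΩ)
  set δ := min (1 / (2 * (D * ‖e‖ + 1))) (η / (D * ‖e‖ + 1)) with hδ
  have hDe : 0 < D * ‖e‖ + 1 := by positivity
  have hδ0 : 0 < δ := by positivity
  have hδ1 : ∀ t ∈ ball (0 : ℝ) δ, |t| * (D * ‖e‖) ≤ 1 / 2 := by
    intro t ht
    rw [mem_ball_zero_iff, Real.norm_eq_abs] at ht
    have h1 : |t| ≤ 1 / (2 * (D * ‖e‖ + 1)) := (ht.le.trans (min_le_left _ _))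
    rw [le_div_iff₀ (by positivity)] at h1
    nlinarith [abs_nonneg t]
  have hδ2 : ∀ t ∈ ball (0 : ℝ) δ, |t| * (D * ‖e‖) ≤ η := by
    intro t ht
    rw [mem_ball_zero_iff, Real.norm_eq_abs] at ht
    have h1 : |t| ≤ η / (D * ‖e‖ + 1) := (ht.le.trans (min_le_right _ _))
    rw [le_div_iff₀ (by positivity)] at h1
    nlinarith [abs_nonneg t]
  have hmem : ∀ t ∈ ball (0 : ℝ) δ, ∀ x ∈ tsupport φ,
      shift φ e t x ∈ cthickening η (tsupport φ) := by
    intro t ht x hx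
    refine mem_cthickening_of_dist_le _ x _ _ hx ?_
    rw [dist_eq_norm, shift, add_sub_cancel_left, norm_smul, Real.norm_eq_abs, abs_mul]
    calc |t| * |φ x| * ‖e‖ ≤ |t| * D * ‖e‖ := by gcongr; exact hφD x
      _ ≤ η := by rw [mul_assoc]; exact hδ2 t ht
  have hmemΩ : ∀ t ∈ ball (0 : ℝ) δ, ∀ x ∈ Ω, shift φ e t x ∈ Ω := by
    intro t ht x hx
    rw [← shift_image_of_tsupport_subset hφ hD (hδ1 t ht) hφΩ]
    exact mem_image_of_mem _ hx
  have hdφ : Continuous fun x => fderiv ℝ φ x e :=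
    (hφ.continuous_fderiv (by simp)).clm_apply continuous_const
  set F : ℝ → Eucl n → ℝ := fun t x => (1 + t * fderiv ℝ φ x e) * Φ (shift φ e t x)
  set F' : ℝ → Eucl n → ℝ := fun t x => fderiv ℝ φ x e * Φ (shift φ e t x) +
    (1 + t * fderiv ℝ φ x e) * fderiv ℝ Φ (shift φ e t x) (φ x • e)
  have hcs : ∀ t, Continuous (shift φ e t) := fun t =>
    continuous_id.add ((continuous_const.mul hφ.continuous).smul continuous_const)
  have hFm : ∀ t ∈ ball (0 : ℝ) δ, AEStronglyMeasurable (F t) (volume.restrict E) := by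
    intro t ht
    refine ContinuousOn.aestronglyMeasurable (ContinuousOn.mono ?_ hEΩ) hE
    exact (continuous_const.add (continuous_const.mul hdφ)).continuousOn.mul
      (hΦ.continuousOn.comp (hcs t).continuousOn (hmemΩ t ht))
  have hF'0 : F' 0 = fun x => fderiv ℝ φ x e * Φ x + φ x * fderiv ℝ Φ x e := by
    funext x
    simp [F', shift]
  -- After the change of variables along the shift the domain of integration is `E` for every `t`,
  -- and the integrand `F t` can be differentiated in `t`.
  have hmain := hasDerivAt_integral_of_dominated_loc_of_deriv_le (𝕜 := ℝ) (x₀ := (0 : ℝ))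
    (μ := volume.restrict E) (F := F) (F' := F')
    (bound := fun _ => D * ‖e‖ * |M₁| + (3 / 2) * (|M₂| * (D * ‖e‖)))
    (ball_mem_nhds 0 hδ0) (eventually_of_mem (ball_mem_nhds 0 hδ0) hFm) ?_ ?_ ?_
    (integrableOn_const hEfin) ?_
  · rw [hF'0] at hmain
    refine ⟨hmain.1, hmain.2.congr_of_eventuallyEq ?_⟩
    filter_upwards [ball_mem_nhds 0 hδ0] with t ht
    exact integral_shift_image hφd hD (hδ1 t ht) hE Φ
  · have : F 0 = Φ := by
      funext x
      simp [F, shift]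
    rw [this]
    exact hΦi
  · rw [hF'0]
    refine ContinuousOn.aestronglyMeasurable (ContinuousOn.mono ?_ hEΩ) hE
    exact (hdφ.continuousOn.mul hΦ.continuousOn).add
      (hφ.continuous.continuousOn.mul (hdΦ.clm_apply continuousOn_const))
  · refine Eventually.of_forall fun x t ht => ?_
    by_cases hx : x ∈ tsupport φ
    · have hs := hmem t ht x hx
      have h1 : |Φ (shift φ e t x)| ≤ |M₁| := (hM₁ _ hs).trans (le_abs_self _)
      have h2 : ‖fderiv ℝ Φ (shift φ e t x)‖ ≤ |M₂| := (hM₂ _ hs).trans (le_abs_self _)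
      have h3 : |fderiv ℝ φ x e| ≤ D * ‖e‖ :=
        ((fderiv ℝ φ x).le_opNorm e).trans (by gcongr; exact hD x)
      have h4 : |fderiv ℝ Φ (shift φ e t x) (φ x • e)| ≤ |M₂| * (D * ‖e‖) := by
        refine ((fderiv ℝ Φ (shift φ e t x)).le_opNorm _).trans ?_
        rw [norm_smul, Real.norm_eq_abs]
        gcongr
        exact hφD x
      have h5 : |1 + t * fderiv ℝ φ x e| ≤ 3 / 2 := by
        have := abs_le.1 (abs_mul_fderiv_le hD (hδ1 t ht) x)
        rw [abs_le]
        constructor <;> linarith [this.1, this.2]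
      refine (norm_add_le _ _).trans ?_
      rw [Real.norm_eq_abs, Real.norm_eq_abs, abs_mul, abs_mul]
      gcongr
    · have h1 : φ x = 0 := image_eq_zero_of_notMem_tsupport hx
      have h2 : fderiv ℝ φ x = 0 := fderiv_of_notMem_tsupport ℝ hx
      simp only [F', h1, h2, zero_smul, map_zero, mul_zero, add_zero, norm_zero,
        _root_.zero_apply, zero_mul]
      positivity
  · filter_upwards [ae_restrict_mem hE] with x hxE t ht
    have hx := hmemΩ t ht x (hEΩ hxE)
    have h1 : HasDerivAt (fun t : ℝ => 1 + t * fderiv ℝ φ x e) (fderiv ℝ φ x e) t := by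
      simpa using ((hasDerivAt_id t).mul_const (fderiv ℝ φ x e)).const_add 1
    have h2 : HasDerivAt (fun t : ℝ => shift φ e t x) (φ x • e) t := by
      have := (((hasDerivAt_id t).mul_const (φ x)).smul_const e).const_add x
      simpa [shift] using this
    have h3 : HasFDerivAt Φ (fderiv ℝ Φ (shift φ e t x)) (shift φ e t x) :=
      ((hΦ.contDiffAt (hΩ.mem_nhds hx)).differentiableAt (by norm_num)).hasFDerivAt
    exact h1.mul (h3.comp_hasDerivAt t h2)

/-! ### First variation of the interaction energy -/

/-- Integrand of the first variation of `∫_E ∫_{Eᶜ ∩ Ω} k(x-y)` along `x ↦ x + t φ(x) e`. -/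
def pairVariation (k φ : Eucl n → ℝ) (e : Eucl n) (p : Eucl n × Eucl n) : ℝ :=
  (fderiv ℝ φ p.1 e + fderiv ℝ φ p.2 e) * k (p.1 - p.2) +
    (φ p.1 - φ p.2) * fderiv ℝ k (p.1 - p.2) e

/-- The product measure on `E × (Eᶜ ∩ Ω)`. -/
def pairMeasure (Ω E : Set (Eucl n)) : Measure (Eucl n × Eucl n) :=
  (volume.restrict E).prod (volume.restrict (Eᶜ ∩ Ω))

theorem ae_pairMeasure {Ω E : Set (Eucl n)} (hE : MeasurableSet E) (hΩ : MeasurableSet Ω) :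
    ∀ᵐ p ∂(pairMeasure Ω E), p.1 ∈ E ∧ p.2 ∈ Eᶜ ∩ Ω ∧ p.1 - p.2 ≠ 0 := by
  rw [pairMeasure, Measure.prod_restrict]
  filter_upwards [ae_restrict_mem (hE.prod (hE.compl.inter hΩ))] with p hp
  refine ⟨hp.1, hp.2, fun h => ?_⟩
  rw [sub_eq_zero] at h
  exact hp.2.1 (h ▸ hp.1)

theorem interaction_eq_lintegral_pair {Ω E : Set (Eucl n)} {K : Eucl n → ℝ} (hK : Measurable K) :
    interaction K E (Eᶜ ∩ Ω) =
      ∫⁻ p, ENNReal.ofReal (K (p.1 - p.2)) ∂(pairMeasure Ω E) := by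
  rw [pairMeasure, lintegral_prod]
  · rfl
  · exact (hK.comp (measurable_fst.sub measurable_snd)).ennreal_ofReal.aemeasurable

theorem isFiniteMeasure_pairMeasure {Ω E : Set (Eucl n)} (hb : Bornology.IsBounded Ω)
    (hEΩ : E ⊆ Ω) : IsFiniteMeasure (pairMeasure Ω E) := by
  have h1 : IsFiniteMeasure (volume.restrict E) :=
    ⟨by rw [Measure.restrict_apply_univ]; exact (hb.subset hEΩ).measure_lt_top⟩
  have h2 : IsFiniteMeasure (volume.restrict (Eᶜ ∩ Ω)) :=
    ⟨by rw [Measure.restrict_apply_univ]; exact (hb.subset inter_subset_right).measure_lt_top⟩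
  unfold pairMeasure
  infer_instance

/-- Finite energy controls the full singularity `|x-y|^{-n-s}` on `E × (Eᶜ ∩ Ω)`. -/
theorem integrable_pair_rpow {s lam : ℝ} {rad : ℝ≥0∞} {K : Eucl n → ℝ} (hs : 0 < s)
    (hK : IsSmoothKernel 2 n s lam rad K) (hlam : 0 < lam) (hrad : 0 < rad)
    {Ω E : Set (Eucl n)} (hΩ : MeasurableSet Ω) (hb : Bornology.IsBounded Ω)
    (hE : MeasurableSet E) (hEΩ : E ⊆ Ω) (hfin : interaction K E (Eᶜ ∩ Ω) < ∞) :
    Integrable (fun p : Eucl n × Eucl n => ‖p.1 - p.2‖ ^ (-((n : ℝ) + s))) (pairMeasure Ω E) := by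
  have hKs := hK.isSingularKernel
  have := isFiniteMeasure_pairMeasure hb hEΩ
  obtain ⟨r, hr, hrr⟩ : ∃ r : ℝ, 0 < r ∧ ENNReal.ofReal r ≤ rad := by
    rcases eq_or_ne rad ∞ with rfl | h
    · exact ⟨1, one_pos, le_top⟩
    · exact ⟨rad.toReal, ENNReal.toReal_pos hrad.ne' h, (ENNReal.ofReal_toReal h).le⟩
  have hae := ae_pairMeasure hE hΩ
  have hKm : Measurable fun p : Eucl n × Eucl n => K (p.1 - p.2) :=
    hKs.measurable.comp (measurable_fst.sub measurable_snd)
  have hKi : Integrable (fun p : Eucl n × Eucl n => K (p.1 - p.2)) (pairMeasure Ω E) := by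
    refine ⟨hKm.aestronglyMeasurable, ?_⟩
    rw [hasFiniteIntegral_iff_ofReal]
    · rwa [← interaction_eq_lintegral_pair hKs.measurable]
    · filter_upwards [hae] with p hp using hK.nonneg _ hp.2.2
  refine Integrable.mono' ((hKi.const_mul lam).add (integrable_const (r ^ (-((n : ℝ) + s)))))
    ((measurable_norm_rpow _).comp (measurable_fst.sub measurable_snd)).aestronglyMeasurable ?_
  filter_upwards [hae] with p hp
  have hz : 0 < ‖p.1 - p.2‖ := norm_pos_iff.2 hp.2.2
  have hK0 := hK.nonneg _ hp.2.2
  have hr0 : 0 < r ^ (-((n : ℝ) + s)) := by positivity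
  rw [Real.norm_of_nonneg (by positivity)]
  simp only [Pi.add_apply]
  rcases lt_or_ge ‖p.1 - p.2‖ r with h | h
  · have h1 := hK.lower _ hp.2.2
      (((ENNReal.ofReal_lt_ofReal_iff hr).2 h).trans_le hrr)
    have h2 : ‖p.1 - p.2‖ ^ (-((n : ℝ) + s)) ≤ lam * K (p.1 - p.2) := by
      rw [one_div, mul_inv, ← Real.rpow_neg hz.le, inv_mul_le_iff₀ hlam] at h1
      exact h1
    linarith
  · have h1 : ‖p.1 - p.2‖ ^ (-((n : ℝ) + s)) ≤ r ^ (-((n : ℝ) + s)) := by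
      apply Real.rpow_le_rpow_of_nonpos hr h
      have : (0 : ℝ) ≤ n := Nat.cast_nonneg n
      linarith
    nlinarith [mul_nonneg hlam.le hK0]

theorem measurable_fderiv_apply_sub {k : Eucl n → ℝ} (e : Eucl n) :
    Measurable fun p : Eucl n × Eucl n => fderiv ℝ k (p.1 - p.2) e :=
  (measurable_fderiv_apply_const ℝ k e).comp (measurable_fst.sub measurable_snd)

theorem measurable_pairVariation {k φ : Eucl n → ℝ} (hk : Measurable k) (hφ : Measurable φ)
    (e : Eucl n) : Measurable (pairVariation k φ e) := by
  have h1 := measurable_fderiv_apply_const ℝ φ e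
  exact (((h1.comp measurable_fst).add (h1.comp measurable_snd)).mul
    (hk.comp (measurable_fst.sub measurable_snd))).add
    (((hφ.comp measurable_fst).sub (hφ.comp measurable_snd)).mul (measurable_fderiv_apply_sub e))

theorem abs_pairVariation_le {k φ : Eucl n → ℝ} {e : Eucl n} {D C₁ C₂ q : ℝ}
    (hφ : Differentiable ℝ φ) (hD : ∀ x, ‖fderiv ℝ φ x‖ ≤ D) {p : Eucl n × Eucl n}
    (hp : p.1 - p.2 ≠ 0) (h1 : |k (p.1 - p.2)| ≤ C₁ * ‖p.1 - p.2‖ ^ (-q))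
    (h2 : ‖fderiv ℝ k (p.1 - p.2)‖ ≤ C₂ * ‖p.1 - p.2‖ ^ (-q - 1)) :
    |pairVariation k φ e p| ≤ (2 * C₁ + C₂) * (D * ‖e‖) * ‖p.1 - p.2‖ ^ (-q) := by
  have hz : 0 < ‖p.1 - p.2‖ := norm_pos_iff.2 hp
  have hD0 : 0 ≤ D := (norm_nonneg _).trans (hD 0)
  have ha : ∀ x, |fderiv ℝ φ x e| ≤ D * ‖e‖ := fun x =>
    ((fderiv ℝ φ x).le_opNorm e).trans (by gcongr; exact hD x)
  have hb : |fderiv ℝ k (p.1 - p.2) e| ≤ C₂ * ‖p.1 - p.2‖ ^ (-q - 1) * ‖e‖ :=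
    ((fderiv ℝ k _).le_opNorm e).trans (by gcongr)
  have hc := abs_sub_le_of_norm_fderiv_le hφ hD p.1 p.2
  have e1 : ‖p.1 - p.2‖ ^ (-q) = ‖p.1 - p.2‖ ^ (-q - 1) * ‖p.1 - p.2‖ := by
    rw [Real.rpow_sub_one hz.ne', div_mul_cancel₀ _ hz.ne']
  calc |pairVariation k φ e p| ≤ |fderiv ℝ φ p.1 e + fderiv ℝ φ p.2 e| * |k (p.1 - p.2)| +
        |φ p.1 - φ p.2| * |fderiv ℝ k (p.1 - p.2) e| := by
        rw [← abs_mul, ← abs_mul]; exact abs_add_le _ _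
    _ ≤ (D * ‖e‖ + D * ‖e‖) * (C₁ * ‖p.1 - p.2‖ ^ (-q)) +
        D * ‖p.1 - p.2‖ * (C₂ * ‖p.1 - p.2‖ ^ (-q - 1) * ‖e‖) := by
        gcongr
        exact (abs_add_le _ _).trans (add_le_add (ha _) (ha _))
    _ = _ := by rw [e1]; ring

theorem IsSmoothKernel.norm_fderiv_le {s lam : ℝ} {rad : ℝ≥0∞} {K : Eucl n → ℝ}
    (hK : IsSmoothKernel 2 n s lam rad K) {z : Eucl n} (hz : z ≠ 0) :
    ‖fderiv ℝ K z‖ ≤ lam * ‖z‖ ^ (-((n : ℝ) + s) - 1) := by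
  have := hK.deriv_le 1 le_rfl (by norm_num) z hz
  rw [norm_iteratedFDeriv_one] at this
  rwa [show -((n : ℝ) + s) - 1 = -((n : ℝ) + s + (1 : ℕ)) by push_cast; ring,
    Real.rpow_neg (norm_nonneg _), ← div_eq_mul_inv]

/-- First variation of the interaction energy along shifts. The difference `φ x - φ y` in
`pairVariation` compensates for the stronger singularity of the gradient of `K`. -/
theorem hasDerivAt_interaction [NeZero n] {s lam : ℝ} {rad : ℝ≥0∞} {K : Eucl n → ℝ} (hs : 0 < s)
    (hK : IsSmoothKernel 2 n s lam rad K) (hlam : 0 < lam) (hrad : 0 < rad)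
    {Ω E : Set (Eucl n)} (hΩ : MeasurableSet Ω) (hb : Bornology.IsBounded Ω)
    (hE : MeasurableSet E) (hEΩ : E ⊆ Ω) (hfin : interaction K E (Eᶜ ∩ Ω) < ∞)
    {φ : Eucl n → ℝ} (hφ : ContDiff ℝ (⊤ : ℕ∞) φ) (hc : HasCompactSupport φ)
    (hφΩ : tsupport φ ⊆ Ω) (e : Eucl n) :
    HasDerivAt (fun t => (interaction K (shift φ e t '' E) ((shift φ e t '' E)ᶜ ∩ Ω)).toReal)
      (∫ p, pairVariation K φ e p ∂(pairMeasure Ω E)) 0 := by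
  have hKs := hK.isSingularKernel
  obtain ⟨D, hD0, -, hD⟩ := exists_fderiv_bound hφ hc
  have hφd : Differentiable ℝ φ := hφ.differentiable (by simp)
  have hint := integrable_pair_rpow hs hK hlam hrad hΩ hb hE hEΩ hfin
  have hae := ae_pairMeasure hE hΩ
  set q := (n : ℝ) + s with hq
  have hq0 : 0 ≤ q := by positivity
  set δ := 1 / (2 * (D * ‖e‖ + 1)) with hδ
  have hDe : 0 < D * ‖e‖ + 1 := by positivity
  have hδ0 : 0 < δ := by positivity
  have hδ1 : ∀ t ∈ ball (0 : ℝ) δ, |t| * (D * ‖e‖) ≤ 1 / 2 := by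
    intro t ht
    rw [mem_ball_zero_iff, Real.norm_eq_abs] at ht
    have h1 := ht.le
    rw [hδ, le_div_iff₀ (by positivity)] at h1
    nlinarith [abs_nonneg t]
  set F : ℝ → Eucl n × Eucl n → ℝ := fun t p => (1 + t * fderiv ℝ φ p.1 e) *
    ((1 + t * fderiv ℝ φ p.2 e) * K (shift φ e t p.1 - shift φ e t p.2))
  set F' : ℝ → Eucl n × Eucl n → ℝ := fun t p =>
    fderiv ℝ φ p.1 e * ((1 + t * fderiv ℝ φ p.2 e) * K (shift φ e t p.1 - shift φ e t p.2)) +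
    (1 + t * fderiv ℝ φ p.1 e) * (fderiv ℝ φ p.2 e * K (shift φ e t p.1 - shift φ e t p.2) +
      (1 + t * fderiv ℝ φ p.2 e) *
        fderiv ℝ K (shift φ e t p.1 - shift φ e t p.2) ((φ p.1 - φ p.2) • e))
  have hdφ : Measurable fun x => fderiv ℝ φ x e := measurable_fderiv_apply_const ℝ φ e
  have hsm : ∀ t, Measurable (shift φ e t) := fun t =>
    (continuous_id.add ((continuous_const.mul hφ.continuous).smul continuous_const)).measurable
  have hsub : ∀ t, Measurable fun p : Eucl n × Eucl n => shift φ e t p.1 - shift φ e t p.2 :=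
    fun t => ((hsm t).comp measurable_fst).sub ((hsm t).comp measurable_snd)
  have hFm : ∀ t, Measurable (F t) := fun t =>
    ((measurable_const.add (measurable_const.mul (hdφ.comp measurable_fst))).mul
      ((measurable_const.add (measurable_const.mul (hdφ.comp measurable_snd))).mul
        (hKs.measurable.comp (hsub t))))
  have hF0 : ∀ t ∈ ball (0 : ℝ) δ, ∀ x, 0 ≤ 1 + t * fderiv ℝ φ x e ∧
      |1 + t * fderiv ℝ φ x e| ≤ 3 / 2 := by
    intro t ht x
    have := abs_le.1 (abs_mul_fderiv_le hD (hδ1 t ht) x)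
    refine ⟨by linarith, ?_⟩
    rw [abs_le]
    constructor <;> linarith [this.1, this.2]
  have hne : ∀ t ∈ ball (0 : ℝ) δ, ∀ p : Eucl n × Eucl n, p.1 - p.2 ≠ 0 →
      shift φ e t p.1 - shift φ e t p.2 ≠ 0 := by
    intro t ht p hp h
    rw [sub_eq_zero] at h
    exact hp (sub_eq_zero.2 (shift_injective hφd hD (hδ1 t ht) h))
  -- Change of variables in both arguments.
  have hI : ∀ t ∈ ball (0 : ℝ) δ,
      (interaction K (shift φ e t '' E) ((shift φ e t '' E)ᶜ ∩ Ω)).toReal =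
        ∫ p, F t p ∂(pairMeasure Ω E) := by
    intro t ht
    have hinj := shift_injective hφd hD (hδ1 t ht)
    have hsurj : Function.Surjective (shift φ e t) := by
      obtain ⟨h, -, -, hr⟩ := exists_shift_inverse hφ hD (hδ1 t ht)
      exact hr.surjective
    have himg : (shift φ e t '' E)ᶜ ∩ Ω = shift φ e t '' (Eᶜ ∩ Ω) := by
      rw [image_inter hinj, image_compl_eq ⟨hinj, hsurj⟩,
        shift_image_of_tsupport_subset hφ hD (hδ1 t ht) hφΩ]
    have h1 : interaction K (shift φ e t '' E) ((shift φ e t '' E)ᶜ ∩ Ω) =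
        ∫⁻ p, ENNReal.ofReal (F t p) ∂(pairMeasure Ω E) := by
      rw [himg, interaction, lintegral_shift_image hφd hD (hδ1 t ht) hE, pairMeasure,
        lintegral_prod _ (hFm t).ennreal_ofReal.aemeasurable]
      refine lintegral_congr fun x => ?_
      rw [lintegral_shift_image hφd hD (hδ1 t ht) (hE.compl.inter hΩ),
        ← lintegral_const_mul' _ _ ENNReal.ofReal_ne_top]
      refine lintegral_congr fun y => ?_
      simp only [F]
      rw [ENNReal.ofReal_mul (hF0 t ht x).1, ENNReal.ofReal_mul (hF0 t ht y).1]
    rw [h1, integral_eq_lintegral_of_nonneg_ae _ (hFm t).aestronglyMeasurable]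
    filter_upwards [hae] with p hp
    exact mul_nonneg (hF0 t ht _).1 (mul_nonneg (hF0 t ht _).1 (hK.nonneg _ (hne t ht p hp.2.2)))
  have hF'0 : F' 0 = pairVariation K φ e := by
    funext p
    simp only [F', pairVariation, shift, zero_mul, zero_smul, add_zero, one_mul, map_smul,
      smul_eq_mul]
    ring
  -- Shifts are bi-Lipschitz, so the singularity of the kernel is preserved up to a constant; this
  -- makes `|x - y|^{-n-s}`, integrable by finiteness of the energy, a dominating function.
  have hpow : ∀ t ∈ ball (0 : ℝ) δ, ∀ p : Eucl n × Eucl n, p.1 - p.2 ≠ 0 → ∀ a : ℝ, 0 ≤ a →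
      ‖shift φ e t p.1 - shift φ e t p.2‖ ^ (-a) ≤ 2 ^ a * ‖p.1 - p.2‖ ^ (-a) := by
    intro t ht p hp a ha
    have hz : 0 < ‖p.1 - p.2‖ := norm_pos_iff.2 hp
    have h1 := half_norm_le_norm_shift_sub hφd hD (hδ1 t ht) p.1 p.2
    have h2 : ‖shift φ e t p.1 - shift φ e t p.2‖ ^ (-a) ≤ (‖p.1 - p.2‖ / 2) ^ (-a) :=
      Real.rpow_le_rpow_of_nonpos (by positivity) h1 (by linarith)
    refine h2.trans (le_of_eq ?_)
    rw [Real.div_rpow hz.le (by norm_num), Real.rpow_neg (by norm_num : (0 : ℝ) ≤ 2),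
      div_inv_eq_mul, mul_comm]
  have hmain := hasDerivAt_integral_of_dominated_loc_of_deriv_le (𝕜 := ℝ) (x₀ := (0 : ℝ))
    (μ := pairMeasure Ω E) (F := F) (F' := F')
    (bound := fun p => (D * ‖e‖ * ((3 / 2) * (lam * 2 ^ q)) + (3 / 2) * (D * ‖e‖ * (lam * 2 ^ q) +
      (3 / 2) * (lam * 2 ^ (q + 1) * (D * ‖e‖)))) * ‖p.1 - p.2‖ ^ (-q))
    (ball_mem_nhds 0 hδ0) (Eventually.of_forall fun t => (hFm t).aestronglyMeasurable) ?_ ?_ ?_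
    (hint.const_mul _) ?_
  · rw [hF'0] at hmain
    refine hmain.2.congr_of_eventuallyEq ?_
    filter_upwards [ball_mem_nhds 0 hδ0] with t ht
    exact hI t ht
  · have : F 0 = fun p => K (p.1 - p.2) := by
      funext p
      simp [F, shift]
    rw [this]
    refine Integrable.mono' (hint.const_mul lam) ?_ ?_
    · exact (hKs.measurable.comp (measurable_fst.sub measurable_snd)).aestronglyMeasurable
    · filter_upwards [hae] with p hp using hKs.bound _ hp.2.2
  · rw [hF'0]
    exact (measurable_pairVariation hKs.measurable hφ.continuous.measurable e).aestronglyMeasurable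
  · filter_upwards [hae] with p hp t ht
    have hz : 0 < ‖p.1 - p.2‖ := norm_pos_iff.2 hp.2.2
    have ha : ∀ x, |fderiv ℝ φ x e| ≤ D * ‖e‖ := fun x =>
      ((fderiv ℝ φ x).le_opNorm e).trans (by gcongr; exact hD x)
    have hKb : |K (shift φ e t p.1 - shift φ e t p.2)| ≤ lam * 2 ^ q * ‖p.1 - p.2‖ ^ (-q) := by
      refine (hKs.bound _ (hne t ht p hp.2.2)).trans ?_
      rw [mul_assoc]
      gcongr
      exact hpow t ht p hp.2.2 q hq0
    have hdK : |fderiv ℝ K (shift φ e t p.1 - shift φ e t p.2) ((φ p.1 - φ p.2) • e)| ≤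
        lam * 2 ^ (q + 1) * (D * ‖e‖) * ‖p.1 - p.2‖ ^ (-q) := by
      refine ((fderiv ℝ K _).le_opNorm _).trans ?_
      rw [norm_smul, Real.norm_eq_abs]
      have h1 := hK.norm_fderiv_le (hne t ht p hp.2.2)
      have h2 := hpow t ht p hp.2.2 (q + 1) (by linarith)
      have h3 := abs_sub_le_of_norm_fderiv_le hφd hD p.1 p.2
      have e1 : ‖p.1 - p.2‖ ^ (-q) = ‖p.1 - p.2‖ ^ (-(q + 1)) * ‖p.1 - p.2‖ := by
        rw [show -(q + 1) = -q - 1 by ring, Real.rpow_sub_one hz.ne', div_mul_cancel₀ _ hz.ne']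
      rw [← hq, show -q - 1 = -(q + 1) by ring] at h1
      calc _ ≤ lam * (2 ^ (q + 1) * ‖p.1 - p.2‖ ^ (-(q + 1))) * (D * ‖p.1 - p.2‖ * ‖e‖) := by
            gcongr
            exact h1.trans (by gcongr)
        _ = _ := by rw [e1]; ring
    have hs1 := (hF0 t ht p.1).2
    have hs2 := (hF0 t ht p.2).2
    refine (norm_add_le _ _).trans ?_
    rw [Real.norm_eq_abs, Real.norm_eq_abs, abs_mul, abs_mul, abs_mul]
    calc _ ≤ D * ‖e‖ * ((3 / 2) * (lam * 2 ^ q * ‖p.1 - p.2‖ ^ (-q))) +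
          (3 / 2) * (D * ‖e‖ * (lam * 2 ^ q * ‖p.1 - p.2‖ ^ (-q)) +
          (3 / 2) * (lam * 2 ^ (q + 1) * (D * ‖e‖) * ‖p.1 - p.2‖ ^ (-q))) := by
          gcongr
          · exact ha _
          · refine (abs_add_le _ _).trans ?_
            rw [abs_mul, abs_mul]
            gcongr
            exact ha _
      _ = _ := by ring
  · filter_upwards [hae] with p hp t ht
    have h1 : ∀ x : Eucl n, HasDerivAt (fun t : ℝ => 1 + t * fderiv ℝ φ x e) (fderiv ℝ φ x e) t :=
      fun x => by simpa using ((hasDerivAt_id t).mul_const (fderiv ℝ φ x e)).const_add 1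
    have h2 : ∀ x : Eucl n, HasDerivAt (fun t : ℝ => shift φ e t x) (φ x • e) t := fun x => by
      have := (((hasDerivAt_id t).mul_const (φ x)).smul_const e).const_add x
      simpa [shift] using this
    have h3 : HasFDerivAt K (fderiv ℝ K (shift φ e t p.1 - shift φ e t p.2))
        (shift φ e t p.1 - shift φ e t p.2) :=
      ((hK.contDiffOn.contDiffAt (isOpen_compl_singleton.mem_nhds
        (hne t ht p hp.2.2))).differentiableAt (by norm_num)).hasFDerivAt
    have h4 := h3.comp_hasDerivAt t ((h2 p.1).sub (h2 p.2))
    rw [← sub_smul] at h4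
    exact (h1 p.1).mul ((h1 p.2).mul h4)

/-- The first variation is the limit of the ones of the truncated energies. -/
theorem tendsto_integral_pairVariation {s lam : ℝ} {rad : ℝ≥0∞} {K : Eucl n → ℝ} (hs : 0 < s)
    (hK : IsSmoothKernel 2 n s lam rad K) (hlam : 0 < lam) (hrad : 0 < rad)
    {Ω E : Set (Eucl n)} (hΩ : MeasurableSet Ω) (hb : Bornology.IsBounded Ω)
    (hE : MeasurableSet E) (hEΩ : E ⊆ Ω) (hfin : interaction K E (Eᶜ ∩ Ω) < ∞)
    {φ : Eucl n → ℝ} (hφ : ContDiff ℝ (⊤ : ℕ∞) φ) (hc : HasCompactSupport φ) (e : Eucl n) :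
    Tendsto (fun ε => ∫ p, pairVariation (truncKernel K ε) φ e p ∂(pairMeasure Ω E)) (𝓝[>] 0)
      (𝓝 (∫ p, pairVariation K φ e p ∂(pairMeasure Ω E))) := by
  have hKs := hK.isSingularKernel
  obtain ⟨D, hD0, -, hD⟩ := exists_fderiv_bound hφ hc
  have hφd : Differentiable ℝ φ := hφ.differentiable (by simp)
  have hint := integrable_pair_rpow hs hK hlam hrad hΩ hb hE hEΩ hfin
  have hae := ae_pairMeasure hE hΩ
  obtain ⟨C, hC, hCb⟩ := exists_norm_fderiv_truncKernel_le hK hlam.le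
  refine tendsto_integral_filter_of_dominated_convergence
    (fun p => (2 * lam + C) * (D * ‖e‖) * ‖p.1 - p.2‖ ^ (-((n : ℝ) + s)))
    (Eventually.of_forall fun ε => (measurable_pairVariation (hKs.truncKernel ε).measurable
      hφ.continuous.measurable e).aestronglyMeasurable) ?_ (hint.const_mul _) ?_
  · filter_upwards [self_mem_nhdsWithin] with ε hε
    filter_upwards [hae] with p hp
    exact abs_pairVariation_le hφd hD hp.2.2 ((hKs.truncKernel ε).bound _ hp.2.2)
      (hCb ε hε _ hp.2.2)
  · filter_upwards [hae] with p hp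
    refine tendsto_const_nhds.congr' ?_
    filter_upwards [truncKernel_eventuallyEq K hp.2.2] with ε hε
    simp only [pairVariation]
    rw [hε.eq_of_nhds, hε.fderiv_eq]

/-! ### The weak Euler–Lagrange equation -/

/-- The function `χ_{Eᶜ ∩ Ω} - χ_E`. -/
def phase (Ω E : Set (Eucl n)) (y : Eucl n) : ℝ :=
  (Eᶜ ∩ Ω).indicator 1 y - E.indicator 1 y

theorem phase_of_mem {Ω E : Set (Eucl n)} {y : Eucl n} (h : y ∈ E) : phase Ω E y = -1 := by
  simp [phase, h]

theorem phase_of_notMem {Ω E : Set (Eucl n)} {y : Eucl n} (h : y ∉ E) (hΩ : y ∈ Ω) :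
    phase Ω E y = 1 := by
  simp [phase, h, hΩ]

theorem phase_of_notMem_domain {Ω E : Set (Eucl n)} {y : Eucl n} (h : y ∉ E) (hΩ : y ∉ Ω) :
    phase Ω E y = 0 := by
  simp [phase, h, hΩ]

theorem abs_phase_le (Ω E : Set (Eucl n)) (y : Eucl n) : |phase Ω E y| ≤ 1 := by
  by_cases h : y ∈ E
  · simp [phase_of_mem h]
  · by_cases hΩ : y ∈ Ω
    · simp [phase_of_notMem h hΩ]
    · simp [phase_of_notMem_domain h hΩ]

theorem measurable_phase {Ω E : Set (Eucl n)} (hΩ : MeasurableSet Ω) (hE : MeasurableSet E) :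
    Measurable (phase Ω E) :=
  (measurable_one.indicator (hE.compl.inter hΩ)).sub (measurable_one.indicator hE)

theorem integral_mul_phase {Ω E : Set (Eucl n)} (hΩ : MeasurableSet Ω) (hE : MeasurableSet E)
    {f : Eucl n → ℝ} (h1 : IntegrableOn f (Eᶜ ∩ Ω)) (h2 : IntegrableOn f E) :
    ∫ y, f y * phase Ω E y = (∫ y in Eᶜ ∩ Ω, f y) - ∫ y in E, f y := by
  rw [← integral_indicator (hE.compl.inter hΩ), ← integral_indicator hE,
    ← integral_sub (h1.integrable_indicator (hE.compl.inter hΩ)) (h2.integrable_indicator hE)]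
  refine integral_congr_ae (Eventually.of_forall fun y => ?_)
  by_cases hy : y ∈ E <;> by_cases hy' : y ∈ Ω <;> simp [phase, hy, hy']

/-- The curvature of `E` computed with the truncated kernel. -/
def truncCurvature (K : Eucl n → ℝ) (Ω E : Set (Eucl n)) (ε : ℝ) (x : Eucl n) : ℝ :=
  ∫ y, truncKernel K ε (x - y) * phase Ω E y

theorem fderiv_neg_of_even {k : Eucl n → ℝ} (hk : ContDiff ℝ 1 k) (he : ∀ z, k (-z) = k z)
    (z e : Eucl n) : fderiv ℝ k (-z) e = -fderiv ℝ k z e := by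
  have h1 : HasFDerivAt k (fderiv ℝ k (-z)) (-z) := (hk.differentiable (by norm_num) _).hasFDerivAt
  have h2 := h1.comp z (hasFDerivAt_id z).neg
  have h3 : k ∘ Neg.neg = k := funext he
  rw [h3] at h2
  rw [h2.fderiv]
  simp

/-- For a regular kernel the first variation of the interaction energy is the integral over `E` of
`∂ₑ(φ H)`, where `H x = ∫ k(x-y) phase(y) dy` is the curvature of `E`: the double integral of a
derivative over `Ω × E` vanishes, so one over `Eᶜ ∩ Ω` can be traded for one over `E`. -/
theorem integral_pairVariation_eq {k φ : Eucl n → ℝ} {C p : ℝ} (hp : (n : ℝ) < p)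
    (hk : ContDiff ℝ 1 k) (hke : ∀ z, k (-z) = k z)
    (hb : ∀ z, |k z| ≤ C * (1 + ‖z‖) ^ (-p) ∧ ‖fderiv ℝ k z‖ ≤ C * (1 + ‖z‖) ^ (-p))
    {Ω E : Set (Eucl n)} (hΩ : MeasurableSet Ω) (hbd : Bornology.IsBounded Ω)
    (hE : MeasurableSet E) (hEΩ : E ⊆ Ω) (hφ : ContDiff ℝ (⊤ : ℕ∞) φ) (hc : HasCompactSupport φ)
    (hφΩ : tsupport φ ⊆ Ω) (e : Eucl n) :
    IntegrableOn (fun x => fderiv ℝ φ x e * (∫ y, k (x - y) * phase Ω E y) +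
      φ x * fderiv ℝ (fun x => ∫ y, k (x - y) * phase Ω E y) x e) E ∧
    ∫ p, pairVariation k φ e p ∂(pairMeasure Ω E) =
      ∫ x in E, (fderiv ℝ φ x e * (∫ y, k (x - y) * phase Ω E y) +
        φ x * fderiv ℝ (fun x => ∫ y, k (x - y) * phase Ω E y) x e) := by
  obtain ⟨D, hD0, hφD, hD⟩ := exists_fderiv_bound hφ hc
  have hp0 : 0 ≤ p := (Nat.cast_nonneg n).trans hp.le
  have hC : 0 ≤ C := by
    have h := (abs_nonneg _).trans (hb 0).1
    simpa using h
  have hfd : Continuous (fderiv ℝ k) := hk.continuous_fderiv (by norm_num)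
  have hdφ : Continuous fun x => fderiv ℝ φ x e :=
    (hφ.continuous_fderiv (by simp)).clm_apply continuous_const
  have hle : ∀ z : Eucl n, C * (1 + ‖z‖) ^ (-p) ≤ C := fun z => mul_le_of_le_one_right hC
    (Real.rpow_le_one_of_one_le_of_nonpos (by linarith [norm_nonneg z]) (by linarith))
  set A := Eᶜ ∩ Ω with hA
  have hAm : MeasurableSet A := hE.compl.inter hΩ
  -- `P` is the half of the integrand that differentiates in the first variable; by evenness of
  -- `k` the other half is `P` with the variables swapped.
  set P : Eucl n × Eucl n → ℝ := fun q => fderiv ℝ φ q.1 e * k (q.1 - q.2) +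
    φ q.1 * fderiv ℝ k (q.1 - q.2) e with hP
  have hPc : Continuous P := by
    refine ((hdφ.comp continuous_fst).mul
      (hk.continuous.comp (continuous_fst.sub continuous_snd))).add
      ((hφ.continuous.comp continuous_fst).mul ?_)
    exact (hfd.comp (continuous_fst.sub continuous_snd)).clm_apply continuous_const
  set M := D * ‖e‖ * C + D * (C * ‖e‖)
  have hPb : ∀ q, ‖P q‖ ≤ M := by
    intro q
    refine (norm_add_le _ _).trans ?_
    rw [norm_mul, norm_mul]
    have h1 : ‖fderiv ℝ φ q.1 e‖ ≤ D * ‖e‖ :=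
      ((fderiv ℝ φ q.1).le_opNorm e).trans (by gcongr; exact hD _)
    have h2 : ‖fderiv ℝ k (q.1 - q.2) e‖ ≤ C * ‖e‖ :=
      ((fderiv ℝ k _).le_opNorm e).trans (by gcongr; exact (hb _).2.trans (hle _))
    exact add_le_add
      (mul_le_mul h1 ((hb _).1.trans (hle _)) (norm_nonneg _) (by positivity))
      (mul_le_mul (hφD _) h2 (norm_nonneg _) hD0.le)
  have hEf : volume E < ∞ := (hbd.subset hEΩ).measure_lt_top
  have hAf : volume A < ∞ := (hbd.subset inter_subset_right).measure_lt_top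
  have : IsFiniteMeasure (volume.restrict E) := ⟨by rwa [Measure.restrict_apply_univ]⟩
  have : IsFiniteMeasure (volume.restrict A) := ⟨by rwa [Measure.restrict_apply_univ]⟩
  have hPi : ∀ μ : Measure (Eucl n × Eucl n), IsFiniteMeasure μ → Integrable P μ := fun μ _ =>
    Integrable.of_bound hPc.aestronglyMeasurable M (Eventually.of_forall hPb)
  have hPi' : ∀ μ : Measure (Eucl n × Eucl n), IsFiniteMeasure μ →
      Integrable (fun q => P q.swap) μ := fun μ _ =>
    Integrable.of_bound (hPc.comp continuous_swap).aestronglyMeasurable M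
      (Eventually.of_forall fun q => hPb q.swap)
  have hsec : ∀ (B : Set (Eucl n)), volume B < ∞ → ∀ x, IntegrableOn (fun y => P (x, y)) B ∧
      IntegrableOn (fun y => P (y, x)) B := by
    intro B hB x
    have : IsFiniteMeasure (volume.restrict B) := ⟨by rwa [Measure.restrict_apply_univ]⟩
    exact ⟨Integrable.of_bound (hPc.comp (by fun_prop)).aestronglyMeasurable M
      (Eventually.of_forall fun y => hPb (x, y)),
      Integrable.of_bound (hPc.comp (by fun_prop)).aestronglyMeasurable M
      (Eventually.of_forall fun y => hPb (y, x))⟩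
  have hpv : pairVariation k φ e = fun q => P q + P q.swap := by
    funext q
    have h1 : q.2 - q.1 = -(q.1 - q.2) := by abel
    simp only [hP, pairVariation, Prod.fst_swap, Prod.snd_swap, h1, hke,
      fderiv_neg_of_even hk hke]
    ring
  -- the integral of a directional derivative of a compactly supported function vanishes
  have hzero : ∀ x, ∫ y, P (y, x) = 0 := by
    intro x
    have hks : ContDiff ℝ 1 fun y => k (y - x) := hk.comp (contDiff_id.sub contDiff_const)
    have hfs : ∀ y, fderiv ℝ (fun y => k (y - x)) y = fderiv ℝ k (y - x) := fun y =>
      fderiv_comp_sub x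
    have hdφc : HasCompactSupport fun x => fderiv ℝ φ x e := hc.fderiv_apply ℝ e
    have hfx : Continuous fun y => fderiv ℝ k (y - x) e :=
      (hfd.comp (continuous_id.sub continuous_const)).clm_apply continuous_const
    have i1 : Integrable fun y => fderiv ℝ k (y - x) e * φ y :=
      (hfx.mul hφ.continuous).integrable_of_hasCompactSupport hc.mul_left
    have i2 : Integrable fun y => k (y - x) * fderiv ℝ φ y e :=
      (hks.continuous.mul hdφ).integrable_of_hasCompactSupport hdφc.mul_left
    have i3 : Integrable fun y => k (y - x) * φ y :=
      (hks.continuous.mul hφ.continuous).integrable_of_hasCompactSupport hc.mul_left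
    have hparts := integral_mul_fderiv_eq_neg_fderiv_mul_of_integrable (𝕜 := ℝ) (μ := volume)
      (f := fun y => k (y - x)) (g := φ) (v := e) (by simpa only [hfs] using i1) i2 i3
      (fun y _ => hks.differentiable (by norm_num) y) (fun y _ => hφ.differentiable (by simp) y)
    simp only [hfs] at hparts
    have : ∀ y, P (y, x) = k (y - x) * fderiv ℝ φ y e + fderiv ℝ k (y - x) e * φ y := by
      intro y; simp only [hP]; ring
    simp only [this]
    rw [integral_add i2 i1, hparts]; ring
  -- The integral over `Ω` vanishes, so that over `A` is minus the one over `E`.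
  have hsplit : ∀ x, ∫ y in A, P (y, x) = -∫ y in E, P (y, x) := by
    intro x
    have h1 : ∫ y in Ω, P (y, x) = 0 := by
      rw [← hzero x]
      refine setIntegral_eq_integral_of_forall_compl_eq_zero fun y hy => ?_
      have hy' : y ∉ tsupport φ := fun h => hy (hφΩ h)
      simp only [hP, image_eq_zero_of_notMem_tsupport hy', fderiv_of_notMem_tsupport ℝ hy',
        _root_.zero_apply, zero_mul, add_zero]
    have h2 : Ω = A ∪ E := by
      ext y
      by_cases hy : y ∈ E
      · simp [hA, hy, hEΩ hy]
      · simp [hA, hy]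
    have h3 : Disjoint A E := Set.disjoint_left.2 fun y hy hy' => hy.1 hy'
    rw [h2, setIntegral_union h3 hE (hsec A hAf x).2 (hsec E hEf x).2] at h1
    linarith
  have hμ : pairMeasure Ω E = (volume.restrict E).prod (volume.restrict A) := rfl
  have hfin : IsFiniteMeasure (pairMeasure Ω E) := isFiniteMeasure_pairMeasure hbd hEΩ
  have e1 : ∫ q, P q ∂(pairMeasure Ω E) = ∫ x in E, ∫ y in A, P (x, y) := by
    rw [hμ]; exact integral_prod _ (hPi _ (hμ ▸ hfin))
  have e2 : ∫ q, P q.swap ∂(pairMeasure Ω E) = -∫ x in E, ∫ y in E, P (x, y) := by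
    have h1 : ∫ q, P q.swap ∂(pairMeasure Ω E) = ∫ x in E, ∫ y in A, P (y, x) := by
      rw [hμ]; exact integral_prod _ (hPi' _ (hμ ▸ hfin))
    rw [h1]
    simp only [hsplit]
    rw [integral_neg]
    congr 1
    exact integral_integral_swap (f := fun x y => P (y, x)) (hPi' _ inferInstance)
  have hcurv := contDiff_integral_kernel hp hk hb (measurable_phase hΩ hE) (abs_phase_le Ω E)
  have hik : ∀ x, Integrable fun y : Eucl n => C * (1 + ‖x - y‖) ^ (-p) := fun x =>
    ((integrable_one_add_norm (by simpa using hp)).comp_sub_left x).const_mul C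
  have hpm : AEStronglyMeasurable (phase Ω E) volume :=
    (measurable_phase hΩ hE).aestronglyMeasurable
  have i1 : ∀ x, Integrable fun y => k (x - y) * phase Ω E y := fun x => by
    refine (hik x).mono' ((hk.continuous.comp
      (continuous_const.sub continuous_id)).aestronglyMeasurable.mul hpm)
      (Eventually.of_forall fun y => ?_)
    rw [Real.norm_eq_abs, abs_mul]
    exact (mul_le_of_le_one_right (abs_nonneg _) (abs_phase_le Ω E y)).trans (hb _).1
  have i2 : ∀ x, Integrable fun y => phase Ω E y • fderiv ℝ k (x - y) := fun x => by
    refine (hik x).mono' (hpm.smul (hfd.comp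
      (continuous_const.sub continuous_id)).aestronglyMeasurable)
      (Eventually.of_forall fun y => ?_)
    rw [norm_smul]
    exact (mul_le_of_le_one_left (norm_nonneg _) (abs_phase_le Ω E y)).trans (hb _).2
  have e3 : ∀ x, fderiv ℝ φ x e * (∫ y, k (x - y) * phase Ω E y) +
      φ x * fderiv ℝ (fun x => ∫ y, k (x - y) * phase Ω E y) x e =
        (∫ y in A, P (x, y)) - ∫ y in E, P (x, y) := by
    intro x
    rw [(hcurv.2 x).fderiv, ContinuousLinearMap.integral_apply (i2 x),
      ← integral_mul_phase hΩ hE (hsec A hAf x).1 (hsec E hEf x).1, ← integral_const_mul,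
      ← integral_const_mul, ← integral_add ((i1 x).const_mul _)]
    · refine integral_congr_ae (Eventually.of_forall fun y => ?_)
      simp only [hP, _root_.smul_apply, smul_eq_mul]
      ring
    · exact ((i2 x).apply_continuousLinearMap e).const_mul _
  have j1 : IntegrableOn (fun x => ∫ y in A, P (x, y)) E :=
    (hPi ((volume.restrict E).prod (volume.restrict A)) inferInstance).integral_prod_left
  have j2 : IntegrableOn (fun x => ∫ y in E, P (x, y)) E :=
    (hPi ((volume.restrict E).prod (volume.restrict E)) inferInstance).integral_prod_left
  simp only [e3]
  refine ⟨j1.sub j2, ?_⟩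
  rw [hpv, integral_add (hPi _ hfin) (hPi' _ hfin), e1, e2, integral_sub j1 j2]
  ring

/-! ### The multiplier of a volume-constrained critical set -/

/-- The standing assumptions: admissible kernels, a smooth domain and a volume-constrained critical
set. -/
structure IsCapillarityProblem (s₁ s₂ lam : ℝ) (rad : ℝ≥0∞) (σ : ℝ) (K₁ K₂ g : Eucl n → ℝ)
    (Ω E : Set (Eucl n)) : Prop where
  s₁_mem : s₁ ∈ Ioo (0 : ℝ) 1
  s₂_mem : s₂ ∈ Ioo (0 : ℝ) 1
  lam_pos : 0 < lam
  rad_pos : 0 < rad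
  kernel₁ : IsSmoothKernel 2 n s₁ lam rad K₁
  kernel₂ : IsSmoothKernel 2 n s₂ lam rad K₂
  contDiff : ContDiff ℝ 1 g
  isOpen : IsOpen Ω
  bounded : Bornology.IsBounded Ω
  boundary : HasC1Boundary Ω
  critical : IsCriticalSet Ω K₁ K₂ σ g E

/-- The potential `σ ∫_{Ωᶜ} K₂(x-y) dy + g(x)` of the adhesion and gravity terms. -/
def outerPotential (σ : ℝ) (K₂ g : Eucl n → ℝ) (Ω : Set (Eucl n)) (x : Eucl n) : ℝ :=
  σ * wallPotential K₂ Ω x + g x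

/-- First variation of the capillarity energy along `x ↦ x + t φ(x) e`. -/
def firstVariation (K₁ Φ : Eucl n → ℝ) (Ω E : Set (Eucl n)) (e : Eucl n) (φ : Eucl n → ℝ) : ℝ :=
  (∫ p, pairVariation K₁ φ e p ∂(pairMeasure Ω E)) +
    ∫ x in E, (fderiv ℝ φ x e * Φ x + φ x * fderiv ℝ Φ x e)

section

variable {s₁ s₂ lam : ℝ} {rad : ℝ≥0∞} {σ : ℝ} {K₁ K₂ g : Eucl n → ℝ} {Ω E : Set (Eucl n)}

theorem IsCapillarityProblem.volume_lt_top
    (h : IsCapillarityProblem s₁ s₂ lam rad σ K₁ K₂ g Ω E) : volume E < ∞ :=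
  (h.bounded.subset h.critical.subset).measure_lt_top

theorem IsCapillarityProblem.contDiffOn_outerPotential
    (h : IsCapillarityProblem s₁ s₂ lam rad σ K₁ K₂ g Ω E) :
    ContDiffOn ℝ 1 (outerPotential σ K₂ g Ω) Ω :=
  (contDiffOn_const.mul (contDiffOn_wallPotential h.s₂_mem.1 h.kernel₂ h.lam_pos.le h.isOpen)).add
    h.contDiff.contDiffOn

theorem IsCapillarityProblem.integrableOn_g
    (h : IsCapillarityProblem s₁ s₂ lam rad σ K₁ K₂ g Ω E) : IntegrableOn g Ω :=
  (h.contDiff.continuous.continuousOn.integrableOn_compact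
    h.bounded.isCompact_closure).mono_set subset_closure

theorem IsCapillarityProblem.integrableOn_outerPotential [NeZero n]
    (h : IsCapillarityProblem s₁ s₂ lam rad σ K₁ K₂ g Ω E) :
    IntegrableOn (outerPotential σ K₂ g Ω) Ω :=
  ((integrableOn_wallPotential h.s₂_mem h.kernel₂ h.lam_pos.le h.isOpen h.bounded
    h.boundary).const_mul σ).add h.integrableOn_g

theorem IsCapillarityProblem.hasDerivAt_capillarity [NeZero n]
    (h : IsCapillarityProblem s₁ s₂ lam rad σ K₁ K₂ g Ω E) {φ : Eucl n → ℝ}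
    (hφ : ContDiff ℝ (⊤ : ℕ∞) φ) (hc : HasCompactSupport φ) (hφΩ : tsupport φ ⊆ Ω) (e : Eucl n) :
    HasDerivAt (fun t => capillarity Ω K₁ K₂ σ g (shift φ e t '' E))
      (firstVariation K₁ (outerPotential σ K₂ g Ω) Ω E e φ) 0 := by
  have hI := hasDerivAt_interaction h.s₁_mem.1 h.kernel₁ h.lam_pos h.rad_pos h.isOpen.measurableSet
    h.bounded h.critical.measurableSet h.critical.subset h.critical.finite hφ hc hφΩ e
  have hP := (hasDerivAt_integral_shift_image h.isOpen h.critical.measurableSet h.critical.subset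
    h.volume_lt_top.ne h.contDiffOn_outerPotential
    (h.integrableOn_outerPotential.mono_set h.critical.subset) hφ hc hφΩ e).2
  refine (hI.add hP).congr_of_eventuallyEq ?_
  obtain ⟨D, hD0, hφD, hD⟩ := exists_fderiv_bound hφ hc
  have hsmall : ∀ᶠ t : ℝ in 𝓝 0, |t| * (D * ‖e‖) ≤ 1 / 2 := by
    have : Tendsto (fun t : ℝ => |t| * (D * ‖e‖)) (𝓝 0) (𝓝 0) := by
      have h0 : Continuous fun t : ℝ => |t| * (D * ‖e‖) := by fun_prop
      simpa using h0.tendsto 0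
    filter_upwards [this.eventually (gt_mem_nhds (show (0 : ℝ) < 1 / 2 by norm_num))] with t ht
      using ht.le
  filter_upwards [hsmall] with t ht
  have hφd : Differentiable ℝ φ := hφ.differentiable (by simp)
  have hm : MeasurableSet (shift φ e t '' E) := by
    refine h.critical.measurableSet.image_of_continuousOn_injOn ?_
      (shift_injective hφd hD ht).injOn
    have : Continuous (shift φ e t) := continuous_id.add
      ((continuous_const.mul hφ.continuous).smul continuous_const)
    exact this.continuousOn
  have hsub : shift φ e t '' E ⊆ Ω := by
    rw [← shift_image_of_tsupport_subset hφ hD ht hφΩ]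
    exact image_mono h.critical.subset
  simp only [capillarity, outerPotential, Pi.add_apply]
  rw [(toReal_interaction_wall h.s₂_mem.1 h.kernel₂ h.lam_pos.le h.isOpen hm hsub).1,
    integral_add (((integrableOn_wallPotential h.s₂_mem h.kernel₂ h.lam_pos.le h.isOpen h.bounded
    h.boundary).mono_set hsub).const_mul σ) (h.integrableOn_g.mono_set hsub), integral_const_mul]
  ring

theorem IsCapillarityProblem.integrable_pairVariation [NeZero n]
    (h : IsCapillarityProblem s₁ s₂ lam rad σ K₁ K₂ g Ω E) {φ : Eucl n → ℝ}
    (hφ : ContDiff ℝ (⊤ : ℕ∞) φ) (hc : HasCompactSupport φ) (e : Eucl n) :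
    Integrable (pairVariation K₁ φ e) (pairMeasure Ω E) := by
  obtain ⟨D, hD0, -, hD⟩ := exists_fderiv_bound hφ hc
  have hK := h.kernel₁.isSingularKernel
  refine ((integrable_pair_rpow h.s₁_mem.1 h.kernel₁ h.lam_pos h.rad_pos h.isOpen.measurableSet
    h.bounded h.critical.measurableSet h.critical.subset h.critical.finite).const_mul
    ((2 * lam + lam) * (D * ‖e‖))).mono' (measurable_pairVariation hK.measurable
      hφ.continuous.measurable e).aestronglyMeasurable ?_
  filter_upwards [ae_pairMeasure h.critical.measurableSet h.isOpen.measurableSet] with p hp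
  exact abs_pairVariation_le (hφ.differentiable (by simp)) hD hp.2.2 (hK.bound _ hp.2.2)
    (h.kernel₁.norm_fderiv_le hp.2.2)

/-- The volume constraint produces a Lagrange multiplier. -/
theorem IsCapillarityProblem.exists_multiplier [NeZero n]
    (h : IsCapillarityProblem s₁ s₂ lam rad σ K₁ K₂ g Ω E) (e : Eucl n) : ∃ c : ℝ,
    ∀ φ : Eucl n → ℝ, ContDiff ℝ (⊤ : ℕ∞) φ → HasCompactSupport φ → tsupport φ ⊆ Ω →
      firstVariation K₁ (outerPotential σ K₂ g Ω) Ω E e φ = c * ∫ x in E, fderiv ℝ φ x e := by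
  set Φ := outerPotential σ K₂ g Ω with hΦ
  have hcrit : ∀ φ : Eucl n → ℝ, ContDiff ℝ (⊤ : ℕ∞) φ → HasCompactSupport φ → tsupport φ ⊆ Ω →
      ∫ x in E, fderiv ℝ φ x e = 0 → firstVariation K₁ Φ Ω E e φ = 0 := by
    intro φ hφ hc hφΩ h0
    obtain ⟨D, hD0, -, hD⟩ := exists_fderiv_bound hφ hc
    have hδ : (0 : ℝ) < (2 * (D * ‖e‖ + 1))⁻¹ := by positivity
    have hvar := isVariation_shift h.critical.measurableSet h.volume_lt_top.ne hφ hc hφΩ h0 hD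
      (δ := (2 * (D * ‖e‖ + 1))⁻¹) (by
        rw [inv_mul_le_iff₀ (by positivity)]; nlinarith [norm_nonneg e])
    exact (h.hasDerivAt_capillarity hφ hc hφΩ e).unique (h.critical.critical _ hδ _ hvar)
  by_cases hex : ∃ φ : Eucl n → ℝ, ContDiff ℝ (⊤ : ℕ∞) φ ∧ HasCompactSupport φ ∧ tsupport φ ⊆ Ω ∧
      ∫ x in E, fderiv ℝ φ x e ≠ 0
  · obtain ⟨ψ, hψ, hψc, hψΩ, hψ0⟩ := hex
    -- Subtracting the right multiple of `ψ` from `φ` produces an admissible variation.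
    refine ⟨firstVariation K₁ Φ Ω E e ψ / ∫ x in E, fderiv ℝ ψ x e, fun φ hφ hc hφΩ => ?_⟩
    set a := (∫ x in E, fderiv ℝ φ x e) / ∫ x in E, fderiv ℝ ψ x e with ha
    have hdφ : Differentiable ℝ φ := hφ.differentiable (by simp)
    have hdψ : Differentiable ℝ ψ := hψ.differentiable (by simp)
    have hcomb : ∀ x v, fderiv ℝ (fun x => φ x - a * ψ x) x v =
        fderiv ℝ φ x v - a * fderiv ℝ ψ x v := by
      intro x v
      have h1 := (hdφ x).hasFDerivAt.sub ((hdψ x).hasFDerivAt.const_mul a)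
      have h2 : HasFDerivAt (fun x => φ x - a * ψ x) _ x := h1
      rw [h2.fderiv]
      simp
    have hi : ∀ φ : Eucl n → ℝ, ContDiff ℝ (⊤ : ℕ∞) φ → HasCompactSupport φ →
        IntegrableOn (fun x => fderiv ℝ φ x e) E := fun φ hφ hc =>
      (((hφ.continuous_fderiv (by simp)).clm_apply
        continuous_const).integrable_of_hasCompactSupport (hc.fderiv_apply ℝ e)).integrableOn
    have hz := hcrit (fun x => φ x - a * ψ x) (hφ.sub (contDiff_const.mul hψ))
      (hc.sub hψc.mul_left) ((tsupport_sub _ _).trans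
        (union_subset hφΩ ((tsupport_mul_subset_right).trans hψΩ))) (by
        simp only [hcomb]
        rw [integral_sub (hi φ hφ hc) ((hi ψ hψ hψc).const_mul a), integral_const_mul, ha,
          div_mul_cancel₀ _ hψ0, sub_self])
    have hpot : ∀ φ : Eucl n → ℝ, ContDiff ℝ (⊤ : ℕ∞) φ → HasCompactSupport φ → tsupport φ ⊆ Ω →
        IntegrableOn (fun x => fderiv ℝ φ x e * Φ x + φ x * fderiv ℝ Φ x e) E :=
      fun φ hφ hc hφΩ => (hasDerivAt_integral_shift_image h.isOpen h.critical.measurableSet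
        h.critical.subset h.volume_lt_top.ne h.contDiffOn_outerPotential
        (h.integrableOn_outerPotential.mono_set h.critical.subset) hφ hc hφΩ e).1
    have hlin : firstVariation K₁ Φ Ω E e (fun x => φ x - a * ψ x) =
        firstVariation K₁ Φ Ω E e φ - a * firstVariation K₁ Φ Ω E e ψ := by
      have e1 : ∫ p, pairVariation K₁ (fun x => φ x - a * ψ x) e p ∂(pairMeasure Ω E) =
          (∫ p, pairVariation K₁ φ e p ∂(pairMeasure Ω E)) -
            a * ∫ p, pairVariation K₁ ψ e p ∂(pairMeasure Ω E) := by
        rw [← integral_const_mul, ← integral_sub (h.integrable_pairVariation hφ hc e)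
          ((h.integrable_pairVariation hψ hψc e).const_mul a)]
        congr 1
        funext p
        simp only [pairVariation, hcomb]
        ring
      have e2 : ∫ x in E, (fderiv ℝ (fun x => φ x - a * ψ x) x e * Φ x +
          (φ x - a * ψ x) * fderiv ℝ Φ x e) =
          (∫ x in E, (fderiv ℝ φ x e * Φ x + φ x * fderiv ℝ Φ x e)) -
            a * ∫ x in E, (fderiv ℝ ψ x e * Φ x + ψ x * fderiv ℝ Φ x e) := by
        rw [← integral_const_mul, ← integral_sub (hpot φ hφ hc hφΩ)
          ((hpot ψ hψ hψc hψΩ).const_mul a)]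
        congr 1
        funext x
        simp only [hcomb]
        ring
      simp only [firstVariation]
      rw [e1, e2]
      ring
    rw [hlin] at hz
    rw [ha] at hz
    field_simp at hz ⊢
    linarith
  · push Not at hex
    refine ⟨0, fun φ hφ hc hφΩ => ?_⟩
    rw [zero_mul]
    exact hcrit φ hφ hc hφΩ (hex φ hφ hc hφΩ)

/-- The integrand `∂_e (φ · (H_ε + Φ - c))` of the weak Euler–Lagrange equation at truncation
scale `ε`. -/
def weakIntegrand (K₁ Φ : Eucl n → ℝ) (Ω E : Set (Eucl n)) (c : ℝ) (e : Eucl n) (φ : Eucl n → ℝ)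
    (ε : ℝ) (x : Eucl n) : ℝ :=
  fderiv ℝ φ x e * (truncCurvature K₁ Ω E ε x + Φ x - c) +
    φ x * (fderiv ℝ (truncCurvature K₁ Ω E ε) x e + fderiv ℝ Φ x e)

/-- The weak Euler–Lagrange equation, as a limit of equations for the truncated kernels, whose
curvatures are of class `C¹`. -/
theorem IsCapillarityProblem.exists_multiplier_tendsto [NeZero n]
    (h : IsCapillarityProblem s₁ s₂ lam rad σ K₁ K₂ g Ω E) (e : Eucl n) : ∃ c : ℝ,
    ∀ φ : Eucl n → ℝ, ContDiff ℝ (⊤ : ℕ∞) φ → HasCompactSupport φ → tsupport φ ⊆ Ω →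
      Tendsto (fun ε => ∫ x in E, weakIntegrand K₁ (outerPotential σ K₂ g Ω) Ω E c e φ ε x)
        (𝓝[>] 0) (𝓝 0) := by
  obtain ⟨c, hcm⟩ := h.exists_multiplier e
  refine ⟨c, fun φ hφ hc hφΩ => ?_⟩
  have ht := tendsto_integral_pairVariation h.s₁_mem.1 h.kernel₁ h.lam_pos h.rad_pos
    h.isOpen.measurableSet h.bounded h.critical.measurableSet h.critical.subset h.critical.finite
    hφ hc e
  have hpot := (hasDerivAt_integral_shift_image h.isOpen h.critical.measurableSet
    h.critical.subset h.volume_lt_top.ne h.contDiffOn_outerPotential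
    (h.integrableOn_outerPotential.mono_set h.critical.subset) hφ hc hφΩ e).1
  have hi : IntegrableOn (fun x => fderiv ℝ φ x e) E :=
    (((hφ.continuous_fderiv (by simp)).clm_apply
      continuous_const).integrable_of_hasCompactSupport (hc.fderiv_apply ℝ e)).integrableOn
  have hlim := (ht.add_const (∫ x in E, (fderiv ℝ φ x e * outerPotential σ K₂ g Ω x +
    φ x * fderiv ℝ (outerPotential σ K₂ g Ω) x e))).sub_const (c * ∫ x in E, fderiv ℝ φ x e)
  have hz := hcm φ hφ hc hφΩ
  rw [firstVariation] at hz
  rw [hz, sub_self] at hlim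
  refine hlim.congr' ?_
  filter_upwards [self_mem_nhdsWithin] with ε hε
  obtain ⟨C, -, hC⟩ := exists_truncKernel_bound h.s₁_mem.1 h.kernel₁ h.lam_pos.le hε
  obtain ⟨j1, j2⟩ := integral_pairVariation_eq (p := (n : ℝ) + s₁) (by linarith [h.s₁_mem.1])
    (contDiff_truncKernel (h.kernel₁.contDiffOn.of_le (by norm_num)) hε)
    (h.kernel₁.isSingularKernel.truncKernel ε).even hC h.isOpen.measurableSet h.bounded
    h.critical.measurableSet h.critical.subset hφ hc hφΩ e
  rw [j2, ← integral_const_mul, ← integral_add j1 hpot]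
  refine (integral_sub (j1.add hpot) (hi.const_mul c)).symm.trans ?_
  refine integral_congr_ae (Eventually.of_forall fun x => ?_)
  simp only [weakIntegrand, truncCurvature, Pi.add_apply]
  change _ = fderiv ℝ φ x e * (_ + _ - c) +
    φ x * (fderiv ℝ (fun x => ∫ y, truncKernel K₁ ε (x - y) * phase Ω E y) x e + _)
  ring

end

/-! ### From the weak to the pointwise equation -/

theorem hasDerivAt_integral_translate {G : Eucl n → ℝ} (hG : ContDiff ℝ 1 G)
    (hc : HasCompactSupport G) (E : Set (Eucl n)) (v : Eucl n) (t₀ : ℝ) :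
    HasDerivAt (fun t : ℝ => ∫ y in E, G (y + t • v)) (∫ y in E, fderiv ℝ G (y + t₀ • v) v) t₀ := by
  have hfd : Continuous (fderiv ℝ G) := hG.continuous_fderiv (by norm_num)
  obtain ⟨D, hD⟩ := (hc.fderiv ℝ).exists_bound_of_continuous hfd
  obtain ⟨R, hR⟩ := hc.isCompact.isBounded.subset_ball (0 : Eucl n)
  set R' := R + (|t₀| + 1) * ‖v‖ with hR'
  have hint : ∀ t : ℝ, Integrable fun y => G (y + t • v) := fun t =>
    (hG.continuous.integrable_of_hasCompactSupport hc).comp_add_right (t • v)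
  refine (hasDerivAt_integral_of_dominated_loc_of_deriv_le
    (F := fun t y => G (y + t • v)) (F' := fun t y => fderiv ℝ G (y + t • v) v)
    (bound := (ball (0 : Eucl n) R').indicator fun _ => D * ‖v‖)
    (ball_mem_nhds t₀ one_pos)
    (Eventually.of_forall fun t => (hint t).aestronglyMeasurable.restrict)
    (hint t₀).integrableOn ?_ ?_ ?_ ?_).2
  · exact ((hfd.comp (continuous_id.add continuous_const)).clm_apply
      continuous_const).aestronglyMeasurable
  · refine Eventually.of_forall fun y t ht => ?_
    by_cases hy : y ∈ ball (0 : Eucl n) R'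
    · rw [indicator_of_mem hy]
      exact ((fderiv ℝ G _).le_opNorm v).trans (mul_le_mul_of_nonneg_right (hD _) (norm_nonneg _))
    · have : y + t • v ∉ tsupport G := by
        intro hmem
        have h1 := hR hmem
        rw [mem_ball_zero_iff] at h1 hy
        rw [Real.ball_eq_Ioo] at ht
        have h2 : |t| ≤ |t₀| + 1 := by
          have : |t - t₀| < 1 := abs_lt.2 ⟨by linarith [ht.1], by linarith [ht.2]⟩
          have h3 := abs_sub_abs_le_abs_sub t t₀
          linarith
        have h4 : ‖y‖ ≤ ‖y + t • v‖ + |t| * ‖v‖ := by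
          have := norm_sub_le (y + t • v) (t • v)
          rwa [add_sub_cancel_right, norm_smul, Real.norm_eq_abs] at this
        have h5 := mul_le_mul_of_nonneg_right h2 (norm_nonneg v)
        exact hy (by linarith)
      rw [indicator_of_notMem hy, fderiv_of_notMem_tsupport ℝ this]
      simp
  · exact ((integrable_indicator_iff measurableSet_ball).2
      (integrableOn_const measure_ball_lt_top.ne)).integrableOn
  · refine Eventually.of_forall fun y t _ => ?_
    have h1 := (hG.differentiable (by norm_num) (y + t • v)).hasFDerivAt
    have h2 : HasDerivAt (fun t : ℝ => y + t • v) v t := by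
      simpa using ((hasDerivAt_id t).smul_const v).const_add y
    exact h1.comp_hasDerivAt t h2

theorem integral_translate_sub {G : Eucl n → ℝ} (hG : Continuous G) (hc : HasCompactSupport G)
    {E : Set (Eucl n)} (hE : MeasurableSet E) (v : Eucl n) :
    (∫ y in E, G (y + v)) - ∫ y in E, G y =
      ∫ y, (E.indicator 1 (y - v) - E.indicator 1 y) * G y ∧
    Integrable fun y => (E.indicator 1 (y - v) - E.indicator 1 y) * G y := by
  have hi := hG.integrable_of_hasCompactSupport hc (μ := volume)
  have i1 : Integrable fun y => E.indicator (fun _ => (1 : ℝ)) (y - v) * G y := by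
    refine hi.bdd_mul (c := 1) ((measurable_const.indicator hE).comp
      (measurable_id.sub_const v)).aestronglyMeasurable (Eventually.of_forall fun y => ?_)
    by_cases h : y - v ∈ E <;> simp [h]
  have i2 : Integrable fun y => E.indicator (fun _ => (1 : ℝ)) y * G y := by
    refine hi.bdd_mul (c := 1) (measurable_const.indicator hE).aestronglyMeasurable
      (Eventually.of_forall fun y => ?_)
    by_cases h : y ∈ E <;> simp [h]
  have e1 : ∫ y in E, G (y + v) = ∫ y, E.indicator (fun _ => (1 : ℝ)) (y - v) * G y := by
    rw [← integral_indicator hE, ← integral_sub_right_eq_self _ v]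
    congr 1
    funext y
    by_cases h : y - v ∈ E <;> simp [h]
  have e2 : ∫ y in E, G y = ∫ y, E.indicator (fun _ => (1 : ℝ)) y * G y := by
    rw [← integral_indicator hE]
    congr 1
    funext y
    by_cases h : y ∈ E <;> simp [h]
  have e3 : (fun y => (E.indicator 1 (y - v) - E.indicator 1 y) * G y) = fun y =>
      E.indicator (fun _ => (1 : ℝ)) (y - v) * G y - E.indicator (fun _ => (1 : ℝ)) y * G y := by
    funext y
    rw [sub_mul]
    rfl
  rw [e1, e2, e3]
  exact ⟨(integral_sub i1 i2).symm, i1.sub i2⟩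

section

variable {u : Eucl n → ℝ} {ν x : Eucl n} {r : ℝ} {E : Set (Eucl n)}

/-- Translating the sublevel set `{u < 0}` in the direction `ν` in which `u` increases only adds
points close to `{u = 0}`. -/
theorem ae_nonneg_translate_mul (hu : AlmostLinearOn u ν (1 / 2) (ball x r)) (hν : ‖ν‖ = 1)
    (hE : IsSublevelOn E u (ball x r)) {G : Eucl n → ℝ}
    (hc : HasCompactSupport G) (hsupp : tsupport G ⊆ ball x r) {m : ℝ} (hm : 0 < m)
    (hpos : ∀ y ∈ ball x r, |u y| < m → 0 ≤ G y) :
    ∃ τ : ℝ, 0 < τ ∧ ∀ t : ℝ, 0 < t → t ≤ τ →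
      0 ≤ᵐ[volume] fun y => (E.indicator 1 (y - t • ν) - E.indicator 1 y) * G y := by
  -- For small `t` the two indicators differ on the support of `G` only where `0 ≤ u < m`.
  obtain ⟨d, hd, hdsub⟩ := hc.isCompact.exists_thickening_subset_open isOpen_ball hsupp
  refine ⟨min (d / 2) (m / 2), by positivity, fun t ht htτ => ?_⟩
  have htd : t < d := by linarith [htτ.trans (min_le_left _ _)]
  have htm : 3 / 2 * t < m := by linarith [htτ.trans (min_le_right _ _)]
  have hE' : ∀ᵐ y, y - t • ν ∈ ball x r →
      (u (y - t • ν) < 0 → y - t • ν ∈ E) ∧ (0 < u (y - t • ν) → y - t • ν ∉ E) :=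
    (measurePreserving_sub_right volume (t • ν)).quasiMeasurePreserving.ae hE
  filter_upwards [hE, hE'] with y hy hy'
  simp only [Pi.zero_apply]
  by_cases hyG : y ∈ tsupport G
  swap
  · rw [image_eq_zero_of_notMem_tsupport hyG, mul_zero]
  have hyb : y ∈ ball x r := hsupp hyG
  have hyb' : y - t • ν ∈ ball x r := by
    refine hdsub (mem_thickening_iff.2 ⟨y, hyG, ?_⟩)
    rw [dist_eq_norm, sub_sub_cancel_left, norm_neg, norm_smul, hν, Real.norm_eq_abs, abs_of_pos ht]
    linarith
  have hinc := hu.add_smul_le hν ht.le hyb' (by rwa [sub_add_cancel])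
  rw [sub_add_cancel] at hinc
  by_cases h1 : y ∈ E
  · have hu0 : u y ≤ 0 := not_lt.1 fun h => (hy hyb).2 h h1
    have h2 : y - t • ν ∈ E := (hy' hyb').1 (by linarith)
    simp [h1, h2]
  · by_cases h2 : y - t • ν ∈ E
    · have hu0 : 0 ≤ u y := not_lt.1 fun h => h1 ((hy hyb).1 h)
      have hu1 : u (y - t • ν) ≤ 0 := not_lt.1 fun h => (hy' hyb').2 h h2
      have := hpos y hyb (by rw [abs_of_nonneg hu0]; linarith)
      simpa [h1, h2] using this
    · simp [h1, h2]

/-- The flux of a function that is nonnegative near `{u = 0}` through the boundary of `{u < 0}`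
is nonnegative. -/
theorem integral_fderiv_nonneg (hu : AlmostLinearOn u ν (1 / 2) (ball x r)) (hν : ‖ν‖ = 1)
    (hEm : MeasurableSet E) (hE : IsSublevelOn E u (ball x r)) {G : Eucl n → ℝ}
    (hG : ContDiff ℝ 1 G) (hc : HasCompactSupport G) (hsupp : tsupport G ⊆ ball x r) {m : ℝ}
    (hm : 0 < m) (hpos : ∀ y ∈ ball x r, |u y| < m → 0 ≤ G y) :
    0 ≤ ∫ y in E, fderiv ℝ G y ν := by
  obtain ⟨τ, hτ, h⟩ := ae_nonneg_translate_mul hu hν hE hc hsupp hm hpos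
  have hd := hasDerivAt_integral_translate hG hc E ν 0
  simp only [zero_smul, add_zero] at hd
  have hs := hd.tendsto_slope_zero_right
  refine ge_of_tendsto hs ?_
  filter_upwards [Ioc_mem_nhdsGT hτ] with t ht
  have := (integral_translate_sub hG.continuous hc hEm (t • ν)).1
  simp only [zero_add, zero_smul, add_zero]
  rw [this, smul_eq_mul]
  exact mul_nonneg (inv_nonneg.2 ht.1.le) (integral_nonneg_of_ae (h t ht.1 ht.2))

/-- There is a nonnegative test function near `x` with positive flux. -/
theorem exists_integral_fderiv_pos (hu : AlmostLinearOn u ν (1 / 2) (ball x r)) (hν : ‖ν‖ = 1)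
    (hux : u x = 0) (hEm : MeasurableSet E) (hE : IsSublevelOn E u (ball x r)) {ρ : ℝ}
    (hρ : 0 < ρ) (hρr : ρ ≤ r) : ∃ φ : Eucl n → ℝ, ContDiff ℝ (⊤ : ℕ∞) φ ∧ HasCompactSupport φ ∧
      tsupport φ ⊆ ball x ρ ∧ (∀ y, 0 ≤ φ y) ∧ 0 < ∫ y in E, fderiv ℝ φ y ν := by
  let φ₀ : ContDiffBump x := ⟨ρ / 4, ρ / 2, by positivity, by linarith⟩
  have hsupp : tsupport φ₀ ⊆ ball x r := by
    rw [φ₀.tsupport_eq]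
    exact closedBall_subset_ball (by change ρ / 2 < r; linarith)
  have hcd : ContDiff ℝ 1 φ₀ := φ₀.contDiff
  obtain ⟨τ, hτ, h⟩ := ae_nonneg_translate_mul hu hν hE φ₀.hasCompactSupport hsupp one_pos
    (fun y _ _ => φ₀.nonneg)
  set t₀ := min τ (ρ / 8) with ht₀
  have ht0 : 0 < t₀ := lt_min hτ (by positivity)
  have ht8 : t₀ ≤ ρ / 8 := min_le_right _ _
  have hxr : 0 < r := hρ.trans_le hρr
  have hcont := hu.continuousOn
  -- the layer between `{u = 0}` and its translate contributes a positive amount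
  have hlt : ∫ y in E, φ₀ y < ∫ y in E, φ₀ (y + t₀ • ν) := by
    obtain ⟨e, hi⟩ := integral_translate_sub φ₀.continuous φ₀.hasCompactSupport hEm (t₀ • ν)
    rw [← sub_pos, e, integral_pos_iff_support_of_nonneg_ae (h t₀ ht0 (min_le_left _ _)) hi]
    have hO1 : IsOpen (ball x r ∩ u ⁻¹' Ioi 0) := hcont.isOpen_inter_preimage isOpen_ball isOpen_Ioi
    have hO2 : IsOpen ((fun y => y - t₀ • ν) ⁻¹' (ball x r ∩ u ⁻¹' Iio 0)) :=
      (hcont.isOpen_inter_preimage isOpen_ball isOpen_Iio).preimage (by fun_prop)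
    set O := (ball x r ∩ u ⁻¹' Ioi 0) ∩ ((fun y => y - t₀ • ν) ⁻¹' (ball x r ∩ u ⁻¹' Iio 0)) ∩
      ball x (ρ / 2) with hO
    have hOo : IsOpen O := (hO1.inter hO2).inter isOpen_ball
    have hn : ∀ a : ℝ, ‖a • ν‖ = |a| := fun a => by rw [norm_smul, hν, mul_one, Real.norm_eq_abs]
    have hxb : ∀ a : ℝ, |a| < ρ / 2 → x + a • ν ∈ ball x (ρ / 2) := by
      intro a ha
      rw [mem_ball, dist_eq_norm, add_sub_cancel_left, hn]
      exact ha
    have hsub : ball x (ρ / 2) ⊆ ball x r := ball_subset_ball (by linarith)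
    have hmem : x + (t₀ / 2) • ν ∈ O := by
      have hb : x + (t₀ / 2) • ν ∈ ball x (ρ / 2) :=
        hxb _ (by rw [abs_of_pos (by positivity)]; linarith)
      have hb' : x + (-(t₀ / 2)) • ν ∈ ball x (ρ / 2) :=
        hxb _ (by rw [abs_neg, abs_of_pos (by positivity)]; linarith)
      have hsh : x + (t₀ / 2) • ν - t₀ • ν = x + (-(t₀ / 2)) • ν := by module
      have e1 := (hu.add_smul_le hν (half_pos ht0).le (mem_ball_self hxr) (hsub hb)).1
      have e2 := (hu.add_smul_le hν (half_pos ht0).le (hsub hb')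
        (by convert mem_ball_self (x := x) hxr using 1; module)).1
      have e3 : x + (-(t₀ / 2)) • ν + (t₀ / 2) • ν = x := by module
      rw [e3, hux] at e2
      rw [hux] at e1
      refine ⟨⟨⟨hsub hb, ?_⟩, ?_⟩, hb⟩
      · change 0 < u _
        linarith
      · change x + (t₀ / 2) • ν - t₀ • ν ∈ ball x r ∩ u ⁻¹' Iio 0
        rw [hsh]
        refine ⟨hsub hb', ?_⟩
        change u _ < 0
        linarith
    refine (hOo.measure_pos volume ⟨_, hmem⟩).trans_le (measure_mono_ae ?_)
    have hE' : ∀ᵐ y, y - t₀ • ν ∈ ball x r →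
        (u (y - t₀ • ν) < 0 → y - t₀ • ν ∈ E) ∧ (0 < u (y - t₀ • ν) → y - t₀ • ν ∉ E) :=
      (measurePreserving_sub_right volume (t₀ • ν)).quasiMeasurePreserving.ae hE
    filter_upwards [hE, hE'] with y hy hy' hyO
    have h1 : y ∉ E := (hy hyO.1.1.1).2 hyO.1.1.2
    have h2 : y - t₀ • ν ∈ E := (hy' hyO.1.2.1).1 hyO.1.2.2
    have h3 : 0 < φ₀ y := φ₀.pos_of_mem_ball hyO.2
    change (E.indicator 1 (y - t₀ • ν) - E.indicator 1 y) * φ₀ y ≠ 0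
    simp [h1, h2, h3.ne']
  have hder := fun t => hasDerivAt_integral_translate hcd φ₀.hasCompactSupport E ν t
  -- By the mean value theorem some translate of the bump function has positive flux.
  obtain ⟨t₁, ht₁, hslope⟩ := exists_hasDerivAt_eq_slope _ _ ht0
    (fun t _ => (hder t).continuousAt.continuousWithinAt) (fun t _ => hder t)
  have hsub : Function.support (fun y => φ₀ (y + t₁ • ν)) ⊆ closedBall x (3 * ρ / 4) := by
    intro y hy
    have h1 : y + t₁ • ν ∈ ball x (ρ / 2) := by
      have : y + t₁ • ν ∈ Function.support φ₀ := hy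
      rwa [φ₀.support_eq] at this
    rw [mem_ball, dist_eq_norm] at h1
    rw [mem_closedBall, dist_eq_norm]
    have h2 : y - x = y + t₁ • ν - x - t₁ • ν := by module
    have h3 := norm_sub_le (y + t₁ • ν - x) (t₁ • ν)
    rw [← h2, norm_smul, hν, Real.norm_eq_abs, abs_of_pos ht₁.1] at h3
    linarith [ht₁.2]
  have hts : tsupport (fun y => φ₀ (y + t₁ • ν)) ⊆ closedBall x (3 * ρ / 4) :=
    closure_minimal hsub isClosed_closedBall
  refine ⟨fun y => φ₀ (y + t₁ • ν), φ₀.contDiff.comp (contDiff_id.add contDiff_const),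
    HasCompactSupport.of_support_subset_isCompact (isCompact_closedBall x (3 * ρ / 4)) hsub,
    hts.trans (closedBall_subset_ball (by linarith)), fun y => φ₀.nonneg, ?_⟩
  have : ∀ y, fderiv ℝ (fun y => φ₀ (y + t₁ • ν)) y = fderiv ℝ φ₀ (y + t₁ • ν) := fun y =>
    fderiv_comp_add_right _
  simp only [this]
  rw [hslope]
  simp only [zero_smul, add_zero, sub_zero]
  exact div_pos (by linarith) ht0

end

section

variable {s₁ s₂ lam : ℝ} {rad : ℝ≥0∞} {σ : ℝ} {K₁ K₂ g : Eucl n → ℝ} {Ω E : Set (Eucl n)}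

theorem IsCapillarityProblem.contDiff_truncCurvature
    (h : IsCapillarityProblem s₁ s₂ lam rad σ K₁ K₂ g Ω E) {ε : ℝ} (hε : 0 < ε) :
    ContDiff ℝ 1 (truncCurvature K₁ Ω E ε) := by
  obtain ⟨C, -, hC⟩ := exists_truncKernel_bound h.s₁_mem.1 h.kernel₁ h.lam_pos.le hε
  exact (contDiff_integral_kernel (p := (n : ℝ) + s₁) (by linarith [h.s₁_mem.1])
    (contDiff_truncKernel (h.kernel₁.contDiffOn.of_le (by norm_num)) hε) hC
    (measurable_phase h.isOpen.measurableSet h.critical.measurableSet) (abs_phase_le Ω E)).1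

/-- One half of the pointwise equation: `a` is a sign. If `a (H_δ + Φ - c)` exceeded the
truncation error `ω` at the point `x` of the interface, then the flux of
`φ (a (H_ε + Φ - c) - η)` would be nonnegative for all small `ε`, against the weak equation. -/
theorem IsCapillarityProblem.mul_truncCurvature_add_le [NeZero n]
    (h : IsCapillarityProblem s₁ s₂ lam rad σ K₁ K₂ g Ω E) {c : ℝ} {ν : Eucl n}
    (hcm : ∀ φ : Eucl n → ℝ, ContDiff ℝ (⊤ : ℕ∞) φ → HasCompactSupport φ → tsupport φ ⊆ Ω →
      Tendsto (fun ε => ∫ x in E, weakIntegrand K₁ (outerPotential σ K₂ g Ω) Ω E c ν φ ε x)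
        (𝓝[>] 0) (𝓝 0))
    {u : Eucl n → ℝ} {x : Eucl n} {r : ℝ} (hr : 0 < r) (hΩ : ball x r ⊆ Ω)
    (hu : AlmostLinearOn u ν (1 / 2) (ball x r)) (hν : ‖ν‖ = 1)
    (hux : u x = 0) (hE : IsSublevelOn E u (ball x r)) {a ω δ : ℝ} (hδ : 0 < δ)
    (hω : ∀ y ∈ ball x r, u y = 0 → ∀ ε, 0 < ε → ε ≤ δ →
      a * truncCurvature K₁ Ω E δ y - ω ≤ a * truncCurvature K₁ Ω E ε y) :
    a * (truncCurvature K₁ Ω E δ x + outerPotential σ K₂ g Ω x - c) ≤ ω := by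
  set Φ := outerPotential σ K₂ g Ω with hΦ
  set F : ℝ → Eucl n → ℝ := fun ε y => a * (truncCurvature K₁ Ω E ε y + Φ y - c) with hF
  by_contra! hlt
  have hΦc := h.contDiffOn_outerPotential
  have hFc : ∀ ε, 0 < ε → ContDiffOn ℝ 1 (F ε) Ω := fun ε hε =>
    contDiffOn_const.mul (((h.contDiff_truncCurvature hε).contDiffOn.add hΦc).sub contDiffOn_const)
  have hxΩ : x ∈ Ω := hΩ (mem_ball_self hr)
  set η := (F δ x - ω) / 2 with hη
  have hη0 : 0 < η := half_pos (sub_pos.2 hlt)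
  have hnear : ∀ᶠ y in 𝓝 x, ω + η < F δ y :=
    ((hFc δ hδ).continuousOn.continuousAt (h.isOpen.mem_nhds hxΩ)).eventually
      (lt_mem_nhds (by linarith))
  obtain ⟨ρ₀, hρ₀, hρF⟩ := Metric.eventually_nhds_iff_ball.1 hnear
  set ρ := min ρ₀ r with hρ
  have hρ0 : 0 < ρ := lt_min hρ₀ hr
  obtain ⟨φ, hφ, hφc, hφs, hφn, hφp⟩ := exists_integral_fderiv_pos hu hν hux
    h.critical.measurableSet hE hρ0 (min_le_right _ _)
  have hφr : tsupport φ ⊆ ball x r := hφs.trans (ball_subset_ball (min_le_right _ _))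
  have hφΩ : tsupport φ ⊆ Ω := hφr.trans hΩ
  have hdφi : IntegrableOn (fun y => fderiv ℝ φ y ν) E :=
    (((hφ.continuous_fderiv (by simp)).clm_apply
      continuous_const).integrable_of_hasCompactSupport (hφc.fderiv_apply ℝ ν)).integrableOn
  -- The flux of `φ (F ε - η)` is nonnegative: by `hω` the bracket is positive on `{u = 0}`, hence
  -- near it on the support of `φ`.
  have key : ∀ ε, 0 < ε → ε ≤ δ →
      η * (∫ y in E, fderiv ℝ φ y ν) ≤ a * ∫ y in E, weakIntegrand K₁ Φ Ω E c ν φ ε y := by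
    intro ε hε hεδ
    set G : Eucl n → ℝ := fun y => φ y * (F ε y - η) with hG
    have hFη : ContDiffOn ℝ 1 (fun y => F ε y - η) Ω := (hFc ε hε).sub contDiffOn_const
    have hGs : tsupport G ⊆ tsupport φ := tsupport_mul_subset_left
    have hGc : HasCompactSupport G := hφc.mul_right
    have hGd : ContDiff ℝ 1 G := by
      refine contDiff_iff_contDiffAt.2 fun y => ?_
      by_cases hy : y ∈ tsupport φ
      · exact (hφ.contDiffAt.of_le (by norm_cast)).mul
          (hFη.contDiffAt (h.isOpen.mem_nhds (hφΩ hy)))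
      · exact contDiffAt_const.congr_of_eventuallyEq
          (notMem_tsupport_iff_eventuallyEq.1 fun hy' => hy (hGs hy'))
    -- away from the zero set of `u`, uniformly, wherever the bracket is negative
    have hm : ∃ m : ℝ, 0 < m ∧ ∀ y ∈ tsupport φ, F ε y - η ≤ 0 → m ≤ |u y| := by
      have hcl : IsCompact (tsupport φ ∩ (fun y => F ε y - η) ⁻¹' Iic 0) :=
        hφc.isCompact.of_isClosed_subset
          ((hFη.continuousOn.mono hφΩ).preimage_isClosed_of_isClosed (isClosed_tsupport φ)
            isClosed_Iic) inter_subset_left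
      rcases (tsupport φ ∩ (fun y => F ε y - η) ⁻¹' Iic 0).eq_empty_or_nonempty with he | hne
      · refine ⟨1, one_pos, fun y hy hy0 => ?_⟩
        have : y ∈ tsupport φ ∩ (fun y => F ε y - η) ⁻¹' Iic 0 := ⟨hy, hy0⟩
        rw [he] at this
        exact this.elim
      · obtain ⟨z, hz, hmin⟩ := hcl.exists_isMinOn hne
          (f := fun y => |u y|) ((hu.continuousOn.mono (inter_subset_left.trans hφr)).abs)
        refine ⟨|u z|, abs_pos.2 fun hz0 => ?_, fun y hy hy0 => hmin ⟨hy, hy0⟩⟩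
        have h1 := hω z (hφr hz.1) hz0 ε hε hεδ
        have h2 := hρF z (ball_subset_ball (min_le_left _ _) (hφs hz.1))
        have h3 : F ε z - η ≤ 0 := hz.2
        simp only [hF] at h2 h3
        linarith
    obtain ⟨m, hm0, hm⟩ := hm
    have hflux := integral_fderiv_nonneg hu hν h.critical.measurableSet hE hGd hGc
      (hGs.trans hφr) hm0 (fun y _ hym => by
        by_cases hy : y ∈ tsupport φ
        · refine mul_nonneg (hφn y) ?_
          by_contra! hneg
          exact absurd (hm y hy hneg.le) (not_le.2 hym)
        · simp [hG, image_eq_zero_of_notMem_tsupport hy])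
    have hfd : ∀ y ∈ E, fderiv ℝ G y ν =
        a * weakIntegrand K₁ Φ Ω E c ν φ ε y - η * fderiv ℝ φ y ν := by
      intro y hy
      have hyΩ := h.isOpen.mem_nhds (h.critical.subset hy)
      have h1 := (hφ.differentiable (by simp) y).hasFDerivAt
      have h2 := ((h.contDiff_truncCurvature hε).differentiable (by norm_num) y).hasFDerivAt
      have h3 := ((hΦc.contDiffAt hyΩ).differentiableAt (by norm_num)).hasFDerivAt
      have h4 := h1.mul ((((h2.add h3).sub_const c).const_mul a).sub_const η)
      have h5 : HasFDerivAt G _ y := h4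
      rw [h5.fderiv]
      simp only [weakIntegrand, _root_.add_apply, _root_.smul_apply, smul_eq_mul, Pi.add_apply]
      ring
    have hGi : IntegrableOn (fun y => fderiv ℝ G y ν) E :=
      (((hGd.continuous_fderiv (by norm_num)).clm_apply
        continuous_const).integrable_of_hasCompactSupport (hGc.fderiv_apply ℝ ν)).integrableOn
    have e1 : ∫ y in E, fderiv ℝ G y ν = (a * ∫ y in E, weakIntegrand K₁ Φ Ω E c ν φ ε y) -
        η * ∫ y in E, fderiv ℝ φ y ν := by
      have hwi : IntegrableOn (fun y => a * weakIntegrand K₁ Φ Ω E c ν φ ε y) E := by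
        refine (hGi.add (hdφi.const_mul η)).congr_fun (fun y hy => ?_) h.critical.measurableSet
        simp only [Pi.add_apply, hfd y hy]
        ring
      rw [setIntegral_congr_fun h.critical.measurableSet hfd, ← integral_const_mul,
        ← integral_const_mul]
      exact integral_sub hwi (hdφi.const_mul η)
    linarith
  have hlim := (hcm φ hφ hφc hφΩ).const_mul a
  rw [mul_zero] at hlim
  have := ge_of_tendsto hlim (by
    filter_upwards [Ioc_mem_nhdsGT hδ] with ε hε using key ε hε.1 hε.2)
  exact absurd this (not_le.2 (mul_pos hη0 hφp))

end

/-- `u` is flat at `y` of order `1 + α`: its sign on `B` is the sign of a linear function off a cusp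
of opening `b`. -/
def IsFlatAt (u : Eucl n → ℝ) (b α : ℝ) (y : Eucl n) (B : Set (Eucl n)) : Prop :=
  ∃ ν : Eucl n, ‖ν‖ = 1 ∧ ∀ z ∈ B, (b * ‖z - y‖ ^ (1 + α) < ⟪ν, z - y⟫ → 0 < u z) ∧
    (⟪ν, z - y⟫ < -(b * ‖z - y‖ ^ (1 + α)) → u z < 0)

theorem IsFlatAt.neg {u : Eucl n → ℝ} {b α : ℝ} {y : Eucl n} {B : Set (Eucl n)}
    (h : IsFlatAt u b α y B) : IsFlatAt (fun z => -u z) b α y B := by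
  obtain ⟨ν, hν, h⟩ := h
  refine ⟨-ν, by rwa [norm_neg], fun z hz => ?_⟩
  rw [inner_neg_left]
  exact ⟨fun h1 => neg_pos.2 ((h z hz).2 (by linarith)),
    fun h1 => neg_lt_zero.2 ((h z hz).1 (by linarith))⟩

theorem IsFlatAt.mono {u : Eucl n → ℝ} {b α : ℝ} {y : Eucl n} {B B' : Set (Eucl n)}
    (h : IsFlatAt u b α y B) (hB : B' ⊆ B) : IsFlatAt u b α y B' := by
  obtain ⟨ν, hν, h⟩ := h
  exact ⟨ν, hν, fun z hz => h z (hB hz)⟩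

theorem IsSingularKernel.integrable_truncKernel {s Λ : ℝ} (hs : 0 < s) {K : Eucl n → ℝ}
    (hK : IsSingularKernel s Λ K) {ε : ℝ} (hε : 0 < ε) :
    Integrable (Capillarity.truncKernel K ε) := by
  rw [← integrableOn_univ, ← compl_union_self (ball (0 : Eucl n) (ε / 2))]
  refine ((hK.truncKernel ε).integrableOn_compl_ball hs (half_pos hε)).union ?_
  refine (integrableOn_zero).congr_fun (fun z hz => ?_) measurableSet_ball
  exact (truncKernel_eq_zero hε (mem_ball_zero_iff.1 hz).le).symm

theorem truncCurvature_eq (K : Eucl n → ℝ) (Ω E : Set (Eucl n)) (ε : ℝ) (x : Eucl n) :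
    truncCurvature K Ω E ε x = ∫ z, truncKernel K ε z * phase Ω E (x - z) := by
  rw [truncCurvature, ← integral_sub_left_eq_self _ volume x]
  simp only [sub_sub_cancel]

theorem integrable_mul_phase {Ω E : Set (Eucl n)} (hΩ : MeasurableSet Ω) (hE : MeasurableSet E)
    {f : Eucl n → ℝ} {μ : Measure (Eucl n)} (hf : Integrable f μ) (x : Eucl n) :
    Integrable (fun z => f z * phase Ω E (x - z)) μ :=
  hf.mul_bdd (c := 1) ((measurable_phase hΩ hE).comp
    (measurable_const.sub measurable_id)).aestronglyMeasurable
    (Eventually.of_forall fun z => abs_phase_le Ω E (x - z))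

/-- Cancellation in the curvature integral at a flat point of the interface. -/
theorem exists_abs_integral_mul_phase_le [NeZero n] {s α : ℝ} (hs : 0 < s) (hα : s < α) :
    ∃ C > 0, ∀ (Λ : ℝ) (k u : Eucl n → ℝ) (Ω E : Set (Eucl n)) (b δ : ℝ) (y : Eucl n),
      IsSingularKernel s Λ k → 0 ≤ Λ → Integrable k → MeasurableSet Ω → MeasurableSet E →
      0 < b → 0 < δ → ball y δ ⊆ Ω → IsSublevelOn E u (ball y δ) → IsFlatAt u b α y (ball y δ) →
      |∫ z in ball 0 δ, k z * phase Ω E (y - z)| ≤ Λ * C * b * δ ^ (α - s) := by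
  obtain ⟨C, hC, h⟩ := exists_cancellation_bound (n := n) hs hα
  refine ⟨C, hC, fun Λ k u Ω E b δ y hk hΛ hki hΩ hE hb hδ hyΩ hEu ⟨ν, hν, hfl⟩ => ?_⟩
  refine h Λ k (fun z => phase Ω E (y - z)) ν b δ hk hΛ
    (integrable_mul_phase hΩ hE hki y).integrableOn (fun z => abs_phase_le _ _ _) hν hb hδ ?_
  have q1 : ∀ᵐ z, y - z ∈ ball y δ → (u (y - z) < 0 → y - z ∈ E) ∧ (0 < u (y - z) → y - z ∉ E) :=
    (quasiMeasurePreserving_sub_left volume y).ae hEu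
  have q2 : ∀ᵐ z, y + z ∈ ball y δ → (u (y + z) < 0 → y + z ∈ E) ∧ (0 < u (y + z) → y + z ∉ E) :=
    (measurePreserving_add_left volume y).quasiMeasurePreserving.ae hEu
  filter_upwards [q1, q2] with z h1 h2 hz hcusp
  have m1 : y - z ∈ ball y δ := by
    rw [mem_ball, dist_eq_norm, sub_sub_cancel_left, norm_neg]; exact mem_ball_zero_iff.1 hz
  have m2 : y + z ∈ ball y δ := by
    rw [mem_ball, dist_eq_norm, add_sub_cancel_left]; exact mem_ball_zero_iff.1 hz
  have f1 := hfl _ m1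
  have f2 := hfl _ m2
  rw [sub_sub_cancel_left, norm_neg, inner_neg_right] at f1
  rw [add_sub_cancel_left] at f2
  rw [sub_neg_eq_add]
  rcases lt_abs.1 hcusp with hp | hp
  · have e1 := (h1 m1).1 (f1.2 (by linarith))
    have e2 := (h2 m2).2 (f2.1 (by linarith))
    rw [phase_of_mem e1, phase_of_notMem e2 (hyΩ m2)]; norm_num
  · have e1 := (h1 m1).2 (f1.1 (by linarith))
    have e2 := (h2 m2).1 (f2.2 (by linarith))
    rw [phase_of_mem e2, phase_of_notMem e1 (hyΩ m1)]; norm_num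

section

variable {s₁ s₂ lam : ℝ} {rad : ℝ≥0∞} {σ : ℝ} {K₁ K₂ g : Eucl n → ℝ} {Ω E : Set (Eucl n)}

theorem IsSingularKernel.sub {s Λ Λ' : ℝ} {K K' : Eucl n → ℝ} (h : IsSingularKernel s Λ K)
    (h' : IsSingularKernel s Λ' K') : IsSingularKernel s (Λ + Λ') (fun z => K z - K' z) where
  measurable := h.measurable.sub h'.measurable
  even z := by rw [h.even, h'.even]
  bound z hz := by
    rw [add_mul]
    exact (abs_sub _ _).trans (add_le_add (h.bound z hz) (h'.bound z hz))

/-- The truncated Euler–Lagrange equation with an error that is uniform in the point: at a flat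
point of the interface whose distance from the walls is at least `2 δ`, the curvature integral
truncated at scale `δ` satisfies the equation up to `O(δ^{α - s₁})`.  The multiplier `c` depends on
the direction `ν` only. -/
theorem IsCapillarityProblem.exists_pointwise_equation [NeZero n]
    (h : IsCapillarityProblem s₁ s₂ lam rad σ K₁ K₂ g Ω E) {ν : Eucl n} (hν : ‖ν‖ = 1) :
    ∃ c : ℝ, ∀ α, s₁ < α → ∀ b > 0, ∃ C > 0, ∀ (u : Eucl n → ℝ) (x : Eucl n) (δ : ℝ), 0 < δ →
      ball x (2 * δ) ⊆ Ω → AlmostLinearOn u ν (1 / 16) (ball x (2 * δ)) → u x = 0 →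
      (∀ y ∈ ball x (2 * δ), y ∈ essBoundary E ↔ u y = 0) →
      (∀ y ∈ ball x (2 * δ), u y = 0 → IsFlatAt u b α y (ball x (2 * δ))) →
      |(∫ y in (ball x δ)ᶜ, K₁ (x - y) * phase Ω E y) + outerPotential σ K₂ g Ω x - c| ≤
        C * δ ^ (α - s₁) := by
  obtain ⟨c, hcm⟩ := h.exists_multiplier_tendsto ν
  refine ⟨c, fun α hα b hb => ?_⟩
  obtain ⟨C, hC, hcanc⟩ := exists_abs_integral_mul_phase_le (n := n) h.s₁_mem.1 hα
  have hlam := h.lam_pos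
  have hΩm := h.isOpen.measurableSet
  have hEm := h.critical.measurableSet
  refine ⟨3 * (lam * C * b), by positivity, fun u x δ hδ hΩ hu hux hEu hfl => ?_⟩
  -- the multiplier does not change when the direction is reversed
  have hcm' : ∀ φ : Eucl n → ℝ, ContDiff ℝ (⊤ : ℕ∞) φ → HasCompactSupport φ → tsupport φ ⊆ Ω →
      Tendsto (fun ε => ∫ x in E, weakIntegrand K₁ (outerPotential σ K₂ g Ω) Ω E c (-ν) φ ε x)
        (𝓝[>] 0) (𝓝 0) := by
    intro φ hφ hc hφΩ
    have h1 := (hcm φ hφ hc hφΩ).neg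
    rw [neg_zero] at h1
    refine h1.congr fun ε => ?_
    rw [← integral_neg]
    congr 1
    funext y
    simp only [weakIntegrand, map_neg]
    ring
  have hK := h.kernel₁.isSingularKernel
  have main : ∀ (u : Eucl n → ℝ) (ν : Eucl n), ‖ν‖ = 1 →
      (∀ φ : Eucl n → ℝ, ContDiff ℝ (⊤ : ℕ∞) φ → HasCompactSupport φ → tsupport φ ⊆ Ω →
        Tendsto (fun ε => ∫ x in E, weakIntegrand K₁ (outerPotential σ K₂ g Ω) Ω E c ν φ ε x)
          (𝓝[>] 0) (𝓝 0)) →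
      AlmostLinearOn u ν (1 / 16) (ball x (2 * δ)) → u x = 0 →
      (∀ y ∈ ball x (2 * δ), u y = 0 → IsFlatAt u b α y (ball x (2 * δ))) →
      IsSublevelOn E u (ball x (2 * δ)) →
      |(∫ y in (ball x δ)ᶜ, K₁ (x - y) * phase Ω E y) + outerPotential σ K₂ g Ω x - c| ≤
        3 * (lam * C * b) * δ ^ (α - s₁) := by
    intro u ν hν hcm hu hux hfl hsub
    have hyb : ∀ y ∈ ball x δ, ball y δ ⊆ ball x (2 * δ) := fun y hy =>
      ball_subset_ball' (by rw [mem_ball] at hy; linarith)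
    -- Two truncations differ by a singular kernel supported in `ball 0 δ`, whose integral is
    -- controlled by cancellation.
    have hdiff : ∀ y ∈ ball x δ, u y = 0 → ∀ ε, 0 < ε → ε ≤ δ →
        |truncCurvature K₁ Ω E ε y - truncCurvature K₁ Ω E δ y| ≤
          (lam + lam) * C * b * δ ^ (α - s₁) := by
      intro y hy huy ε hε hεδ
      have i1 := hK.integrable_truncKernel h.s₁_mem.1 hε
      have i2 := hK.integrable_truncKernel h.s₁_mem.1 hδ
      have := hcanc (lam + lam) (fun z => truncKernel K₁ ε z - truncKernel K₁ δ z) u Ω E b δ y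
        ((hK.truncKernel ε).sub (hK.truncKernel δ)) (by positivity) (i1.sub i2) hΩm hEm hb hδ
        ((hyb y hy).trans hΩ) (hsub.mono (hyb y hy))
        ((hfl y (ball_subset_ball (by linarith) hy) huy).mono (hyb y hy))
      rw [setIntegral_eq_integral_of_forall_compl_eq_zero] at this
      · rw [truncCurvature_eq, truncCurvature_eq,
          ← integral_sub (integrable_mul_phase hΩm hEm i1 y) (integrable_mul_phase hΩm hEm i2 y)]
        simpa only [sub_mul] using this
      · intro z hz
        have hz' : δ ≤ ‖z‖ := not_lt.1 fun h => hz (mem_ball_zero_iff.2 h)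
        rw [truncKernel_eq_self hε (hεδ.trans hz'), truncKernel_eq_self hδ hz', sub_self, zero_mul]
    have hhalf : AlmostLinearOn u ν (1 / 2) (ball x δ) :=
      hu.mono (by norm_num) (ball_subset_ball (by linarith))
    have hside := fun a : ℝ => h.mul_truncCurvature_add_le (a := a) hcm hδ
      ((ball_subset_ball (by linarith)).trans hΩ) hhalf hν hux
      (hsub.mono (ball_subset_ball (by linarith))) (ω := (lam + lam) * C * b * δ ^ (α - s₁)) hδ
    have s1 := hside 1 (fun y hy huy ε hε hεδ => by
      linarith [(abs_le.1 (hdiff y hy huy ε hε hεδ)).1])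
    have s2 := hside (-1) (fun y hy huy ε hε hεδ => by
      linarith [(abs_le.1 (hdiff y hy huy ε hε hεδ)).2])
    -- replacing the smooth truncation by the sharp one
    have i2 := hK.integrable_truncKernel h.s₁_mem.1 hδ
    have hxδ : ball x δ ⊆ ball x (2 * δ) := ball_subset_ball (by linarith)
    have hsharp : |truncCurvature K₁ Ω E δ x - ∫ y in (ball x δ)ᶜ, K₁ (x - y) * phase Ω E y| ≤
        lam * C * b * δ ^ (α - s₁) := by
      have hb := hcanc lam (truncKernel K₁ δ) u Ω E b δ x (hK.truncKernel δ) hlam.le i2 hΩm hEm hb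
        hδ (hxδ.trans hΩ) (hsub.mono hxδ)
        ((hfl x (mem_ball_self (by linarith)) hux).mono hxδ)
      have e1 : ∫ y in (ball x δ)ᶜ, K₁ (x - y) * phase Ω E y =
          ∫ z in (ball (0 : Eucl n) δ)ᶜ, truncKernel K₁ δ z * phase Ω E (x - z) := by
        have := setIntegral_comp_sub_left (fun z => K₁ z * phase Ω E (x - z)) x δ
        simp only [sub_sub_cancel] at this
        rw [this]
        refine setIntegral_congr_fun measurableSet_ball.compl fun z hz => ?_
        have hz' : δ ≤ ‖z‖ := not_lt.1 fun h => hz (mem_ball_zero_iff.2 h)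
        simp only [truncKernel_eq_self hδ hz']
      rw [e1, truncCurvature_eq, ← integral_add_compl measurableSet_ball
        (integrable_mul_phase hΩm hEm i2 x), add_sub_cancel_right]
      exact hb
    rw [abs_le] at hsharp ⊢
    constructor <;> linarith [hsharp.1, hsharp.2]
  rcases isSublevelOn_or_of_essBoundary hu hν (by norm_num) le_rfl (by linarith) hux hEu
    with hs | hs
  · exact main u ν hν hcm hu hux hfl hs
  · exact main (fun y => -u y) (-ν) (by rwa [norm_neg]) hcm' hu.neg (by simp [hux])
      (fun y hy huy => (hfl y hy (by simpa using huy)).neg) hs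

end

/-! ### Charts of the interface at a contact point -/

/-- Near `x₀` the set `M` is `{u = 0, 0 ≤ w}`, where `u` has unit gradient `ν` at `x₀` and is of
class `C^{1,α}`, in the weak form that the proof needs.  At a boundary point of `M` the gradient `μ`
of `w` is not parallel to `ν`; at an interior point `w` and `μ` are zero. -/
structure IsContactChart (M : Set (Eucl n)) (x₀ : Eucl n) (α b : ℝ) (u w : Eucl n → ℝ)
    (ν μ : Eucl n) : Prop where
  norm_normal : ‖ν‖ = 1
  eq_zero : u x₀ = 0
  approx : ∀ ε > 0, ∃ ρ > 0, AlmostLinearOn u ν ε (ball x₀ ρ)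
  flat : ∃ ρ > 0, ∀ y ∈ ball x₀ ρ, u y = 0 → IsFlatAt u b α y (ball x₀ ρ)
  edge_eq_zero : w x₀ = 0
  edge_approx : ∀ ε > 0, ∃ ρ > 0, AlmostLinearOn w μ ε (ball x₀ ρ)
  edge : (∀ y, w y = 0) ∨ ∀ c : ℝ, μ ≠ c • ν
  mem_iff : ∃ ρ > 0, ∀ y ∈ ball x₀ ρ, y ∈ M ↔ u y = 0 ∧ 0 ≤ w y

theorem IsContactChart.neg {M : Set (Eucl n)} {x₀ : Eucl n} {α b : ℝ} {u w : Eucl n → ℝ}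
    {ν μ : Eucl n} (h : IsContactChart M x₀ α b u w ν μ) :
    IsContactChart M x₀ α b (fun y => -u y) w (-ν) μ where
  norm_normal := by rw [norm_neg, h.norm_normal]
  eq_zero := by simp [h.eq_zero]
  approx ε hε := by
    obtain ⟨ρ, hρ, h⟩ := h.approx ε hε
    exact ⟨ρ, hρ, h.neg⟩
  flat := by
    obtain ⟨ρ, hρ, h⟩ := h.flat
    exact ⟨ρ, hρ, fun y hy hy0 => (h y hy (by simpa using hy0)).neg⟩
  edge_eq_zero := h.edge_eq_zero
  edge_approx := h.edge_approx
  edge := h.edge.imp id fun h c => by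
    rw [smul_neg, ← neg_smul]
    exact h (-c)
  mem_iff := by simpa using h.mem_iff

/-- A `C^{1,α}` function with nonzero gradient is flat of order `1 + α` at its zeros. -/
theorem exists_isFlatAt {α : ℝ} (hα : 0 < α) {U : Set (Eucl n)} (hU : IsOpen U) {u : Eucl n → ℝ}
    (hu : IsC1Holder α U u) {x : Eucl n} (hx : x ∈ U) (hne : fderiv ℝ u x ≠ 0) :
    ∃ b > 0, ∃ ρ > 0, ∀ y ∈ ball x ρ, u y = 0 → IsFlatAt u b α y (ball x ρ) := by
  obtain ⟨hu1, C, hC⟩ := hu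
  set C' := max C 0 with hC'
  have hC'0 : 0 ≤ C' := le_max_right _ _
  have hm : 0 < ‖fderiv ℝ u x‖ := norm_pos_iff.2 hne
  set m := ‖fderiv ℝ u x‖ / 2 with hmdef
  have hm0 : 0 < m := half_pos hm
  have hcont : ContinuousAt (fun y => ‖fderiv ℝ u y‖) x :=
    ((hu1.continuousOn_fderiv_of_isOpen hU le_rfl).continuousAt (hU.mem_nhds hx)).norm
  have hev : ∀ᶠ y in 𝓝 x, m < ‖fderiv ℝ u y‖ ∧ y ∈ U :=
    (hcont.eventually (lt_mem_nhds (half_lt_self hm))).and (hU.mem_nhds hx)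
  obtain ⟨ρ, hρ, hball⟩ := Metric.eventually_nhds_iff_ball.1 hev
  refine ⟨C' / m + 1, by positivity, ρ, hρ, fun y hy hy0 => ?_⟩
  set ℓ := fderiv ℝ u y with hℓ
  set γ := (InnerProductSpace.toDual ℝ (Eucl n)).symm ℓ with hγ
  have hγn : ‖γ‖ = ‖ℓ‖ := LinearIsometryEquiv.norm_map _ _
  have hγm : m < ‖γ‖ := hγn ▸ (hball y hy).1
  have hγ0 : 0 < ‖γ‖ := hm0.trans hγm
  have hin : ∀ v, ⟪γ, v⟫ = ℓ v := fun v => InnerProductSpace.toDual_symm_apply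
  have hnorm : ‖(‖γ‖⁻¹ • γ : Eucl n)‖ = 1 := by
    rw [norm_smul, norm_inv, norm_norm, inv_mul_cancel₀ hγ0.ne']
  -- Taylor expansion of first order at `y`, where `u` vanishes.
  have taylor : ∀ z ∈ ball x ρ, |u z - ℓ (z - y)| ≤ C' * ‖z - y‖ ^ (1 + α) := by
    intro z hz
    have hseg : segment ℝ y z ⊆ ball x ρ := (convex_ball x ρ).segment_subset hy hz
    have h1 := (convex_segment y z).norm_image_sub_le_of_norm_hasFDerivWithin_le' (f := u)
      (f' := fderiv ℝ u) (φ := ℓ) (C := C' * ‖z - y‖ ^ α)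
      (fun t ht => ((hu1.contDiffAt (hU.mem_nhds (hball t (hseg ht)).2)).differentiableAt
        (by norm_num)).hasFDerivAt.hasFDerivWithinAt) (fun t ht => by
        refine (hC t (hball t (hseg ht)).2 y (hball y hy).2).trans ?_
        have h2 : ‖t - y‖ ≤ ‖z - y‖ := by
          obtain ⟨s, hs, rfl⟩ := (segment_eq_image' ℝ y z).subset ht
          rw [add_sub_cancel_left, norm_smul, Real.norm_eq_abs, abs_of_nonneg hs.1]
          exact mul_le_of_le_one_left (norm_nonneg _) hs.2
        exact mul_le_mul (le_max_left _ _) (Real.rpow_le_rpow (norm_nonneg _) h2 hα.le)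
          (Real.rpow_nonneg (norm_nonneg _) _) hC'0)
      (left_mem_segment ℝ y z) (right_mem_segment ℝ y z)
    rw [hy0, sub_zero, Real.norm_eq_abs] at h1
    refine h1.trans_eq ?_
    rw [add_comm 1 α, Real.rpow_add_one' (norm_nonneg _) (by positivity), mul_assoc]
  refine ⟨‖γ‖⁻¹ • γ, hnorm, fun z hz => ?_⟩
  have ht := abs_le.1 (taylor z hz)
  have hT : 0 ≤ ‖z - y‖ ^ (1 + α) := Real.rpow_nonneg (norm_nonneg _) _
  have hb : C' * ‖z - y‖ ^ (1 + α) ≤ ‖γ‖ * ((C' / m + 1) * ‖z - y‖ ^ (1 + α)) := by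
    rw [← mul_assoc]
    refine mul_le_mul_of_nonneg_right ?_ hT
    calc C' = m * (C' / m) := by field_simp
      _ ≤ ‖γ‖ * (C' / m + 1) := mul_le_mul hγm.le (by linarith) (by positivity) hγ0.le
  have hsm : ⟪(‖γ‖⁻¹ • γ : Eucl n), z - y⟫ = ‖γ‖⁻¹ * ℓ (z - y) := by
    rw [real_inner_smul_left, hin]
  rw [hsm]
  constructor
  · intro h1
    have h2 := mul_lt_mul_of_pos_left h1 hγ0
    rw [mul_inv_cancel_left₀ hγ0.ne'] at h2
    linarith
  · intro h1
    have h2 := mul_lt_mul_of_pos_left h1 hγ0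
    rw [mul_inv_cancel_left₀ hγ0.ne', mul_neg] at h2
    linarith

theorem IsFlatAt.const_mul {u : Eucl n → ℝ} {b α : ℝ} {y : Eucl n} {B : Set (Eucl n)}
    (h : IsFlatAt u b α y B) {κ : ℝ} (hκ : 0 < κ) : IsFlatAt (fun z => κ * u z) b α y B := by
  obtain ⟨ν, hν, h⟩ := h
  exact ⟨ν, hν, fun z hz => ⟨fun h1 => mul_pos hκ ((h z hz).1 h1),
    fun h1 => mul_neg_of_pos_of_neg hκ ((h z hz).2 h1)⟩⟩

/-- At a regular point the interface has a contact chart; at a boundary point `u` and `w` are the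
two functions in the definition of a hypersurface with boundary. -/
theorem exists_contactChart {s : ℝ} (hs : 0 < s) {Ω E : Set (Eucl n)} {x₀ : Eucl n}
    (hx₀ : x₀ ∈ regularSet s Ω E) : ∃ α, s < α ∧ ∃ b > 0, ∃ u w ν μ,
      IsContactChart (interface Ω E) x₀ α b u w ν μ := by
  obtain ⟨hM, ρ, hρ, α, hsα, hα1, h⟩ := hx₀
  refine ⟨α, hsα, ?_⟩
  have hα : 0 < α := hs.trans hsα
  rcases h x₀ ⟨hM, mem_ball_self hρ⟩ with ⟨U, hU, hxU, u, hu, hux, hne, hS⟩ |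
    ⟨-, U, hU, hxU, u, w, hu, hw, hux, hwx, hli, hS⟩
  · obtain ⟨κ, hκ, ν, hν, -, happ⟩ := exists_unit_almostLinearOn hU hxU hu.1 hne
    obtain ⟨b, hb, ρ₁, hρ₁, hfl⟩ := exists_isFlatAt hα hU hu hxU hne
    obtain ⟨ρ₂, hρ₂, hball⟩ := Metric.isOpen_iff.1 hU x₀ hxU
    refine ⟨b, hb, fun y => κ * u y, fun _ => 0, ν, 0, hν, by simp [hux], happ,
      ⟨ρ₁, hρ₁, fun y hy hy0 => (hfl y hy ?_).const_mul hκ⟩, rfl,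
      fun ε hε => ⟨1, one_pos, fun y _ z _ => ?_⟩, Or.inl fun _ => rfl, ρ₂, hρ₂, fun y hy => ?_⟩
    · simpa [hκ.ne'] using hy0
    · simp only [sub_self, inner_zero_left, abs_zero]
      positivity
    · have : y ∈ interface Ω E ∩ U ↔ y ∈ {y ∈ U | u y = 0} := by rw [hS]
      simp only [mem_inter_iff, hball hy, and_true, mem_ofPred_eq, true_and] at this
      simp [this, hκ.ne']
  · have hne : fderiv ℝ u x₀ ≠ 0 := hli.ne_zero 0
    obtain ⟨κ, hκ, ν, hν, hνeq, happ⟩ := exists_unit_almostLinearOn hU hxU hu.1 hne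
    obtain ⟨b, hb, ρ₁, hρ₁, hfl⟩ := exists_isFlatAt hα hU hu hxU hne
    obtain ⟨ρ₂, hρ₂, hball⟩ := Metric.isOpen_iff.1 hU x₀ hxU
    refine ⟨b, hb, fun y => κ * u y, w, ν, (InnerProductSpace.toDual ℝ (Eucl n)).symm
      (fderiv ℝ w x₀), hν, by simp [hux], happ,
      ⟨ρ₁, hρ₁, fun y hy hy0 => (hfl y hy ?_).const_mul hκ⟩, hwx,
      fun ε hε => exists_almostLinearOn hU hxU hw.1 hε, Or.inr fun c hc => ?_, ρ₂, hρ₂,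
      fun y hy => ?_⟩
    · simpa [hκ.ne'] using hy0
    · rw [hνeq, smul_smul, ← LinearIsometryEquiv.map_smul] at hc
      have hc' := (InnerProductSpace.toDual ℝ (Eucl n)).symm.injective hc
      have := LinearIndependent.pair_iff.1 hli (c * κ) (-1) (by
        rw [hc']
        simp)
      norm_num at this
    · have : y ∈ interface Ω E ∩ U ↔ y ∈ {y ∈ U | u y = 0 ∧ 0 ≤ w y} := by rw [hS]
      simp only [mem_inter_iff, hball hy, and_true, mem_ofPred_eq, true_and] at this
      simp [this, hκ.ne']

section

variable {M : Set (Eucl n)} {x₀ : Eucl n} {α b : ℝ} {u w : Eucl n → ℝ} {ν μ : Eucl n}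

/-- The directions tangent to `M` that point strictly into `M`. -/
def IsInward (w : Eucl n → ℝ) (ν μ τ : Eucl n) : Prop :=
  ⟪ν, τ⟫ = 0 ∧ (0 < ⟪μ, τ⟫ ∨ ∀ y, w y = 0)

theorem IsContactChart.exists_isInward (h : IsContactChart M x₀ α b u w ν μ) :
    ∃ τ, IsInward w ν μ τ := by
  rcases h.edge with h0 | hne
  · exact ⟨0, inner_zero_right _, Or.inr h0⟩
  · have hνν : ⟪ν, ν⟫ = 1 := by rw [real_inner_self_eq_norm_sq, h.norm_normal, one_pow]
    have h1 : ⟪ν, μ - ⟪ν, μ⟫ • ν⟫ = 0 := by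
      rw [inner_sub_right, inner_smul_right, hνν, mul_one, sub_self]
    refine ⟨μ - ⟪ν, μ⟫ • ν, h1, Or.inl ?_⟩
    have h2 : ⟪μ, μ - ⟪ν, μ⟫ • ν⟫ = ‖μ - ⟪ν, μ⟫ • ν‖ ^ 2 := by
      rw [← real_inner_self_eq_norm_sq]
      conv_rhs => rw [inner_sub_left, real_inner_smul_left, h1, mul_zero, sub_zero]
    rw [h2]
    have : μ - ⟪ν, μ⟫ • ν ≠ 0 := sub_ne_zero.2 (hne _)
    positivity

/-- In every inward direction there are, at every small scale `r`, points of the dense subset `D`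
of `M` around which `M` is the full zero set of `u` on a ball of radius comparable to `r`. -/
theorem IsContactChart.exists_point (h : IsContactChart M x₀ α b u w ν μ) {D : Set (Eucl n)}
    (hD : M = closure D) {τ : Eucl n} (hτ : IsInward w ν μ τ) : ∃ c > 0, ∀ η > 0, ∃ r₀ > 0,
      ∀ r, 0 < r → r < r₀ → ∃ x ∈ D, ‖x - x₀ - r • τ‖ ≤ η * r ∧
        ∀ y ∈ ball x (c * r), y ∈ M ↔ u y = 0 := by
  -- the ball of radius `2 c r` around a zero of `u` close to `x₀ + r τ` lies in `{0 ≤ w}`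
  have hc : ∃ c > 0, ∃ ρ > 0, ∃ η₀ > 0, ∀ r, 0 < r → ∀ y ∈ ball x₀ ρ,
      ‖y - x₀ - r • τ‖ ≤ (2 * c + η₀) * r → 0 ≤ w y := by
    rcases hτ.2 with hpos | h0
    · set a := ⟪μ, τ⟫ with ha
      set c := a / (8 * (‖μ‖ + 1)) with hcdef
      have hc0 : 0 < c := by positivity
      obtain ⟨ρ, hρ, hw⟩ := h.edge_approx (a / (4 * (‖τ‖ + 4 * c))) (by positivity)
      refine ⟨c, hc0, ρ, hρ, c, hc0, fun r hr y hy hyr => ?_⟩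
      have h1 := (abs_le.1 (hw y hy x₀ (mem_ball_self hρ))).1
      rw [h.edge_eq_zero, sub_zero] at h1
      have h2 : y - x₀ = r • τ + (y - x₀ - r • τ) := by abel
      have h3 : ‖y - x₀‖ ≤ r * (‖τ‖ + 4 * c) := by
        rw [h2]
        refine (norm_add_le _ _).trans ?_
        rw [norm_smul, Real.norm_eq_abs, abs_of_pos hr]
        nlinarith
      have h4 : r * a - ‖μ‖ * (3 * c * r) ≤ ⟪μ, y - x₀⟫ := by
        rw [h2, inner_add_right, inner_smul_right]
        have h5 := (abs_le.1 (abs_real_inner_le_norm μ (y - x₀ - r • τ))).1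
        have h6 : ‖μ‖ * ‖y - x₀ - r • τ‖ ≤ ‖μ‖ * (3 * c * r) :=
          mul_le_mul_of_nonneg_left (by linarith) (norm_nonneg _)
        linarith
      have h7 : a / (4 * (‖τ‖ + 4 * c)) * ‖y - x₀‖ ≤ a / 4 * r := by
        calc a / (4 * (‖τ‖ + 4 * c)) * ‖y - x₀‖
            ≤ a / (4 * (‖τ‖ + 4 * c)) * (r * (‖τ‖ + 4 * c)) := by gcongr
          _ = a / 4 * r := by field_simp
      have h8 : ‖μ‖ * (3 * c * r) ≤ a / 2 * r := by
        have : ‖μ‖ * c ≤ a / 8 := by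
          rw [hcdef, mul_div_assoc', div_le_div_iff₀ (by positivity) (by norm_num)]
          nlinarith [norm_nonneg μ]
        nlinarith
      nlinarith [mul_pos hr hpos]
    · exact ⟨1, one_pos, 1, one_pos, 1, one_pos, fun r hr y _ _ => (h0 y).ge⟩
  obtain ⟨c, hc0, ρw, hρw, η₀, hη₀, hw⟩ := hc
  obtain ⟨ρm, hρm, hmem⟩ := h.mem_iff
  refine ⟨c, hc0, fun η hη => ?_⟩
  set η' := min (η / 2) η₀ with hη'
  have hη'0 : 0 < η' := lt_min (half_pos hη) hη₀
  set ε := min (1 / 2) (η' / (2 * (‖τ‖ + 1))) with hε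
  have hε0 : 0 < ε := lt_min (by norm_num) (by positivity)
  obtain ⟨ρu, hρu, hu⟩ := h.approx ε hε0
  set ρ := min ρu (min ρw ρm) with hρdef
  have hρ : 0 < ρ := lt_min hρu (lt_min hρw hρm)
  set L := ‖τ‖ + η + 2 * c + 2 * η₀ + 1 with hL
  have hL0 : 0 < L := by positivity
  refine ⟨ρ / L, by positivity, fun r hr hrr => ?_⟩
  have hrL : r * L < ρ := (lt_div_iff₀ hL0).1 hrr
  have hin : ∀ y, ‖y - x₀ - r • τ‖ ≤ (η + 2 * c + 2 * η₀) * r → y ∈ ball x₀ ρ := by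
    intro y hy
    rw [mem_ball, dist_eq_norm]
    have h2 : y - x₀ = r • τ + (y - x₀ - r • τ) := by abel
    rw [h2]
    refine (norm_add_le _ _).trans_lt ?_
    rw [norm_smul, Real.norm_eq_abs, abs_of_pos hr]
    nlinarith
  have hτb : x₀ + r • τ ∈ ball x₀ ρ := hin _ (by
    rw [add_sub_cancel_left, sub_self, norm_zero]; positivity)
  have huτ : 2 * |u (x₀ + r • τ)| ≤ η' * r := by
    have h1 := hu _ (ball_subset_ball (min_le_left _ _) hτb) x₀ (mem_ball_self hρu)
    rw [h.eq_zero, sub_zero, add_sub_cancel_left, inner_smul_right, hτ.1, mul_zero, sub_zero,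
      norm_smul, Real.norm_eq_abs, abs_of_pos hr] at h1
    have h2 : ε * (r * ‖τ‖) ≤ η' / (2 * (‖τ‖ + 1)) * (r * (‖τ‖ + 1)) :=
      mul_le_mul (min_le_right _ _) (by nlinarith [norm_nonneg τ]) (by positivity) (by positivity)
    have h3 : η' / (2 * (‖τ‖ + 1)) * (r * (‖τ‖ + 1)) = η' * r / 2 := by field_simp
    linarith
  have hη'1 : η' ≤ η / 2 := min_le_left _ _
  have hη'2 : η' ≤ η₀ := min_le_right _ _
  -- A zero of `u` close to `x₀ + r τ`; below, a point of `D` close to it.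
  obtain ⟨z, hz, huz⟩ := hu.exists_zero h.norm_normal (min_le_left _ _) (y := x₀ + r • τ) (by
    intro y hy
    rw [mem_closedBall, dist_eq_norm, ← sub_sub] at hy
    refine ball_subset_ball (min_le_left _ _) (hin y ?_)
    nlinarith)
  rw [← sub_sub] at hz
  have hzr : ‖z - x₀ - r • τ‖ ≤ η' * r := hz.trans huτ
  have key : ∀ y, ‖y - z‖ ≤ 2 * c * r → (y ∈ M ↔ u y = 0) := by
    intro y hy
    have h1 : ‖y - x₀ - r • τ‖ ≤ (2 * c + η₀) * r := by
      have h2 : y - x₀ - r • τ = (y - z) + (z - x₀ - r • τ) := by abel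
      rw [h2]
      refine (norm_add_le _ _).trans ?_
      nlinarith
    have h3 : y ∈ ball x₀ ρ := hin y (h1.trans (by nlinarith))
    rw [hmem y (ball_subset_ball ((min_le_right _ _).trans (min_le_right _ _)) h3)]
    exact and_iff_left (hw r hr y
      (ball_subset_ball ((min_le_right _ _).trans (min_le_left _ _)) h3) h1)
  have hzM : z ∈ closure D := by
    rw [← hD, key z (by rw [sub_self, norm_zero]; positivity)]
    exact huz
  obtain ⟨x, hxD, hxz⟩ := Metric.mem_closure_iff.1 hzM (min c (η / 2) * r) (by positivity)
  rw [dist_comm, dist_eq_norm] at hxz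
  have hm1 : min c (η / 2) * r ≤ c * r := mul_le_mul_of_nonneg_right (min_le_left _ _) hr.le
  have hm2 : min c (η / 2) * r ≤ η / 2 * r := mul_le_mul_of_nonneg_right (min_le_right _ _) hr.le
  refine ⟨x, hxD, ?_, fun y hy => key y ?_⟩
  · have h2 : x - x₀ - r • τ = (x - z) + (z - x₀ - r • τ) := by abel
    rw [h2]
    refine (norm_add_le _ _).trans ?_
    nlinarith
  · rw [mem_ball, dist_eq_norm] at hy
    have h2 : y - z = (y - x) + (x - z) := by abel
    rw [h2]
    refine (norm_add_le _ _).trans ?_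
    linarith

end

/-! ### Blow-ups -/

theorem mem_blowUp {F : Set (Eucl n)} {x₀ y : Eucl n} {r : ℝ} (hr : r ≠ 0) :
    y ∈ blowUp F x₀ r ↔ x₀ + r • y ∈ F := by
  constructor
  · rintro ⟨z, hz, rfl⟩
    rwa [smul_inv_smul₀ hr, add_sub_cancel]
  · intro h
    exact ⟨_, h, by simp [inv_smul_smul₀ hr]⟩

theorem volume_preimage_rescale (F : Set (Eucl n)) (x₀ : Eucl n) {r : ℝ} (hr : 0 < r) :
    volume F = ENNReal.ofReal (r ^ n) * volume ((fun y => x₀ + r • y) ⁻¹' F) := by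
  have h1 : (fun y : Eucl n => x₀ + r • y) ⁻¹' F = (fun y => r • y) ⁻¹' ((fun y => x₀ + y) ⁻¹' F) :=
    rfl
  rw [h1, Measure.addHaar_preimage_smul _ hr.ne', measure_preimage_add, ← mul_assoc,
    finrank_euclideanSpace_fin, ← ENNReal.ofReal_mul (by positivity),
    abs_of_pos (by positivity), mul_inv_cancel₀ (by positivity), ENNReal.ofReal_one, one_mul]

/-- Scaling back: in `ball x₀ (R r)` the set `F` differs from the rescaled limit by less than the
volume of a ball of radius `κ r`. -/
theorem BlowUpTendsto.eventually_lt {F G : Set (Eucl n)} {x₀ : Eucl n}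
    (h : BlowUpTendsto F x₀ G) {R κ : ℝ} (hR : 0 < R) (hκ : 0 < κ) :
    ∀ᶠ r in 𝓝[>] (0 : ℝ), volume (symmDiff F {y | r⁻¹ • (y - x₀) ∈ G} ∩ ball x₀ (R * r)) <
      volume (ball x₀ (κ * r)) := by
  have hpos : 0 < volume (ball (0 : Eucl n) κ) := measure_ball_pos volume _ hκ
  filter_upwards [(h R hR).eventually (gt_mem_nhds hpos), self_mem_nhdsWithin] with r hr hr0
  have hr0 : 0 < r := hr0
  have hball : ∀ a : ℝ, (fun y : Eucl n => x₀ + r • y) ⁻¹' ball x₀ (a * r) = ball 0 a := by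
    intro a
    ext y
    rw [mem_preimage, mem_ball, dist_eq_norm, add_sub_cancel_left, norm_smul, Real.norm_eq_abs,
      abs_of_pos hr0, mem_ball_zero_iff, mul_comm a, mul_lt_mul_iff_right₀ hr0]
  have hsd : (fun y : Eucl n => x₀ + r • y) ⁻¹'
      (symmDiff F {y | r⁻¹ • (y - x₀) ∈ G} ∩ ball x₀ (R * r)) =
      symmDiff (blowUp F x₀ r) G ∩ ball 0 R := by
    rw [preimage_inter, hball]
    congr 1
    ext y
    have h1 : y ∈ blowUp F x₀ r ↔ x₀ + r • y ∈ F := mem_blowUp hr0.ne'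
    have h2 : x₀ + r • y ∈ {y | r⁻¹ • (y - x₀) ∈ G} ↔ y ∈ G := by
      rw [mem_ofPred_eq, add_sub_cancel_left, inv_smul_smul₀ hr0.ne']
    simp only [mem_preimage, Set.mem_symmDiff, h1, h2]
  rw [volume_preimage_rescale _ x₀ hr0, hsd, volume_preimage_rescale (ball x₀ (κ * r)) x₀ hr0,
    hball]
  refine ENNReal.mul_lt_mul_right ?_ ENNReal.ofReal_ne_top hr
  simp only [ne_eq, ENNReal.ofReal_eq_zero, not_le]
  positivity

theorem volume_ball_eq_volume_ball (x y : Eucl n) (r : ℝ) :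
    volume (ball x r) = volume (ball y r) := by
  rw [Measure.addHaar_ball_center, Measure.addHaar_ball_center volume y]

/-- A set whose blow-up avoids a ball does not fill the corresponding small balls. -/
theorem BlowUpTendsto.eventually_not_mem {F G : Set (Eucl n)} {x₀ : Eucl n}
    (h : BlowUpTendsto F x₀ G) {R κ : ℝ} (hR : 0 < R) (hκ : 0 < κ) :
    ∀ᶠ r in 𝓝[>] (0 : ℝ), ∀ z, ball z (κ * r) ⊆ ball x₀ (R * r) →
      (∀ y ∈ ball z (κ * r), r⁻¹ • (y - x₀) ∉ G) → ¬∀ᵐ y, y ∈ ball z (κ * r) → y ∈ F := by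
  filter_upwards [h.eventually_lt hR hκ] with r hr z hz hG hF
  refine absurd hr (not_lt.2 ?_)
  rw [volume_ball_eq_volume_ball x₀ z]
  refine measure_mono_ae ?_
  filter_upwards [hF] with y hy hyb
  exact ⟨Or.inl ⟨hy hyb, hG y hyb⟩, hz hyb⟩

/-- A set whose blow-up contains a ball is not negligible in the corresponding small balls. -/
theorem BlowUpTendsto.eventually_mem {F G : Set (Eucl n)} {x₀ : Eucl n}
    (h : BlowUpTendsto F x₀ G) {R κ : ℝ} (hR : 0 < R) (hκ : 0 < κ) :
    ∀ᶠ r in 𝓝[>] (0 : ℝ), ∀ z, ball z (κ * r) ⊆ ball x₀ (R * r) →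
      (∀ y ∈ ball z (κ * r), r⁻¹ • (y - x₀) ∈ G) → ¬∀ᵐ y, y ∈ ball z (κ * r) → y ∉ F := by
  filter_upwards [h.eventually_lt hR hκ] with r hr z hz hG hF
  refine absurd hr (not_lt.2 ?_)
  rw [volume_ball_eq_volume_ball x₀ z]
  refine measure_mono_ae ?_
  filter_upwards [hF] with y hy hyb
  exact ⟨Or.inr ⟨hG y hyb, hy hyb⟩, hz hyb⟩

theorem inner_rescale_sub_le {e v x₀ y : Eucl n} {r κ : ℝ} (he : ‖e‖ = 1) (hr : 0 < r)
    (hy : y ∈ ball (x₀ + r • v) (κ * r)) : |⟪e, r⁻¹ • (y - x₀)⟫ - ⟪e, v⟫| ≤ κ ∧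
      |⟪e, y - x₀⟫ - r * ⟪e, v⟫| ≤ κ * r ∧ ‖y - x₀‖ ≤ (‖v‖ + κ) * r := by
  rw [mem_ball, dist_eq_norm, ← sub_sub] at hy
  have h1 : |⟪e, y - x₀⟫ - r * ⟪e, v⟫| ≤ κ * r := by
    rw [← inner_smul_right, ← inner_sub_right]
    refine (abs_real_inner_le_norm _ _).trans ?_
    rw [he, one_mul]
    exact hy.le
  refine ⟨?_, h1, ?_⟩
  · rw [inner_smul_right]
    have h2 : r⁻¹ * ⟪e, y - x₀⟫ - ⟪e, v⟫ = (⟪e, y - x₀⟫ - r * ⟪e, v⟫) / r := by field_simp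
    rw [h2, abs_div, abs_of_pos hr, div_le_iff₀ hr]
    exact h1
  · have h2 : y - x₀ = r • v + (y - x₀ - r • v) := by abel
    rw [h2]
    refine (norm_add_le _ _).trans ?_
    rw [norm_smul, Real.norm_eq_abs, abs_of_pos hr]
    linarith

theorem ball_rescale_subset {x₀ v : Eucl n} {r κ R : ℝ} (hr : 0 < r) (hR : ‖v‖ + κ ≤ R) :
    ball (x₀ + r • v) (κ * r) ⊆ ball x₀ (R * r) := by
  refine ball_subset_ball' ?_
  rw [dist_eq_norm, add_sub_cancel_left, norm_smul, Real.norm_eq_abs, abs_of_pos hr]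
  nlinarith

/-- Balls that blow up to balls in the tangent half-space lie in `Ω`. -/
theorem IsDomainChart.exists_ball_subset {Ω : Set (Eucl n)} {x₀ : Eucl n} {φ : Eucl n → ℝ}
    {ν v : Eucl n} (h : IsDomainChart Ω x₀ φ ν) (hv : ⟪ν, v⟫ < 0) :
    ∃ κ > 0, ∃ r₀ > 0, ∀ r, 0 < r → r < r₀ → ball (x₀ + r • v) (κ * r) ⊆ Ω := by
  set κ := -⟪ν, v⟫ / 4 with hκ
  have hκ0 : 0 < κ := by linarith
  obtain ⟨ρ, hρ, hφ⟩ := h.approx (κ / (‖v‖ + κ)) (by positivity)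
  obtain ⟨ρ', hρ', hmem⟩ := h.mem_iff
  refine ⟨κ, hκ0, min ρ ρ' / (‖v‖ + κ), by positivity, fun r hr hrr y hy => ?_⟩
  obtain ⟨-, h1, h2⟩ := inner_rescale_sub_le h.norm_normal hr hy
  have h3 : (‖v‖ + κ) * r < min ρ ρ' := by
    rw [mul_comm]; exact (lt_div_iff₀ (by positivity)).1 hrr
  have hyb : y ∈ ball x₀ (min ρ ρ') := by
    rw [mem_ball, dist_eq_norm]; exact h2.trans_lt h3
  rw [hmem y (ball_subset_ball (min_le_right _ _) hyb)]
  have h4 := (abs_le.1 (hφ y (ball_subset_ball (min_le_left _ _) hyb) x₀ (mem_ball_self hρ))).2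
  rw [h.eq_zero, sub_zero] at h4
  have h5 : κ / (‖v‖ + κ) * ‖y - x₀‖ ≤ κ * r := by
    calc κ / (‖v‖ + κ) * ‖y - x₀‖ ≤ κ / (‖v‖ + κ) * ((‖v‖ + κ) * r) := by gcongr
      _ = κ * r := by field_simp
  have h6 := (abs_le.1 h1).2
  have h7 : ⟪ν, v⟫ = -4 * κ := by rw [hκ]; ring
  rw [h7] at h6
  nlinarith

/-- The chart normal is the outer normal `-q` of the blow-up half-space: otherwise the direction
`-(ν + q)` would point into `Ω` but out of the half-space. -/
theorem IsDomainChart.normal_eq {Ω : Set (Eucl n)} {x₀ : Eucl n} {φ : Eucl n → ℝ}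
    {ν q : Eucl n} (h : IsDomainChart Ω x₀ φ ν) (hq : ‖q‖ = 1)
    (hb : BlowUpTendsto Ω x₀ {x | 0 < ⟪q, x⟫}) : ν = -q := by
  by_contra hne
  have hne' : ν + q ≠ 0 := fun h0 => hne (eq_neg_of_add_eq_zero_left h0)
  have hexp : ‖ν + q‖ ^ 2 = 2 + 2 * ⟪ν, q⟫ := by
    rw [norm_add_sq_real, h.norm_normal, hq]; ring
  have hpos : 0 < 1 + ⟪ν, q⟫ := by
    have : 0 < ‖ν + q‖ ^ 2 := by positivity
    linarith
  have hν : ⟪ν, -(ν + q)⟫ < 0 := by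
    rw [inner_neg_right, inner_add_right, real_inner_self_eq_norm_sq, h.norm_normal]
    linarith
  have hqq : ⟪q, -(ν + q)⟫ < 0 := by
    rw [inner_neg_right, inner_add_right, real_inner_self_eq_norm_sq, hq, real_inner_comm]
    linarith
  obtain ⟨κ, hκ, r₀, hr₀, hsub⟩ := h.exists_ball_subset hν
  set κ' := min κ (-⟪q, -(ν + q)⟫ / 2) with hκ'
  have hκ'0 : 0 < κ' := lt_min hκ (by linarith)
  have hev := hb.eventually_not_mem (R := ‖-(ν + q)‖ + κ') (by positivity) hκ'0
  obtain ⟨r, hr, hr0⟩ := (hev.and (Ioo_mem_nhdsGT hr₀)).exists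
  refine hr (x₀ + r • -(ν + q)) (ball_rescale_subset hr0.1 le_rfl) (fun y hy => ?_)
    (Eventually.of_forall fun y hy => hsub r hr0.1 hr0.2
      (ball_subset_ball (mul_le_mul_of_nonneg_right (min_le_left _ _) hr0.1.le) hy))
  rw [mem_ofPred_eq, not_lt]
  have h1 := (abs_le.1 (inner_rescale_sub_le hq hr0.1 hy).1).2
  have h2 : κ' ≤ -⟪q, -(ν + q)⟫ / 2 := min_le_right _ _
  linarith

/-- Near the points of the face `{⟪m, ·⟫ = 0}` of the wedge there are points of the interface. -/
theorem exists_mem_essBoundary {Ω E : Set (Eucl n)} {x₀ : Eucl n} {φ : Eucl n → ℝ}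
    {q m v : Eucl n} (h : IsDomainChart Ω x₀ φ (-q)) (hm : ‖m‖ = 1)
    (hE : BlowUpTendsto E x₀ {x | 0 < ⟪q, x⟫ ∧ 0 < ⟪m, x⟫}) (hqv : 0 < ⟪q, v⟫) (hmv : ⟪m, v⟫ = 0)
    {η : ℝ} (hη : 0 < η) :
    ∀ᶠ r in 𝓝[>] (0 : ℝ), ∃ x ∈ Ω ∩ essBoundary E, ‖x - x₀ - r • v‖ ≤ η * r := by
  have hq : ‖q‖ = 1 := by rw [← norm_neg, h.norm_normal]
  obtain ⟨κ, hκ, r₀, hr₀, hsub⟩ := h.exists_ball_subset (v := v) (by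
    rw [inner_neg_left]; linarith)
  set t := min (min κ η) ⟪q, v⟫ / 2 with ht
  have ht0 : 0 < t := by positivity
  have htκ : 2 * t ≤ κ := by
    have := (min_le_left (min κ η) ⟪q, v⟫).trans (min_le_left _ _)
    linarith
  have htη : 2 * t ≤ η := by
    have := (min_le_left (min κ η) ⟪q, v⟫).trans (min_le_right _ _)
    linarith
  have htq : 2 * t ≤ ⟪q, v⟫ := by
    have := min_le_right (min κ η) ⟪q, v⟫
    linarith
  have hmm : ⟪m, m⟫ = 1 := by rw [real_inner_self_eq_norm_sq, hm, one_pow]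
  have hqm : |⟪q, m⟫| ≤ 1 := by
    have := abs_real_inner_le_norm q m
    rwa [hq, hm, one_mul] at this
  have hvt : ∀ a : ℝ, |a| = t → ‖v + a • m‖ + t / 2 ≤ ‖v‖ + 2 * t := by
    intro a ha
    have := norm_add_le v (a • m)
    rw [norm_smul, hm, mul_one, Real.norm_eq_abs, ha] at this
    linarith
  have e1 := hE.eventually_not_mem (R := ‖v‖ + 2 * t) (κ := t / 2) (by positivity) (by positivity)
  have e2 := hE.eventually_mem (R := ‖v‖ + 2 * t) (κ := t / 2) (by positivity) (by positivity)
  filter_upwards [e1, e2, Ioo_mem_nhdsGT hr₀] with r h1 h2 hr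
  by_contra! hno
  have hbΩ : ball (x₀ + r • v) (2 * t * r) ⊆ Ω :=
    (ball_subset_ball (mul_le_mul_of_nonneg_right htκ hr.1.le)).trans (hsub r hr.1 hr.2)
  have hdisj : ∀ x ∈ ball (x₀ + r • v) (2 * t * r), x ∉ essBoundary E := by
    intro x hx hxE
    have h3 := hno x ⟨hbΩ hx, hxE⟩
    rw [mem_ball, dist_eq_norm, ← sub_sub] at hx
    have : 2 * t * r ≤ η * r := mul_le_mul_of_nonneg_right htη hr.1.le
    linarith
  have hin : ∀ a : ℝ, |a| = t → ball (x₀ + r • (v + a • m)) (t / 2 * r) ⊆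
      ball (x₀ + r • v) (2 * t * r) := by
    intro a ha
    refine ball_subset_ball' ?_
    have : x₀ + r • (v + a • m) - (x₀ + r • v) = (r * a) • m := by module
    rw [dist_eq_norm, this, norm_smul, hm, mul_one, Real.norm_eq_abs, abs_mul, ha,
      abs_of_pos hr.1]
    nlinarith [hr.1]
  -- Without boundary points `E` would be null or conull in this ball, against the blow-up near `v
  -- + t m` or `v - t m`.
  rcases null_or_conull_of_isPreconnected (convex_ball _ _).isPreconnected hdisj with h3 | h3
  · refine h2 _ (ball_rescale_subset hr.1 (hvt t (abs_of_pos ht0))) (fun y hy => ?_) ?_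
    · have a1 := (abs_le.1 (inner_rescale_sub_le hq hr.1 hy).1).1
      have a2 := (abs_le.1 (inner_rescale_sub_le hm hr.1 hy).1).1
      rw [inner_add_right, inner_smul_right _ m] at a1 a2
      rw [hmv, hmm] at a2
      have a3 := (abs_le.1 hqm).1
      exact ⟨by nlinarith, by linarith⟩
    · filter_upwards [h3] with y hy hyb using hy (hin t (abs_of_pos ht0) hyb)
  · refine h1 _ (ball_rescale_subset hr.1 (hvt (-t) (by rw [abs_neg, abs_of_pos ht0])))
      (fun y hy hyG => ?_) ?_
    · have a2 := (abs_le.1 (inner_rescale_sub_le hm hr.1 hy).1).2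
      rw [inner_add_right, inner_smul_right _ m, hmv, hmm] at a2
      linarith [hyG.2]
    · filter_upwards [h3] with y hy hyb using hy (hin (-t) (by rw [abs_neg, abs_of_pos ht0]) hyb)

theorem eq_inner_smul_of_orthogonal {a m : Eucl n} (hm : ‖m‖ = 1)
    (h : ∀ t, ⟪m, t⟫ = 0 → ⟪a, t⟫ = 0) : a = ⟪m, a⟫ • m := by
  have hmm : ⟪m, m⟫ = 1 := by rw [real_inner_self_eq_norm_sq, hm, one_pow]
  have h1 : ⟪m, a - ⟪m, a⟫ • m⟫ = 0 := by
    rw [inner_sub_right, inner_smul_right, hmm, mul_one, sub_self]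
  have h2 := h _ h1
  rw [← sub_eq_zero, ← inner_self_eq_zero (𝕜 := ℝ), inner_sub_left, h2, real_inner_smul_left, h1,
    mul_zero, sub_zero]

section

variable {M : Set (Eucl n)} {x₀ : Eucl n} {α b : ℝ} {u w : Eucl n → ℝ} {ν μ : Eucl n}

/-- Limits of directions towards points of `M` are tangent to `M` and point into `M`. -/
theorem IsContactChart.inner_of_limit (h : IsContactChart M x₀ α b u w ν μ) {v : Eucl n}
    (hv : ∀ η > 0, ∀ᶠ r in 𝓝[>] (0 : ℝ), ∃ x ∈ M, ‖x - x₀ - r • v‖ ≤ η * r) :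
    ⟪ν, v⟫ = 0 ∧ 0 ≤ ⟪μ, v⟫ := by
  have key : ∀ ε > 0, ε ≤ 1 →
      |⟪ν, v⟫| ≤ ε * (‖v‖ + 2) ∧ -(ε * (‖v‖ + 1 + ‖μ‖)) ≤ ⟪μ, v⟫ := by
    intro ε hε hε1
    obtain ⟨ρ₁, hρ₁, hu⟩ := h.approx ε hε
    obtain ⟨ρ₂, hρ₂, hw⟩ := h.edge_approx ε hε
    obtain ⟨ρ₃, hρ₃, hmem⟩ := h.mem_iff
    have hρ : 0 < min ρ₁ (min ρ₂ ρ₃) / (‖v‖ + 1) := by positivity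
    obtain ⟨r, ⟨x, hx, hxr⟩, hr⟩ := ((hv ε hε).and (Ioo_mem_nhdsGT hρ)).exists
    have h2 : x - x₀ = r • v + (x - x₀ - r • v) := by abel
    have h3 : ‖x - x₀‖ ≤ (‖v‖ + 1) * r := by
      rw [h2]
      refine (norm_add_le _ _).trans ?_
      rw [norm_smul, Real.norm_eq_abs, abs_of_pos hr.1]
      nlinarith [hr.1]
    have h4 : x ∈ ball x₀ (min ρ₁ (min ρ₂ ρ₃)) := by
      rw [mem_ball, dist_eq_norm]
      refine h3.trans_lt ?_
      rw [mul_comm]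
      exact (lt_div_iff₀ (by positivity)).1 hr.2
    obtain ⟨hux, hwx⟩ := (hmem x (ball_subset_ball
      ((min_le_right _ _).trans (min_le_right _ _)) h4)).1 hx
    have h5 := abs_le.1 (hu x (ball_subset_ball (min_le_left _ _) h4) x₀ (mem_ball_self hρ₁))
    have h6 := (abs_le.1 (hw x (ball_subset_ball ((min_le_right _ _).trans (min_le_left _ _)) h4)
      x₀ (mem_ball_self hρ₂))).2
    rw [h.eq_zero, hux, sub_zero] at h5
    rw [h.edge_eq_zero, sub_zero] at h6
    rw [h2, inner_add_right, inner_smul_right, ← h2] at h5 h6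
    have h7 := abs_le.1 (abs_real_inner_le_norm ν (x - x₀ - r • v))
    have h8 := abs_le.1 (abs_real_inner_le_norm μ (x - x₀ - r • v))
    rw [h.norm_normal, one_mul] at h7
    have h9 : ε * ‖x - x₀‖ ≤ ε * ((‖v‖ + 1) * r) := mul_le_mul_of_nonneg_left h3 hε.le
    have h10 : ‖μ‖ * ‖x - x₀ - r • v‖ ≤ ‖μ‖ * (ε * r) :=
      mul_le_mul_of_nonneg_left hxr (norm_nonneg _)
    have hr0 := hr.1
    refine ⟨abs_le.2 ⟨?_, ?_⟩, ?_⟩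
    · refine le_of_mul_le_mul_left ?_ hr0
      linarith [h5.2, h7.2]
    · refine le_of_mul_le_mul_left ?_ hr0
      linarith [h5.1, h7.1]
    · refine le_of_mul_le_mul_left ?_ hr0
      linarith [h8.2]
  have hlim : ∀ C : ℝ, Tendsto (fun ε : ℝ => ε * C) (𝓝[>] 0) (𝓝 0) := fun C => by
    have : Continuous fun ε : ℝ => ε * C := by fun_prop
    simpa using (this.tendsto 0).mono_left nhdsWithin_le_nhds
  constructor
  · refine abs_eq_zero.1 (le_antisymm (ge_of_tendsto (hlim (‖v‖ + 2)) ?_) (abs_nonneg _))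
    filter_upwards [Ioc_mem_nhdsGT one_pos] with ε hε using (key ε hε.1 hε.2).1
  · have := (hlim (‖v‖ + 1 + ‖μ‖)).neg
    rw [neg_zero] at this
    refine le_of_tendsto this ?_
    filter_upwards [Ioc_mem_nhdsGT one_pos] with ε hε using (key ε hε.1 hε.2).2

/-- If every direction of an open half of the hyperplane `m^⊥` is a limit direction of `M`, then
these directions are inward and `m = ± ν`. -/
theorem IsContactChart.isInward_of_limits (h : IsContactChart M x₀ α b u w ν μ) {q m : Eucl n}
    (hm : ‖m‖ = 1) (hv : ∀ v, 0 < ⟪q, v⟫ → ⟪m, v⟫ = 0 → ∀ η > 0, ∀ᶠ r in 𝓝[>] (0 : ℝ),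
      ∃ x ∈ M, ‖x - x₀ - r • v‖ ≤ η * r) {v : Eucl n} (hqv : 0 < ⟪q, v⟫) (hmv : ⟪m, v⟫ = 0) :
    IsInward w ν μ v := by
  have hall := fun v h1 h2 => h.inner_of_limit (hv v h1 h2)
  refine ⟨(hall v hqv hmv).1, ?_⟩
  rcases h.edge with h0 | hne
  · exact Or.inr h0
  refine Or.inl ((hall v hqv hmv).2.lt_of_ne fun h0 => ?_)
  -- If `⟪μ, v⟫ = 0`, then `⟪μ, ·⟫` has a minimum at `v` over an open set of directions in `m^⊥`,
  -- so `μ` is parallel to `m`, as `ν` is.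
  have hperp : ∀ t, ⟪m, t⟫ = 0 → 0 ≤ ⟪μ, t⟫ ∧ ⟪ν, t⟫ = 0 := by
    intro t ht
    have hs : ∃ s : ℝ, 0 < s ∧ 0 < ⟪q, v + s • t⟫ := by
      refine ⟨⟪q, v⟫ / (2 * (|⟪q, t⟫| + 1)), by positivity, ?_⟩
      rw [inner_add_right, inner_smul_right]
      have h1 : ⟪q, v⟫ / (2 * (|⟪q, t⟫| + 1)) * (|⟪q, t⟫| + 1) = ⟪q, v⟫ / 2 := by field_simp
      have h2 : 0 < ⟪q, v⟫ / (2 * (|⟪q, t⟫| + 1)) := by positivity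
      nlinarith [neg_abs_le ⟪q, t⟫]
    obtain ⟨s, hs0, hs⟩ := hs
    obtain ⟨h1, h2⟩ := hall (v + s • t) hs (by
      rw [inner_add_right, inner_smul_right, hmv, ht, mul_zero, add_zero])
    rw [inner_add_right, inner_smul_right, (hall v hqv hmv).1, zero_add] at h1
    rw [inner_add_right, inner_smul_right, ← h0, zero_add] at h2
    exact ⟨nonneg_of_mul_nonneg_right h2 hs0, (mul_eq_zero.1 h1).resolve_left hs0.ne'⟩
  have e1 := eq_inner_smul_of_orthogonal (a := ν) hm fun t ht => (hperp t ht).2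
  have e2 := eq_inner_smul_of_orthogonal (a := μ) hm fun t ht => by
    have h1 := (hperp t ht).1
    have h2 := (hperp (-t) (by rw [inner_neg_right, ht, neg_zero])).1
    rw [inner_neg_right] at h2
    linarith
  have hne0 : ⟪m, ν⟫ ≠ 0 := by
    intro h1
    rw [h1, zero_smul] at e1
    have := h.norm_normal
    rw [e1, norm_zero] at this
    exact zero_ne_one this
  refine hne (⟪m, μ⟫ / ⟪m, ν⟫) ?_
  have e3 : (⟪m, μ⟫ / ⟪m, ν⟫) • ν = (⟪m, μ⟫ / ⟪m, ν⟫) • (⟪m, ν⟫ • m) := congrArg _ e1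
  rw [e3, smul_smul, div_mul_cancel₀ _ hne0]
  exact e2

end

/-! ### Estimates at points close to the wall -/

theorem isClosed_essBoundary (E : Set (Eucl n)) : IsClosed (essBoundary E) := by
  refine isClosed_of_closure_subset fun x hx r hr => ?_
  obtain ⟨y, hy, hxy⟩ := Metric.mem_closure_iff.1 hx (r / 2) (half_pos hr)
  have hsub : ball y (r / 2) ⊆ ball x r := ball_subset_ball' (by rw [dist_comm]; linarith)
  obtain ⟨h1, h2⟩ := hy (r / 2) (half_pos hr)
  exact ⟨h1.trans_le (measure_mono (inter_subset_inter_right _ hsub)),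
    h2.trans_le (measure_mono (inter_subset_inter_right _ hsub))⟩

theorem mem_interface_iff {Ω E : Set (Eucl n)} {y : Eucl n} (hy : y ∈ Ω) :
    y ∈ interface Ω E ↔ y ∈ essBoundary E :=
  ⟨fun h => closure_minimal inter_subset_right (isClosed_essBoundary E) h,
    fun h => subset_closure ⟨hy, h⟩⟩

/-- A point `x` of `Ω` near `x₀` at distance `d` from the complement of `Ω` sees a ball of radius
`d / 4` of the complement at distance at most `3 d`. -/
theorem IsDomainChart.exists_hole {Ω : Set (Eucl n)} (hΩ : IsOpen Ω) {x₀ : Eucl n}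
    {φ : Eucl n → ℝ} {ν : Eucl n} (h : IsDomainChart Ω x₀ φ ν) :
    ∃ ρ > 0, ∀ x ∈ Ω ∩ ball x₀ ρ, 0 < infDist x Ωᶜ ∧ infDist x Ωᶜ ≤ ‖x - x₀‖ ∧
      ball x (infDist x Ωᶜ) ⊆ Ω ∧ ∃ z, ball z (infDist x Ωᶜ / 4) ⊆ Ωᶜ ∩ ball x (3 * infDist x Ωᶜ) ∧
        ∀ y ∈ ball z (infDist x Ωᶜ / 4), infDist x Ωᶜ / 8 ≤ φ y := by
  obtain ⟨ρ₁, hρ₁, hφ⟩ := h.approx (1 / 2) (by norm_num)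
  obtain ⟨ρ₂, hρ₂, hmem⟩ := h.mem_iff
  set ρ := min ρ₁ ρ₂ / 4 with hρ
  have hρ0 : 0 < ρ := by positivity
  have h4 : 4 * ρ = min ρ₁ ρ₂ := by rw [hρ]; ring
  refine ⟨ρ, hρ0, fun x ⟨hxΩ, hxρ⟩ => ?_⟩
  have hx₀ : x₀ ∈ Ωᶜ := fun hx => by
    have := (hmem x₀ (mem_ball_self hρ₂)).1 hx
    rw [h.eq_zero] at this
    exact lt_irrefl _ this
  set d := infDist x Ωᶜ with hd
  have hd0 : 0 < d := (hΩ.isClosed_compl.notMem_iff_infDist_pos ⟨x₀, hx₀⟩).1 (by simpa using hxΩ)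
  have hdx : d ≤ ‖x - x₀‖ := by
    rw [← dist_eq_norm]; exact infDist_le_dist_of_mem hx₀
  obtain ⟨p, hp, hpd⟩ := hΩ.isClosed_compl.exists_infDist_eq_dist ⟨x₀, hx₀⟩ x
  rw [← hd, dist_comm, dist_eq_norm] at hpd
  rw [mem_ball, dist_eq_norm] at hxρ
  have hin : ∀ y, ‖y - x‖ < 3 * d → y ∈ ball x₀ (min ρ₁ ρ₂) := by
    intro y hy
    rw [← h4, mem_ball, dist_eq_norm, ← sub_add_sub_cancel y x x₀]
    refine (norm_add_le _ _).trans_lt ?_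
    linarith
  have hpb := hin p (by linarith)
  have hφp : 0 ≤ φ p := not_lt.1 fun hlt =>
    hp ((hmem p (ball_subset_ball (min_le_right _ _) hpb)).2 hlt)
  -- `p` is a nearest point of the complement and the hole is centred at `p + d ν`.
  have hball : ∀ y ∈ ball (p + d • ν) (d / 4), y ∈ ball x (3 * d) ∧ d / 8 ≤ φ y := by
    intro y hy
    rw [mem_ball, dist_eq_norm] at hy
    have e1 : y - p = (y - (p + d • ν)) + d • ν := by abel
    have hyp : ‖y - p‖ ≤ 5 / 4 * d := by
      rw [e1]
      refine (norm_add_le _ _).trans ?_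
      rw [norm_smul, h.norm_normal, Real.norm_eq_abs, abs_of_pos hd0]
      linarith
    have hyx : ‖y - x‖ < 3 * d := by
      rw [← sub_add_sub_cancel y p x]
      refine (norm_add_le _ _).trans_lt ?_
      linarith
    refine ⟨by rwa [mem_ball, dist_eq_norm], ?_⟩
    have h1 := (abs_le.1 (hφ y (ball_subset_ball (min_le_left _ _) (hin y hyx)) p
      (ball_subset_ball (min_le_left _ _) hpb))).1
    have h2 : ⟪ν, y - p⟫ = ⟪ν, y - (p + d • ν)⟫ + d := by
      conv_lhs => rw [e1]
      rw [inner_add_right, inner_smul_right, real_inner_self_eq_norm_sq, h.norm_normal]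
      ring
    have h3 := (abs_le.1 (abs_real_inner_le_norm ν (y - (p + d • ν)))).1
    rw [h.norm_normal, one_mul] at h3
    linarith
  refine ⟨hd0, hdx, ?_, p + d • ν, fun y hy => ?_, fun y hy => (hball y hy).2⟩
  · intro y hy
    by_contra hyΩ
    have := infDist_le_dist_of_mem (x := x) (s := Ωᶜ) hyΩ
    rw [mem_ball, dist_comm] at hy
    linarith
  · obtain ⟨h1, h2⟩ := hball y hy
    refine ⟨fun hyΩ => ?_, h1⟩
    have h3 := (hmem y (ball_subset_ball (min_le_right _ _) (hin y (by
      rwa [mem_ball, dist_eq_norm] at h1)))).1 hyΩ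
    linarith

/-- Mass of the kernel on a ball of radius comparable to its distance from the pole. -/
theorem exists_kernel_ball_ge {s lam : ℝ} {rad : ℝ≥0∞} {K : Eucl n → ℝ} (hs : 0 < s)
    (hK : IsSmoothKernel 2 n s lam rad K) (hlam : 0 < lam) (hrad : 0 < rad) :
    ∃ c > 0, ∃ d₀ > 0, ∀ d, 0 < d → d < d₀ → ∀ x z : Eucl n, ball z (d / 4) ⊆ ball x (3 * d) →
      ball z (d / 4) ⊆ (ball x d)ᶜ → c * d ^ (-s) ≤ ∫ y in ball z (d / 4), K (x - y) := by
  obtain ⟨R, hR0, hR⟩ : ∃ R : ℝ, 0 < R ∧ ENNReal.ofReal R ≤ rad := by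
    rcases eq_or_ne rad ∞ with rfl | hne
    · exact ⟨1, one_pos, le_top⟩
    · exact ⟨rad.toReal, ENNReal.toReal_pos hrad.ne' hne, ENNReal.ofReal_toReal_le⟩
  have hω := unitBallVolume_pos (n := n)
  refine ⟨unitBallVolume n * (1 / 4) ^ (n : ℝ) * (1 / (lam * 3 ^ ((n : ℝ) + s))), by positivity,
    R / 3, by positivity, fun d hd hdR x z h1 h2 => ?_⟩
  have hint : IntegrableOn (fun y => K (x - y)) (ball z (d / 4)) :=
    (hK.isSingularKernel.integrableOn_comp_sub hs hd x).mono_set h2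
  have hle : ∀ y ∈ ball z (d / 4), 1 / (lam * (3 * d) ^ ((n : ℝ) + s)) ≤ K (x - y) := by
    intro y hy
    have hy1 : ‖x - y‖ < 3 * d := by
      rw [← dist_eq_norm, dist_comm]; exact h1 hy
    have hy2 : d ≤ ‖x - y‖ := by
      rw [← dist_eq_norm, dist_comm]
      exact not_lt.1 (h2 hy)
    have hpos : 0 < ‖x - y‖ := hd.trans_le hy2
    refine le_trans ?_ (hK.lower _ (norm_pos_iff.1 hpos) (lt_of_lt_of_le ?_ hR))
    · have hp : 0 ≤ (n : ℝ) + s := by positivity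
      gcongr
    · exact (ENNReal.ofReal_lt_ofReal_iff hR0).2 (by linarith)
  have hconst : IntegrableOn (fun _ : Eucl n => 1 / (lam * (3 * d) ^ ((n : ℝ) + s)))
      (ball z (d / 4)) := integrableOn_const measure_ball_lt_top.ne
  refine le_trans (le_of_eq ?_) (setIntegral_mono_on hconst hint measurableSet_ball hle)
  rw [setIntegral_const, measureReal_def, volume_ball_eq z (by positivity),
    ENNReal.toReal_ofReal (by positivity), smul_eq_mul, Real.mul_rpow (by norm_num) hd.le,
    show d / 4 = 1 / 4 * d by ring, Real.mul_rpow (by norm_num) hd.le, Real.rpow_neg hd.le,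
    Real.rpow_add hd]
  have := Real.rpow_pos_of_pos hd (n : ℝ)
  have := Real.rpow_pos_of_pos hd s
  field_simp

section

variable {s₁ s₂ lam : ℝ} {rad : ℝ≥0∞} {σ : ℝ} {K₁ K₂ g : Eucl n → ℝ} {Ω E : Set (Eucl n)}

/-- The Euler–Lagrange equation at interface points approaching a contact point in an inward
direction `τ`, with truncation radius up to the distance from the wall. -/
theorem IsCapillarityProblem.exists_contact_estimate [NeZero n]
    (h : IsCapillarityProblem s₁ s₂ lam rad σ K₁ K₂ g Ω E) {x₀ : Eucl n} {α b : ℝ} (hα : s₁ < α)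
    (hb : 0 < b) {u w : Eucl n → ℝ} {ν μ τ : Eucl n}
    (hc : IsContactChart (interface Ω E) x₀ α b u w ν μ) (hτ : IsInward w ν μ τ) :
    ∃ c > 0, ∃ C > 0, ∀ η > 0, ∃ r₀ > 0, ∀ r, 0 < r → r < r₀ →
      ∃ x ∈ Ω ∩ essBoundary E, ‖x - x₀ - r • τ‖ ≤ η * r ∧
        (∀ y ∈ ball x (c * r), y ∈ interface Ω E ↔ u y = 0) ∧
        ∀ δ, 0 < δ → 2 * δ ≤ c * r → ball x (2 * δ) ⊆ Ω →
          |(∫ y in (ball x δ)ᶜ, K₁ (x - y) * phase Ω E y) + σ * wallPotential K₂ Ω x| ≤ C := by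
  obtain ⟨a, ha⟩ := h.exists_pointwise_equation hc.norm_normal
  obtain ⟨C, hC, hest⟩ := ha α hα b hb
  obtain ⟨c, hc0, hpt⟩ := hc.exists_point (D := Ω ∩ essBoundary E) rfl hτ
  obtain ⟨G, hG⟩ := h.bounded.isCompact_closure.exists_bound_of_continuousOn
    h.contDiff.continuous.continuousOn
  obtain ⟨ρ₁, hρ₁, hu⟩ := hc.approx (1 / 16) (by norm_num)
  obtain ⟨ρ₂, hρ₂, hfl⟩ := hc.flat
  refine ⟨c, hc0, C + |a| + |G| + 1, by positivity, fun η hη => ?_⟩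
  obtain ⟨r₁, hr₁, hpt⟩ := hpt η hη
  set L := η + ‖τ‖ + c with hL
  have hL0 : 0 < L := by positivity
  refine ⟨min r₁ (min (1 / c) (min ρ₁ ρ₂ / L)), by positivity, fun r hr hrr => ?_⟩
  obtain ⟨x, hx, hxr, hxM⟩ := hpt r hr (hrr.trans_le (min_le_left _ _))
  have hrc : c * r < 1 := by
    rw [mul_comm]
    exact (lt_div_iff₀ hc0).1 (hrr.trans_le ((min_le_right _ _).trans (min_le_left _ _)))
  have hrL : r * L < min ρ₁ ρ₂ :=
    (lt_div_iff₀ hL0).1 (hrr.trans_le ((min_le_right _ _).trans (min_le_right _ _)))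
  have hsub : ball x (c * r) ⊆ ball x₀ (min ρ₁ ρ₂) := by
    refine ball_subset_ball' ?_
    have h1 : ‖x - x₀‖ ≤ η * r + ‖τ‖ * r := by
      rw [← sub_add_cancel (x - x₀) (r • τ)]
      refine (norm_add_le _ _).trans ?_
      rw [norm_smul, Real.norm_eq_abs, abs_of_pos hr]
      linarith
    rw [dist_eq_norm]
    nlinarith
  refine ⟨x, hx, hxr, hxM, fun δ hδ hδr hδΩ => ?_⟩
  have hb2 : ball x (2 * δ) ⊆ ball x (c * r) := ball_subset_ball hδr
  have hb3 : ball x (2 * δ) ⊆ ball x₀ ρ₂ :=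
    (hb2.trans hsub).trans (ball_subset_ball (min_le_right _ _))
  have hux : u x = 0 := (hxM x (mem_ball_self (by positivity))).1 (subset_closure hx)
  have key := hest u x δ hδ hδΩ
    (hu.mono le_rfl ((hb2.trans hsub).trans (ball_subset_ball (min_le_left _ _)))) hux
    (fun y hy => by rw [← mem_interface_iff (hδΩ hy)]; exact hxM y (hb2 hy))
    (fun y hy hy0 => (hfl y (hb3 hy) hy0).mono hb3)
  have hδ1 : δ ^ (α - s₁) ≤ 1 := Real.rpow_le_one hδ.le (by linarith) (by linarith)
  have hgx := hG x (subset_closure hx.1)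
  rw [Real.norm_eq_abs] at hgx
  have hCδ : C * δ ^ (α - s₁) ≤ C := mul_le_of_le_one_right hC.le hδ1
  rw [outerPotential] at key
  have a1 := abs_le.1 key
  have a2 := abs_le.1 hgx
  have a3 := le_abs_self a
  have a4 := neg_abs_le a
  have a5 := le_abs_self G
  rw [abs_le]
  constructor <;> linarith [a1.1, a1.2, a2.1, a2.2]

/-- If adhesion is the dominant term, the interface has no regular contact point: the potential
of the wall, of order `d^{-s₂}` at distance `d`, is not balanced by the curvature, which is at most
of order `d^{-s₁}`. -/
theorem IsCapillarityProblem.not_contact_of_lt [NeZero n]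
    (h : IsCapillarityProblem s₁ s₂ lam rad σ K₁ K₂ g Ω E) {x₀ : Eucl n}
    (hx₀ : x₀ ∈ regularSet s₁ Ω E ∩ frontier Ω) (hs : s₁ < s₂) (hσ : σ ≠ 0) : False := by
  obtain ⟨α, hα, b, hb, u, w, ν, μ, hc⟩ := exists_contactChart h.s₁_mem.1 hx₀.1
  obtain ⟨φ, νΩ, hφ⟩ := h.boundary.exists_chart h.isOpen hx₀.2
  obtain ⟨τ, hτ⟩ := hc.exists_isInward
  obtain ⟨c, hc0, C, hC, hpts⟩ := h.exists_contact_estimate hα hb hc hτ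
  obtain ⟨r₀, hr₀, hpts⟩ := hpts 1 one_pos
  obtain ⟨ρ, hρ, hhole⟩ := hφ.exists_hole h.isOpen
  obtain ⟨k, hk, d₀, hd₀, hker⟩ := exists_kernel_ball_ge h.s₂_mem.1 h.kernel₂ h.lam_pos h.rad_pos
  obtain ⟨B, hB, hcurv⟩ := exists_abs_setIntegral_compl_ball_le (n := n) h.s₁_mem.1
  set T := ‖τ‖ + 1 with hT
  have hT0 : 0 < T := by positivity
  -- the truncation radius is `a d`
  set a := min (1 / 2) (c / (2 * T)) with ha
  have ha0 : 0 < a := by positivity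
  -- a power of the distance that beats all constants
  have hlim : Tendsto (fun d : ℝ => lam * B * a ^ (-s₁) * d ^ (s₂ - s₁) + C * d ^ s₂) (𝓝[>] 0)
      (𝓝 0) := by
    have h1 : ∀ t : ℝ, 0 < t → Tendsto (fun d : ℝ => d ^ t) (𝓝[>] 0) (𝓝 0) := fun t ht => by
      have := (Real.continuousAt_rpow_const 0 t (Or.inr ht.le)).tendsto
      rw [Real.zero_rpow ht.ne'] at this
      exact this.mono_left nhdsWithin_le_nhds
    simpa using ((h1 (s₂ - s₁) (by linarith)).const_mul (lam * B * a ^ (-s₁))).add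
      ((h1 s₂ h.s₂_mem.1).const_mul C)
  have hσk : 0 < |σ| * k := by positivity
  obtain ⟨d₁, hd₁, hsmall⟩ := mem_nhdsGT_iff_exists_Ioo_subset.1
    (hlim.eventually (gt_mem_nhds hσk))
  have hd₁' : 0 < d₁ := hd₁
  set r := min (r₀ / 2) (min ρ (min d₀ d₁) / (2 * T)) with hr
  have hr0 : 0 < r := by positivity
  obtain ⟨x, hx, hxr, hxM, hest⟩ := hpts r hr0 ((min_le_left _ _).trans_lt (half_lt_self hr₀))
  have hxx₀ : ‖x - x₀‖ ≤ T * r := by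
    rw [← sub_add_cancel (x - x₀) (r • τ)]
    refine (norm_add_le _ _).trans ?_
    rw [norm_smul, Real.norm_eq_abs, abs_of_pos hr0]
    nlinarith
  have hTr : T * r < min ρ (min d₀ d₁) := by
    have h1 : r ≤ min ρ (min d₀ d₁) / (2 * T) := min_le_right _ _
    rw [le_div_iff₀ (by positivity)] at h1
    have : 0 < min ρ (min d₀ d₁) := by positivity
    nlinarith
  obtain ⟨hd0, hdx, hdΩ, z, hz, -⟩ := hhole x ⟨hx.1, by
    rw [mem_ball, dist_eq_norm]; exact (hxx₀.trans_lt hTr).trans_le (min_le_left _ _)⟩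
  set d := infDist x Ωᶜ with hd
  have hdT : d < min ρ (min d₀ d₁) := (hdx.trans hxx₀).trans_lt hTr
  have hdd₀ : d < d₀ := hdT.trans_le ((min_le_right _ _).trans (min_le_left _ _))
  have hdd₁ : d < d₁ := hdT.trans_le ((min_le_right _ _).trans (min_le_right _ _))
  have hδ1 : 2 * (a * d) ≤ d := by
    have : a ≤ 1 / 2 := min_le_left _ _
    nlinarith
  have hδ2 : 2 * (a * d) ≤ c * r := by
    have h1 : a ≤ c / (2 * T) := min_le_right _ _
    rw [le_div_iff₀ (by positivity)] at h1
    have h2 : d ≤ T * r := hdx.trans hxx₀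
    nlinarith
  have e1 := hest (a * d) (by positivity) hδ2 ((ball_subset_ball hδ1).trans hdΩ)
  have e2 := hcurv lam K₁ (phase Ω E) h.kernel₁.isSingularKernel h.lam_pos.le (abs_phase_le Ω E) x
    (a * d) (by positivity)
  have e3 := hker d hd0 hdd₀ x z (hz.trans inter_subset_right)
    ((hz.trans inter_subset_left).trans (compl_subset_compl.2 hdΩ))
  have e4 : ∫ y in ball z (d / 4), K₂ (x - y) ≤ wallPotential K₂ Ω x := by
    refine setIntegral_mono_set (h.kernel₂.isSingularKernel.integrableOn_wall h.s₂_mem.1 hd0 hdΩ)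
      ?_ (hz.trans inter_subset_left).eventuallyLE
    filter_upwards [ae_restrict_mem h.isOpen.measurableSet.compl] with y hy
    refine h.kernel₂.nonneg _ (sub_ne_zero.2 fun hxy => hy (hxy ▸ hx.1))
  have e5 : |σ| * (k * d ^ (-s₂)) ≤ |σ * wallPotential K₂ Ω x| := by
    rw [abs_mul]
    exact mul_le_mul_of_nonneg_left ((e3.trans e4).trans (le_abs_self _)) (abs_nonneg _)
  have e6 : |σ * wallPotential K₂ Ω x| ≤ C + lam * B * (a * d) ^ (-s₁) := by
    have h1 := abs_le.1 e1
    have h2 := abs_le.1 e2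
    rw [abs_le]
    constructor <;> linarith [h1.1, h1.2, h2.1, h2.2]
  have e7 := hsmall ⟨hd0, hdd₁⟩
  rw [mem_ofPred_eq] at e7
  have hp2 : 0 < d ^ s₂ := Real.rpow_pos_of_pos hd0 _
  -- Multiplying by `d ^ s₂` turns the balance into a bound that fails for small `d`.
  have e8 := mul_le_mul_of_nonneg_right (e5.trans e6) hp2.le
  rw [Real.mul_rpow ha0.le hd0.le, Real.rpow_neg hd0.le s₂] at e8
  have e9 : |σ| * (k * (d ^ s₂)⁻¹) * d ^ s₂ = |σ| * k := by field_simp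
  have e10 : (C + lam * B * (a ^ (-s₁) * d ^ (-s₁))) * d ^ s₂ =
      lam * B * a ^ (-s₁) * d ^ (s₂ - s₁) + C * d ^ s₂ := by
    rw [show s₂ - s₁ = -s₁ + s₂ by ring, Real.rpow_add hd0]
    ring
  rw [e9, e10] at e8
  linarith

end

/-! ### Thin phases -/

/-- The ball of radius `ρ / 4` around `x - (ρ / 2) ν` lies in `{u < 0}`. -/
theorem AlmostLinearOn.exists_ball_neg {u : Eucl n → ℝ} {ν x : Eucl n} {ρ : ℝ}
    (h : AlmostLinearOn u ν (1 / 16) (ball x ρ)) (hν : ‖ν‖ = 1) (hρ : 0 < ρ) (hux : u x ≤ 0) :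
    ∀ y ∈ ball (x - (ρ / 2) • ν) (ρ / 4), y ∈ ball x ρ ∧ u y < 0 := by
  intro y hy
  rw [mem_ball, dist_eq_norm] at hy
  have e1 : y - x = (y - (x - (ρ / 2) • ν)) - (ρ / 2) • ν := by abel
  have h1 : ‖y - x‖ < 3 / 4 * ρ := by
    rw [e1]
    refine (norm_sub_le _ _).trans_lt ?_
    rw [norm_smul, hν, Real.norm_eq_abs, abs_of_pos (by positivity)]
    linarith
  have hyb : y ∈ ball x ρ := by
    rw [mem_ball, dist_eq_norm]; linarith
  refine ⟨hyb, ?_⟩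
  have h2 := (abs_le.1 (h y hyb x (mem_ball_self hρ))).2
  have h3 : ⟪ν, y - x⟫ = ⟪ν, y - (x - (ρ / 2) • ν)⟫ - ρ / 2 := by
    conv_lhs => rw [e1]
    rw [inner_sub_right, inner_smul_right, real_inner_self_eq_norm_sq, hν]
    ring
  have h4 := (abs_le.1 (abs_real_inner_le_norm ν (y - (x - (ρ / 2) • ν)))).2
  rw [hν, one_mul] at h4
  linarith

/-- A thin set has no full interface in balls of radius comparable to the scale. -/
theorem IsContactChart.eventually_not_essBoundary {M A : Set (Eucl n)} {x₀ : Eucl n} {α b : ℝ}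
    {u w : Eucl n → ℝ} {ν μ : Eucl n} (hc : IsContactChart M x₀ α b u w ν μ)
    (hA : BlowUpTendsto A x₀ ∅) {R κ : ℝ} (hR : 0 < R) (hκ : 0 < κ) :
    ∀ᶠ r in 𝓝[>] (0 : ℝ), ∀ x, ball x (κ * r) ⊆ ball x₀ (R * r) → u x = 0 →
      ¬∀ y ∈ ball x (κ * r), y ∈ essBoundary A ↔ u y = 0 := by
  obtain ⟨ρ, hρ, hu⟩ := hc.approx (1 / 16) (by norm_num)
  filter_upwards [hA.eventually_not_mem hR (show 0 < κ / 4 by positivity),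
    Ioo_mem_nhdsGT (show 0 < ρ / R by positivity)] with r hr hr0 x hx hux hess
  have hκr : 0 < κ * r := mul_pos hκ hr0.1
  have hRr : R * r ≤ ρ := by
    rw [mul_comm]; exact ((lt_div_iff₀ hR).1 hr0.2).le
  have hux' := hu.mono le_rfl (hx.trans (ball_subset_ball hRr))
  have main : ∀ (v : Eucl n → ℝ) (ν : Eucl n), ‖ν‖ = 1 → v x = 0 →
      AlmostLinearOn v ν (1 / 16) (ball x (κ * r)) → IsSublevelOn A v (ball x (κ * r)) → False := by
    intro v ν hν hv hal hsub
    have hneg := hal.exists_ball_neg hν hκr hv.le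
    have hrad : κ * r / 4 = κ / 4 * r := by ring
    rw [hrad] at hneg
    refine hr _ (fun y hy => hx (hneg y hy).1) (fun y _ => notMem_empty _) ?_
    filter_upwards [hsub] with y hy hyb
    exact (hy (hneg y hyb).1).1 (hneg y hyb).2
  rcases isSublevelOn_or_of_essBoundary hux' hc.norm_normal (by norm_num) le_rfl hκr hux hess
    with h | h
  · exact main u ν hc.norm_normal hux hux' h
  · exact main _ (-ν) (by rw [norm_neg, hc.norm_normal]) (by simp [hux]) hux'.neg h

/-- The curvature of a thin layer between a wall and a parallel sheet is large: symmetrizing the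
integral about the point `x` of the sheet, the two sides of the sheet balance except in a
narrow cone, while the part of the complement of `Ω` close to `x` contributes a gain. -/
theorem exists_thin_curvature_ge {s lam : ℝ} {rad : ℝ≥0∞} {K : Eucl n → ℝ} (hs : 0 < s)
    (hK : IsSmoothKernel 2 n s lam rad K) (hlam : 0 < lam) : ∃ C > 0,
    ∀ (Ω A : Set (Eucl n)) (u φ : Eucl n → ℝ) (ν x z : Eucl n) (ε d R : ℝ), MeasurableSet Ω →
      MeasurableSet A → A ⊆ Ω → ‖ν‖ = 1 → 0 < ε → ε ≤ 1 / 64 → 0 < d → 3 * d < R →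
      AlmostLinearOn u ν ε (ball x R) → AlmostLinearOn φ ν ε (ball x R) → u x = 0 → φ x < 0 →
      (∀ y ∈ ball x R, y ∈ Ω ↔ φ y < 0) →
      (∀ᵐ y, y ∈ ball x R → u y < 0 → φ y < 0 → y ∉ A) → ball x d ⊆ Ω →
      ball z (d / 4) ⊆ Ωᶜ ∩ ball x (3 * d) → (∀ y ∈ ball z (d / 4), d / 8 ≤ φ y) →
      (∫ y in ball z (d / 4), K (x - y)) - C * ε * (d / 2) ^ (-s) - C * R ^ (-s) ≤
        2 * ∫ y in (ball x (d / 2))ᶜ, K (x - y) * phase Ω A y := by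
  obtain ⟨C₁, hC₁, hcone⟩ := exists_cone_bound (n := n) hs
  obtain ⟨C₂, hC₂, htail⟩ := exists_abs_setIntegral_compl_ball_le (n := n) hs
  have hKs := hK.isSingularKernel
  refine ⟨max (2 * lam * C₁) (2 * (lam * C₂)), by positivity, fun Ω A u φ ν x z ε d R hΩ hAm hAΩ hν
    hε hε64 hd hdR hu hφ hux hφx hmem hnull hdΩ hz hzφ => ?_⟩
  set δ := d / 2 with hδ
  have hδ0 : 0 < δ := half_pos hd
  have hR : 0 < R := by linarith
  set χ := phase Ω A with hχ
  have hχ1 := abs_phase_le Ω A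
  set S := ball (0 : Eucl n) R \ ball 0 δ with hS
  have hSm : MeasurableSet S := measurableSet_ball.diff measurableSet_ball
  have hSc : S ⊆ (ball (0 : Eucl n) δ)ᶜ := fun y hy => hy.2
  have hKδ := hKs.integrableOn_compl_ball hs hδ0
  have hKS : IntegrableOn K S := hKδ.mono_set hSc
  have hKχ : IntegrableOn (fun y => K y * χ (x - y)) (ball (0 : Eucl n) δ)ᶜ :=
    integrable_mul_phase hΩ hAm hKδ x
  have hχm : Measurable fun y => χ (x + y) :=
    (measurable_phase hΩ hAm).comp (measurable_const_add x)
  have hKχ' : IntegrableOn (fun y => K y * χ (x + y)) S :=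
    hKS.mul_bdd (c := 1) hχm.aestronglyMeasurable (Eventually.of_forall fun y => hχ1 _)
  -- the annulus and the far part
  have hsplit : ∫ y in (ball x δ)ᶜ, K (x - y) * χ y =
      (∫ y in S, K y * χ (x - y)) + ∫ y in (ball (0 : Eucl n) R)ᶜ, K y * χ (x - y) := by
    have h1 := setIntegral_comp_sub_left (fun y => K y * χ (x - y)) x δ
    simp only [sub_sub_cancel] at h1
    have hsub : (ball (0 : Eucl n) R)ᶜ ⊆ (ball (0 : Eucl n) δ)ᶜ :=
      compl_subset_compl.2 (ball_subset_ball (by linarith))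
    have h2 : (ball (0 : Eucl n) δ)ᶜ = S ∪ (ball (0 : Eucl n) R)ᶜ := by
      ext y
      simp only [hS, mem_union, Set.mem_sdiff, mem_compl_iff]
      have := @hsub y
      simp only [mem_compl_iff] at this
      tauto
    have h3 : Disjoint S (ball (0 : Eucl n) R)ᶜ := Set.disjoint_left.2 fun y hy hy' => hy' hy.1
    rw [h1, h2]
    exact setIntegral_union h3 measurableSet_ball.compl (hKχ.mono_set hSc) (hKχ.mono_set hsub)
  have hfar : |∫ y in (ball (0 : Eucl n) R)ᶜ, K y * χ (x - y)| ≤ lam * C₂ * R ^ (-s) := by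
    have h1 := setIntegral_comp_sub_left (fun y => K y * χ (x - y)) x R
    simp only [sub_sub_cancel] at h1
    rw [← h1]
    exact htail lam K χ hKs hlam.le hχ1 x R hR
  have hSs : ∀ y, -y ∈ S ↔ y ∈ S := fun y => by
    simp only [hS, Set.mem_sdiff, mem_ball_zero_iff, norm_neg]
  have hsym := two_mul_setIntegral_even hSm hSs hKs.even (hKχ.mono_set hSc)
  simp only [sub_neg_eq_add] at hsym
  -- the pointwise lower bound for the symmetrized phase
  set T := {y : Eucl n | |⟪ν, y⟫| ≤ ε * ‖y‖} with hT
  have hTm : MeasurableSet T := measurableSet_le (by fun_prop) (by fun_prop)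
  set Q := ball (x - z) (d / 4) with hQ
  have hQz : ∀ y, y ∈ Q ↔ x - y ∈ ball z (d / 4) := fun y => by
    rw [hQ, mem_ball, mem_ball, dist_eq_norm, dist_eq_norm, ← norm_neg]
    congr! 2
    abel
  have hQS : Q ⊆ S := by
    intro y hy
    have h1 := hz ((hQz y).1 hy)
    have h2 : ‖y‖ < 3 * d := by
      have := h1.2
      rwa [mem_ball, dist_eq_norm, sub_sub_cancel_left, norm_neg] at this
    refine ⟨mem_ball_zero_iff.2 (h2.trans hdR), fun h3 => h1.1 (hdΩ ?_)⟩
    rw [mem_ball, dist_eq_norm, sub_sub_cancel_left, norm_neg]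
    rw [mem_ball_zero_iff] at h3
    linarith
  have hside : ∀ y ∈ ball x R, ⟪ν, y - x⟫ < -(ε * ‖y - x‖) → u y < 0 ∧ φ y < 0 := by
    intro y hy hlt
    have h1 := (abs_le.1 (hu y hy x (mem_ball_self hR))).2
    have h2 := (abs_le.1 (hφ y hy x (mem_ball_self hR))).2
    constructor <;> linarith
  have hQT : ∀ y ∈ Q, ε * ‖y‖ < -⟪ν, y⟫ := by
    intro y hy
    have h1 := (hQz y).1 hy
    have h2 := (hz h1).2
    have h3 : x - y ∈ ball x R := ball_subset_ball hdR.le h2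
    rw [mem_ball, dist_eq_norm, sub_sub_cancel_left, norm_neg] at h2
    have h4 := (abs_le.1 (hφ (x - y) h3 x (mem_ball_self hR))).2
    rw [sub_sub_cancel_left, norm_neg, inner_neg_right] at h4
    have h5 := hzφ _ h1
    nlinarith
  have hae1 : ∀ᵐ y : Eucl n, x - y ∈ ball x R → u (x - y) < 0 → φ (x - y) < 0 → x - y ∉ A :=
    (quasiMeasurePreserving_sub_left volume x).ae hnull
  have hae2 : ∀ᵐ y : Eucl n, x + y ∈ ball x R → u (x + y) < 0 → φ (x + y) < 0 → x + y ∉ A :=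
    (measurePreserving_add_left volume x).quasiMeasurePreserving.ae hnull
  have hpt : ∀ᵐ y : Eucl n, y ∈ S →
      Q.indicator K y - T.indicator (fun y => 2 * K y) y ≤ K y * (χ (x - y) + χ (x + y)) := by
    filter_upwards [hae1, hae2] with y h1 h2 hyS
    have hyR : ‖y‖ < R := mem_ball_zero_iff.1 hyS.1
    have hy0 : y ≠ 0 := by
      rintro rfl
      exact hyS.2 (mem_ball_self hδ0)
    have hKy := hK.nonneg y hy0
    have b1 : x - y ∈ ball x R := by
      rwa [mem_ball, dist_eq_norm, sub_sub_cancel_left, norm_neg]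
    have b2 : x + y ∈ ball x R := by rwa [mem_ball, dist_eq_norm, add_sub_cancel_left]
    have c1 := (abs_le.1 (hχ1 (x - y))).1
    have c2 := (abs_le.1 (hχ1 (x + y))).1
    have p1 : ε * ‖y‖ < ⟪ν, y⟫ → χ (x - y) = 1 := by
      intro hlt
      obtain ⟨q1, q2⟩ := hside _ b1 (by
        rw [sub_sub_cancel_left, norm_neg, inner_neg_right]; linarith)
      exact phase_of_notMem (h1 b1 q1 q2) ((hmem _ b1).2 q2)
    have p2 : ε * ‖y‖ < -⟪ν, y⟫ → χ (x + y) = 1 := by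
      intro hlt
      obtain ⟨q1, q2⟩ := hside _ b2 (by rw [add_sub_cancel_left]; linarith)
      exact phase_of_notMem (h2 b2 q1 q2) ((hmem _ b2).2 q2)
    by_cases hyQ : y ∈ Q
    · have hlt := hQT y hyQ
      have hyT : y ∉ T := fun h => by
        have : |⟪ν, y⟫| ≤ ε * ‖y‖ := h
        linarith [(abs_le.1 this).1]
      have hout := (hz ((hQz y).1 hyQ)).1
      have h0 : χ (x - y) = 0 := phase_of_notMem_domain (fun h => hout (hAΩ h)) hout
      rw [indicator_of_mem hyQ, indicator_of_notMem hyT, h0, p2 hlt]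
      linarith
    · rw [indicator_of_notMem hyQ]
      by_cases hyT : y ∈ T
      · rw [indicator_of_mem hyT]
        nlinarith
      · rw [indicator_of_notMem hyT, sub_zero]
        refine mul_nonneg hKy ?_
        have hlt : ε * ‖y‖ < |⟪ν, y⟫| := not_le.1 hyT
        rcases lt_abs.1 hlt with h3 | h3
        · rw [p1 h3]; linarith
        · rw [p2 h3]; linarith
  have hi1 : IntegrableOn (Q.indicator K) S := hKS.indicator measurableSet_ball
  have hi2 : IntegrableOn (T.indicator fun y => 2 * K y) S := (hKS.const_mul 2).indicator hTm
  have hi3 : IntegrableOn (fun y => K y * (χ (x - y) + χ (x + y))) S := by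
    simp only [mul_add]
    exact (hKχ.mono_set hSc).add hKχ'
  have hmono := setIntegral_mono_on_ae (hi1.sub hi2) hi3 hSm hpt
  have hQint : ∫ y in S, Q.indicator K y = ∫ y in ball z (d / 4), K (x - y) := by
    rw [setIntegral_indicator measurableSet_ball, inter_eq_self_of_subset_right hQS,
      ← integral_indicator measurableSet_ball, ← integral_indicator measurableSet_ball,
      ← integral_sub_left_eq_self _ volume x]
    congr 1
    funext y
    have : x - y ∈ Q ↔ y ∈ ball z (d / 4) := by rw [hQz, sub_sub_cancel]
    by_cases hy : y ∈ ball z (d / 4)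
    · rw [indicator_of_mem (this.2 hy), indicator_of_mem hy]
    · rw [indicator_of_notMem fun h => hy (this.1 h), indicator_of_notMem hy]
  have hTint : ∫ y in S, T.indicator (fun y => 2 * K y) y ≤ 2 * lam * C₁ * ε * δ ^ (-s) := by
    have hsub : S ∩ T ⊆ T \ ball 0 δ := fun y hy => ⟨hy.2, hy.1.2⟩
    obtain ⟨C₃, -, hC₃⟩ := exists_tail_bound (n := n) hs
    have hi : IntegrableOn (fun y : Eucl n => ‖y‖ ^ (-((n : ℝ) + s))) (T \ ball 0 δ) :=
      (hC₃ δ hδ0).1.mono_set fun y hy => hy.2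
    rw [setIntegral_indicator hTm]
    calc ∫ y in S ∩ T, 2 * K y ≤ ∫ y in S ∩ T, 2 * lam * ‖y‖ ^ (-((n : ℝ) + s)) := by
          refine setIntegral_mono_on ((hKS.mono_set inter_subset_left).const_mul 2)
            ((hi.mono_set hsub).const_mul _) (hSm.inter hTm) fun y hy => ?_
          have hy0 : y ≠ 0 := by
            rintro rfl
            exact hy.1.2 (mem_ball_self hδ0)
          have := (le_abs_self _).trans (hKs.bound y hy0)
          linarith
      _ ≤ ∫ y in T \ ball 0 δ, 2 * lam * ‖y‖ ^ (-((n : ℝ) + s)) :=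
          setIntegral_mono_set (hi.const_mul _) (Eventually.of_forall fun y => by
            change (0 : ℝ) ≤ _; positivity) hsub.eventuallyLE
      _ = 2 * lam * ∫ y in T \ ball 0 δ, ‖y‖ ^ (-((n : ℝ) + s)) := integral_const_mul _ _
      _ ≤ 2 * lam * (C₁ * ε * δ ^ (-s)) :=
          mul_le_mul_of_nonneg_left (hcone ν hν ε hε δ hδ0) (by positivity)
      _ = 2 * lam * C₁ * ε * δ ^ (-s) := by ring
  have hsubint : ∫ y in S, (Q.indicator K - T.indicator fun y => 2 * K y) y =
      (∫ y in S, Q.indicator K y) - ∫ y in S, T.indicator (fun y => 2 * K y) y :=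
    integral_sub hi1 hi2
  rw [hsubint, hQint, ← hsym] at hmono
  have hδp : 0 < δ ^ (-s) := Real.rpow_pos_of_pos hδ0 _
  have hRp : 0 < R ^ (-s) := Real.rpow_pos_of_pos hR _
  have g1 : 2 * lam * C₁ * ε * δ ^ (-s) ≤ max (2 * lam * C₁) (2 * (lam * C₂)) * ε * δ ^ (-s) := by
    gcongr; exact le_max_left _ _
  have g2 : 2 * (lam * C₂) * R ^ (-s) ≤ max (2 * lam * C₁) (2 * (lam * C₂)) * R ^ (-s) := by
    gcongr; exact le_max_right _ _
  rw [hsplit]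
  have g3 := (abs_le.1 hfar).1
  linarith

section

variable {s₁ s₂ lam : ℝ} {rad : ℝ≥0∞} {σ : ℝ} {K₁ K₂ g : Eucl n → ℝ} {Ω E A : Set (Eucl n)}

theorem tendsto_rpow_zero {t : ℝ} (ht : 0 < t) :
    Tendsto (fun d : ℝ => d ^ t) (𝓝[>] 0) (𝓝 0) := by
  have := (Real.continuousAt_rpow_const 0 t (Or.inr ht.le)).tendsto
  rw [Real.zero_rpow ht.ne'] at this
  exact this.mono_left nhdsWithin_le_nhds

/-- If the boundary of `A` does not meet `{u < 0} ∩ {φ < 0}`, where `u` and `φ` have the same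
gradient, and `A` does not fill this set, then `A` is negligible in it. -/
theorem ae_notMem_of_disjoint_essBoundary {u φ : Eucl n → ℝ} {ν x : Eucl n} {ε R : ℝ}
    (hu : AlmostLinearOn u ν ε (ball x R)) (hφ : AlmostLinearOn φ ν ε (ball x R)) (hν : ‖ν‖ = 1)
    (hε : 0 < ε) (hε16 : ε ≤ 1 / 16) (hR : 0 < R) (hux : u x ≤ 0) (hφx : φ x ≤ 0)
    (hess : ∀ y ∈ ball x R, u y < 0 → φ y < 0 → y ∉ essBoundary A)
    (hfull : ¬∀ᵐ y, y ∈ ball (x - (R / 2) • ν) (R / 4) → y ∈ A) :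
    ∀ᵐ y, y ∈ ball x R → u y < 0 → φ y < 0 → y ∉ A := by
  have hneg : ∀ f : Eucl n → ℝ, f x ≤ 0 → AlmostLinearOn f ν ε (ball x R) →
      StarConvex ℝ (x - (R / 2) • ν) (ball x R ∩ {y | f y < 0}) ∧
      ball (x - (R / 2) • ν) (R / 4) ⊆ ball x R ∩ {y | f y < 0} := by
    intro f hfx hf
    have hsub : ball (x - (R / 2) • ν) (R / 4) ⊆ ball x R ∩ {y | f y < 0} :=
      fun y hy => (hf.mono hε16 Subset.rfl).exists_ball_neg hν hR hfx y hy
    have hzb := (hsub (mem_ball_self (by positivity))).1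
    refine ⟨hf.starConvex hε hzb ?_, hsub⟩
    have h1 := (abs_le.1 (hf _ hzb x (mem_ball_self hR))).2
    rw [sub_sub_cancel_left, inner_neg_right, inner_smul_right, real_inner_self_eq_norm_sq,
      hν, norm_neg, norm_smul, hν, Real.norm_eq_abs, abs_of_pos (by positivity)] at h1
    nlinarith
  obtain ⟨s1, b1⟩ := hneg u hux hu
  obtain ⟨s2, b2⟩ := hneg φ hφx hφ
  have hbO := subset_inter b1 b2
  have hconn := ((s1.inter s2).isPathConnected
    (hbO (mem_ball_self (by positivity)))).isConnected.isPreconnected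
  rcases null_or_conull_of_isPreconnected (E := A) hconn
    (fun y hy => hess y hy.1.1 hy.1.2 hy.2.2) with hn | hn
  · filter_upwards [hn] with y hy hyb hu0 hφ0 using hy ⟨⟨hyb, hu0⟩, hyb, hφ0⟩
  · refine absurd ?_ hfull
    filter_upwards [hn] with y hy hyb using hy (hbO hyb)

/-- Arithmetic behind the exclusion of thin phases: after multiplication by `d ^ s₁` the gain `k`
exceeds the cone error, the far part and the bounded terms. -/
theorem not_curvature_balance {s₁ s₂ k C C₁ C₂ ε κ a b d : ℝ} (hs₁ : 0 < s₁) (hk : 0 < k)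
    (hC₁ : 0 < C₁) (hd0 : 0 < d) (hb : 0 < b) (hab : a * b = κ) (hdκ : d ≤ κ)
    (hεk : C₁ * ε * 2 ^ s₁ ≤ k / 8) (hκk : C₁ * a ^ s₁ ≤ k / 8)
    (hV : 2 * (C * d ^ s₁ + C₂ * d ^ (s₁ - s₂)) < k / 2)
    (h : k * d ^ (-s₁) ≤ C₁ * ε * (d / 2) ^ (-s₁) + C₁ * b ^ (-s₁) +
      2 * (C + C₂ * d ^ (-s₂))) : False := by
  have hp : 0 < d ^ s₁ := Real.rpow_pos_of_pos hd0 _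
  have e8 := mul_le_mul_of_nonneg_right h hp.le
  have f1 : d ^ (-s₁) * d ^ s₁ = 1 := by
    rw [← Real.rpow_add hd0, neg_add_cancel, Real.rpow_zero]
  have f2 : (d / 2) ^ (-s₁) * d ^ s₁ = 2 ^ s₁ := by
    rw [Real.div_rpow hd0.le (by norm_num), div_mul_eq_mul_div, f1, Real.rpow_neg (by norm_num)]
    simp
  have f3 : b ^ (-s₁) * d ^ s₁ ≤ a ^ s₁ := by
    rw [Real.rpow_neg hb.le, ← Real.inv_rpow hb.le, ← Real.mul_rpow (by positivity) hd0.le]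
    refine Real.rpow_le_rpow (by positivity) ?_ hs₁.le
    rw [inv_mul_le_iff₀ hb]
    linarith
  have f4 : d ^ (-s₂) * d ^ s₁ = d ^ (s₁ - s₂) := by
    rw [← Real.rpow_add hd0]; ring_nf
  have f5 : C₁ * (b ^ (-s₁) * d ^ s₁) ≤ C₁ * a ^ s₁ := mul_le_mul_of_nonneg_left f3 hC₁.le
  have g1 : k * d ^ (-s₁) * d ^ s₁ = k := by rw [mul_assoc, f1, mul_one]
  have g2 : (C₁ * ε * (d / 2) ^ (-s₁) + C₁ * b ^ (-s₁) + 2 * (C + C₂ * d ^ (-s₂))) * d ^ s₁ =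
      C₁ * ε * 2 ^ s₁ + C₁ * (b ^ (-s₁) * d ^ s₁) + 2 * (C * d ^ s₁ + C₂ * d ^ (s₁ - s₂)) := by
    rw [← f2, ← f4]
    ring
  rw [g1, g2] at e8
  linarith

/-- A thin phase next to a wall parallel to the interface is impossible. -/
theorem IsCapillarityProblem.not_thin_of_parallel [NeZero n]
    (h : IsCapillarityProblem s₁ s₂ lam rad σ K₁ K₂ g Ω E) (hσ : σ = 0 ∨ s₂ < s₁) {a : ℝ}
    (ha : |a| = 1) (hAm : MeasurableSet A) (hAΩ : A ⊆ Ω)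
    (hphase : ∀ y, phase Ω E y = a * phase Ω A y)
    (hess : ∀ y ∈ Ω, y ∈ essBoundary A ↔ y ∈ essBoundary E) {x₀ : Eucl n}
    (hthin : BlowUpTendsto A x₀ ∅) {α b : ℝ} (hα : s₁ < α) (hb : 0 < b)
    {u w φ : Eucl n → ℝ} {ν μ : Eucl n} (hc : IsContactChart (interface Ω E) x₀ α b u w ν μ)
    (hφ : IsDomainChart Ω x₀ φ ν) : False := by
  have hs₁ := h.s₁_mem.1
  have hlam := h.lam_pos
  obtain ⟨τ, hτ⟩ := hc.exists_isInward
  obtain ⟨c, hc0, C, hC, hpts⟩ := h.exists_contact_estimate hα hb hc hτ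
  obtain ⟨r₁, hr₁, hpts⟩ := hpts 1 one_pos
  obtain ⟨ρ₁, hρ₁, hhole⟩ := hφ.exists_hole h.isOpen
  obtain ⟨k, hk, d₀, hd₀, hker⟩ := exists_kernel_ball_ge hs₁ h.kernel₁ hlam h.rad_pos
  obtain ⟨C₁, hC₁, hlow⟩ := exists_thin_curvature_ge hs₁ h.kernel₁ hlam
  obtain ⟨B, hB, hwall⟩ := exists_abs_wallPotential_le (n := n) h.s₂_mem.1
  -- `ε` makes the cone negligible, `κ` the far part
  set ε := min (1 / 64) (k / (8 * C₁ * 2 ^ s₁)) with hε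
  have hε0 : 0 < ε := by positivity
  have hεk : C₁ * ε * 2 ^ s₁ ≤ k / 8 := by
    have h1 : ε ≤ k / (8 * C₁ * 2 ^ s₁) := min_le_right _ _
    rw [le_div_iff₀ (by positivity)] at h1
    linarith
  obtain ⟨κ, hκ0, hκc, hκk⟩ : ∃ κ : ℝ, 0 < κ ∧ 4 * κ ≤ c ∧ C₁ * (κ / c) ^ s₁ ≤ k / 8 := by
    have h1 : Tendsto (fun t : ℝ => C₁ * (t / c) ^ s₁) (𝓝 0) (𝓝 (C₁ * (0 / c) ^ s₁)) :=
      (((Real.continuousAt_rpow_const _ _ (Or.inr hs₁.le)).comp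
        (continuousAt_id.div_const c)).const_mul C₁ : ContinuousAt _ _)
    rw [zero_div, Real.zero_rpow hs₁.ne', mul_zero] at h1
    have h2 := (h1.mono_left (nhdsWithin_le_nhds (s := Ioi 0))).eventually
      (gt_mem_nhds (show 0 < k / 8 by positivity))
    obtain ⟨t, ht, ht'⟩ := (h2.and (Ioc_mem_nhdsGT (show 0 < c / 4 by positivity))).exists
    exact ⟨t, ht'.1, by linarith [ht'.2], ht.le⟩
  obtain ⟨ρ₂, hρ₂, hu⟩ := hc.approx ε hε0
  obtain ⟨ρ₃, hρ₃, hφa⟩ := hφ.approx ε hε0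
  obtain ⟨ρ₄, hρ₄, hmem⟩ := hφ.mem_iff
  set V : ℝ → ℝ := fun d => 2 * (C * d ^ s₁ + |σ| * (lam * B) * d ^ (s₁ - s₂)) with hV
  have hlim : Tendsto V (𝓝[>] 0) (𝓝 0) := by
    have h1 : Tendsto (fun d : ℝ => |σ| * (lam * B) * d ^ (s₁ - s₂)) (𝓝[>] 0) (𝓝 0) := by
      rcases hσ with rfl | hlt
      · simp
      · simpa using (tendsto_rpow_zero (sub_pos.2 hlt)).const_mul (|σ| * (lam * B))
    simpa using (((tendsto_rpow_zero hs₁).const_mul C).add h1).const_mul 2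
  obtain ⟨d₁, hd₁, hsmall⟩ := mem_nhdsGT_iff_exists_Ioo_subset.1
    (hlim.eventually (gt_mem_nhds (show 0 < k / 2 by positivity)))
  have hd₁' : 0 < d₁ := hd₁
  set T := ‖τ‖ + 1 + c with hT
  have hT0 : 0 < T := by positivity
  set m := min (min ρ₁ (min ρ₂ (min ρ₃ ρ₄))) (min d₀ d₁) with hm
  have hm0 : 0 < m := by positivity
  have hev1 := hc.eventually_not_essBoundary hthin hT0 hκ0
  have hev2 := hthin.eventually_not_mem hT0 (show 0 < c / 4 by positivity)
  obtain ⟨r, ⟨hr1, hr2⟩, hr⟩ := ((hev1.and hev2).and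
    (Ioo_mem_nhdsGT (show 0 < min r₁ (m / T) by positivity))).exists
  have hr0 := hr.1
  obtain ⟨x, hx, hxr, hxM, hest⟩ := hpts r hr0 (hr.2.trans_le (min_le_left _ _))
  have hTr : T * r < m := by
    rw [mul_comm]
    exact (lt_div_iff₀ hT0).1 (hr.2.trans_le (min_le_right _ _))
  have hxx₀ : ‖x - x₀‖ ≤ (‖τ‖ + 1) * r := by
    rw [← sub_add_cancel (x - x₀) (r • τ)]
    refine (norm_add_le _ _).trans ?_
    rw [norm_smul, Real.norm_eq_abs, abs_of_pos hr0]
    nlinarith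
  have hcr : 0 < c * r := mul_pos hc0 hr0
  have hballT : ball x (c * r) ⊆ ball x₀ (T * r) := by
    refine ball_subset_ball' ?_
    rw [dist_eq_norm]
    linarith
  have hballm : ball x (c * r) ⊆ ball x₀ m := hballT.trans (ball_subset_ball hTr.le)
  have hm1 : m ≤ ρ₁ := (min_le_left _ _).trans (min_le_left _ _)
  have hm2 : m ≤ ρ₂ := (min_le_left _ _).trans ((min_le_right _ _).trans (min_le_left _ _))
  have hm3 : m ≤ ρ₃ := (min_le_left _ _).trans
    ((min_le_right _ _).trans ((min_le_right _ _).trans (min_le_left _ _)))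
  have hm4 : m ≤ ρ₄ := (min_le_left _ _).trans
    ((min_le_right _ _).trans ((min_le_right _ _).trans (min_le_right _ _)))
  have hux : u x = 0 := (hxM x (mem_ball_self hcr)).1 (subset_closure hx)
  obtain ⟨hd0, hdx, hdΩ, z, hz, hzφ⟩ := hhole x ⟨hx.1,
    ball_subset_ball hm1 (hballm (mem_ball_self hcr))⟩
  set d := infDist x Ωᶜ with hd
  have hdm : d < m := by nlinarith
  have hdd₀ : d < d₀ := hdm.trans_le ((min_le_right _ _).trans (min_le_left _ _))
  have hdd₁ : d < d₁ := hdm.trans_le ((min_le_right _ _).trans (min_le_right _ _))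
  have hessA : ∀ y ∈ Ω, y ∈ ball x (c * r) → (y ∈ essBoundary A ↔ u y = 0) := fun y hyΩ hy => by
    rw [hess y hyΩ, ← mem_interface_iff hyΩ, hxM y hy]
  -- the distance from the wall is much smaller than the scale
  have hdκ : d < κ * r := by
    by_contra! hle
    have hsub : ball x (κ * r) ⊆ Ω := (ball_subset_ball hle).trans hdΩ
    have hsub' : ball x (κ * r) ⊆ ball x (c * r) :=
      ball_subset_ball (mul_le_mul_of_nonneg_right (by linarith) hr0.le)
    exact hr1 x (hsub'.trans hballT) hux fun y hy => hessA y (hsub hy) (hsub' hy)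
  have hux' : AlmostLinearOn u ν ε (ball x (c * r)) :=
    hu.mono le_rfl (hballm.trans (ball_subset_ball hm2))
  have hφx' : AlmostLinearOn φ ν ε (ball x (c * r)) :=
    hφa.mono le_rfl (hballm.trans (ball_subset_ball hm3))
  have hmem' : ∀ y ∈ ball x (c * r), y ∈ Ω ↔ φ y < 0 := fun y hy =>
    hmem y (ball_subset_ball hm4 (hballm hy))
  have hφx : φ x < 0 := (hmem' x (mem_ball_self hcr)).1 hx.1
  have hε16 : ε ≤ 1 / 16 := (min_le_left _ _).trans (by norm_num)
  -- `A` is absent from the far side of the interface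
  have hnull : ∀ᵐ y, y ∈ ball x (c * r) → u y < 0 → φ y < 0 → y ∉ A := by
    refine ae_notMem_of_disjoint_essBoundary hux' hφx' hc.norm_normal hε0 hε16 hcr hux.le hφx.le
      (fun y hy hu0 hφ0 hyA => ?_) fun hfull => ?_
    · have := (hessA y ((hmem' y hy).2 hφ0) hy).1 hyA
      exact hu0.ne this
    · rw [show c * r / 4 = c / 4 * r by ring] at hfull
      have hsub : ball (x - (c * r / 2) • ν) (c / 4 * r) ⊆ ball x (c * r) := by
        rw [show c / 4 * r = c * r / 4 by ring]
        exact fun y hy => ((hux'.mono hε16 Subset.rfl).exists_ball_neg hc.norm_normal hcr hux.le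
          y hy).1
      exact hr2 _ (hsub.trans hballT) (fun y _ => notMem_empty _) hfull
  have hκr4 : 4 * (κ * r) ≤ c * r := by
    rw [← mul_assoc]
    exact mul_le_mul_of_nonneg_right hκc hr0.le
  have e1 := hlow Ω A u φ ν x z ε d (c * r) h.isOpen.measurableSet hAm hAΩ hc.norm_normal hε0
    (min_le_left _ _) hd0 (by linarith only [hκr4, hdκ, hd0]) hux' hφx' hux hφx hmem' hnull
    hdΩ hz hzφ
  have e2 := hker d hd0 hdd₀ x z (hz.trans inter_subset_right)
    ((hz.trans inter_subset_left).trans (compl_subset_compl.2 hdΩ))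
  have e3 := hest (d / 2) (half_pos hd0) (by linarith only [hκr4, hdκ, hd0])
    (by rwa [mul_div_cancel₀ d (two_ne_zero)])
  have e4 := hwall lam K₂ h.kernel₂.isSingularKernel hlam.le Ω h.isOpen.measurableSet x d hd0 hdΩ
  have e5 : ∫ y in (ball x (d / 2))ᶜ, K₁ (x - y) * phase Ω E y =
      a * ∫ y in (ball x (d / 2))ᶜ, K₁ (x - y) * phase Ω A y := by
    rw [← integral_const_mul]
    congr 1
    funext y
    rw [hphase]
    ring
  rw [e5] at e3
  set I := ∫ y in (ball x (d / 2))ᶜ, K₁ (x - y) * phase Ω A y with hI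
  have e6 : I ≤ C + |σ| * (lam * B) * d ^ (-s₂) := by
    have h2 : |σ * wallPotential K₂ Ω x| ≤ |σ| * (lam * B) * d ^ (-s₂) := by
      rw [abs_mul, mul_assoc]
      exact mul_le_mul_of_nonneg_left e4 (abs_nonneg _)
    have h3 := abs_sub (a * I + σ * wallPotential K₂ Ω x) (σ * wallPotential K₂ Ω x)
    rw [add_sub_cancel_right, abs_mul, ha, one_mul] at h3
    exact (le_abs_self I).trans (h3.trans (add_le_add e3 h2))
  have hab : κ / c * (c * r) = κ * r := by field_simp
  exact not_curvature_balance hs₁ hk hC₁ hd0 hcr hab hdκ.le hεk hκk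
    (hsmall ⟨hd0, hdd₁⟩) (by linarith only [e1, e2, e6])

/-- No regular contact point has a thin phase. -/
theorem IsCapillarityProblem.not_thin [NeZero n]
    (h : IsCapillarityProblem s₁ s₂ lam rad σ K₁ K₂ g Ω E) (hσ : σ = 0 ∨ s₂ < s₁) {a : ℝ}
    (ha : |a| = 1) (hAm : MeasurableSet A) (hAΩ : A ⊆ Ω)
    (hphase : ∀ y, phase Ω E y = a * phase Ω A y)
    (hess : ∀ y ∈ Ω, y ∈ essBoundary A ↔ y ∈ essBoundary E) {x₀ : Eucl n}
    (hx₀ : x₀ ∈ regularSet s₁ Ω E ∩ frontier Ω) (hthin : BlowUpTendsto A x₀ ∅) : False := by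
  obtain ⟨α, hα, b, hb, u, w, ν, μ, hc⟩ := exists_contactChart h.s₁_mem.1 hx₀.1
  obtain ⟨φ, νΩ, hφ⟩ := h.boundary.exists_chart h.isOpen hx₀.2
  -- the wall is tangent to every inward direction of the interface
  have htan : ∀ τ, IsInward w ν μ τ → ⟪νΩ, τ⟫ = 0 := by
    intro τ hτ
    obtain ⟨c, hc0, hpt⟩ := hc.exists_point (D := Ω ∩ essBoundary E) rfl hτ
    rcases lt_trichotomy ⟪νΩ, τ⟫ 0 with hlt | heq | hgt
    · exfalso
      -- If `τ` points into `Ω`, a thin set would have a full interface in a ball inside `Ω`.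
      obtain ⟨κ, hκ, r₀, hr₀, hsub⟩ := hφ.exists_ball_subset hlt
      set κ' := min (κ / 2) c with hκ'
      have hκ'0 : 0 < κ' := by positivity
      obtain ⟨r₁, hr₁, hpt⟩ := hpt (κ / 2) (half_pos hκ)
      obtain ⟨r, hr, hr0, hrr⟩ := ((hc.eventually_not_essBoundary hthin
        (show 0 < ‖τ‖ + κ by positivity) hκ'0).and
        (Ioo_mem_nhdsGT (show 0 < min r₀ r₁ by positivity))).exists
      obtain ⟨x, hx, hxr, hxM⟩ := hpt r hr0 (hrr.trans_le (min_le_right _ _))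
      have hb1 : ball x (κ' * r) ⊆ ball (x₀ + r • τ) (κ * r) := by
        refine ball_subset_ball' ?_
        have h1 : κ' ≤ κ / 2 := min_le_left _ _
        rw [dist_eq_norm, ← sub_sub]
        nlinarith
      have hb2 : ball x (κ' * r) ⊆ Ω := hb1.trans (hsub r hr0 (hrr.trans_le (min_le_left _ _)))
      have hb3 : ball x (κ' * r) ⊆ ball x (c * r) :=
        ball_subset_ball (mul_le_mul_of_nonneg_right (min_le_right _ _) hr0.le)
      refine hr x (hb1.trans (ball_rescale_subset hr0 le_rfl))
        ((hxM x (mem_ball_self (by positivity))).1 (subset_closure hx)) fun y hy => ?_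
      rw [hess y (hb2 hy), ← mem_interface_iff (hb2 hy), hxM y (hb3 hy)]
    · exact heq
    · exfalso
      -- the complementary side of the wall
      have hφ' : IsDomainChart {y | 0 < φ y} x₀ (fun y => -φ y) (-νΩ) :=
        { norm_normal := by rw [norm_neg, hφ.norm_normal]
          eq_zero := by simp [hφ.eq_zero]
          approx := fun ε hε => (hφ.approx ε hε).imp fun ρ hρ => ⟨hρ.1, hρ.2.neg⟩
          mem_iff := ⟨1, one_pos, fun y _ => by
            rw [mem_ofPred_eq]; exact neg_lt_zero.symm⟩ }
      obtain ⟨κ, hκ, r₀, hr₀, hsub⟩ := hφ'.exists_ball_subset (v := τ) (by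
        rw [inner_neg_left]; linarith)
      obtain ⟨ρ, hρ, hmem⟩ := hφ.mem_iff
      obtain ⟨r₁, hr₁, hpt⟩ := hpt (κ / 2) (half_pos hκ)
      obtain ⟨r, hr0, hrr⟩ := exists_between
        (show 0 < min (min r₀ r₁) (ρ / (‖τ‖ + κ)) by positivity)
      obtain ⟨x, hx, hxr, -⟩ := hpt r hr0
        (hrr.trans_le ((min_le_left _ _).trans (min_le_right _ _)))
      have hxb : x ∈ ball (x₀ + r • τ) (κ * r) := by
        rw [mem_ball, dist_eq_norm, ← sub_sub]
        nlinarith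
      have h1 : 0 < φ x :=
        hsub r hr0 (hrr.trans_le ((min_le_left _ _).trans (min_le_left _ _))) hxb
      have hxρ : x ∈ ball x₀ ρ := by
        refine ball_subset_ball ?_ (ball_rescale_subset hr0 le_rfl hxb)
        rw [mul_comm]
        exact ((lt_div_iff₀ (by positivity)).1 (hrr.trans_le (min_le_right _ _))).le
      exact lt_asymm h1 ((hmem x hxρ).1 hx.1)
  -- hence its normal is parallel to that of the interface
  have hperp : ∀ t, ⟪ν, t⟫ = 0 → ⟪νΩ, t⟫ = 0 := by
    intro t ht
    obtain ⟨τ, hτ⟩ := hc.exists_isInward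
    have hs : ∃ s : ℝ, s ≠ 0 ∧ IsInward w ν μ (τ + s • t) := by
      have h0 : ∀ s : ℝ, ⟪ν, τ + s • t⟫ = 0 := fun s => by
        rw [inner_add_right, inner_smul_right, hτ.1, ht, mul_zero, add_zero]
      rcases hτ.2 with hpos | hw
      · refine ⟨⟪μ, τ⟫ / (2 * (|⟪μ, t⟫| + 1)), by positivity, h0 _, Or.inl ?_⟩
        rw [inner_add_right, inner_smul_right]
        have h1 : ⟪μ, τ⟫ / (2 * (|⟪μ, t⟫| + 1)) * (|⟪μ, t⟫| + 1) = ⟪μ, τ⟫ / 2 := by field_simp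
        have h2 : 0 < ⟪μ, τ⟫ / (2 * (|⟪μ, t⟫| + 1)) := by positivity
        nlinarith [neg_abs_le ⟪μ, t⟫]
      · exact ⟨1, one_ne_zero, h0 _, Or.inr hw⟩
    obtain ⟨s, hs0, hs⟩ := hs
    have h1 := htan _ hs
    rw [inner_add_right, inner_smul_right, htan τ hτ, zero_add] at h1
    exact (mul_eq_zero.1 h1).resolve_left hs0
  have heq := eq_inner_smul_of_orthogonal hc.norm_normal hperp
  have habs : |⟪ν, νΩ⟫| = 1 := by
    have := congrArg norm heq
    rwa [norm_smul, hc.norm_normal, hφ.norm_normal, mul_one, Real.norm_eq_abs, eq_comm] at this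
  rcases (abs_eq zero_le_one).1 habs with h1 | h1
  · rw [h1, one_smul] at heq
    exact h.not_thin_of_parallel hσ ha hAm hAΩ hphase hess hthin hα hb hc (heq ▸ hφ)
  · rw [h1, neg_one_smul] at heq
    exact h.not_thin_of_parallel hσ ha hAm hAΩ hphase hess hthin hα hb hc.neg (heq ▸ hφ)

end

/-! ### The blow-up of the Euler–Lagrange equation -/

theorem IsSingularKernel.rescale {s Λ : ℝ} {K : Eucl n → ℝ} (h : IsSingularKernel s Λ K) {r : ℝ}
    (hr : 0 < r) : IsSingularKernel s Λ (fun z => r ^ ((n : ℝ) + s) * K (r • z)) where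
  measurable := measurable_const.mul (h.measurable.comp (measurable_const_smul r))
  even z := by rw [smul_neg, h.even]
  bound z hz := by
    have h1 := h.bound (r • z) (smul_ne_zero hr.ne' hz)
    have hp : 0 < r ^ ((n : ℝ) + s) := Real.rpow_pos_of_pos hr _
    rw [norm_smul, Real.norm_eq_abs, abs_of_pos hr, Real.mul_rpow hr.le (norm_nonneg _),
      Real.rpow_neg hr.le] at h1
    rw [abs_mul, abs_of_pos hp]
    calc r ^ ((n : ℝ) + s) * |K (r • z)|
        ≤ r ^ ((n : ℝ) + s) * (Λ * ((r ^ ((n : ℝ) + s))⁻¹ * ‖z‖ ^ (-((n : ℝ) + s)))) := by gcongr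
      _ = Λ * ‖z‖ ^ (-((n : ℝ) + s)) := by field_simp

theorem measurableSet_blowUp {F : Set (Eucl n)} (hF : MeasurableSet F) (x₀ : Eucl n) {r : ℝ}
    (hr : r ≠ 0) : MeasurableSet (blowUp F x₀ r) := by
  have : blowUp F x₀ r = (fun y => x₀ + r • y) ⁻¹' F := by
    ext y
    exact mem_blowUp hr
  rw [this]
  exact ((measurable_const_smul r).const_add x₀) hF

theorem phase_congr {Ω E Ω' E' : Set (Eucl n)} {y y' : Eucl n} (h₁ : y ∈ E ↔ y' ∈ E')
    (h₂ : y ∈ Ω ↔ y' ∈ Ω') : phase Ω E y = phase Ω' E' y' := by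
  by_cases a : y ∈ E <;> by_cases b : y ∈ Ω
  all_goals
    have a' := a
    have b' := b
    rw [h₁] at a'
    rw [h₂] at b'
    simp [phase, a, b, a', b']

theorem phase_blowUp {Ω E : Set (Eucl n)} {x₀ y : Eucl n} {r : ℝ} (hr : r ≠ 0) :
    phase (blowUp Ω x₀ r) (blowUp E x₀ r) y = phase Ω E (x₀ + r • y) :=
  phase_congr (mem_blowUp hr) (mem_blowUp hr)

open scoped Pointwise in
/-- Change of variables `y = x₀ + r (v - z)` in the truncated curvature integral. -/
theorem rescaled_integral_eq {K : Eucl n → ℝ} {Ω E : Set (Eucl n)} {x₀ v : Eucl n} {r η s : ℝ}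
    (hr : 0 < r) : r ^ s * ∫ y in (ball (x₀ + r • v) (η * r))ᶜ,
      K (x₀ + r • v - y) * phase Ω E y = ∫ z in (ball (0 : Eucl n) η)ᶜ,
        r ^ ((n : ℝ) + s) * K (r • z) * phase (blowUp Ω x₀ r) (blowUp E x₀ r) (v - z) := by
  have h1 := setIntegral_comp_sub_left (fun z => K z * phase Ω E (x₀ + r • v - z)) (x₀ + r • v)
    (η * r)
  simp only [sub_sub_cancel] at h1
  have h2 := Measure.setIntegral_comp_smul_of_pos (volume : Measure (Eucl n))
    (fun z => K z * phase Ω E (x₀ + r • v - z)) (ball (0 : Eucl n) η)ᶜ hr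
  have h3 : r • (ball (0 : Eucl n) η)ᶜ = (ball (0 : Eucl n) (η * r))ᶜ := by
    ext y
    rw [mem_smul_set_iff_inv_smul_mem₀ hr.ne', mem_compl_iff, mem_compl_iff, mem_ball_zero_iff,
      mem_ball_zero_iff, norm_smul, norm_inv, Real.norm_eq_abs, abs_of_pos hr,
      inv_mul_lt_iff₀ hr, mul_comm]
  rw [h3, finrank_euclideanSpace_fin, smul_eq_mul, eq_inv_mul_iff_mul_eq₀ (by positivity)] at h2
  rw [h1, ← h2, ← mul_assoc, ← integral_const_mul]
  congr 1
  funext z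
  have h4 : x₀ + r • v - r • z = x₀ + r • (v - z) := by module
  rw [phase_blowUp hr.ne', h4, Real.rpow_add hr, Real.rpow_natCast]
  ring

theorem abs_phase_sub_le {Ω E Ω' E' : Set (Eucl n)} (y : Eucl n) :
    |(phase Ω E y - phase Ω' E' y) / 2| ≤ 1 := by
  have h1 := abs_le.1 (abs_phase_le Ω E y)
  have h2 := abs_le.1 (abs_phase_le Ω' E' y)
  rw [abs_le]
  constructor <;> linarith [h1.1, h1.2, h2.1, h2.2]

/-- Convergence of the rescaled truncated curvatures. -/
theorem tendsto_rescaled_integral {s Λ : ℝ} (hs : 0 < s) {K Ks : Eucl n → ℝ}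
    (hK : IsSingularKernel s Λ K) (hΛ : 0 ≤ Λ) (hKs : IsBlowUpLimit s K Ks) {Ω E H W : Set (Eucl n)}
    (hΩ : MeasurableSet Ω) (hE : MeasurableSet E) (hH : MeasurableSet H) (hW : MeasurableSet W)
    {x₀ v : Eucl n} (hΩH : BlowUpTendsto Ω x₀ H) (hEW : BlowUpTendsto E x₀ W) {r : ℕ → ℝ}
    (hr0 : ∀ j, 0 < r j) (hr : Tendsto r atTop (𝓝 0)) {ω : ℕ → Eucl n}
    (hω : Tendsto ω atTop (𝓝 v))
    (hcont : ∀ᵐ z : Eucl n, ∀ᶠ y in 𝓝 (v - z), phase H W y = phase H W (v - z)) {η : ℝ}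
    (hη : 0 < η) :
    Tendsto (fun j => ∫ z in (ball (0 : Eucl n) η)ᶜ, r j ^ ((n : ℝ) + s) * K (r j • z) *
      phase (blowUp Ω x₀ (r j)) (blowUp E x₀ (r j)) (ω j - z)) atTop
      (𝓝 (∫ z in (ball (0 : Eucl n) η)ᶜ, Ks z * phase H W (v - z))) := by
  have hr' : Tendsto r atTop (𝓝[>] 0) := tendsto_nhdsWithin_iff.2 ⟨hr, Eventually.of_forall hr0⟩
  set k : ℕ → Eucl n → ℝ := fun j z => r j ^ ((n : ℝ) + s) * K (r j • z) with hk
  have hkS : ∀ j, IsSingularKernel s Λ (k j) := fun j => hK.rescale (hr0 j)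
  have hki := fun j => (hkS j).integrableOn_compl_ball hs hη
  set Ψ := phase H W with hΨ
  set G : ℕ → Eucl n → ℝ := fun j => phase (blowUp Ω x₀ (r j)) (blowUp E x₀ (r j)) with hG
  have hΩm := fun j => measurableSet_blowUp hΩ x₀ (hr0 j).ne'
  have hEm := fun j => measurableSet_blowUp hE x₀ (hr0 j).ne'
  obtain ⟨C₃, -, hC₃⟩ := exists_tail_bound (n := n) hs
  obtain ⟨C, hC, htail⟩ := exists_abs_setIntegral_compl_ball_le (n := n) hs
  -- the sets are replaced by their limits at the cost of an error that vanishes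
  have hdiff : Tendsto
      (fun j => ∫ z in (ball (0 : Eucl n) η)ᶜ, k j z * (G j (ω j - z) - Ψ (ω j - z)))
      atTop (𝓝 0) := by
    rw [Metric.tendsto_nhds]
    intro ε hε
    obtain ⟨R, hRη, hR⟩ : ∃ R, η ≤ R ∧ 2 * (Λ * C * R ^ (-s)) < ε / 2 := by
      have h1 : Tendsto (fun R : ℝ => 2 * (Λ * C * R ^ (-s))) atTop (𝓝 0) := by
        simpa using ((tendsto_rpow_neg_atTop hs).const_mul (Λ * C)).const_mul 2
      obtain ⟨R, h2, h3⟩ := ((h1.eventually (gt_mem_nhds (half_pos hε))).and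
        (eventually_ge_atTop η)).exists
      exact ⟨R, h3, h2⟩
    have hR0 : 0 < R := hη.trans_le hRη
    set R' := R + ‖v‖ + 1 with hR'
    have hR'0 : 0 < R' := by positivity
    set D : ℕ → Set (Eucl n) := fun j => symmDiff (blowUp Ω x₀ (r j)) H ∩ ball 0 R' ∪
      symmDiff (blowUp E x₀ (r j)) W ∩ ball 0 R' with hD
    have hDm : ∀ j, MeasurableSet (D j) := fun j =>
      (((hΩm j).symmDiff hH).inter measurableSet_ball).union
        (((hEm j).symmDiff hW).inter measurableSet_ball)
    set N := Λ * η ^ (-((n : ℝ) + s)) * 2 with hN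
    have hN0 : 0 ≤ N := by positivity
    have hvol : Tendsto (fun j => N * (volume (D j)).toReal) atTop (𝓝 0) := by
      have h1 : Tendsto (fun j => volume (D j)) atTop (𝓝 0) := by
        have h2 := ((hΩH R' hR'0).comp hr').add ((hEW R' hR'0).comp hr')
        rw [add_zero] at h2
        exact tendsto_of_tendsto_of_tendsto_of_le_of_le tendsto_const_nhds h2
          (fun _ => zero_le) (fun j => measure_union_le _ _)
      have h3 := (ENNReal.tendsto_toReal ENNReal.zero_ne_top).comp h1
      simpa using h3.const_mul N
    have hDfin : ∀ j, volume (D j) < ∞ := fun j =>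
      (measure_mono (union_subset inter_subset_right inter_subset_right)).trans_lt
        (measure_ball_lt_top (x := (0 : Eucl n)) (r := R'))
    have hωv : ∀ᶠ j in atTop, ‖ω j‖ < ‖v‖ + 1 :=
      hω.norm.eventually (gt_mem_nhds (by linarith))
    filter_upwards [hvol.eventually (gt_mem_nhds (half_pos hε)), hωv] with j hj hωj
    rw [Real.dist_eq, sub_zero]
    set f : Eucl n → ℝ := fun z => k j z * (G j (ω j - z) - Ψ (ω j - z)) with hf
    have hfi : IntegrableOn f (ball (0 : Eucl n) η)ᶜ := by
      simp only [hf, mul_sub]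
      exact (integrable_mul_phase (hΩm j) (hEm j) (hki j) (ω j)).sub
        (integrable_mul_phase hH hW (hki j) (ω j))
    set S := ball (0 : Eucl n) R \ ball 0 η with hS
    have hSm : MeasurableSet S := measurableSet_ball.diff measurableSet_ball
    have hsplit : ∫ z in (ball (0 : Eucl n) η)ᶜ, f z =
        (∫ z in S, f z) + ∫ z in (ball (0 : Eucl n) R)ᶜ, f z := by
      have hsub : (ball (0 : Eucl n) R)ᶜ ⊆ (ball (0 : Eucl n) η)ᶜ :=
        compl_subset_compl.2 (ball_subset_ball hRη)
      have h2 : (ball (0 : Eucl n) η)ᶜ = S ∪ (ball (0 : Eucl n) R)ᶜ := by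
        ext y
        simp only [hS, mem_union, Set.mem_sdiff, mem_compl_iff]
        have := @hsub y
        simp only [mem_compl_iff] at this
        tauto
      rw [h2]
      exact setIntegral_union (Set.disjoint_left.2 fun y hy hy' => hy' hy.1)
        measurableSet_ball.compl (hfi.mono_set fun y hy => hy.2) (hfi.mono_set hsub)
    have hfar : |∫ z in (ball (0 : Eucl n) R)ᶜ, f z| ≤ 2 * (Λ * C * R ^ (-s)) := by
      have h1 := setIntegral_comp_sub_left
        (fun z => k j z * ((G j (ω j - z) - Ψ (ω j - z)) / 2)) (ω j) R
      simp only [sub_sub_cancel] at h1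
      have h2 := htail Λ (k j) (fun y => (G j y - Ψ y) / 2) (hkS j) hΛ
        (fun y => abs_phase_sub_le y) (ω j) R hR0
      rw [h1] at h2
      have h3 : ∫ z in (ball (0 : Eucl n) R)ᶜ, f z =
          2 * ∫ z in (ball (0 : Eucl n) R)ᶜ, k j z * ((G j (ω j - z) - Ψ (ω j - z)) / 2) := by
        rw [← integral_const_mul]
        congr 1
        funext z
        simp only [hf]
        ring
      rw [h3, abs_mul, abs_two]
      linarith
    have hnear : |∫ z in S, f z| ≤ N * (volume (D j)).toReal := by
      set P := (fun z => ω j - z) ⁻¹' D j with hP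
      have hPvol : volume P = volume (D j) :=
        (Measure.measurePreserving_sub_left volume (ω j)).measure_preimage (hDm j).nullMeasurableSet
      have hzero : ∀ z ∈ S \ (S ∩ P), f z = 0 := by
        intro z hz
        have hzP : ω j - z ∉ D j := fun h => hz.2 ⟨hz.1, h⟩
        have hzb : ω j - z ∈ ball (0 : Eucl n) R' := by
          rw [mem_ball_zero_iff]
          have h1 := norm_sub_le (ω j) z
          have h2 := mem_ball_zero_iff.1 hz.1.1
          linarith
        have h1 : ω j - z ∈ blowUp Ω x₀ (r j) ↔ ω j - z ∈ H := by
          by_contra hcon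
          refine hzP (Or.inl ⟨?_, hzb⟩)
          rw [Set.mem_symmDiff]
          tauto
        have h2 : ω j - z ∈ blowUp E x₀ (r j) ↔ ω j - z ∈ W := by
          by_contra hcon
          refine hzP (Or.inr ⟨?_, hzb⟩)
          rw [Set.mem_symmDiff]
          tauto
        have h3 : G j (ω j - z) = Ψ (ω j - z) := phase_congr h2 h1
        simp only [hf, h3, sub_self, mul_zero]
      have hle : volume (S ∩ P) ≤ volume (D j) := hPvol ▸ measure_mono inter_subset_right
      rw [setIntegral_eq_of_subset_of_forall_sdiff_eq_zero (μ := volume) hSm inter_subset_left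
        hzero]
      have h1 := norm_setIntegral_le_of_norm_le_const (μ := volume) (s := S ∩ P) (f := f) (C := N)
        (hle.trans_lt (hDfin j)) (fun z hz => by
          have hz0 : z ≠ 0 := by
            rintro rfl
            exact hz.1.2 (mem_ball_self hη)
          have hzη : η ≤ ‖z‖ := not_lt.1 fun h => hz.1.2 (mem_ball_zero_iff.2 h)
          have h2 := (hkS j).bound z hz0
          have h3 : ‖z‖ ^ (-((n : ℝ) + s)) ≤ η ^ (-((n : ℝ) + s)) :=
            Real.rpow_le_rpow_of_nonpos hη hzη (by
              have : (0 : ℝ) ≤ n := Nat.cast_nonneg n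
              linarith)
          have h4 : |G j (ω j - z) - Ψ (ω j - z)| ≤ 2 := by
            have h5 : |(G j (ω j - z) - Ψ (ω j - z)) / 2| ≤ 1 := abs_phase_sub_le (ω j - z)
            rw [abs_div, abs_two] at h5
            linarith
          rw [Real.norm_eq_abs, abs_mul]
          exact mul_le_mul (h2.trans (mul_le_mul_of_nonneg_left h3 hΛ)) h4 (abs_nonneg _)
            (by positivity))
      rw [Real.norm_eq_abs] at h1
      exact h1.trans (mul_le_mul_of_nonneg_left
        (ENNReal.toReal_mono (hDfin j).ne hle) hN0)
    rw [hsplit]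
    exact (abs_add_le _ _).trans_lt (by linarith)
  -- dominated convergence for the limit sets
  have hlim : Tendsto (fun j => ∫ z in (ball (0 : Eucl n) η)ᶜ, k j z * Ψ (ω j - z)) atTop
      (𝓝 (∫ z in (ball (0 : Eucl n) η)ᶜ, Ks z * Ψ (v - z))) := by
    refine tendsto_integral_of_dominated_convergence (fun z => Λ * ‖z‖ ^ (-((n : ℝ) + s)))
      (fun j => (integrable_mul_phase hH hW (hki j) (ω j)).aestronglyMeasurable)
      ((hC₃ η hη).1.const_mul Λ) (fun j => ?_) ?_
    · filter_upwards [ae_restrict_mem measurableSet_ball.compl] with z hz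
      have hz0 : z ≠ 0 := by
        rintro rfl
        exact hz (mem_ball_self hη)
      rw [Real.norm_eq_abs, abs_mul]
      exact (mul_le_of_le_one_right (abs_nonneg _) (abs_phase_le _ _ _)).trans ((hkS j).bound z hz0)
    · filter_upwards [ae_restrict_mem measurableSet_ball.compl, ae_restrict_of_ae hcont]
        with z hz hc
      have hz0 : z ≠ 0 := by
        rintro rfl
        exact hz (mem_ball_self hη)
      refine ((hKs z hz0).comp hr').mul (tendsto_const_nhds.congr' ?_)
      filter_upwards [(hω.sub_const z).eventually hc] with j hj using hj.symm
  have hsum := hdiff.add hlim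
  rw [zero_add] at hsum
  refine hsum.congr fun j => ?_
  have i1 : IntegrableOn (fun z => k j z * (G j (ω j - z) - Ψ (ω j - z)))
      (ball (0 : Eucl n) η)ᶜ := by
    simp only [mul_sub]
    exact (integrable_mul_phase (hΩm j) (hEm j) (hki j) (ω j)).sub
      (integrable_mul_phase hH hW (hki j) (ω j))
  rw [← integral_add i1 (integrable_mul_phase hH hW (hki j) (ω j))]
  congr 1
  funext z
  simp only [hk, hG]
  ring

section

variable {s₁ s₂ lam σ : ℝ} {rad : ℝ≥0∞} {K₁ K₂ g : Eucl n → ℝ} {Ω E : Set (Eucl n)}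

theorem volume_orthogonal_eq_zero {q : Eucl n} (hq : q ≠ 0) :
    volume {x : Eucl n | ⟪q, x⟫ = 0} = 0 := by
  have h1 : {x : Eucl n | ⟪q, x⟫ = 0} = ((innerSL ℝ q).ker : Set (Eucl n)) := by
    ext x
    simp
  rw [h1]
  refine Measure.addHaar_submodule _ _ fun htop => hq ?_
  have h2 : q ∈ (innerSL ℝ q).ker := htop ▸ Submodule.mem_top
  simpa using h2

theorem isOpen_inner_pos (q : Eucl n) : IsOpen {x : Eucl n | 0 < ⟪q, x⟫} :=
  isOpen_lt continuous_const (continuous_const.inner continuous_id)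

/-- The phase function of a wedge is locally constant off the two hyperplanes that bound it. -/
theorem ae_eventually_phase_eq {q m : Eucl n} (hq : q ≠ 0) (hm : m ≠ 0) (v : Eucl n) :
    ∀ᵐ z : Eucl n, ∀ᶠ y in 𝓝 (v - z),
      phase {x | 0 < ⟪q, x⟫} {x | 0 < ⟪q, x⟫ ∧ 0 < ⟪m, x⟫} y =
        phase {x | 0 < ⟪q, x⟫} {x | 0 < ⟪q, x⟫ ∧ 0 < ⟪m, x⟫} (v - z) := by
  have hloc : ∀ (e x : Eucl n), ⟪e, x⟫ ≠ 0 → ∀ᶠ y in 𝓝 x, (0 < ⟪e, y⟫ ↔ 0 < ⟪e, x⟫) := by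
    intro e x hx
    have hc : Tendsto (fun y : Eucl n => ⟪e, y⟫) (𝓝 x) (𝓝 ⟪e, x⟫) :=
      (continuous_const.inner continuous_id).tendsto x
    rcases lt_or_gt_of_ne hx with h | h
    · filter_upwards [hc.eventually (gt_mem_nhds h)] with y hy
      exact ⟨fun h' => absurd h' hy.not_gt, fun h' => absurd h' h.not_gt⟩
    · filter_upwards [hc.eventually (lt_mem_nhds h)] with y hy
      exact ⟨fun _ => h, fun _ => hy⟩
  have hnull : ∀ e : Eucl n, e ≠ 0 → ∀ᵐ z : Eucl n, ⟪e, v - z⟫ ≠ 0 := by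
    intro e he
    have h1 := (Measure.measurePreserving_sub_left volume v).quasiMeasurePreserving.ae
      (p := fun y => ⟪e, y⟫ ≠ 0) (by
        rw [ae_iff]
        simpa using volume_orthogonal_eq_zero he)
    exact h1
  filter_upwards [hnull q hq, hnull m hm] with z h1 h2
  filter_upwards [hloc q _ h1, hloc m _ h2] with y h3 h4
  exact phase_congr (and_congr h3 h4) h3

/-- The limit equation: at the points of the limit interface the truncated curvature of the
tangent wedge, relative to the tangent half-space, vanishes.  The bounded multiplier disappears in
the scaling, and so does the adhesion term if it is absent or of lower order. -/
theorem IsCapillarityProblem.integral_blowUp_eq_zero [NeZero n]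
    (h : IsCapillarityProblem s₁ s₂ lam rad σ K₁ K₂ g Ω E) (hσ : σ = 0 ∨ s₂ < s₁) {x₀ : Eucl n}
    (hx₀ : x₀ ∈ regularSet s₁ Ω E ∩ frontier Ω) {q m : Eucl n} (hq : ‖q‖ = 1) (hm : ‖m‖ = 1)
    (hΩH : BlowUpTendsto Ω x₀ {x | 0 < ⟪q, x⟫})
    (hEW : BlowUpTendsto E x₀ {x | 0 < ⟪q, x⟫ ∧ 0 < ⟪m, x⟫}) {Ks : Eucl n → ℝ}
    (hKs : IsBlowUpLimit s₁ K₁ Ks) {v : Eucl n} (hqv : 0 < ⟪q, v⟫) (hmv : ⟪m, v⟫ = 0) :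
    ∃ η₀ > 0, ∀ η, 0 < η → η ≤ η₀ → ∫ z in (ball (0 : Eucl n) η)ᶜ,
      Ks z * phase {x | 0 < ⟪q, x⟫} {x | 0 < ⟪q, x⟫ ∧ 0 < ⟪m, x⟫} (v - z) = 0 := by
  obtain ⟨α, hα, b, hb, u, w, ν, μ, hc⟩ := exists_contactChart h.s₁_mem.1 hx₀.1
  obtain ⟨φ, νΩ, hφ⟩ := h.boundary.exists_chart h.isOpen hx₀.2
  obtain rfl := hφ.normal_eq hq hΩH
  have hin : IsInward w ν μ v := hc.isInward_of_limits hm (fun v' h1 h2 η hη => by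
    filter_upwards [exists_mem_essBoundary hφ hm hEW h1 h2 hη] with r hr
    obtain ⟨x, hx, hxr⟩ := hr
    exact ⟨x, subset_closure hx, hxr⟩) hqv hmv
  obtain ⟨c, hc0, C, hC, hpts⟩ := h.exists_contact_estimate hα hb hc hin
  obtain ⟨κ, hκ, r₁, hr₁, hsub⟩ := hφ.exists_ball_subset (v := v) (by
    rw [inner_neg_left]; linarith)
  obtain ⟨B, hB, hwall⟩ := exists_abs_wallPotential_le (n := n) h.s₂_mem.1
  have hΩm := h.isOpen.measurableSet
  have hEm := h.critical.measurableSet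
  set D := |σ| * (lam * B * (κ / 2) ^ (-s₂)) with hD
  set T : ℝ → ℝ := fun r => C * r ^ s₁ + D * r ^ (s₁ - s₂) with hT
  have hT0 : Tendsto T (𝓝[>] 0) (𝓝 0) := by
    have h1 := (tendsto_rpow_zero h.s₁_mem.1).const_mul C
    rcases hσ with h0 | h0
    · simpa [hT, hD, h0] using h1
    · simpa using h1.add ((tendsto_rpow_zero (sub_pos.2 h0)).const_mul D)
  refine ⟨min (c / 2) (κ / 4), by positivity, fun η hη hηle => ?_⟩
  have hηc : 2 * η ≤ c := by linarith [hηle.trans (min_le_left _ _)]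
  have hηκ : 2 * η ≤ κ / 2 := by linarith [hηle.trans (min_le_right _ _)]
  -- points of the interface near `x₀ + r v`
  have hseq : ∀ j : ℕ, ∃ r : ℝ, 0 < r ∧ r < 1 / ((j : ℝ) + 1) ∧ ∃ ω : Eucl n,
      ‖ω - v‖ ≤ 1 / ((j : ℝ) + 1) ∧ |r ^ s₁ * ∫ y in (ball (x₀ + r • ω) (η * r))ᶜ,
        K₁ (x₀ + r • ω - y) * phase Ω E y| ≤ T r := by
    intro j
    obtain ⟨r₀, hr₀, hpt⟩ := hpts (min (κ / 2) (1 / ((j : ℝ) + 1))) (by positivity)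
    obtain ⟨r, hr0, hr⟩ := exists_between
      (show 0 < min (min r₀ r₁) (1 / ((j : ℝ) + 1)) by positivity)
    obtain ⟨x, hx, hxr, -, hest⟩ := hpt r hr0 (hr.trans_le ((min_le_left _ _).trans
      (min_le_left _ _)))
    refine ⟨r, hr0, hr.trans_le (min_le_right _ _), r⁻¹ • (x - x₀), ?_, ?_⟩
    · have h1 : r⁻¹ • (x - x₀) - v = r⁻¹ • (x - x₀ - r • v) := by
        rw [smul_sub r⁻¹ (x - x₀), inv_smul_smul₀ hr0.ne']
      rw [h1, norm_smul, norm_inv, Real.norm_eq_abs, abs_of_pos hr0, inv_mul_le_iff₀ hr0, mul_comm]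
      exact hxr.trans (mul_le_mul_of_nonneg_right (min_le_right _ _) hr0.le)
    · have h1 : x₀ + r • r⁻¹ • (x - x₀) = x := by
        rw [smul_inv_smul₀ hr0.ne']; abel
      rw [h1]
      have hxκ : ‖x - x₀ - r • v‖ ≤ κ / 2 * r :=
        hxr.trans (mul_le_mul_of_nonneg_right (min_le_left _ _) hr0.le)
      have hball : ball x (κ / 2 * r) ⊆ Ω := by
        refine Subset.trans (fun y hy => ?_) (hsub r hr0 (hr.trans_le ((min_le_left _ _).trans
          (min_le_right _ _))))
        rw [mem_ball, dist_eq_norm] at hy ⊢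
        have h2 : y - (x₀ + r • v) = (y - x) + (x - x₀ - r • v) := by abel
        rw [h2]
        exact (norm_add_le _ _).trans_lt (by linarith)
      have e1 := hest (η * r) (by positivity) (by nlinarith)
        ((ball_subset_ball (by nlinarith)).trans hball)
      have e2 := hwall lam K₂ h.kernel₂.isSingularKernel h.lam_pos.le Ω hΩm x (κ / 2 * r)
        (by positivity) hball
      rw [Real.mul_rpow (by positivity) hr0.le] at e2
      set J := ∫ y in (ball x (η * r))ᶜ, K₁ (x - y) * phase Ω E y with hJ
      have e3 : |J| ≤ C + D * r ^ (-s₂) := by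
        have h2 : |J| ≤ |J + σ * wallPotential K₂ Ω x| + |σ * wallPotential K₂ Ω x| := by
          have := abs_sub (J + σ * wallPotential K₂ Ω x) (σ * wallPotential K₂ Ω x)
          rwa [add_sub_cancel_right] at this
        have h3 : |σ * wallPotential K₂ Ω x| ≤ D * r ^ (-s₂) := by
          rw [abs_mul, hD]
          calc |σ| * |wallPotential K₂ Ω x|
              ≤ |σ| * (lam * B * ((κ / 2) ^ (-s₂) * r ^ (-s₂))) := by gcongr
            _ = _ := by ring
        linarith
      have hp : 0 < r ^ s₁ := Real.rpow_pos_of_pos hr0 _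
      rw [abs_mul, abs_of_pos hp]
      calc r ^ s₁ * |J| ≤ r ^ s₁ * (C + D * r ^ (-s₂)) := by gcongr
        _ = T r := by
          simp only [hT]
          rw [sub_eq_add_neg, Real.rpow_add hr0]
          ring
  choose r hr0 hr ω hω hJ using hseq
  have hdec : Tendsto (fun j : ℕ => 1 / ((j : ℝ) + 1)) atTop (𝓝 0) :=
    tendsto_one_div_add_atTop_nhds_zero_nat
  have hrlim : Tendsto r atTop (𝓝 0) :=
    squeeze_zero (fun j => (hr0 j).le) (fun j => (hr j).le) hdec
  have hωlim : Tendsto ω atTop (𝓝 v) :=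
    tendsto_iff_norm_sub_tendsto_zero.2 (squeeze_zero (fun _ => norm_nonneg _) hω hdec)
  have hq0 : q ≠ 0 := norm_ne_zero_iff.1 (by rw [hq]; exact one_ne_zero)
  have hm0 : m ≠ 0 := norm_ne_zero_iff.1 (by rw [hm]; exact one_ne_zero)
  have hlim := tendsto_rescaled_integral h.s₁_mem.1 h.kernel₁.isSingularKernel h.lam_pos.le hKs
    hΩm hEm (isOpen_inner_pos q).measurableSet
    ((isOpen_inner_pos q).inter (isOpen_inner_pos m)).measurableSet hΩH hEW hr0 hrlim hωlim
    (ae_eventually_phase_eq hq0 hm0 v) hη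
  -- The rescaled equation has right-hand side `O(r ^ s₁) + O(r ^ (s₁ - s₂))`, without the second
  -- term if `σ = 0`.
  refine tendsto_nhds_unique hlim ?_
  have hTr : Tendsto (fun j => T (r j)) atTop (𝓝 0) :=
    hT0.comp (tendsto_nhdsWithin_iff.2 ⟨hrlim, Eventually.of_forall hr0⟩)
  refine squeeze_zero_norm (fun j => ?_) hTr
  rw [Real.norm_eq_abs, ← rescaled_integral_eq (hr0 j)]
  exact hJ j

end

/-! ### Wedges -/

/-- Polar coordinates with the angle in a prescribed half-open period. -/
theorem exists_polar_coord (a b θ : ℝ) (hab : a ≠ 0 ∨ b ≠ 0) :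
    ∃ ρ > 0, ∃ β ∈ Ioc θ (θ + 2 * Real.pi), a = ρ * Real.cos β ∧ b = ρ * Real.sin β := by
  set z : ℂ := ⟨a, b⟩ with hz
  have hz0 : z ≠ 0 := by
    intro h0
    have h1 := congrArg Complex.re h0
    have h2 := congrArg Complex.im h0
    simp only [hz, Complex.zero_re, Complex.zero_im] at h1 h2
    tauto
  refine ⟨‖z‖, norm_pos_iff.2 hz0, toIocMod Real.two_pi_pos θ z.arg, toIocMod_mem_Ioc _ _ _, ?_⟩
  have h1 : toIocMod Real.two_pi_pos θ z.arg =
      z.arg - (toIocDiv Real.two_pi_pos θ z.arg : ℤ) * (2 * Real.pi) := by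
    rw [toIocMod, zsmul_eq_mul]
  rw [h1, Real.cos_sub_int_mul_two_pi, Real.sin_sub_int_mul_two_pi, Complex.cos_arg hz0,
    Complex.sin_arg]
  have : ‖z‖ ≠ 0 := norm_ne_zero_iff.2 hz0
  constructor <;> field_simp <;> rfl

/-- The unit vector `sin θ p - cos θ q`, the normal of the half-plane at angle `θ` that points
towards smaller angles. -/
def unitNormal (p q : Eucl n) (θ : ℝ) : Eucl n := Real.sin θ • p - Real.cos θ • q

theorem inner_unitNormal {p q x : Eucl n} (θ : ℝ) :
    ⟪unitNormal p q θ, x⟫ = Real.sin θ * ⟪p, x⟫ - Real.cos θ * ⟪q, x⟫ := by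
  rw [unitNormal, inner_sub_left, real_inner_smul_left, real_inner_smul_left]

theorem inner_unitNormal_polar {p q x : Eucl n} {ρ β : ℝ} (hp : ⟪p, x⟫ = ρ * Real.cos β)
    (hq : ⟪q, x⟫ = ρ * Real.sin β) (θ : ℝ) : ⟪unitNormal p q θ, x⟫ = ρ * Real.sin (θ - β) := by
  rw [inner_unitNormal, hp, hq, Real.sin_sub]
  ring

theorem unitNormal_zero (p q : Eucl n) : unitNormal p q 0 = -q := by
  simp [unitNormal]

theorem unitNormal_pi (p q : Eucl n) : unitNormal p q Real.pi = q := by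
  simp [unitNormal]

/-- A wedge of opening at most `π` is an intersection of two half-spaces. -/
theorem mem_wedge_iff {p q x : Eucl n} {θ₁ θ₂ : ℝ} (h₁ : θ₁ ≤ θ₂) (h₂ : θ₂ ≤ θ₁ + Real.pi) :
    x ∈ wedge p q θ₁ θ₂ ↔ ⟪unitNormal p q θ₁, x⟫ < 0 ∧ 0 < ⟪unitNormal p q θ₂, x⟫ := by
  constructor
  · rintro ⟨β, hβ, ρ, hρ, hp, hq⟩
    rw [inner_unitNormal_polar hp hq, inner_unitNormal_polar hp hq]
    have h3 : Real.sin (θ₁ - β) < 0 :=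
      Real.sin_neg_of_neg_of_neg_pi_lt (by linarith [hβ.1]) (by linarith [hβ.2])
    have h4 : 0 < Real.sin (θ₂ - β) :=
      Real.sin_pos_of_pos_of_lt_pi (by linarith [hβ.2]) (by linarith [hβ.1])
    exact ⟨mul_neg_of_pos_of_neg hρ h3, mul_pos hρ h4⟩
  · rintro ⟨h3, h4⟩
    have hne : ⟪p, x⟫ ≠ 0 ∨ ⟪q, x⟫ ≠ 0 := by
      by_contra hcon
      push Not at hcon
      rw [inner_unitNormal, hcon.1, hcon.2] at h3
      simp at h3
    obtain ⟨ρ, hρ, β, hβ, hp, hq⟩ := exists_polar_coord ⟪p, x⟫ ⟪q, x⟫ θ₁ hne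
    rw [inner_unitNormal_polar hp hq] at h3 h4
    have h5 : Real.sin (θ₁ - β) < 0 := neg_of_mul_neg_right h3 hρ.le
    have h6 : 0 < Real.sin (θ₂ - β) := (mul_pos_iff_of_pos_left hρ).1 h4
    have h7 : β < θ₁ + Real.pi := by
      by_contra hcon
      push Not at hcon
      have h8 : 0 ≤ Real.sin (θ₁ - β + 2 * Real.pi) :=
        Real.sin_nonneg_of_nonneg_of_le_pi (by linarith [hβ.2]) (by linarith)
      rw [Real.sin_add_two_pi] at h8
      linarith
    refine ⟨β, ⟨hβ.1, ?_⟩, ρ, hρ, hp, hq⟩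
    by_contra hcon
    push Not at hcon
    have h8 : Real.sin (θ₂ - β) ≤ 0 :=
      Real.sin_nonpos_of_nonpos_of_neg_pi_le (by linarith) (by linarith)
    linarith

theorem isOpen_wedge (p q : Eucl n) (a b : ℝ) : IsOpen (wedge p q a b) := by
  have hsmall : ∀ c d : ℝ, c ≤ d → d ≤ c + Real.pi → IsOpen (wedge p q c d) := by
    intro c d h1 h2
    have h3 : wedge p q c d =
        {x | 0 < ⟪-unitNormal p q c, x⟫} ∩ {x | 0 < ⟪unitNormal p q d, x⟫} := by
      ext x
      rw [mem_wedge_iff h1 h2, mem_inter_iff, mem_ofPred_eq, mem_ofPred_eq, inner_neg_left,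
        neg_pos]
    rw [h3]
    exact (isOpen_inner_pos _).inter (isOpen_inner_pos _)
  -- A general wedge is a union of small ones.
  rw [isOpen_iff_forall_mem_open]
  rintro x ⟨β, hβ, ρ, hρ, hx⟩
  have hπ := Real.pi_pos
  have h1 := hβ.1
  have h2 := hβ.2
  refine ⟨wedge p q (max a (β - 1)) (min b (β + 1)), ?_, hsmall _ _ ?_ ?_, β, ⟨?_, ?_⟩, ρ, hρ, hx⟩
  · rintro y ⟨β', hβ', hy⟩
    exact ⟨β', ⟨(le_max_left _ _).trans_lt hβ'.1, hβ'.2.trans_le (min_le_left _ _)⟩, hy⟩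
  · exact (max_lt h1 (by linarith)).le.trans (lt_min h2 (by linarith)).le
  · have h3 := le_max_right a (β - 1)
    have h4 := min_le_right b (β + 1)
    linarith [Real.pi_gt_three]
  · exact max_lt h1 (by linarith)
  · exact lt_min h2 (by linarith)

theorem wedge_mono {p q : Eucl n} {a b a' b' : ℝ} (ha : a' ≤ a) (hb : b ≤ b') :
    wedge p q a b ⊆ wedge p q a' b' := by
  rintro x ⟨β, hβ, hx⟩
  exact ⟨β, ⟨ha.trans_lt hβ.1, hβ.2.trans_le hb⟩, hx⟩

/-- Consecutive wedges of total opening at most `2π` are disjoint. -/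
theorem disjoint_wedge {p q : Eucl n} {a b c : ℝ} (hc : c ≤ a + 2 * Real.pi) :
    Disjoint (wedge p q a b) (wedge p q b c) := by
  rw [Set.disjoint_left]
  rintro x ⟨β, hβ, ρ, hρ, h1, h2⟩ ⟨β', hβ', ρ', hρ', h3, h4⟩
  rw [h1] at h3
  rw [h2] at h4
  have e1 := Real.sin_sq_add_cos_sq β
  have e2 := Real.sin_sq_add_cos_sq β'
  have e3 : ρ ^ 2 = ρ' ^ 2 := by
    calc ρ ^ 2 = (ρ * Real.cos β) ^ 2 + (ρ * Real.sin β) ^ 2 := by linear_combination -ρ ^ 2 * e1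
      _ = ρ' ^ 2 := by rw [h3, h4]; linear_combination ρ' ^ 2 * e2
  obtain rfl : ρ = ρ' := (sq_eq_sq₀ hρ.le hρ'.le).1 e3
  have e4 : Real.cos (β' - β) = 1 := by
    rw [Real.cos_sub, ← mul_left_cancel₀ hρ.ne' h3, ← mul_left_cancel₀ hρ.ne' h4]
    linarith
  have e5 := (Real.cos_eq_one_iff_of_lt_of_lt (by linarith [hβ.2, hβ'.1, Real.pi_pos])
    (by linarith [hβ.1, hβ'.2])).1 e4
  linarith [hβ.2, hβ'.1]

theorem wedge_self (p q : Eucl n) (a : ℝ) : wedge p q a a = ∅ := by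
  ext x
  simp [wedge]

theorem inner_of_orthonormal {p q : Eucl n} (h : Orthonormal ℝ ![p, q]) :
    ⟪p, p⟫ = 1 ∧ ⟪q, q⟫ = 1 ∧ ⟪p, q⟫ = 0 ∧ ⟪q, p⟫ = 0 := by
  have h0 : ‖p‖ = 1 := h.1 0
  have h1 : ‖q‖ = 1 := h.1 1
  have h2 : ⟪p, q⟫ = 0 := h.2 (show (0 : Fin 2) ≠ 1 by decide)
  refine ⟨?_, ?_, h2, ?_⟩
  · rw [real_inner_self_eq_norm_sq, h0, one_pow]
  · rw [real_inner_self_eq_norm_sq, h1, one_pow]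
  · rw [real_inner_comm, h2]

theorem norm_unitNormal {p q : Eucl n} (h : Orthonormal ℝ ![p, q]) (θ : ℝ) :
    ‖unitNormal p q θ‖ = 1 := by
  obtain ⟨hpp, hqq, hpq, hqp⟩ := inner_of_orthonormal h
  have h1 : ‖unitNormal p q θ‖ ^ 2 = 1 := by
    rw [← real_inner_self_eq_norm_sq, inner_unitNormal, unitNormal, inner_sub_right,
      inner_sub_right, real_inner_smul_right, real_inner_smul_right, real_inner_smul_right,
      real_inner_smul_right, hpp, hqq, hpq, hqp]
    linear_combination Real.sin_sq_add_cos_sq θ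
  exact (sq_eq_sq₀ (norm_nonneg _) zero_le_one).1 (by rw [h1, one_pow])

theorem inner_unitVec {p q : Eucl n} (h : Orthonormal ℝ ![p, q]) (θ : ℝ) :
    ⟪p, unitVec p q θ⟫ = Real.cos θ ∧ ⟪q, unitVec p q θ⟫ = Real.sin θ := by
  obtain ⟨hpp, hqq, hpq, hqp⟩ := inner_of_orthonormal h
  constructor <;>
  · rw [unitVec, inner_add_right, real_inner_smul_right, real_inner_smul_right]
    simp only [hpp, hqq, hpq, hqp, mul_one, mul_zero, add_zero, zero_add]

theorem smul_unitVec_mem_wedge {p q : Eucl n} (h : Orthonormal ℝ ![p, q]) {a b β R : ℝ}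
    (hβ : β ∈ Ioo a b) (hR : 0 < R) : R • unitVec p q β ∈ wedge p q a b := by
  obtain ⟨h1, h2⟩ := inner_unitVec h β
  exact ⟨β, hβ, R, hR, by rw [real_inner_smul_right, h1], by rw [real_inner_smul_right, h2]⟩

theorem norm_unitVec {p q : Eucl n} (h : Orthonormal ℝ ![p, q]) (θ : ℝ) :
    ‖unitVec p q θ‖ = 1 := by
  obtain ⟨h1, h2⟩ := inner_unitVec h θ
  have h3 : ‖unitVec p q θ‖ ^ 2 = 1 := by
    rw [← real_inner_self_eq_norm_sq]
    nth_rewrite 1 [unitVec]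
    rw [inner_add_left, real_inner_smul_left, real_inner_smul_left, h1, h2]
    linear_combination Real.sin_sq_add_cos_sq θ
  exact (sq_eq_sq₀ (norm_nonneg _) zero_le_one).1 (by rw [h3, one_pow])

theorem wedge_zero_pi (p q : Eucl n) : wedge p q 0 Real.pi = {x | 0 < ⟪q, x⟫} := by
  ext x
  rw [mem_wedge_iff Real.pi_pos.le (by linarith), unitNormal_zero, unitNormal_pi, inner_neg_left,
    neg_lt_zero, and_self, mem_ofPred_eq]

theorem wedge_zero_eq (p q : Eucl n) {ϑ : ℝ} (h : ϑ ∈ Icc 0 Real.pi) :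
    wedge p q 0 ϑ = {x | 0 < ⟪q, x⟫ ∧ 0 < ⟪unitNormal p q ϑ, x⟫} := by
  ext x
  rw [mem_wedge_iff h.1 (by linarith [h.2]), unitNormal_zero, inner_neg_left, neg_lt_zero,
    mem_ofPred_eq]

theorem mem_wedge_pi_iff (p q : Eucl n) {ϑ : ℝ} (h : ϑ ∈ Icc 0 Real.pi) {x : Eucl n} :
    x ∈ wedge p q ϑ Real.pi ↔ ⟪unitNormal p q ϑ, x⟫ < 0 ∧ 0 < ⟪q, x⟫ := by
  rw [mem_wedge_iff h.2 (by linarith [h.1]), unitNormal_pi]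

/-! ### Homogeneous kernels -/

theorem continuousOn_angularKernel {s : ℝ} {a : Eucl n → ℝ} (ha : IsAngularDensity a) :
    ContinuousOn (angularKernel s a) {0}ᶜ := by
  have hnorm : ContinuousOn (fun ζ : Eucl n => ‖ζ‖) {0}ᶜ := continuous_norm.continuousOn
  refine ContinuousOn.div ?_ (hnorm.rpow_const fun ζ hζ => Or.inl (norm_ne_zero_iff.2 hζ))
    fun ζ hζ => (Real.rpow_pos_of_pos (norm_pos_iff.2 hζ) _).ne'
  refine ha.continuousOn.comp ((hnorm.inv₀ fun ζ hζ => norm_ne_zero_iff.2 hζ).smul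
    continuousOn_id) fun ζ hζ => ?_
  rw [mem_sphere_zero_iff_norm, norm_smul, norm_inv, norm_norm]
  exact inv_mul_cancel₀ (norm_ne_zero_iff.2 hζ)

theorem inv_norm_smul_mem_sphere {ζ : Eucl n} (hζ : ζ ≠ 0) :
    ‖ζ‖⁻¹ • ζ ∈ sphere (0 : Eucl n) 1 := by
  rw [mem_sphere_zero_iff_norm, norm_smul, norm_inv, norm_norm]
  exact inv_mul_cancel₀ (norm_ne_zero_iff.2 hζ)

theorem angularKernel_neg {s : ℝ} {a : Eucl n → ℝ} (ha : IsAngularDensity a) (ζ : Eucl n) :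
    angularKernel s a (-ζ) = angularKernel s a ζ := by
  rcases eq_or_ne ζ 0 with rfl | hζ
  · simp
  · rw [angularKernel, angularKernel, norm_neg, smul_neg, ha.even _ (inv_norm_smul_mem_sphere hζ)]

theorem angularKernel_pos {s : ℝ} {a : Eucl n → ℝ} (ha : IsAngularDensity a) {ζ : Eucl n}
    (hζ : ζ ≠ 0) : 0 < angularKernel s a ζ := by
  obtain ⟨c, C, hc, hb⟩ := ha.bounds
  exact div_pos (hc.trans_le (hb _ (inv_norm_smul_mem_sphere hζ)).1)
    (Real.rpow_pos_of_pos (norm_pos_iff.2 hζ) _)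

theorem IsAngularDensity.isSingularKernel {s : ℝ} {a Ks : Eucl n → ℝ} (ha : IsAngularDensity a)
    (hK : ∀ ζ, ζ ≠ 0 → Ks ζ = angularKernel s a ζ) : ∃ Λ, IsSingularKernel s Λ Ks := by
  obtain ⟨c, C, hc, hb⟩ := ha.bounds
  refine ⟨C, measurable_of_continuousOn_compl_singleton 0
    ((continuousOn_angularKernel ha).congr fun ζ hζ => hK ζ hζ), fun z => ?_, fun z hz => ?_⟩
  · rcases eq_or_ne z 0 with rfl | hz
    · rw [neg_zero]
    · rw [hK z hz, hK (-z) (neg_ne_zero.2 hz), angularKernel_neg ha]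
  · rw [hK z hz, abs_of_pos (angularKernel_pos ha hz), Real.rpow_neg (norm_nonneg _),
      ← div_eq_mul_inv, angularKernel]
    have := (hb _ (inv_norm_smul_mem_sphere hz)).2
    gcongr

/-! ### Exclusion of the degenerate angles -/

section Degenerate

variable {s₁ s₂ lam σ : ℝ} {rad : ℝ≥0∞} {K₁ K₂ g : Eucl n → ℝ} {Ω E : Set (Eucl n)}

theorem mem_essBoundary_iff_of_le (A : Set (Eucl n)) {y : Eucl n} {ρ : ℝ} (hρ : 0 < ρ) :
    y ∈ essBoundary A ↔ ∀ r, 0 < r → r ≤ ρ →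
      0 < volume (A ∩ ball y r) ∧ 0 < volume (Aᶜ ∩ ball y r) := by
  refine ⟨fun h r hr _ => h r hr, fun h r hr => ?_⟩
  obtain ⟨h1, h2⟩ := h (min r ρ) (by positivity) (min_le_right _ _)
  have hsub : ball y (min r ρ) ⊆ ball y r := ball_subset_ball (min_le_left _ _)
  exact ⟨h1.trans_le (measure_mono (inter_subset_inter_right _ hsub)),
    h2.trans_le (measure_mono (inter_subset_inter_right _ hsub))⟩

theorem mem_essBoundary_sdiff_iff (hΩ : IsOpen Ω) (hE : E ⊆ Ω) {y : Eucl n} (hy : y ∈ Ω) :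
    y ∈ essBoundary (Ω \ E) ↔ y ∈ essBoundary E := by
  obtain ⟨ρ, hρ, hsub⟩ := Metric.isOpen_iff.1 hΩ y hy
  rw [mem_essBoundary_iff_of_le _ hρ, mem_essBoundary_iff_of_le _ hρ]
  refine forall_congr' fun r => forall_congr' fun _ => forall_congr' fun hrρ => ?_
  have hr := (ball_subset_ball hrρ).trans hsub
  have h1 : (Ω \ E) ∩ ball y r = Eᶜ ∩ ball y r := by
    ext z
    have := @hr z
    simp only [mem_inter_iff, Set.mem_sdiff, mem_compl_iff]
    tauto
  have h2 : (Ω \ E)ᶜ ∩ ball y r = E ∩ ball y r := by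
    ext z
    have := @hr z
    have := @hE z
    simp only [mem_inter_iff, Set.mem_sdiff, mem_compl_iff]
    tauto
  rw [h1, h2, and_comm]

theorem phase_sdiff (hE : E ⊆ Ω) (y : Eucl n) : phase Ω E y = -1 * phase Ω (Ω \ E) y := by
  by_cases h : y ∈ E
  · rw [phase_of_mem h, phase_of_notMem (fun h' => h'.2 h) (hE h), mul_one]
  · by_cases h' : y ∈ Ω
    · rw [phase_of_notMem h h', phase_of_mem (show y ∈ Ω \ E from ⟨h', h⟩)]
      norm_num
    · rw [phase_of_notMem_domain h h', phase_of_notMem_domain (fun h'' => h' h''.1) h', mul_zero]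

/-- If `Ω` and `E` have the same blow-up, the complementary phase `Ω \ E` is thin. -/
theorem BlowUpTendsto.sdiff {x₀ : Eucl n} {H : Set (Eucl n)} (hΩ : BlowUpTendsto Ω x₀ H)
    (hE : BlowUpTendsto E x₀ H) : BlowUpTendsto (Ω \ E) x₀ ∅ := by
  intro R hR
  have h1 := (hΩ R hR).add (hE R hR)
  rw [add_zero] at h1
  refine tendsto_of_tendsto_of_tendsto_of_le_of_le' tendsto_const_nhds h1
    (Eventually.of_forall fun _ => zero_le) ?_
  filter_upwards [self_mem_nhdsWithin] with r hr
  have hr0 : r ≠ 0 := (show (0 : ℝ) < r from hr).ne'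
  refine (measure_mono ?_).trans (measure_union_le _ _)
  rintro y ⟨hy, hyR⟩
  rw [Set.mem_symmDiff, mem_blowUp hr0] at hy
  simp only [Set.mem_sdiff, mem_empty_iff_false, not_false_eq_true, and_true, false_and,
    or_false] at hy
  by_cases hyH : y ∈ H
  · exact Or.inr ⟨Or.inr ⟨hyH, fun h => hy.2 ((mem_blowUp hr0).1 h)⟩, hyR⟩
  · exact Or.inl ⟨Or.inl ⟨(mem_blowUp hr0).2 hy.1, hyH⟩, hyR⟩

/-- Exclusion of the angle `0`. -/
theorem IsCapillarityProblem.not_blowUpTendsto_empty [NeZero n]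
    (h : IsCapillarityProblem s₁ s₂ lam rad σ K₁ K₂ g Ω E) (hσ : σ = 0 ∨ s₂ < s₁) {x₀ : Eucl n}
    (hx₀ : x₀ ∈ regularSet s₁ Ω E ∩ frontier Ω) : ¬ BlowUpTendsto E x₀ ∅ := fun hE =>
  h.not_thin hσ (a := 1) (by simp) h.critical.measurableSet h.critical.subset (by simp)
    (fun _ _ => Iff.rfl) hx₀ hE

/-- Exclusion of the angle `π`: the thin phase is `Ω \ E`, and the sign of the curvature changes.
-/
theorem IsCapillarityProblem.not_blowUpTendsto_same [NeZero n]
    (h : IsCapillarityProblem s₁ s₂ lam rad σ K₁ K₂ g Ω E) (hσ : σ = 0 ∨ s₂ < s₁) {x₀ : Eucl n}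
    (hx₀ : x₀ ∈ regularSet s₁ Ω E ∩ frontier Ω) {H : Set (Eucl n)} (hΩ : BlowUpTendsto Ω x₀ H) :
    ¬ BlowUpTendsto E x₀ H := fun hE =>
  h.not_thin hσ (a := -1) (by simp) (h.isOpen.measurableSet.diff h.critical.measurableSet)
    Set.sdiff_subset (phase_sdiff h.critical.subset)
    (fun _ hy => mem_essBoundary_sdiff_iff h.isOpen h.critical.subset hy) hx₀ (hΩ.sdiff hE)

end Degenerate

/-! ### Young's law -/

theorem integral_phase_eq {s Λ : ℝ} (hs : 0 < s) {K : Eucl n → ℝ} (hK : IsSingularKernel s Λ K)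
    {H W : Set (Eucl n)} (hH : MeasurableSet H) (hW : MeasurableSet W) (v : Eucl n) {ε : ℝ}
    (hε : 0 < ε) : ∫ z in (ball (0 : Eucl n) ε)ᶜ, K z * phase H W (v - z) =
      (∫ y in (Wᶜ ∩ H) \ ball v ε, K (v - y)) - ∫ y in W \ ball v ε, K (v - y) := by
  have h1 := setIntegral_comp_sub_left (fun z => K z * phase H W (v - z)) v ε
  simp only [sub_sub_cancel] at h1
  have hB : MeasurableSet (ball v ε)ᶜ := measurableSet_ball.compl
  have hi := (hK.integrableOn_comp_sub hs hε v).integrable_indicator hB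
  have h2 := integral_mul_phase hH hW (hi.integrableOn (s := Wᶜ ∩ H)) (hi.integrableOn (s := W))
  rw [setIntegral_indicator hB, setIntegral_indicator hB] at h2
  rw [← h1, ← integral_indicator hB, Set.sdiff_eq, Set.sdiff_eq, ← h2]
  congr 1
  funext y
  by_cases hy : y ∈ (ball v ε)ᶜ <;> simp [hy]

/-- A point at which all small truncations of the relative curvature vanish satisfies Young's law:
the curvature integrals stop depending on the truncation. -/
theorem hasMeanCurvature_of_truncated {s Λ : ℝ} (hs : 0 < s) {K : Eucl n → ℝ}
    (hK : IsSingularKernel s Λ K) {H W : Set (Eucl n)} (hH : MeasurableSet H)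
    (hW : MeasurableSet W) (hWH : W ⊆ H) {v : Eucl n} {d η₀ : ℝ} (hd : 0 < d) (hη₀ : 0 < η₀)
    (hdH : ball v d ⊆ H)
    (hz : ∀ η, 0 < η → η ≤ η₀ →
      ∫ z in (ball (0 : Eucl n) η)ᶜ, K z * phase H W (v - z) = 0) :
    HasMeanCurvature K W v (∫ y in Hᶜ, K (v - y)) := by
  refine tendsto_const_nhds.congr' ?_
  filter_upwards [Ioo_mem_nhdsGT (show 0 < min η₀ d by positivity)] with ε hε
  have hεη : ε ≤ η₀ := hε.2.le.trans (min_le_left _ _)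
  have hεd : ε ≤ d := hε.2.le.trans (min_le_right _ _)
  have hsub : Hᶜ ⊆ (ball v ε)ᶜ := compl_subset_compl.2 ((ball_subset_ball hεd).trans hdH)
  have hKi := hK.integrableOn_comp_sub hs hε.1 v
  have h1 := setIntegral_comp_sub_left (fun z => K z * phase H W (v - z)) v ε
  simp only [sub_sub_cancel] at h1
  have h2 : IntegrableOn (fun y => K (v - y) * phase H W y) (ball v ε)ᶜ := by
    refine Integrable.mono hKi.abs (hKi.aestronglyMeasurable.mul
      (measurable_phase hH hW).aestronglyMeasurable) (Eventually.of_forall fun y => ?_)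
    rw [Real.norm_eq_abs, Real.norm_eq_abs, abs_mul, abs_abs]
    exact mul_le_of_le_one_right (abs_nonneg _) (abs_phase_le _ _ _)
  have h3 : ∫ y in (ball v ε)ᶜ, (K (v - y) * phase H W y + Hᶜ.indicator (fun y => K (v - y)) y) =
      ∫ y in Hᶜ, K (v - y) := by
    rw [integral_add h2 (hKi.indicator hH.compl), h1, hz ε hε.1 hεη, zero_add,
      setIntegral_indicator hH.compl, inter_eq_self_of_subset_right hsub]
  rw [← h3]
  congr 1
  funext y
  by_cases hy : y ∈ W
  · simp [hy, phase_of_mem hy, hWH hy]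
  · by_cases hy' : y ∈ H
    · simp [hy, hy', phase_of_notMem hy hy']
    · simp [hy, hy', phase_of_notMem_domain hy hy']

section Balance

variable {p q : Eucl n} {s : ℝ} {a : Eucl n → ℝ}

theorem integrableOn_angularKernel (hs : 0 < s) (ha : IsAngularDensity a) (e : Eucl n) {ε : ℝ}
    (hε : 0 < ε) : IntegrableOn (fun y => angularKernel s a (y - e)) (ball e ε)ᶜ := by
  obtain ⟨Λ, hK⟩ := ha.isSingularKernel (s := s) fun _ _ => rfl
  refine (hK.integrableOn_comp_sub hs hε e).congr (Eventually.of_forall fun y => ?_)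
  change angularKernel s a (e - y) = angularKernel s a (y - e)
  rw [← angularKernel_neg ha (y - e), neg_sub]

/-- The truncated integral over a wedge grows with the opening, by an amount that does not depend
on the truncation. -/
theorem exists_wedge_integral_gap (hpq : Orthonormal ℝ ![p, q]) (hs : 0 < s)
    (ha : IsAngularDensity a) {α β γ : ℝ} (ϑ : ℝ) (hαβ : α ≤ β) (hβγ : β < γ)
    (hγ : γ ≤ α + 2 * Real.pi) : ∃ κ > 0, ∀ ε, 0 < ε → ε ≤ 1 →
      (∫ x in wedge p q α β \ ball (unitVec p q ϑ) ε, angularKernel s a (x - unitVec p q ϑ)) + κ ≤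
        ∫ x in wedge p q α γ \ ball (unitVec p q ϑ) ε, angularKernel s a (x - unitVec p q ϑ) := by
  set e := unitVec p q ϑ with he
  set k : Eucl n → ℝ := fun x => angularKernel s a (x - e) with hk
  have hpos : ∀ x, x ≠ e → 0 < k x := fun x hx => angularKernel_pos ha (sub_ne_zero.2 hx)
  have hpos' : ∀ x ε, 0 < ε → x ∉ ball e ε → 0 < k x := fun x ε hε hx => hpos x (by
    rintro rfl
    exact hx (mem_ball_self hε))
  have hint : ∀ (S : Set (Eucl n)) (ε : ℝ), 0 < ε → IntegrableOn k (S \ ball e ε) :=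
    fun S ε hε => (integrableOn_angularKernel hs ha e hε).mono_set fun x hx => hx.2
  have hmeas : ∀ b c ε, MeasurableSet (wedge p q b c \ ball e ε) := fun b c ε =>
    (isOpen_wedge p q b c).measurableSet.diff measurableSet_ball
  have hnn : ∀ b c ε, 0 < ε → 0 ≤ᵐ[volume.restrict (wedge p q b c \ ball e ε)] k :=
    fun b c ε hε => by
      filter_upwards [ae_restrict_mem (hmeas b c ε)] with x hx using (hpos' x ε hε hx.2).le
  refine ⟨∫ x in wedge p q β γ \ ball e 1, k x, ?_, fun ε hε hε1 => ?_⟩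
  · rw [gt_iff_lt, setIntegral_pos_iff_support_of_nonneg_ae (hnn β γ 1 one_pos)
      (hint _ 1 one_pos)]
    have hopen : IsOpen (wedge p q β γ ∩ (closedBall e 1)ᶜ) :=
      (isOpen_wedge p q β γ).inter isClosed_closedBall.isOpen_compl
    -- The point `3 e((β + γ) / 2)` of the added wedge lies outside the unit ball around `e(ϑ)`.
    refine (hopen.measure_pos volume ⟨(3 : ℝ) • unitVec p q ((β + γ) / 2),
      smul_unitVec_mem_wedge hpq ⟨by linarith, by linarith⟩ (by norm_num), ?_⟩).trans_le
      (measure_mono ?_)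
    · rw [mem_compl_iff, mem_closedBall, dist_eq_norm, not_le]
      have h1 := norm_sub_norm_le ((3 : ℝ) • unitVec p q ((β + γ) / 2)) e
      rw [norm_smul, norm_unitVec hpq, he, norm_unitVec hpq] at h1
      refine lt_of_lt_of_le ?_ h1
      norm_num
    · rintro x ⟨hx, hx1⟩
      have hxb : x ∉ ball e 1 := fun h => hx1 (ball_subset_closedBall h)
      exact ⟨(hpos' x 1 one_pos hxb).ne', hx, hxb⟩
  · have hdisj : Disjoint (wedge p q α β \ ball e ε) (wedge p q β γ \ ball e ε) :=
      (disjoint_wedge hγ).mono Set.sdiff_subset Set.sdiff_subset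
    calc (∫ x in wedge p q α β \ ball e ε, k x) + ∫ x in wedge p q β γ \ ball e 1, k x
        ≤ (∫ x in wedge p q α β \ ball e ε, k x) + ∫ x in wedge p q β γ \ ball e ε, k x := by
          refine add_le_add le_rfl (setIntegral_mono_set (hint _ ε hε) (hnn _ _ ε hε)
            (Set.sdiff_subset_sdiff_right (ball_subset_ball hε1)).eventuallyLE)
      _ = ∫ x in wedge p q α β \ ball e ε ∪ wedge p q β γ \ ball e ε, k x :=
          (setIntegral_union hdisj (hmeas _ _ _) (hint _ ε hε) (hint _ ε hε)).symm
      _ ≤ ∫ x in wedge p q α γ \ ball e ε, k x :=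
          setIntegral_mono_set (hint _ ε hε) (hnn _ _ ε hε) (union_subset
            (Set.sdiff_subset_sdiff_left (wedge_mono le_rfl hβγ.le))
            (Set.sdiff_subset_sdiff_left (wedge_mono hαβ le_rfl))).eventuallyLE

/-- Since the integral over a wedge is strictly increasing in its opening, a dual angle is
unique. -/
theorem hasWedgeBalance_iff (hpq : Orthonormal ℝ ![p, q]) (hs : 0 < s) (ha : IsAngularDensity a)
    {ϑ η₀ : ℝ} (hϑ : ϑ ∈ Ioo 0 Real.pi) (hη₀ : 0 < η₀)
    (hbal : ∀ η, 0 < η → η ≤ η₀ →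
      ∫ x in wedge p q ϑ Real.pi \ ball (unitVec p q ϑ) η, angularKernel s a (x - unitVec p q ϑ) =
        ∫ x in wedge p q 0 ϑ \ ball (unitVec p q ϑ) η, angularKernel s a (x - unitVec p q ϑ))
    {ϑh : ℝ} (hϑh : ϑh ∈ Ioo 0 (2 * Real.pi)) :
    HasWedgeBalance p q s a ϑ ϑh 0 ↔ ϑh = Real.pi - ϑ := by
  have hev : ∀ᶠ ε in 𝓝[>] (0 : ℝ), ε ∈ Ioo 0 (min η₀ 1) :=
    Ioo_mem_nhdsGT (by positivity)
  constructor
  · intro h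
    rcases lt_trichotomy ϑh (Real.pi - ϑ) with hlt | heq | hgt
    · obtain ⟨κ, hκ, hgap⟩ := exists_wedge_integral_gap (α := ϑ) (β := ϑ + ϑh) (γ := Real.pi) hpq
        hs ha ϑ (by linarith [hϑh.1]) (by linarith) (by linarith [hϑ.1, Real.pi_pos])
      have h1 := le_of_tendsto (b := -κ) h (by
        filter_upwards [hev] with ε hε
        have h2 := hgap ε hε.1 (hε.2.le.trans (min_le_right _ _))
        rw [hbal ε hε.1 (hε.2.le.trans (min_le_left _ _))] at h2
        linarith)
      linarith
    · exact heq
    · obtain ⟨κ, hκ, hgap⟩ := exists_wedge_integral_gap (α := ϑ) (β := Real.pi) (γ := ϑ + ϑh) hpq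
        hs ha ϑ hϑ.2.le (by linarith) (by linarith [hϑh.2])
      have h1 := ge_of_tendsto (b := κ) h (by
        filter_upwards [hev] with ε hε
        have h2 := hgap ε hε.1 (hε.2.le.trans (min_le_right _ _))
        rw [hbal ε hε.1 (hε.2.le.trans (min_le_left _ _))] at h2
        linarith)
      linarith
  · rintro rfl
    refine tendsto_const_nhds.congr' ?_
    filter_upwards [hev] with ε hε
    rw [add_sub_cancel, hbal ε hε.1 (hε.2.le.trans (min_le_left _ _)), sub_self]

end Balance

end Capillarity

end

theorem theorem1p4 (n : ℕ) (hn : 2 ≤ n) (s₁ s₂ : ℝ) (hs₁ : s₁ ∈ Set.Ioo (0 : ℝ) 1)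
    (hs₂ : s₂ ∈ Set.Ioo (0 : ℝ) 1) (lam : ℝ) (hlam : 1 ≤ lam) (rad : ℝ≥0∞) (hrad : 0 < rad)
    (σ : ℝ) (K₁ K₂ : Capillarity.Eucl n → ℝ)
    (hK₁ : Capillarity.IsSmoothKernel 2 n s₁ lam rad K₁)
    (hK₂ : Capillarity.IsSmoothKernel 2 n s₂ lam rad K₂)
    -- the blow-up kernels and their form
    (K₁s K₂s : Capillarity.Eucl n → ℝ)
    (hK₁s : Capillarity.IsBlowUpLimit s₁ K₁ K₁s) (hK₂s : Capillarity.IsBlowUpLimit s₂ K₂ K₂s)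
    (a₁ a₂ : Capillarity.Eucl n → ℝ)
    (ha₁ : Capillarity.IsAngularDensity a₁) (ha₂ : Capillarity.IsAngularDensity a₂)
    (hK₁a : ∀ ζ, ζ ≠ 0 → K₁s ζ = Capillarity.angularKernel s₁ a₁ ζ)
    (hK₂a : ∀ ζ, ζ ≠ 0 → K₂s ζ = Capillarity.angularKernel s₂ a₂ ζ)
    (g : Capillarity.Eucl n → ℝ) (hg : ContDiff ℝ 1 g)
    (Ω : Set (Capillarity.Eucl n)) (hΩ : IsOpen Ω) (hΩb : Bornology.IsBounded Ω)
    (hΩ1 : Capillarity.HasC1Boundary Ω)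
    (E : Set (Capillarity.Eucl n)) (hE : Capillarity.IsCriticalSet Ω K₁ K₂ σ g E)
    (x₀ : Capillarity.Eucl n) (hx₀ : x₀ ∈ Capillarity.regularSet s₁ Ω E ∩ frontier Ω)
    (H V : Set (Capillarity.Eucl n))
    (hH : Capillarity.IsOpenHalfSpace H) (hV : Capillarity.IsOpenHalfSpace V)
    (hΩH : Capillarity.BlowUpTendsto Ω x₀ H) (hEHV : Capillarity.BlowUpTendsto E x₀ (H ∩ V))
    -- coordinates in which `H = {xₙ > 0}` and `H ∩ V` is the wedge of opening `ϑ`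
    (p q : Capillarity.Eucl n) (hpq : Orthonormal ℝ ![p, q])
    (ϑ : ℝ) (hϑ : ϑ ∈ Set.Icc 0 Real.pi)
    (hHJ : H = Capillarity.wedge p q 0 Real.pi)
    (hHVJ : H ∩ V = Capillarity.wedge p q 0 ϑ) :
    (s₁ < s₂ → σ < 0 → ϑ = 0) ∧
    (s₁ < s₂ → 0 < σ → ϑ = Real.pi) ∧
    ((s₁ < s₂ ∧ σ = 0) ∨ s₂ < s₁ →
      ϑ ∈ Set.Ioo 0 Real.pi ∧
      (∀ ϑh ∈ Set.Ioo 0 (2 * Real.pi),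
        Capillarity.HasWedgeBalance p q s₁ a₁ ϑ ϑh 0 ↔ ϑh = Real.pi - ϑ) ∧
      ∀ v ∈ H ∩ frontier V, ∃ h : ℝ,
        Capillarity.HasMeanCurvature K₁s (H ∩ V) v h ∧
        MeasureTheory.IntegrableOn (fun y => K₁s (v - y)) Hᶜ ∧
        h - ∫ y in Hᶜ, K₁s (v - y) = 0) := by
  have : NeZero n := ⟨by omega⟩
  have h : Capillarity.IsCapillarityProblem s₁ s₂ lam rad σ K₁ K₂ g Ω E :=
    ⟨hs₁, hs₂, by linarith, hrad, hK₁, hK₂, hg, hΩ, hΩb, hΩ1, hE⟩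
  refine ⟨fun hs hσ => (h.not_contact_of_lt hx₀ hs hσ.ne).elim,
    fun hs hσ => (h.not_contact_of_lt hx₀ hs hσ.ne').elim, fun hcase => ?_⟩
  have hσ : σ = 0 ∨ s₂ < s₁ := hcase.imp_left And.right
  have hne0 : ϑ ≠ 0 := by
    rintro rfl
    rw [hHVJ, Capillarity.wedge_self] at hEHV
    exact h.not_blowUpTendsto_empty hσ hx₀ hEHV
  have hneπ : ϑ ≠ Real.pi := by
    rintro rfl
    rw [hHVJ, ← hHJ] at hEHV
    exact h.not_blowUpTendsto_same hσ hx₀ hΩH hEHV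
  have hϑ' : ϑ ∈ Set.Ioo 0 Real.pi := ⟨hϑ.1.lt_of_ne' hne0, hϑ.2.lt_of_ne hneπ⟩
  have hHq : H = {x | 0 < ⟪q, x⟫} := hHJ.trans (Capillarity.wedge_zero_pi p q)
  have hW : H ∩ V = {x | 0 < ⟪q, x⟫ ∧ 0 < ⟪Capillarity.unitNormal p q ϑ, x⟫} :=
    hHVJ.trans (Capillarity.wedge_zero_eq p q hϑ)
  have hq : ‖q‖ = 1 := hpq.1 1
  have hm := Capillarity.norm_unitNormal hpq ϑ
  have hopen := Capillarity.isOpen_inner_pos q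
  have hWm : MeasurableSet {x | 0 < ⟪q, x⟫ ∧ 0 < ⟪Capillarity.unitNormal p q ϑ, x⟫} :=
    (hopen.inter (Capillarity.isOpen_inner_pos _)).measurableSet
  rw [hHq] at hΩH
  rw [hW] at hEHV
  refine ⟨hϑ', fun ϑh hϑh => ?_, fun v hv => ?_⟩
  · obtain ⟨hpe, hqe⟩ := Capillarity.inner_unitVec hpq ϑ
    obtain ⟨η₀, hη₀, hz⟩ := h.integral_blowUp_eq_zero hσ hx₀ hq hm hΩH hEHV
      (Ks := Capillarity.angularKernel s₁ a₁) (fun ζ hζ => hK₁a ζ hζ ▸ hK₁s ζ hζ)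
      (v := Capillarity.unitVec p q ϑ)
      (by rw [hqe]; exact Real.sin_pos_of_pos_of_lt_pi hϑ'.1 hϑ'.2)
      (by rw [Capillarity.inner_unitNormal, hpe, hqe]; ring)
    obtain ⟨Λ, hK⟩ := ha₁.isSingularKernel (s := s₁) fun _ _ => rfl
    refine Capillarity.hasWedgeBalance_iff hpq hs₁.1 ha₁ hϑ' hη₀ (fun η hη hηle => ?_) hϑh
    have h1 := hz η hη hηle
    rw [Capillarity.integral_phase_eq hs₁.1 hK hopen.measurableSet hWm _ hη, sub_eq_zero,
      ← Capillarity.wedge_zero_eq p q hϑ] at h1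
    have hflip : ∀ y, Capillarity.angularKernel s₁ a₁ (Capillarity.unitVec p q ϑ - y) =
        Capillarity.angularKernel s₁ a₁ (y - Capillarity.unitVec p q ϑ) := fun y => by
      rw [← Capillarity.angularKernel_neg ha₁, neg_sub]
    simp only [hflip] at h1
    rw [← h1]
    -- the two descriptions of the complementary wedge differ by a piece of a hyperplane
    refine MeasureTheory.setIntegral_congr_set ?_
    have hnull : ∀ᵐ x : Capillarity.Eucl n, ⟪Capillarity.unitNormal p q ϑ, x⟫ ≠ 0 := by
      rw [MeasureTheory.ae_iff]
      simpa using Capillarity.volume_orthogonal_eq_zero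
        (norm_ne_zero_iff.1 (by rw [hm]; exact one_ne_zero))
    filter_upwards [hnull] with x hx
    refine propext (and_congr_left fun _ => ?_)
    change x ∈ Capillarity.wedge p q ϑ Real.pi ↔ x ∉ Capillarity.wedge p q 0 ϑ ∧ 0 < ⟪q, x⟫
    rw [Capillarity.mem_wedge_pi_iff p q hϑ, Capillarity.wedge_zero_eq p q hϑ,
      Set.mem_ofPred_eq]
    refine and_congr_left fun hqx => ⟨fun h1 h2 => lt_asymm h1 h2.2, fun h1 => ?_⟩
    exact hx.lt_of_le (not_lt.1 fun h2 => h1 ⟨hqx, h2⟩)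
  · have hVo : IsOpen V := by
      obtain ⟨ν, -, c, rfl⟩ := hV
      exact isOpen_lt continuous_const (continuous_const.inner continuous_id)
    have hqv : 0 < ⟪q, v⟫ := by
      have := hv.1
      rwa [hHq] at this
    have hHo : IsOpen H := hHq ▸ hopen
    have hmv : ⟪Capillarity.unitNormal p q ϑ, v⟫ = 0 := by
      refine le_antisymm (not_lt.1 fun hlt => ?_) ?_
      · have h1 : v ∈ H ∩ V := by
          rw [hW]
          exact ⟨hqv, hlt⟩
        exact (hVo.frontier_eq ▸ hv.2).2 h1.2
      · have h1 : v ∈ closure (H ∩ V) :=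
          hHo.inter_closure ⟨hv.1, frontier_subset_closure hv.2⟩
        have h2 : closure (H ∩ V) ⊆ {x | 0 ≤ ⟪Capillarity.unitNormal p q ϑ, x⟫} := by
          refine closure_minimal ?_
            (isClosed_le continuous_const (continuous_const.inner continuous_id))
          rw [hW]
          exact fun x hx => hx.2.le
        exact h2 h1
    obtain ⟨η₀, hη₀, hz⟩ := h.integral_blowUp_eq_zero hσ hx₀ hq hm hΩH hEHV hK₁s hqv hmv
    obtain ⟨Λ, hK⟩ := ha₁.isSingularKernel hK₁a
    obtain ⟨d, hd, hdH⟩ := Metric.isOpen_iff.1 hopen v hqv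
    rw [hW, hHq]
    exact ⟨_, Capillarity.hasMeanCurvature_of_truncated hs₁.1 hK hopen.measurableSet hWm
      (fun x hx => hx.1) hd hη₀ hdH hz, hK.integrableOn_wall hs₁.1 hd hdH, sub_self _⟩
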